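/- Let $n\ge 1$ be an integer. All functions and distributions $f$ below are real-valued, and $B(x,r)$ denotes the open ball in $\mathbb R^n$. **Spaces.** A Banach space $X$ of (classes of) measurable functions on $\mathbb R^n$, with a norm $\|\cdot\|_X\in[0,\infty]$ defined for all measurable functions (also those with values in $[0,\infty]$) and $X=\{f:\|f\|_X<\infty\}$, is a *ball Banach function space* if: $\|f\|_X=0$ implies $f=0$ a.e.; $|g|\le|f|$ a.e. implies $\|g\|_X\le\|f\|_X$; $0\le f_m\uparrow f$ a.e. implies $\|f_m\|_X\uparrow\|f\|_X$; $\mathbf 1_B\in X$ for every ball $B$; and for every ball $B$ there is $C_{(B)}>0$ with $\int_B|f|\le C_{(B)}\|f\|_X$ for all $f\in X$. For $s>0$ let $\|f\|_{X^s}:=\|\,|f|^s\|_X^{1/s}$, and let $\|f\|_{X'}:=\sup\{\|fg\|_{L^1(\mathbb R^n)}:\|g\|_X=1\}$ be the associate norm. $X$ has an *absolutely continuous norm* if $\|f\mathbf 1_{E_j}\|_X\to0$ for every $f\in X$ and all measurable $E_j$ with $\mathbf 1_{E_j}\to0$ a.e. Let $\mathcal M(f)(x):=\sup_{B\ni x}|B|^{-1}\int_B|f|$,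 the supremum being over all balls $B$ containing $x$, and let $\|\mathcal M\|_{Y\to Y}$ denote its operator norm on $Y$. Let $\dot W^{1,X}(\mathbb R^n)$ be the set of all distributions $f$ whose distributional gradient $\nabla f$ is a locally integrable vector field with $|\nabla f|\in X$; every such $f$ is a locally integrable function. For $\lambda>0$ and $b\in\mathbb R$ put $$E_{\lambda,b}[f]:=\Big\{(x,y)\in\mathbb R^n\times\mathbb R^n:\ x\ne y,\ \frac{|f(x)-f(y)|}{|x-y|^{1+b}}>\lambda\Big\},$$ $$\Phi_\lambda[f]:=\lambda\left\|\left[\int_{\mathbb R^n}\mathbf 1_{E_{\lambda,\gamma/q}[f]}(\cdot,y)\,|\cdot-y|^{\gamma-n}\,dy\right]^{1/q}\right\|_X ,$$ and let $\kappa(q,n):=\int_{\mathbb S^{n-1}}|e\cdot\omega|^q\,d\omega$ for any unit vector $e\in\mathbb R^n$. **Theorem.** Let $X$ be a ball Banach function space with an absolutely continuous norm and let $p\in[1,\infty)$ be such that $X^{1/p}$ is a ball Banach function space and $\mathcal M$ is bounded on $(X^{1/p})'$. Assume one of the following: (a) $\gamma\in\mathbb R\setminus\{0\}$, $q\in(0,p]$,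 and $\mathcal M$ is bounded on $X$; (b) $\gamma\in\mathbb R\setminus\{0\}$, $q\in(0,\infty)$, and there is $r\in(n,\infty)$ such that $\mathcal M$ is bounded on $X^{1/r}$; (c) $\gamma\in(0,\infty)$, $q\in(0,\infty)$, and $n(\frac1p-\frac1q)<1$; (d) $\gamma\in(-\infty,-1)$, $n=1$, and $q\in[1,p]$. Then: (i) There is a constant $C>0$ such that, for every $f\in\dot W^{1,X}(\mathbb R^n)$, $$\left[\frac{\kappa(q,n)}{|\gamma|}\right]^{1/q}\|\,|\nabla f|\,\|_X\le\sup_{\lambda\in(0,\infty)}\Phi_\lambda[f]\le C\,\|\,|\nabla f|\,\|_X .$$ Here $C$ is the value at $\|\mathcal M\|_{(X^{1/p})'\to(X^{1/p})'}$ of a positive, continuous, increasing function which depends only on $n,p,q,\gamma$ and, in case (a), on an upper bound for $\|\mathcal M\|_{X\to X}$ and, in case (b), on $r$ and an upper bound for $\|\mathcal M\|_{X^{1/r}\to X^{1/r}}$. (ii) If $\gamma\in(0,\infty)$, then, for every $f\in\dot W^{1,X}(\mathbb R^n)$, $$\lim_{\lambda\to\infty}\Phi_\lambda[f]=\left[\frac{\kappa(q,n)}{\gamma}\right]^{1/q}\|\,|\nabla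 f|\,\|_X .$$ (iii) If $\gamma\in(-\infty,0)$ and, in addition, either $n\ge2$ and $q\in(0,\frac{n-\gamma}{n}p)$, or $n=1$, $\gamma\in(-\infty,-1)$ and $q\in(0,-p\gamma)$, then, for every $f\in\dot W^{1,X}(\mathbb R^n)$, $$\lim_{\lambda\to0^+}\Phi_\lambda[f]=\left[-\frac{\kappa(q,n)}{\gamma}\right]^{1/q}\|\,|\nabla f|\,\|_X .$$ -/

import Mathlib

open MeasureTheory Filter Topology Set TopologicalSpace
open scoped ENNReal NNReal Distributions LineDeriv

noncomputable section

namespace BallBanach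

/-- The Euclidean space `ℝⁿ`. -/
abbrev Rn (n : ℕ) : Type := EuclideanSpace ℝ (Fin n)

/-- A function norm on `ℝⁿ`. A space `X` of measurable functions whose (extended) norm depends only
on the modulus is encoded by its values `ρ |f| = ‖f‖_X ∈ [0,∞]` on the measurable functions with
values in `[0,∞]`; then `f ∈ X` means `ρ |f| < ∞`. Only the values of `ρ` on
(almost everywhere) measurable functions are ever used. -/
abbrev FunctionNorm (n : ℕ) : Type := (Rn n → ℝ≥0∞) → ℝ≥0∞

/-- `X`, given by its norm `ρ`, is a ball Banach function space. (Completeness of `X` follows from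
the lattice property and the Fatou property.) -/
structure IsBallBanach {n : ℕ} (ρ : FunctionNorm n) : Prop where
  /-- absolute homogeneity of the norm -/
  smul : ∀ (c : ℝ≥0) (g : Rn n → ℝ≥0∞), AEMeasurable g volume →
    ρ (fun x => (c : ℝ≥0∞) * g x) = (c : ℝ≥0∞) * ρ g
  /-- a function of norm zero vanishes almost everywhere -/
  eq_zero : ∀ g : Rn n → ℝ≥0∞, AEMeasurable g volume → ρ g = 0 → g =ᵐ[volume] 0
  /-- lattice property -/
  mono : ∀ g h : Rn n → ℝ≥0∞, AEMeasurable g volume → AEMeasurable h volume →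
    g ≤ᵐ[volume] h → ρ g ≤ ρ h
  /-- Fatou property -/
  fatou : ∀ (u : ℕ → Rn n → ℝ≥0∞) (g : Rn n → ℝ≥0∞), (∀ m, AEMeasurable (u m) volume) →
    AEMeasurable g volume →
    (∀ᵐ x, Monotone (fun m => u m x) ∧ Tendsto (fun m => u m x) atTop (𝓝 (g x))) →
    Tendsto (fun m => ρ (u m)) atTop (𝓝 (ρ g))
  /-- characteristic functions of balls belong to the space -/
  ball_mem : ∀ (c : Rn n) (R : ℝ), 0 < R → ρ ((Metric.ball c R).indicator 1) < ∞
  /-- triangle inequality -/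
  add_le : ∀ g h : Rn n → ℝ≥0∞, AEMeasurable g volume → AEMeasurable h volume →
    ρ (fun x => g x + h x) ≤ ρ g + ρ h
  /-- local integrability -/
  lintegral_ball_le : ∀ (c : Rn n) (R : ℝ), 0 < R → ∃ C : ℝ≥0, 0 < C ∧
    ∀ g : Rn n → ℝ≥0∞, AEMeasurable g volume → ρ g < ∞ →
      (∫⁻ x in Metric.ball c R, g x) ≤ C * ρ g

/-- The norm of the `s`-convexification `X^s`: `‖g‖_{X^s} = ‖ |g|^s ‖_X^{1/s}`. -/
def convexify {n : ℕ} (ρ : FunctionNorm n) (s : ℝ) : FunctionNorm n :=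
  fun g => ρ (fun x => g x ^ s) ^ (1 / s)

/-- The norm of the associate space `X'`:
`‖g‖_{X'} = sup { ‖g h‖_{L¹} : h ∈ X, ‖h‖_X = 1 }`. -/
def associate {n : ℕ} (ρ : FunctionNorm n) : FunctionNorm n :=
  fun g => ⨆ (h : Rn n → ℝ≥0∞) (_ : AEMeasurable h volume) (_ : ρ h = 1), ∫⁻ x, g x * h x

/-- `X` has an absolutely continuous norm. -/
def HasAbsolutelyContinuousNorm {n : ℕ} (ρ : FunctionNorm n) : Prop :=
  ∀ g : Rn n → ℝ≥0∞, AEMeasurable g volume → ρ g < ∞ →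
    ∀ A : ℕ → Set (Rn n), (∀ j, NullMeasurableSet (A j) volume) →
      (∀ᵐ x, Tendsto (fun j => (A j).indicator (1 : Rn n → ℝ) x) atTop (𝓝 0)) →
      Tendsto (fun j => ρ ((A j).indicator g)) atTop (𝓝 0)

/-- The (uncentred) Hardy–Littlewood maximal function of `g`, where `g` stands for the modulus. -/
def maximal {n : ℕ} (g : Rn n → ℝ≥0∞) (x : Rn n) : ℝ≥0∞ :=
  ⨆ (c : Rn n) (R : ℝ) (_ : 0 < R) (_ : x ∈ Metric.ball c R),
    (∫⁻ y in Metric.ball c R, g y) / volume (Metric.ball c R)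

/-- The operator norm on `X` of the maximal operator; the operator is bounded on `X` if and only
if this is finite. -/
def maximalOpNorm {n : ℕ} (ρ : FunctionNorm n) : ℝ≥0∞ :=
  sInf {C : ℝ≥0∞ | ∀ g : Rn n → ℝ≥0∞, AEMeasurable g volume → ρ g < ∞ →
    ρ (maximal g) ≤ C * ρ g}

/-- The distribution `T` is the locally integrable function `f`. -/
def IsFunction {n : ℕ} (T : 𝓓'((⊤ : Opens (Rn n)), ℝ)) (f : Rn n → ℝ) : Prop :=
  LocallyIntegrable f volume ∧ ∀ φ : 𝓓((⊤ : Opens (Rn n)), ℝ), T φ = ∫ x, φ x * f x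

/-- The distributional gradient of `T` is the vector field `G`: each distributional partial
derivative of `T` is the corresponding component of `G`. -/
def IsGradient {n : ℕ} (T : 𝓓'((⊤ : Opens (Rn n)), ℝ)) (G : Rn n → Rn n) : Prop :=
  ∀ i : Fin n, IsFunction (∂_{(EuclideanSpace.single i (1 : ℝ) : Rn n)} T) (fun x => G x i)

/-- `‖ |G| ‖_X` for a vector field `G`. -/
def fieldNorm {n : ℕ} (ρ : FunctionNorm n) (G : Rn n → Rn n) : ℝ≥0∞ := ρ (fun x => ‖G x‖ₑ)

/-- The constant `κ(q,n) = ∫_{S^{n-1}} |e ⬝ ω|^q dω`, where `e` is a unit vector of `ℝⁿ` and `dω` is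
the surface measure. -/
def kappa {n : ℕ} (q : ℝ) (e : Rn n) : ℝ :=
  ∫ ω : Metric.sphere (0 : Rn n) 1, |inner ℝ e (ω : Rn n)| ^ q ∂(volume : Measure (Rn n)).toSphere

/-- The set `E_{l,b}[f]` of all `(x,y)` with `x ≠ y` and `|f(x) - f(y)| / |x - y|^{1+b} > l`. -/
def levelSet {n : ℕ} (l b : ℝ) (f : Rn n → ℝ) : Set (Rn n × Rn n) :=
  {z | z.1 ≠ z.2 ∧ l < |f z.1 - f z.2| / ‖z.1 - z.2‖ ^ (1 + b)}

/-- `l ‖ [∫ 1_{E_{l,γ/q}[f]}(·,y) |· - y|^{γ-n} dy]^{1/q} ‖_X`. -/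
def functional {n : ℕ} (ρ : FunctionNorm n) (q γ l : ℝ) (f : Rn n → ℝ) : ℝ≥0∞ :=
  ENNReal.ofReal l * ρ (fun x =>
    (∫⁻ y, (levelSet l (γ / q) f).indicator
      (fun z => ENNReal.ofReal (‖z.1 - z.2‖ ^ (γ - n))) (x, y)) ^ (1 / q))

end BallBanach

end

/-!
The proof combines a weighted estimate, uniform in the weight, with a density argument.

*Duality.* If `ρ` is the norm of `X`, then `X^{1/p}` is the associate space of `(X^{1/p})'`
(`norm_le_of_associate`, a form of the Lorentz–Luxemburg theorem, obtained from the separation of a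
closed convex set of bounded functions in `L²` of a ball). Hence an inequality
`∫ F^p h ≤ K ∫ g^p (M h + M M h)` for all weights `h` implies a norm inequality between `F` and `g` in
`X`, with a constant that depends only on `K` and the norm of `M` on `(X^{1/p})'`
(`norm_le_of_weighted`). This replaces the extrapolation with Muckenhoupt weights.

*Upper bounds for nice functions.* Call a `C¹` function nice if its gradient has compact support and,
for `n ≥ 2`, the function is constant near infinity. In case (a), `|f(x) - f(y)|` is at most
`C |x - y| (M|∇f|(x) + M|∇f|(y))`, and integrating the kernel gives `functional_le_maximal`. In case
(b), Morrey's inequality replaces the sum by `(M(|∇f|^r)(x))^{1/r}` (`functional_le_morrey`). In case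
(c), the level set is decomposed into dyadic scales, and a Vitali covering of the superlevel sets of
the averages of `|∇f|^p` sums the scales up (`tsum_lintegral_superlevel_le`, `weightedBound_of_pos`).
In case (d), a Vitali covering that selects the shortest intervals first gives the weighted bound on
the line (`weightedBound_line`). The four bounds are collected in `exists_niceBound`, with a constant
`c exp(2t)`, where `t` is the norm of `M` on `(X^{1/p})'`.

*The limit for nice functions.* With `l τ^{γ/q} = 1`, the substitution `y = x + τ w` turns the
functional into the norm of the `q`-th root of
`∫ 1_{|w|^{1+γ/q} < |f(x+τw)-f(x)|/τ} |w|^{γ-n} dw` (`functional_eq_scaled`), and `τ → 0` in the limits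
considered. Pointwise, the limit is the same integral for the linear function `w ↦ ∇f(x) ⬝ w`, which
polar coordinates evaluate as `κ(q,n) |∇f(x)|^q / |γ|` (`linearIntegral_eq`). Fatou's lemma in `X`
gives the lower half of the limit formula for every `γ ≠ 0`; the full formula needs a dominating
function in `X` (`IsNice.exists_dominating`). For `γ < 0` this is a power of `|x|` near infinity,
which belongs to `X` because the indicator functions of the balls of radius `2^k` have norms of order
at most `2^{kn/p}` (`norm_ball_pow_le`); here the additional conditions of (iii) enter.

*General functions.* A distribution with locally integrable gradient is a locally integrable function
(`exists_isFunction`). It is an almost everywhere limit of nice functions whose gradients converge in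
`X` (`exists_isNice_seq`): mollification works because averages over balls are uniformly bounded on
`X`, and cutting off works by a Poincaré inequality on annuli for `n ≥ 2`, and by integrating the cut
off derivative for `n = 1`. The upper bound passes to the limit by Fatou's lemma
(`IsApproximable.functional_le`). The functional is not subadditive in `f`, but `f ↦ g` costs only a
factor close to `1` plus a multiple of the functional of `f - g` (`exists_functional_le_add`), which
the upper bound makes small; so both halves of the limit formula pass to general functions
(`IsApproximable.eventually_lt_functional`, `IsApproximable.eventually_functional_lt`). The lower
half of the limit formula also yields the lower bound in (i).
-/

noncomputable section

namespace BallBanach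

/-! ### Function norms and duality -/

section FunctionNorm

variable {n : ℕ} {ρ : FunctionNorm n}

lemma IsBallBanach.congr (hρ : IsBallBanach ρ) {g h : Rn n → ℝ≥0∞} (hg : AEMeasurable g volume)
    (hgh : g =ᵐ[volume] h) : ρ g = ρ h :=
  le_antisymm (hρ.mono g h hg (hg.congr hgh) hgh.le)
    (hρ.mono h g (hg.congr hgh) hg hgh.symm.le)

/-- Lower semicontinuity of a function norm, a reformulation of the Fatou property. -/
lemma IsBallBanach.liminf_le (hρ : IsBallBanach ρ) {u : ℕ → Rn n → ℝ≥0∞}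
    (hu : ∀ m, AEMeasurable (u m) volume) :
    ρ (fun x => liminf (fun m => u m x) atTop) ≤ liminf (fun m => ρ (u m)) atTop := by
  have hmeas : ∀ m, AEMeasurable (fun x => ⨅ k ≥ m, u k x) volume := fun m =>
    AEMeasurable.biInf _ (Set.to_countable _) fun k _ => hu k
  have hmono : ∀ x, Monotone (fun m => ⨅ k ≥ m, u k x) := fun x m m' h =>
    biInf_mono fun k hk => le_trans h hk
  have hlim : ∀ x, Tendsto (fun m => ⨅ k ≥ m, u k x) atTop
      (𝓝 (liminf (fun m => u m x) atTop)) := by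
    intro x
    rw [liminf_eq_iSup_iInf_of_nat]
    exact tendsto_atTop_iSup (hmono x)
  have hf := hρ.fatou (fun m x => ⨅ k ≥ m, u k x) (fun x => liminf (fun m => u m x) atTop) hmeas
    (aemeasurable_of_tendsto_metrizable_ae' hmeas (Eventually.of_forall hlim))
    (Eventually.of_forall fun x => ⟨hmono x, hlim x⟩)
  rw [← hf.liminf_eq]
  exact liminf_le_liminf (Eventually.of_forall fun m => hρ.mono _ _ (hmeas m) (hu m)
    (Eventually.of_forall fun x => iInf₂_le m le_rfl))

lemma lintegral_mul_le_associate (hρ : IsBallBanach ρ) {g h : Rn n → ℝ≥0∞}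
    (hg : AEMeasurable g volume) (hgfin : ρ g < ∞) :
    ∫⁻ x, g x * h x ≤ ρ g * associate ρ h := by
  by_cases h0 : ρ g = 0
  · have : (fun x => g x * h x) =ᵐ[volume] 0 := by
      filter_upwards [hρ.eq_zero g hg h0] with x hx
      simp [hx]
    rw [lintegral_congr_ae this]
    simp
  · obtain ⟨c, hc⟩ : ∃ c : ℝ≥0, (c : ℝ≥0∞) = (ρ g)⁻¹ :=
      ⟨(ρ g)⁻¹.toNNReal, ENNReal.coe_toNNReal (by simpa using h0)⟩
    have h1 : ρ (fun x => (c : ℝ≥0∞) * g x) = 1 := by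
      rw [hρ.smul c g hg, hc, ENNReal.inv_mul_cancel h0 hgfin.ne]
    have h2 : ∫⁻ x, h x * ((c : ℝ≥0∞) * g x) ≤ associate ρ h :=
      le_iSup₂_of_le (fun x => (c : ℝ≥0∞) * g x) (hg.const_mul _) (le_iSup_of_le h1 le_rfl)
    calc ∫⁻ x, g x * h x = ∫⁻ x, ρ g * (h x * ((c : ℝ≥0∞) * g x)) := by
          refine lintegral_congr fun x => ?_
          rw [hc]
          calc g x * h x = (ρ g * (ρ g)⁻¹) * (g x * h x) := by
                rw [ENNReal.mul_inv_cancel h0 hgfin.ne, one_mul]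
            _ = _ := by ring
      _ = ρ g * ∫⁻ x, h x * ((c : ℝ≥0∞) * g x) := lintegral_const_mul' _ _ hgfin.ne
      _ ≤ _ := by gcongr

lemma associate_add_le {g h : Rn n → ℝ≥0∞} (hg : AEMeasurable g volume) :
    associate ρ (fun x => g x + h x) ≤ associate ρ g + associate ρ h := by
  refine iSup₂_le fun w hw => iSup_le fun h1 => ?_
  simp_rw [add_mul]
  rw [lintegral_add_left' (f := fun x => g x * w x) (hg.mul hw)]
  exact add_le_add (le_iSup₂_of_le w hw (le_iSup_of_le h1 le_rfl))
    (le_iSup₂_of_le w hw (le_iSup_of_le h1 le_rfl))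

/-- The truncations `min g N` on the ball of radius `N`. -/
def truncate (g : Rn n → ℝ≥0∞) (N : ℕ) : Rn n → ℝ≥0∞ :=
  (Metric.ball (0 : Rn n) N).indicator fun x => min (g x) N

lemma aemeasurable_truncate {g : Rn n → ℝ≥0∞} (hg : AEMeasurable g volume) (N : ℕ) :
    AEMeasurable (truncate g N) volume :=
  (hg.min aemeasurable_const).indicator Metric.isOpen_ball.measurableSet

lemma truncate_le (g : Rn n → ℝ≥0∞) (N : ℕ) (x : Rn n) : truncate g N x ≤ g x := by
  unfold truncate
  by_cases hx : x ∈ Metric.ball (0 : Rn n) N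
  · simp [indicator_of_mem hx]
  · simp [indicator_of_notMem hx]

lemma monotone_truncate (g : Rn n → ℝ≥0∞) (x : Rn n) : Monotone fun N => truncate g N x := by
  intro N N' h
  have h' : (N : ℝ≥0∞) ≤ N' := by exact_mod_cast h
  have h'' : (N : ℝ) ≤ N' := by exact_mod_cast h
  by_cases hx : x ∈ Metric.ball (0 : Rn n) N
  · have hx' : x ∈ Metric.ball (0 : Rn n) N' := Metric.ball_subset_ball h'' hx
    simp only [truncate, indicator_of_mem hx, indicator_of_mem hx']
    gcongr
  · simp [truncate, indicator_of_notMem hx]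

lemma tendsto_truncate (g : Rn n → ℝ≥0∞) (x : Rn n) :
    Tendsto (fun N => truncate g N x) atTop (𝓝 (g x)) := by
  have h1 : Tendsto (fun N : ℕ => min (g x) (N : ℝ≥0∞)) atTop (𝓝 (min (g x) ∞)) :=
    tendsto_const_nhds.min ENNReal.tendsto_nat_nhds_top
  rw [min_eq_left le_top] at h1
  refine h1.congr' ?_
  obtain ⟨N₀, hN₀⟩ := exists_nat_gt ‖x‖
  filter_upwards [eventually_ge_atTop N₀] with N hN
  have : x ∈ Metric.ball (0 : Rn n) N := by
    rw [mem_ball_zero_iff]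
    exact hN₀.trans_le (by exact_mod_cast hN)
  simp [truncate, indicator_of_mem this]

/-- In `L²` of a ball, an element outside the closed convex set `{ρ ≤ b}` is separated from it by a
function of the associate space. -/
lemma norm_truncate_le_of_associate (hρ : IsBallBanach ρ) {g : Rn n → ℝ≥0∞}
    (hg : AEMeasurable g volume) {B : ℝ≥0∞}
    (H : ∀ h : Rn n → ℝ≥0∞, AEMeasurable h volume → associate ρ h ≤ 1 →
      ∫⁻ x, g x * h x ≤ B) (N : ℕ) : ρ (truncate g N) ≤ B := by
  by_contra! hlt
  obtain ⟨b, hBb, hbg⟩ := ENNReal.lt_iff_exists_nnreal_btwn.1 hlt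
  have hb0 : (0 : ℝ) < b := by
    have : (0 : ℝ≥0∞) < b := bot_le.trans_lt hBb
    exact_mod_cast this
  set S : Set (Rn n) := Metric.ball (0 : Rn n) N with hS
  have hSm : MeasurableSet S := Metric.isOpen_ball.measurableSet
  set μ : Measure (Rn n) := volume.restrict S with hμ
  have : IsFiniteMeasure μ := ⟨by
    rw [hμ, Measure.restrict_apply_univ]; exact measure_ball_lt_top⟩
  let J : Lp ℝ 2 μ → Rn n → ℝ≥0∞ := fun u => S.indicator fun x => ‖u x‖ₑ
  have hJ : ∀ u, AEMeasurable (J u) volume := fun u =>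
    (aemeasurable_indicator_iff hSm).2 (Lp.aestronglyMeasurable u).enorm
  have hae : ∀ {P : Rn n → Prop}, (∀ᵐ x ∂μ, P x) → ∀ᵐ x, x ∈ S → P x := fun h =>
    (ae_restrict_iff' hSm).1 h
  -- the closed convex set
  let C : Set (Lp ℝ 2 μ) := {u | ρ (J u) ≤ b}
  have hconv : Convex ℝ C := by
    intro u hu v hv a c ha hc hac
    have h1 : J (a • u + c • v) ≤ᵐ[volume]
        fun x => ((a.toNNReal : ℝ≥0) : ℝ≥0∞) * J u x + ((c.toNNReal : ℝ≥0) : ℝ≥0∞) * J v x := by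
      have e1 := Lp.coeFn_add (a • u) (c • v)
      have e2 := Lp.coeFn_smul a u
      have e3 := Lp.coeFn_smul c v
      have e := hae (e1.and (e2.and e3))
      filter_upwards [e] with x hx
      by_cases hxS : x ∈ S
      · obtain ⟨x1, x2, x3⟩ := hx hxS
        simp only [J, indicator_of_mem hxS]
        rw [x1, Pi.add_apply, x2, x3]
        refine (enorm_add_le _ _).trans ?_
        simp only [Pi.smul_apply, enorm_smul]
        rw [Real.enorm_of_nonneg ha, Real.enorm_of_nonneg hc]
        rfl
      · simp [J, indicator_of_notMem hxS]
    calc ρ (J (a • u + c • v)) ≤ _ := hρ.mono _ _ (hJ _)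
          (((hJ u).const_mul _).add ((hJ v).const_mul _)) h1
      _ ≤ _ := hρ.add_le _ _ ((hJ u).const_mul _) ((hJ v).const_mul _)
      _ = (a.toNNReal : ℝ≥0∞) * ρ (J u) + (c.toNNReal : ℝ≥0∞) * ρ (J v) := by
          rw [hρ.smul _ _ (hJ u), hρ.smul _ _ (hJ v)]
      _ ≤ (a.toNNReal : ℝ≥0∞) * b + (c.toNNReal : ℝ≥0∞) * b := by
          gcongr
          · exact hu
          · exact hv
      _ = b := by
          rw [← add_mul, ← ENNReal.coe_add, ← Real.toNNReal_add ha hc, hac]; simp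
  have hclosed : IsClosed C := by
    refine IsSeqClosed.isClosed fun u v hu huv => ?_
    obtain ⟨ns, -, hns⟩ := (tendstoInMeasure_of_tendsto_Lp huv).exists_seq_tendsto_ae
    have h1 : J v =ᵐ[volume] fun x => liminf (fun i => J (u (ns i)) x) atTop := by
      filter_upwards [hae hns] with x hx
      by_cases hxS : x ∈ S
      · simp only [J, indicator_of_mem hxS]
        exact ((hx hxS).enorm.liminf_eq).symm
      · simp [J, indicator_of_notMem hxS]
    change ρ (J v) ≤ b
    rw [hρ.congr (hJ v) h1]
    refine (hρ.liminf_le fun i => hJ _).trans ?_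
    exact (liminf_le_liminf (v := fun _ => (b : ℝ≥0∞))
      (Eventually.of_forall fun i => hu (ns i))).trans (by simp)
  -- bounded functions as elements of `L²`
  have hmem : ∀ s : Rn n → ℝ, AEMeasurable s volume → (∃ R : ℝ, ∀ x, ‖s x‖ ≤ R) →
      MemLp s 2 μ := fun s hs ⟨R, hR⟩ =>
    MemLp.of_bound hs.aestronglyMeasurable.restrict R (Eventually.of_forall hR)
  have htr : ∀ w : Rn n → ℝ≥0∞, AEMeasurable w volume → ∀ M : ℕ,
      AEMeasurable (fun x => (truncate w M x).toReal) volume := fun w hw M =>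
    (aemeasurable_truncate hw M).ennreal_toReal
  have htr_le : ∀ (w : Rn n → ℝ≥0∞) (M : ℕ) (x : Rn n), truncate w M x ≤ M := by
    intro w M x
    unfold truncate
    by_cases hx : x ∈ Metric.ball (0 : Rn n) M
    · simp [indicator_of_mem hx]
    · simp [indicator_of_notMem hx]
  have htr_b : ∀ (w : Rn n → ℝ≥0∞) (M : ℕ) (x : Rn n), ‖(truncate w M x).toReal‖ ≤ M := by
    intro w M x
    rw [Real.norm_of_nonneg ENNReal.toReal_nonneg]
    exact ENNReal.toReal_le_of_le_ofReal (Nat.cast_nonneg _) (by simpa using htr_le w M x)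
  have htr_top : ∀ (w : Rn n → ℝ≥0∞) (M : ℕ) (x : Rn n), truncate w M x ≠ ∞ := fun w M x =>
    ((htr_le w M x).trans_lt (ENNReal.natCast_lt_top M)).ne
  let gN : Lp ℝ 2 μ := (hmem _ (htr g hg N) ⟨N, htr_b g N⟩).toLp
  have hgN : gN ∉ C := by
    intro hC
    have h1 : J gN =ᵐ[volume] truncate g N := by
      have e := MemLp.coeFn_toLp (hmem _ (htr g hg N) ⟨N, htr_b g N⟩)
      filter_upwards [hae e] with x hx
      by_cases hxS : x ∈ S
      · simp only [J, indicator_of_mem hxS]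
        erw [hx hxS]
        rw [Real.enorm_of_nonneg ENNReal.toReal_nonneg, ENNReal.ofReal_toReal (htr_top g N x)]
      · simp only [J, truncate]
        rw [indicator_of_notMem hxS, indicator_of_notMem hxS]
    have : ρ (J gN) ≤ b := hC
    rw [hρ.congr (hJ _) h1] at this
    exact absurd hbg (not_lt.2 this)
  obtain ⟨φ, u, hφC, hφg⟩ := geometric_hahn_banach_closed_point hconv hclosed hgN
  set v : Lp ℝ 2 μ := (InnerProductSpace.toDual ℝ (Lp ℝ 2 μ)).symm φ with hv
  have hφ : ∀ a, φ a = ∫ x, a x * v x ∂μ := by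
    intro a
    have : φ a = inner ℝ v a := by rw [hv, InnerProductSpace.toDual_symm_apply]
    rw [this, L2.inner_def]
    rfl
  have hzero : (0 : Lp ℝ 2 μ) ∈ C := by
    have h1 : J 0 =ᵐ[volume] fun x => ((0 : ℝ≥0) : ℝ≥0∞) * (0 : ℝ≥0∞) := by
      have e := Lp.coeFn_zero ℝ 2 μ
      filter_upwards [hae e] with x hx
      by_cases hxS : x ∈ S
      · simp only [J, indicator_of_mem hxS]
        erw [hx hxS]
        simp
      · simp [J, indicator_of_notMem hxS]
    change ρ (J 0) ≤ b
    rw [hρ.congr (hJ _) h1, hρ.smul 0 _ aemeasurable_const]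
    simp
  have hu0 : 0 < u := by simpa using hφC 0 hzero
  let σ : ℝ → ℝ := fun t => if 0 ≤ t then 1 else -1
  have hσm : Measurable σ := Measurable.ite measurableSet_Ici measurable_const measurable_const
  have hσ : ∀ t, σ t * t = |t| := by
    intro t
    by_cases ht : 0 ≤ t
    · simp [σ, ht, abs_of_nonneg ht]
    · simp [σ, ht, abs_of_neg (not_le.1 ht)]
  have hsgn : AEMeasurable (fun x => σ (v x)) μ :=
    hσm.comp_aemeasurable (Lp.aestronglyMeasurable v).aemeasurable
  have hsb : ∀ x, ‖σ (v x)‖ ≤ 1 := by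
    intro x
    by_cases ht : 0 ≤ v x <;> simp [σ, ht]
  have hsmem : ∀ (w : Rn n → ℝ≥0∞), AEMeasurable w volume → ∀ M : ℕ,
      MemLp (fun x => σ (v x) * (truncate w M x).toReal) 2 μ := by
    intro w hw M
    refine MemLp.of_bound (hsgn.mul (htr w hw M).restrict).aestronglyMeasurable M
      (Eventually.of_forall fun x => ?_)
    rw [norm_mul]
    calc _ ≤ 1 * (M : ℝ) := mul_le_mul (hsb x) (htr_b w M x) (norm_nonneg _) zero_le_one
      _ = M := one_mul _
  set h : Rn n → ℝ≥0∞ := S.indicator fun x => ‖v x‖ₑ with hh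
  have hhm : AEMeasurable h volume := hJ v
  have hφs : ∀ (w : Rn n → ℝ≥0∞) (hw : AEMeasurable w volume) (M : ℕ),
      ENNReal.ofReal (φ (hsmem w hw M).toLp) = ∫⁻ x, h x * truncate w M x := by
    intro w hw M
    have hint : Integrable (fun x => ‖v x‖ * (truncate w M x).toReal) μ :=
      ((Lp.memLp v).norm).integrable_mul (hmem _ (htr w hw M) ⟨M, htr_b w M⟩)
    have h1 : φ (hsmem w hw M).toLp = ∫ x, ‖v x‖ * (truncate w M x).toReal ∂μ := by
      rw [hφ]
      refine integral_congr_ae ?_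
      filter_upwards [MemLp.coeFn_toLp (hsmem w hw M)] with x hx
      rw [hx, Real.norm_eq_abs, ← hσ (v x)]
      ring
    rw [h1, ofReal_integral_eq_lintegral_ofReal hint
      (Eventually.of_forall fun x => mul_nonneg (norm_nonneg _) ENNReal.toReal_nonneg),
      ← lintegral_indicator hSm]
    refine lintegral_congr fun x => ?_
    by_cases hxS : x ∈ S
    · simp only [hh, indicator_of_mem hxS]
      rw [ENNReal.ofReal_mul (norm_nonneg _), ENNReal.ofReal_toReal (htr_top w M x), ofReal_norm]
    · simp [hh, indicator_of_notMem hxS]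
  -- the separating function belongs to the associate space
  have hass : associate ρ h ≤ ENNReal.ofReal (u / b) := by
    refine iSup₂_le fun w hw => iSup_le fun h1 => ?_
    have h2 : ∀ M : ℕ, ∫⁻ x, h x * truncate w M x ≤ ENNReal.ofReal (u / b) := by
      intro M
      have hC : (b : ℝ) • (hsmem w hw M).toLp ∈ C := by
        have h3 : J ((b : ℝ) • (hsmem w hw M).toLp) ≤ᵐ[volume] fun x => (b : ℝ≥0∞) * w x := by
          have e1 := Lp.coeFn_smul (b : ℝ) (hsmem w hw M).toLp
          have e2 := MemLp.coeFn_toLp (hsmem w hw M)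
          have e := hae (e1.and e2)
          filter_upwards [e] with x hx
          by_cases hxS : x ∈ S
          · obtain ⟨x1, x2⟩ := hx hxS
            simp only [J, indicator_of_mem hxS]
            rw [x1, Pi.smul_apply, x2, enorm_smul, enorm_mul]
            have h4 : ‖(b : ℝ)‖ₑ = (b : ℝ≥0∞) := by
              rw [Real.enorm_of_nonneg hb0.le]; simp
            have h5 : ‖σ (v x)‖ₑ ≤ 1 := by
              rw [← ofReal_norm]
              exact ENNReal.ofReal_le_one.2 (hsb x)
            have h6 : ‖(truncate w M x).toReal‖ₑ = truncate w M x := by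
              rw [Real.enorm_of_nonneg ENNReal.toReal_nonneg,
                ENNReal.ofReal_toReal (htr_top w M x)]
            rw [h4, h6]
            gcongr
            calc _ ≤ 1 * w x := mul_le_mul' h5 (truncate_le w M x)
              _ = w x := one_mul _
          · simp [J, indicator_of_notMem hxS]
        change ρ _ ≤ b
        calc _ ≤ _ := hρ.mono _ _ (hJ _) (hw.const_mul _) h3
          _ = b := by rw [hρ.smul b w hw, h1, mul_one]
      have h3 := hφC _ hC
      rw [map_smul, smul_eq_mul] at h3
      rw [← hφs w hw M]
      refine ENNReal.ofReal_le_ofReal ?_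
      rw [le_div_iff₀ hb0, mul_comm]
      exact h3.le
    have h3 : Tendsto (fun M => ∫⁻ x, h x * truncate w M x) atTop (𝓝 (∫⁻ x, h x * w x)) := by
      refine lintegral_tendsto_of_tendsto_of_monotone
        (fun M => hhm.mul (aemeasurable_truncate hw M))
        (Eventually.of_forall fun x M M' hM => mul_le_mul_right (monotone_truncate w x hM) _)
        (Eventually.of_forall fun x => ?_)
      refine ENNReal.Tendsto.const_mul (tendsto_truncate w x) (Or.inr ?_)
      by_cases hxS : x ∈ S
      · simp [hh, indicator_of_mem hxS]
      · simp [hh, indicator_of_notMem hxS]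
    exact le_of_tendsto' h3 h2
  -- testing `g` against it gives a contradiction
  have hub : 0 < u / b := div_pos hu0 hb0
  set k : ℝ≥0∞ := ENNReal.ofReal (u / b) with hk
  have hk0 : k ≠ 0 := by simpa [hk] using hub
  have hkt : k ≠ ∞ := ENNReal.ofReal_ne_top
  have h1 : associate ρ (fun x => k⁻¹ * h x) ≤ 1 := by
    refine iSup₂_le fun w hw => iSup_le fun h1 => ?_
    simp_rw [mul_assoc]
    rw [lintegral_const_mul' _ _ (ENNReal.inv_ne_top.2 hk0)]
    calc k⁻¹ * ∫⁻ x, h x * w x ≤ k⁻¹ * k := by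
          gcongr
          exact (le_iSup₂_of_le w hw (le_iSup_of_le h1 le_rfl) :
            ∫⁻ x, h x * w x ≤ associate ρ h).trans hass
      _ = 1 := ENNReal.inv_mul_cancel hk0 hkt
  have h2 := H _ (hhm.const_mul _) h1
  have h3 : ∫⁻ x, h x * truncate g N x ≤ k * B := by
    calc ∫⁻ x, h x * truncate g N x ≤ ∫⁻ x, k * (g x * (k⁻¹ * h x)) := by
          refine lintegral_mono fun x => ?_
          calc h x * truncate g N x ≤ h x * g x := by gcongr; exact truncate_le g N x
            _ = (k * k⁻¹) * (h x * g x) := by rw [ENNReal.mul_inv_cancel hk0 hkt, one_mul]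
            _ = _ := by ring
      _ = k * ∫⁻ x, g x * (k⁻¹ * h x) := lintegral_const_mul' _ _ hkt
      _ ≤ _ := by gcongr
  rw [← hφs g hg N] at h3
  have h4 : φ gN ≤ φ (hsmem g hg N).toLp := by
    rw [hφ, hφ]
    refine integral_mono_ae (MemLp.integrable_mul (Lp.memLp gN) (Lp.memLp v))
      (MemLp.integrable_mul (Lp.memLp _) (Lp.memLp v)) ?_
    filter_upwards [MemLp.coeFn_toLp (hsmem g hg N),
      MemLp.coeFn_toLp (hmem _ (htr g hg N) ⟨N, htr_b g N⟩)] with x hx1 hx2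
    have hx2' : gN x = (truncate g N x).toReal := hx2
    simp only
    rw [hx1, hx2']
    calc (truncate g N x).toReal * v x ≤ (truncate g N x).toReal * |v x| := by
          gcongr; exact le_abs_self _
      _ = _ := by rw [← hσ (v x)]; ring
  have h5 : ENNReal.ofReal u ≤ k * B :=
    (ENNReal.ofReal_le_ofReal (hφg.le.trans h4)).trans h3
  have h6 : k * B < k * b := by
    exact (ENNReal.mul_lt_mul_iff_right hk0 hkt).2 hBb
  have h7 : k * b = ENNReal.ofReal u := by
    rw [hk, ← ENNReal.ofReal_coe_nnreal, ← ENNReal.ofReal_mul hub.le, div_mul_cancel₀ _ hb0.ne']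
  rw [h7] at h6
  exact absurd h6 (not_lt.2 h5)

/-- The Lorentz–Luxemburg theorem: a ball Banach function norm is the associate of its associate
norm. -/
lemma norm_le_of_associate (hρ : IsBallBanach ρ) {g : Rn n → ℝ≥0∞}
    (hg : AEMeasurable g volume) {B : ℝ≥0∞}
    (H : ∀ h : Rn n → ℝ≥0∞, AEMeasurable h volume → associate ρ h ≤ 1 →
      ∫⁻ x, g x * h x ≤ B) : ρ g ≤ B :=
  le_of_tendsto' (hρ.fatou (fun N => truncate g N) g (fun N => aemeasurable_truncate hg N) hg
    (Eventually.of_forall fun x => ⟨monotone_truncate g x, tendsto_truncate g x⟩))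
    (norm_truncate_le_of_associate hρ hg H)

end FunctionNorm

/-! ### The maximal operator and averages over balls -/

section Maximal

variable {n : ℕ} {ρ : FunctionNorm n}

lemma setLIntegral_ball_le_maximal (g : Rn n → ℝ≥0∞) {c x : Rn n} {R : ℝ} (hR : 0 < R)
    (hx : x ∈ Metric.ball c R) :
    ∫⁻ y in Metric.ball c R, g y ≤ volume (Metric.ball c R) * maximal g x := by
  have h0 : volume (Metric.ball c R) ≠ 0 := (Metric.measure_ball_pos volume c hR).ne'
  have h1 : volume (Metric.ball c R) ≠ ∞ := measure_ball_lt_top.ne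
  have : (∫⁻ y in Metric.ball c R, g y) / volume (Metric.ball c R) ≤ maximal g x :=
    le_iSup₂_of_le c R (le_iSup₂_of_le hR hx le_rfl)
  rwa [ENNReal.div_le_iff h0 h1, mul_comm] at this

lemma measurable_maximal (g : Rn n → ℝ≥0∞) : Measurable (maximal g) := by
  refine LowerSemicontinuous.measurable fun x a ha => ?_
  simp only [maximal, lt_iSup_iff] at ha
  obtain ⟨c, R, hR, hx, h⟩ := ha
  filter_upwards [Metric.isOpen_ball.mem_nhds hx] with y hy
  exact h.trans_le (le_iSup₂_of_le c R (le_iSup₂_of_le hR hy le_rfl))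

lemma maximal_le_of_le {g : Rn n → ℝ≥0∞} {L : ℝ≥0∞} (h : ∀ x, g x ≤ L) (x : Rn n) :
    maximal g x ≤ L := by
  refine iSup₂_le fun c R => iSup₂_le fun hR _ => ENNReal.div_le_of_le_mul ?_
  calc ∫⁻ y in Metric.ball c R, g y ≤ ∫⁻ _ in Metric.ball c R, L := lintegral_mono fun y => h y
    _ = _ := by simp

lemma norm_maximal_le (hfin : maximalOpNorm ρ < ∞) {g : Rn n → ℝ≥0∞}
    (hg : AEMeasurable g volume) (hgfin : ρ g < ∞) :
    ρ (maximal g) ≤ maximalOpNorm ρ * ρ g := by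
  by_cases h0 : ρ g = 0
  · obtain ⟨C, hC, -⟩ := sInf_lt_iff.1 hfin
    simpa [h0] using hC g hg hgfin
  · rw [← ENNReal.div_le_iff h0 hgfin.ne]
    refine le_sInf fun C hC => ?_
    rw [ENNReal.div_le_iff h0 hgfin.ne]
    exact hC g hg hgfin

lemma norm_eq_convexify {p : ℝ} (hp : 0 < p) (F : Rn n → ℝ≥0∞) :
    ρ F ^ p = convexify ρ (1 / p) fun x => F x ^ p := by
  have : (fun x => (F x ^ p) ^ (1 / p)) = F := by
    funext x
    rw [← ENNReal.rpow_mul, mul_one_div_cancel hp.ne', ENNReal.rpow_one]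
  rw [convexify, this, one_div_one_div]

/-- The extrapolation principle: an `L^p` estimate with an arbitrary weight `h` on the left and
iterated maximal functions of `h` on the right passes to the space `X`, because `X^{1/p}` is the
associate space of `(X^{1/p})'` and the maximal operator is bounded on the latter. -/
lemma norm_le_of_weighted {p : ℝ} (hp : 1 ≤ p) (hY : IsBallBanach (convexify ρ (1 / p)))
    (ht : maximalOpNorm (associate (convexify ρ (1 / p))) < ∞) {F g : Rn n → ℝ≥0∞}
    (hF : AEMeasurable F volume) (hg : AEMeasurable g volume) (hgfin : ρ g < ∞) (K : ℝ≥0∞)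
    (H : ∀ h : Rn n → ℝ≥0∞, Measurable h →
      ∫⁻ x, F x ^ p * h x ≤ K * ∫⁻ x, g x ^ p * (maximal h x + maximal (maximal h) x)) :
    ρ F ≤ (K * (maximalOpNorm (associate (convexify ρ (1 / p))) +
      maximalOpNorm (associate (convexify ρ (1 / p))) ^ 2)) ^ (1 / p) * ρ g := by
  have hp0 : 0 < p := by linarith
  set Y := convexify ρ (1 / p) with hYdef
  set t := maximalOpNorm (associate Y) with htdef
  have hgp : Y (fun x => g x ^ p) < ∞ := by
    rw [hYdef, ← norm_eq_convexify hp0]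
    exact ENNReal.rpow_lt_top_of_nonneg hp0.le hgfin.ne
  have key : Y (fun x => F x ^ p) ≤ K * (t + t ^ 2) * Y fun x => g x ^ p := by
    refine norm_le_of_associate hY (hF.pow_const p) fun h hh h1 => ?_
    have e1 : associate Y (hh.mk h) ≤ 1 := by
      refine le_trans (le_of_eq ?_) h1
      unfold associate
      congr 1; funext w; congr 1; funext hw; congr 1; funext _
      refine lintegral_congr_ae ?_
      filter_upwards [hh.ae_eq_mk] with x hx
      rw [hx]
    have e2 : ∫⁻ x, F x ^ p * h x = ∫⁻ x, F x ^ p * hh.mk h x := by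
      refine lintegral_congr_ae ?_
      filter_upwards [hh.ae_eq_mk] with x hx
      rw [hx]
    set k := hh.mk h with hk
    have hkm : Measurable k := hh.measurable_mk
    have a1 : associate Y (maximal k) ≤ t := by
      refine (norm_maximal_le ht hkm.aemeasurable (e1.trans_lt ENNReal.one_lt_top)).trans ?_
      calc t * associate Y k ≤ t * 1 := by gcongr
        _ = t := mul_one t
    have a2 : associate Y (maximal (maximal k)) ≤ t ^ 2 := by
      refine (norm_maximal_le ht (measurable_maximal k).aemeasurable (a1.trans_lt ht)).trans ?_
      rw [sq]
      gcongr
    rw [e2]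
    calc _ ≤ K * ∫⁻ x, g x ^ p * (maximal k x + maximal (maximal k) x) := H k hkm
      _ ≤ K * (Y (fun x => g x ^ p) * associate Y (fun x => maximal k x + maximal (maximal k) x)) := by
          gcongr
          exact lintegral_mul_le_associate hY (hg.pow_const p) hgp
      _ ≤ K * (Y (fun x => g x ^ p) * (t + t ^ 2)) := by
          gcongr
          exact (associate_add_le (measurable_maximal k).aemeasurable).trans (add_le_add a1 a2)
      _ = _ := by ring
  rw [hYdef, ← norm_eq_convexify hp0, ← norm_eq_convexify hp0] at key
  have := ENNReal.rpow_le_rpow key (one_div_nonneg.2 hp0.le)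
  rwa [← ENNReal.rpow_mul, mul_one_div_cancel hp0.ne', ENNReal.rpow_one,
    ENNReal.mul_rpow_of_nonneg _ _ (one_div_nonneg.2 hp0.le), ← ENNReal.rpow_mul,
    mul_one_div_cancel hp0.ne', ENNReal.rpow_one] at this

/-- The average of `g` over the ball of radius `s` centred at `x`. -/
def ballAvg (s : ℝ) (g : Rn n → ℝ≥0∞) (x : Rn n) : ℝ≥0∞ :=
  (∫⁻ y in Metric.ball x s, g y) / volume (Metric.ball x s)

lemma ballAvg_le_maximal {s : ℝ} (hs : 0 < s) (g : Rn n → ℝ≥0∞) (x : Rn n) :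
    ballAvg s g x ≤ maximal g x :=
  le_iSup₂_of_le x s (le_iSup₂_of_le hs (Metric.mem_ball_self hs) le_rfl)

lemma volume_ball_eq (c : Rn n) (s : ℝ) :
    volume (Metric.ball c s) = volume (Metric.ball (0 : Rn n) s) :=
  Measure.addHaar_ball_center volume c s

lemma ballAvg_eq (s : ℝ) (g : Rn n → ℝ≥0∞) (x : Rn n) :
    ballAvg s g x = (volume (Metric.ball (0 : Rn n) s))⁻¹ *
      ∫⁻ y, ({z : Rn n × Rn n | dist z.2 z.1 < s}).indicator (fun z => g z.2) (x, y) := by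
  rw [ballAvg, volume_ball_eq, div_eq_mul_inv, mul_comm, ← lintegral_indicator measurableSet_ball]
  rfl

lemma measurableSet_dist_lt (s : ℝ) : MeasurableSet {z : Rn n × Rn n | dist z.2 z.1 < s} :=
  (isOpen_lt (by fun_prop) continuous_const).measurableSet

lemma measurable_ballAvg {g : Rn n → ℝ≥0∞} (hg : Measurable g) (s : ℝ) :
    Measurable (ballAvg s g) := by
  have : ballAvg s g = fun x => _ := funext fun x => ballAvg_eq s g x
  rw [this]
  exact (((hg.comp measurable_snd).indicator (measurableSet_dist_lt s)).lintegral_prod_right').const_mul _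

/-- The averaging operators are symmetric. -/
lemma lintegral_ballAvg_mul {g h : Rn n → ℝ≥0∞} (hg : Measurable g)
    (hh : Measurable h) (s : ℝ) :
    ∫⁻ x, ballAvg s g x * h x = ∫⁻ x, g x * ballAvg s h x := by
  have hS := measurableSet_dist_lt (n := n) s
  have hgx : ∀ x, Measurable fun y =>
      ({z : Rn n × Rn n | dist z.2 z.1 < s}).indicator (fun z => g z.2) (x, y) := fun x =>
    ((hg.comp measurable_snd).indicator hS).comp measurable_prodMk_left
  have hhx : ∀ x, Measurable fun y =>
      ({z : Rn n × Rn n | dist z.2 z.1 < s}).indicator (fun z => h z.2) (x, y) := fun x =>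
    ((hh.comp measurable_snd).indicator hS).comp measurable_prodMk_left
  have e1 : ∀ x, ballAvg s g x * h x = (volume (Metric.ball (0 : Rn n) s))⁻¹ *
      ∫⁻ y, ({z : Rn n × Rn n | dist z.2 z.1 < s}).indicator (fun z => g z.2 * h z.1) (x, y) := by
    intro x
    rw [ballAvg_eq, mul_assoc, ← lintegral_mul_const _ (hgx x)]
    congr 1
    refine lintegral_congr fun y => ?_
    by_cases hz : dist y x < s <;> simp [indicator, hz]
  have e2 : ∀ y, g y * ballAvg s h y = (volume (Metric.ball (0 : Rn n) s))⁻¹ *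
      ∫⁻ x, ({z : Rn n × Rn n | dist z.2 z.1 < s}).indicator (fun z => g z.2 * h z.1) (x, y) := by
    intro y
    rw [ballAvg_eq, mul_left_comm, ← lintegral_const_mul _ (hhx y)]
    congr 1
    refine lintegral_congr fun x => ?_
    by_cases hz : dist y x < s <;> simp [indicator, hz, dist_comm x y]
  have hm : Measurable (({z : Rn n × Rn n | dist z.2 z.1 < s}).indicator
      (fun z => g z.2 * h z.1)) :=
    ((hg.comp measurable_snd).mul (hh.comp measurable_fst)).indicator hS
  simp_rw [e1, e2]
  rw [lintegral_const_mul _ hm.lintegral_prod_right', lintegral_const_mul _ hm.lintegral_prod_left']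
  congr 1
  exact lintegral_lintegral_swap hm.aemeasurable

lemma lintegral_ballAvg_mul_le {g h : Rn n → ℝ≥0∞} (hg : Measurable g)
    (hh : Measurable h) {s : ℝ} (hs : 0 < s) :
    ∫⁻ x, ballAvg s g x * h x ≤ ∫⁻ x, g x * maximal h x := by
  rw [lintegral_ballAvg_mul hg hh]
  exact lintegral_mono fun x => mul_le_mul_right (ballAvg_le_maximal hs h x) _

lemma rpow_lintegral_le {α : Type*} [MeasurableSpace α] {μ : Measure α} [IsProbabilityMeasure μ]
    {p : ℝ} (hp : 1 ≤ p) {f : α → ℝ≥0∞} (hf : AEMeasurable f μ) :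
    (∫⁻ x, f x ∂μ) ^ p ≤ ∫⁻ x, f x ^ p ∂μ := by
  have h := eLpNorm'_le_eLpNorm'_of_exponent_le (f := f) zero_lt_one hp μ hf.aestronglyMeasurable
  simp only [eLpNorm', enorm_eq_self, ENNReal.rpow_one, one_div_one] at h
  have h2 := ENNReal.rpow_le_rpow h (z := p) (by linarith)
  rwa [← ENNReal.rpow_mul, one_div_mul_cancel (by linarith : p ≠ 0), ENNReal.rpow_one] at h2

lemma rpow_ballAvg_le {p : ℝ} (hp : 1 ≤ p) {g : Rn n → ℝ≥0∞} (hg : Measurable g) {s : ℝ}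
    (hs : 0 < s) (x : Rn n) : ballAvg s g x ^ p ≤ ballAvg s (fun y => g y ^ p) x := by
  have h0 : volume (Metric.ball x s) ≠ 0 := (Metric.measure_ball_pos volume x hs).ne'
  have h1 : volume (Metric.ball x s) ≠ ∞ := measure_ball_lt_top.ne
  let μ : Measure (Rn n) := (volume (Metric.ball x s))⁻¹ • volume.restrict (Metric.ball x s)
  have : IsProbabilityMeasure μ := ⟨by
    simp only [μ, Measure.smul_apply, Measure.restrict_apply_univ, smul_eq_mul]
    exact ENNReal.inv_mul_cancel h0 h1⟩
  have e : ∀ f : Rn n → ℝ≥0∞, ballAvg s f x = ∫⁻ y, f y ∂μ := by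
    intro f
    simp only [μ, lintegral_smul_measure, smul_eq_mul]
    rw [ballAvg, div_eq_mul_inv, mul_comm]
  rw [e, e]
  exact rpow_lintegral_le hp hg.aemeasurable

/-- The averaging operators of all radii are uniformly bounded on `X`. -/
lemma norm_ballAvg_le {p : ℝ} (hp : 1 ≤ p) (hY : IsBallBanach (convexify ρ (1 / p)))
    (ht : maximalOpNorm (associate (convexify ρ (1 / p))) < ∞) {g : Rn n → ℝ≥0∞}
    (hg : Measurable g) (hgfin : ρ g < ∞) {s : ℝ} (hs : 0 < s) :
    ρ (ballAvg s g) ≤ (maximalOpNorm (associate (convexify ρ (1 / p))) +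
      maximalOpNorm (associate (convexify ρ (1 / p))) ^ 2) ^ (1 / p) * ρ g := by
  have := norm_le_of_weighted hp hY ht (measurable_ballAvg hg s).aemeasurable hg.aemeasurable hgfin 1
    fun h hh => ?_
  · rwa [one_mul] at this
  · rw [one_mul]
    calc _ ≤ ∫⁻ x, ballAvg s (fun y => g y ^ p) x * h x :=
          lintegral_mono fun x => mul_le_mul_left (rpow_ballAvg_le hp hg hs x) _
      _ ≤ _ := lintegral_ballAvg_mul_le (hg.pow_const p) hh hs
      _ ≤ _ := lintegral_mono fun x => mul_le_mul_right le_self_add _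

lemma measurable_ballAvg_uncurry {g : Rn n → ℝ≥0∞} (hg : Measurable g) (s : ℝ) :
    Measurable fun z : ℝ × Rn n => ballAvg (z.1 * s) g z.2 := by
  have e : (fun z : ℝ × Rn n => ballAvg (z.1 * s) g z.2) = fun z =>
      (∫⁻ y, ({w : (ℝ × Rn n) × Rn n | dist w.2 w.1.2 < w.1.1 * s}).indicator
        (fun w => g w.2) (z, y)) / volume (Metric.ball (0 : Rn n) (z.1 * s)) := by
    funext z
    rw [ballAvg, volume_ball_eq, ← lintegral_indicator measurableSet_ball]
    rfl
  rw [e]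
  refine Measurable.div ?_ ?_
  · refine ((hg.comp measurable_snd).indicator ?_).lintegral_prod_right'
    exact (isOpen_lt (by fun_prop) (by fun_prop)).measurableSet
  · have : Monotone fun r : ℝ => volume (Metric.ball (0 : Rn n) r) := fun r r' h =>
      measure_mono (Metric.ball_subset_ball h)
    exact this.measurable.comp (by fun_prop)

lemma measurable_ballAvg_radius {g : Rn n → ℝ≥0∞} (hg : Measurable g) (s : ℝ) (x : Rn n) :
    Measurable fun t : ℝ => ballAvg (t * s) g x :=
  Measurable.of_uncurry_right (f := fun t x => ballAvg (t * s) g x)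
    (measurable_ballAvg_uncurry hg s)

/-- The mean over `t ∈ (0,1)` of the averages of `g` over the balls of radius `t s`. -/
def radialAvg (s : ℝ) (g : Rn n → ℝ≥0∞) (x : Rn n) : ℝ≥0∞ :=
  ∫⁻ t in Ioo (0 : ℝ) 1, ballAvg (t * s) g x

lemma measurable_radialAvg {g : Rn n → ℝ≥0∞} (hg : Measurable g) (s : ℝ) :
    Measurable (radialAvg s g) :=
  ((measurable_ballAvg_uncurry hg s).comp measurable_swap).lintegral_prod_right'

lemma radialAvg_le_maximal {s : ℝ} (hs : 0 < s) (g : Rn n → ℝ≥0∞) (x : Rn n) :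
    radialAvg s g x ≤ maximal g x := by
  calc radialAvg s g x ≤ ∫⁻ _ in Ioo (0 : ℝ) 1, maximal g x := by
        refine setLIntegral_mono measurable_const fun t ht => ?_
        exact ballAvg_le_maximal (mul_pos ht.1 hs) g x
    _ = maximal g x := by simp

lemma norm_radialAvg_le {p : ℝ} (hp : 1 ≤ p) (hY : IsBallBanach (convexify ρ (1 / p)))
    (ht : maximalOpNorm (associate (convexify ρ (1 / p))) < ∞) {g : Rn n → ℝ≥0∞}
    (hg : Measurable g) (hgfin : ρ g < ∞) {s : ℝ} (hs : 0 < s) :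
    ρ (radialAvg s g) ≤ (maximalOpNorm (associate (convexify ρ (1 / p))) +
      maximalOpNorm (associate (convexify ρ (1 / p))) ^ 2) ^ (1 / p) * ρ g := by
  have := norm_le_of_weighted hp hY ht (measurable_radialAvg hg s).aemeasurable hg.aemeasurable
    hgfin 1 fun h hh => ?_
  · rwa [one_mul] at this
  · rw [one_mul]
    have hprob : IsProbabilityMeasure (volume.restrict (Ioo (0 : ℝ) 1)) := ⟨by simp⟩
    have hm := measurable_ballAvg_uncurry (hg.pow_const p) s
    have hmx : ∀ x, Measurable fun t : ℝ => ballAvg (t * s) (fun y => g y ^ p) x := fun x =>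
      measurable_ballAvg_radius (hg.pow_const p) s x
    calc _ ≤ ∫⁻ x, ∫⁻ t in Ioo (0 : ℝ) 1, ballAvg (t * s) (fun y => g y ^ p) x * h x := by
          refine lintegral_mono fun x => ?_
          rw [lintegral_mul_const _ (hmx x)]
          gcongr
          calc radialAvg s g x ^ p ≤ ∫⁻ t in Ioo (0 : ℝ) 1, ballAvg (t * s) g x ^ p :=
                rpow_lintegral_le hp (measurable_ballAvg_radius hg s x).aemeasurable
            _ ≤ _ := setLIntegral_mono (hmx x) fun t ht =>
                rpow_ballAvg_le hp hg (mul_pos ht.1 hs) x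
      _ = ∫⁻ t in Ioo (0 : ℝ) 1, ∫⁻ x, ballAvg (t * s) (fun y => g y ^ p) x * h x := by
          have hm2 : Measurable fun z : Rn n × ℝ =>
              ballAvg (z.2 * s) (fun y => g y ^ p) z.1 * h z.1 :=
            (hm.comp measurable_swap).mul (hh.comp measurable_fst)
          exact lintegral_lintegral_swap (f := fun x t => ballAvg (t * s) (fun y => g y ^ p) x * h x)
            hm2.aemeasurable
      _ ≤ ∫⁻ t in Ioo (0 : ℝ) 1, ∫⁻ x, g x ^ p * maximal h x := by
          refine setLIntegral_mono measurable_const fun t ht => ?_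
          exact lintegral_ballAvg_mul_le (hg.pow_const p) hh (mul_pos ht.1 hs)
      _ = ∫⁻ x, g x ^ p * maximal h x := by simp
      _ ≤ _ := lintegral_mono fun x => mul_le_mul_right le_self_add _

end Maximal

section DominatedConvergence

variable {n : ℕ} {ρ : FunctionNorm n}

/-- Dominated convergence to zero in a space with absolutely continuous norm. -/
lemma tendsto_norm_zero_of_dominated (hρ : IsBallBanach ρ) (hac : HasAbsolutelyContinuousNorm ρ)
    {g : Rn n → ℝ≥0∞} (hg : AEMeasurable g volume) (hgfin : ρ g < ∞) {u : ℕ → Rn n → ℝ≥0∞}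
    (hu : ∀ m, AEMeasurable (u m) volume) (hug : ∀ m, u m ≤ᵐ[volume] g)
    (hlim : ∀ᵐ x, Tendsto (fun m => u m x) atTop (𝓝 0)) :
    Tendsto (fun m => ρ (u m)) atTop (𝓝 0) := by
  have key : ∀ δ : ℝ≥0, 0 < δ → limsup (fun m => ρ (u m)) atTop ≤ δ * ρ g := by
    intro δ hδ
    set A : ℕ → Set (Rn n) := fun m => {x | (δ : ℝ≥0∞) * g x < u m x} with hA
    have hAm : ∀ m, NullMeasurableSet (A m) volume := fun m =>
      nullMeasurableSet_lt (hg.const_mul _) (hu m)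
    have hAlim : ∀ᵐ x, Tendsto (fun j => (A j).indicator (1 : Rn n → ℝ) x) atTop (𝓝 0) := by
      filter_upwards [hlim, ae_all_iff.2 hug] with x hx hxg
      have : ∀ᶠ m in atTop, x ∉ A m := by
        by_cases h0 : g x = 0
        · refine Eventually.of_forall fun m => ?_
          have : u m x = 0 := le_antisymm ((hxg m).trans h0.le) bot_le
          simp [hA, this]
        · have hpos : 0 < (δ : ℝ≥0∞) * g x := ENNReal.mul_pos (by exact_mod_cast hδ.ne') h0
          filter_upwards [hx.eventually (gt_mem_nhds hpos)] with m hm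
          simp only [hA, mem_ofPred_eq, not_lt]
          exact hm.le
      refine tendsto_const_nhds.congr' ?_
      filter_upwards [this] with m hm
      simp [indicator_of_notMem hm]
    have h1 := hac g hg hgfin A hAm hAlim
    have h2 : ∀ m, ρ (u m) ≤ δ * ρ g + ρ ((A m).indicator g) := by
      intro m
      have hind : AEMeasurable ((A m).indicator g) volume := hg.indicator₀ (hAm m)
      rw [← hρ.smul δ g hg]
      refine (hρ.mono _ _ (hu m) ((hg.const_mul _).add hind) ?_).trans
        (hρ.add_le _ _ (hg.const_mul _) hind)
      filter_upwards [hug m] with x hx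
      by_cases hxA : x ∈ A m
      · rw [Pi.add_apply, indicator_of_mem hxA]
        exact hx.trans le_add_self
      · rw [Pi.add_apply, indicator_of_notMem hxA, add_zero]
        exact not_lt.1 hxA
    have h3 : Tendsto (fun m => (δ : ℝ≥0∞) * ρ g + ρ ((A m).indicator g)) atTop
        (𝓝 ((δ : ℝ≥0∞) * ρ g + 0)) := tendsto_const_nhds.add h1
    calc _ ≤ limsup (fun m => (δ : ℝ≥0∞) * ρ g + ρ ((A m).indicator g)) atTop :=
          limsup_le_limsup (Eventually.of_forall h2)
      _ = _ := by rw [h3.limsup_eq, add_zero]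
  have h0 : limsup (fun m => ρ (u m)) atTop ≤ 0 := by
    have hlimδ : Tendsto (fun k : ℕ => (((k : ℝ≥0) + 1)⁻¹ : ℝ≥0) * ρ g) atTop (𝓝 (0 * ρ g)) := by
      refine ENNReal.Tendsto.mul_const ?_ (Or.inr hgfin.ne)
      have : Tendsto (fun k : ℕ => ((k : ℝ≥0) + 1)⁻¹) atTop (𝓝 0) := by
        have := tendsto_one_div_add_atTop_nhds_zero_nat (𝕜 := ℝ≥0)
        simpa using this
      rw [← ENNReal.coe_zero]
      exact ENNReal.tendsto_coe.2 this
    rw [zero_mul] at hlimδ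
    exact ge_of_tendsto' hlimδ fun k => key _ (by positivity)
  exact tendsto_of_le_liminf_of_limsup_le bot_le h0

/-- Dominated convergence in a space with absolutely continuous norm. -/
lemma tendsto_norm_of_dominated (hρ : IsBallBanach ρ) (hac : HasAbsolutelyContinuousNorm ρ)
    {g : Rn n → ℝ≥0∞} (hg : AEMeasurable g volume) (hgfin : ρ g < ∞) {u : ℕ → Rn n → ℝ≥0∞}
    (hu : ∀ m, AEMeasurable (u m) volume) (hug : ∀ m, u m ≤ᵐ[volume] g)
    {v : Rn n → ℝ≥0∞} (hv : AEMeasurable v volume) (hvfin : ∀ᵐ x, v x ≠ ∞)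
    (hlim : ∀ᵐ x, Tendsto (fun m => u m x) atTop (𝓝 (v x))) :
    Tendsto (fun m => ρ (u m)) atTop (𝓝 (ρ v)) := by
  have hd : Tendsto (fun m => ρ (fun x => u m x - v x)) atTop (𝓝 0) := by
    refine tendsto_norm_zero_of_dominated hρ hac hg hgfin (fun m => (hu m).sub hv) (fun m => ?_) ?_
    · filter_upwards [hug m] with x hx
      exact tsub_le_self.trans hx
    · filter_upwards [hlim, hvfin] with x hx hf
      have := ENNReal.Tendsto.sub hx (tendsto_const_nhds (x := v x)) (Or.inl hf)
      simpa using this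
  have hup : limsup (fun m => ρ (u m)) atTop ≤ ρ v := by
    have h3 : Tendsto (fun m => ρ v + ρ (fun x => u m x - v x)) atTop (𝓝 (ρ v + 0)) :=
      tendsto_const_nhds.add hd
    calc _ ≤ limsup (fun m => ρ v + ρ (fun x => u m x - v x)) atTop := by
          refine limsup_le_limsup (Eventually.of_forall fun m => ?_)
          refine (hρ.mono _ _ (hu m) (hv.add ((hu m).sub hv)) (Eventually.of_forall fun x => ?_)).trans
            (hρ.add_le _ _ hv ((hu m).sub hv))
          exact le_add_tsub
      _ = _ := by rw [h3.limsup_eq, add_zero]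
  have hlow : ρ v ≤ liminf (fun m => ρ (u m)) atTop := by
    refine le_trans (le_of_eq ?_) (hρ.liminf_le hu)
    refine hρ.congr hv ?_
    filter_upwards [hlim] with x hx
    exact hx.liminf_eq.symm
  exact tendsto_of_le_liminf_of_limsup_le hlow hup

end DominatedConvergence

/-! ### Power kernels and dyadic coverings -/

section Kernel

variable {n : ℕ}

/-- The scale attached to the `j`-th dyadic layer of `{a : a ^ γ < T}`. -/
lemma exists_layer_radius {γ T a : ℝ} (hγ : γ ≠ 0) (hT : 0 < T) (ha : 0 < a) (haT : a ^ γ < T) :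
    ∃ j : ℕ, a ≤ (((2 : ℝ)⁻¹ ^ j * T * if 0 < γ then 1 else 2⁻¹) ^ (1 / γ)) ∧
      a ^ γ ≤ (2 : ℝ)⁻¹ ^ j * T ∧
      (2 : ℝ) ^ (-(1 / |γ|)) * (((2 : ℝ)⁻¹ ^ j * T * if 0 < γ then 1 else 2⁻¹) ^ (1 / γ)) ≤ a := by
  have haγ : 0 < a ^ γ := Real.rpow_pos_of_pos ha γ
  obtain ⟨j, hj1, hj2⟩ := exists_nat_pow_near_of_lt_one (div_pos haγ hT)
    ((div_le_one hT).2 haT.le) (by norm_num : (0 : ℝ) < 2⁻¹) (by norm_num)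
  rw [lt_div_iff₀ hT] at hj1
  rw [div_le_iff₀ hT] at hj2
  have hP : 0 < (2 : ℝ)⁻¹ ^ j * T := by positivity
  have haa : (a ^ γ) ^ (1 / γ) = a := by
    rw [← Real.rpow_mul ha.le, mul_one_div_cancel hγ, Real.rpow_one]
  refine ⟨j, ?_, hj2, ?_⟩
  · rcases lt_or_gt_of_ne hγ with h | h
    · rw [if_neg (not_lt.2 h.le)]
      calc a = (a ^ γ) ^ (1 / γ) := haa.symm
        _ ≤ _ := by
          refine Real.rpow_le_rpow_of_nonpos (by positivity) ?_ (one_div_neg.2 h).le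
          rw [pow_succ] at hj1
          linarith
    · rw [if_pos h, mul_one]
      calc a = (a ^ γ) ^ (1 / γ) := haa.symm
        _ ≤ _ := Real.rpow_le_rpow haγ.le hj2 (one_div_pos.2 h).le
  · rcases lt_or_gt_of_ne hγ with h | h
    · rw [if_neg (not_lt.2 h.le), abs_of_neg h]
      have e : (2 : ℝ) ^ (-(1 / -γ)) = 2 ^ (1 / γ) := by congr 1; field_simp
      rw [e, ← Real.mul_rpow (by norm_num) (by positivity)]
      calc _ ≤ (a ^ γ) ^ (1 / γ) := by
            refine Real.rpow_le_rpow_of_nonpos haγ ?_ (one_div_neg.2 h).le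
            linarith
        _ = a := haa
    · rw [if_pos h, mul_one, abs_of_pos h]
      have e : (2 : ℝ) ^ (-(1 / γ)) = (2⁻¹ : ℝ) ^ (1 / γ) := by
        rw [Real.inv_rpow (by norm_num), Real.rpow_neg (by norm_num)]
      rw [e, ← Real.mul_rpow (by norm_num) (by positivity)]
      calc _ ≤ (a ^ γ) ^ (1 / γ) := by
            refine Real.rpow_le_rpow (by positivity) ?_ (one_div_pos.2 h).le
            rw [pow_succ] at hj1
            linarith
        _ = a := haa

/-- The kernel `|x - m|^{γ-n}` with the cutoff `|x - m|^γ < T`, integrated against `h`, is at most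
`T` times the averages of `h` over the balls centred at `m` which the cutoff involves. The cutoff is
cut into layers on which `|x - m|^γ` is comparable to `2^{-j} T`. -/
lemma lintegral_kernel_le {γ T : ℝ} (hγ : γ ≠ 0) (hT : 0 < T) (m : Rn n)
    {h : Rn n → ℝ≥0∞} (hh : Measurable h) {W : ℝ≥0∞}
    (hW : ∀ R : ℝ, 0 < R → R ^ γ ≤ T →
      ∫⁻ x in Metric.closedBall m R, h x ≤ ENNReal.ofReal (R ^ (n : ℝ)) * W) :
    ∫⁻ x, ({x : Rn n | x ≠ m ∧ ‖x - m‖ ^ γ < T}).indicator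
      (fun x => ENNReal.ofReal (‖x - m‖ ^ (γ - n)) * h x) x ≤
        ENNReal.ofReal (2 * 2 ^ ((n : ℝ) / |γ|) * T) * W := by
  set R : ℕ → ℝ := fun j => ((2 : ℝ)⁻¹ ^ j * T * if 0 < γ then 1 else 2⁻¹) ^ (1 / γ) with hR
  have hc : 0 < (if 0 < γ then (1 : ℝ) else 2⁻¹) := by split_ifs <;> norm_num
  have hc1 : (if 0 < γ then (1 : ℝ) else 2⁻¹) ≤ 1 := by split_ifs <;> norm_num
  have hRpos : ∀ j, 0 < R j := fun j => Real.rpow_pos_of_pos (by positivity) _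
  have hRγ : ∀ j, R j ^ γ ≤ T := by
    intro j
    simp only [hR]
    rw [← Real.rpow_mul (by positivity), one_div_mul_cancel hγ, Real.rpow_one]
    have : (2 : ℝ)⁻¹ ^ j ≤ 1 := pow_le_one₀ (by norm_num) (by norm_num)
    calc (2 : ℝ)⁻¹ ^ j * T * _ ≤ 1 * T * 1 := by gcongr
      _ = T := by ring
  set c : ℕ → ℝ := fun j => (2 : ℝ)⁻¹ ^ j * T * (2 ^ ((n : ℝ) / |γ|) * R j ^ (-(n : ℝ))) with hcdef
  have hpt : ∀ x, ({x : Rn n | x ≠ m ∧ ‖x - m‖ ^ γ < T}).indicator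
      (fun x => ENNReal.ofReal (‖x - m‖ ^ (γ - n)) * h x) x ≤
      ∑' j, (Metric.closedBall m (R j)).indicator (fun x => ENNReal.ofReal (c j) * h x) x := by
    intro x
    by_cases hx : x ∈ {x : Rn n | x ≠ m ∧ ‖x - m‖ ^ γ < T}
    · rw [indicator_of_mem hx]
      have ha : 0 < ‖x - m‖ := norm_pos_iff.2 (sub_ne_zero.2 hx.1)
      obtain ⟨j, h1, h2, h3⟩ := exists_layer_radius hγ hT ha hx.2
      refine le_trans ?_ (ENNReal.le_tsum j)
      have hxm : x ∈ Metric.closedBall m (R j) := by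
        rw [mem_closedBall_iff_norm]; exact h1
      rw [indicator_of_mem hxm]
      gcongr
      simp only [hcdef]
      rw [sub_eq_add_neg γ, Real.rpow_add ha]
      gcongr
      have e : (2 : ℝ) ^ ((n : ℝ) / |γ|) * R j ^ (-(n : ℝ)) =
          ((2 : ℝ) ^ (-(1 / |γ|)) * R j) ^ (-(n : ℝ)) := by
        have e0 : ((2 : ℝ) ^ (-(1 / |γ|))) ^ (-(n : ℝ)) = 2 ^ ((n : ℝ) / |γ|) := by
          rw [← Real.rpow_mul (by norm_num)]
          congr 1
          ring
        rw [Real.mul_rpow (by positivity) (hRpos j).le, e0]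
      rw [e]
      exact Real.rpow_le_rpow_of_nonpos (mul_pos (by positivity) (hRpos j)) h3 (by simp)
    · rw [indicator_of_notMem hx]
      exact bot_le
  calc _ ≤ ∫⁻ x, ∑' j, (Metric.closedBall m (R j)).indicator
          (fun x => ENNReal.ofReal (c j) * h x) x := lintegral_mono hpt
    _ = ∑' j, ∫⁻ x, (Metric.closedBall m (R j)).indicator
          (fun x => ENNReal.ofReal (c j) * h x) x :=
        lintegral_tsum fun j => ((hh.const_mul _).indicator measurableSet_closedBall).aemeasurable
    _ ≤ ∑' j : ℕ, ENNReal.ofReal ((2 : ℝ)⁻¹ ^ j * (T * 2 ^ ((n : ℝ) / |γ|))) * W := by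
        refine ENNReal.tsum_le_tsum fun j => ?_
        rw [lintegral_indicator measurableSet_closedBall, lintegral_const_mul _ hh]
        calc _ ≤ ENNReal.ofReal (c j) * (ENNReal.ofReal (R j ^ (n : ℝ)) * W) := by
              gcongr
              exact hW _ (hRpos j) (hRγ j)
          _ = _ := by
              rw [← mul_assoc, ← ENNReal.ofReal_mul (by simp only [hcdef]; have := hRpos j; positivity)]
              congr 2
              simp only [hcdef]
              have : R j ^ (-(n : ℝ)) * R j ^ (n : ℝ) = 1 := by
                rw [← Real.rpow_add (hRpos j)]; simp
              calc _ = (2 : ℝ)⁻¹ ^ j * T * 2 ^ ((n : ℝ) / |γ|) *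
                    (R j ^ (-(n : ℝ)) * R j ^ (n : ℝ)) := by ring
                _ = _ := by rw [this]; ring
    _ = _ := by
        rw [ENNReal.tsum_mul_right]
        congr 1
        simp_rw [ENNReal.ofReal_mul (pow_nonneg (by norm_num : (0 : ℝ) ≤ 2⁻¹) _)]
        rw [ENNReal.tsum_mul_right]
        simp_rw [ENNReal.ofReal_pow (by norm_num : (0 : ℝ) ≤ 2⁻¹)]
        rw [ENNReal.tsum_geometric, ENNReal.ofReal_inv_of_pos (by norm_num)]
        simp only [ENNReal.ofReal_ofNat, ENNReal.one_sub_inv_two, inv_inv]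
        rw [← ENNReal.ofReal_ofNat, ← ENNReal.ofReal_mul (by norm_num)]
        congr 1
        ring

/-- The constant of the kernel estimates: the volume of the unit ball times `2^{1 + n/|γ|}`. -/
def kernelConst (n : ℕ) (γ : ℝ) : ℝ≥0∞ :=
  ENNReal.ofReal (2 * 2 ^ ((n : ℝ) / |γ|)) * volume (Metric.ball (0 : Rn n) 1)

lemma kernelConst_ne_top (n : ℕ) (γ : ℝ) : kernelConst n γ ≠ ∞ :=
  ENNReal.mul_ne_top ENNReal.ofReal_ne_top measure_ball_lt_top.ne

lemma kernelConst_pos (n : ℕ) (γ : ℝ) : 0 < kernelConst n γ :=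
  ENNReal.mul_pos (by simpa using by positivity) (Metric.measure_ball_pos volume _ one_pos).ne'

lemma volume_ball_scale (c : Rn n) {R : ℝ} (hR : 0 < R) :
    volume (Metric.ball c R) = ENNReal.ofReal (R ^ (n : ℝ)) * volume (Metric.ball (0 : Rn n) 1) := by
  rw [Measure.addHaar_ball_of_pos volume c hR, finrank_euclideanSpace_fin, Real.rpow_natCast]

lemma volume_closedBall_eq (c : Rn n) {R : ℝ} (hR : 0 < R) :
    volume (Metric.closedBall c R) = volume (Metric.ball c R) := by
  rw [Measure.addHaar_closedBall volume c hR.le, Measure.addHaar_ball_of_pos volume c hR]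

lemma lintegral_kernel_le_const {γ T : ℝ} (hγ : γ ≠ 0) (hT : 0 < T) (m : Rn n) :
    ∫⁻ x, ({x : Rn n | x ≠ m ∧ ‖x - m‖ ^ γ < T}).indicator
      (fun x => ENNReal.ofReal (‖x - m‖ ^ (γ - n))) x ≤ kernelConst n γ * ENNReal.ofReal T := by
  have := lintegral_kernel_le hγ hT m (h := fun _ => 1) measurable_const
    (W := volume (Metric.ball (0 : Rn n) 1)) fun R hR _ => by
      rw [setLIntegral_one, volume_closedBall_eq m hR, volume_ball_scale m hR]
  simp only [mul_one] at this
  refine this.trans (le_of_eq ?_)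
  rw [kernelConst, ENNReal.ofReal_mul (by positivity)]
  ring

lemma setLIntegral_closedBall_le_maximal (h : Rn n → ℝ≥0∞) {m y : Rn n} {R : ℝ}
    (hR : 0 < R) (hy : y ∈ Metric.ball m R) :
    ∫⁻ x in Metric.closedBall m R, h x ≤
      ENNReal.ofReal (R ^ (n : ℝ)) * (volume (Metric.ball (0 : Rn n) 1) * maximal h y) := by
  have e : Metric.closedBall m R =ᵐ[volume] Metric.ball m R :=
    (ae_eq_of_subset_of_measure_ge Metric.ball_subset_closedBall
      (volume_closedBall_eq m hR).le measurableSet_ball.nullMeasurableSet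
      measure_closedBall_lt_top.ne).symm
  rw [setLIntegral_congr e]
  refine (setLIntegral_ball_le_maximal h hR hy).trans (le_of_eq ?_)
  rw [volume_ball_scale m hR, mul_assoc]

lemma lintegral_kernel_le_maximal {γ T : ℝ} (hγ : γ ≠ 0) (hT : 0 < T) {m y : Rn n}
    {h : Rn n → ℝ≥0∞} (hh : Measurable h)
    (hy : ∀ R : ℝ, 0 < R → R ^ γ ≤ T → y ∈ Metric.ball m R) :
    ∫⁻ x, ({x : Rn n | x ≠ m ∧ ‖x - m‖ ^ γ < T}).indicator
      (fun x => ENNReal.ofReal (‖x - m‖ ^ (γ - n)) * h x) x ≤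
        kernelConst n γ * ENNReal.ofReal T * maximal h y := by
  refine (lintegral_kernel_le hγ hT m hh
    fun R hR hRT => setLIntegral_closedBall_le_maximal h hR (hy R hR hRT)).trans (le_of_eq ?_)
  rw [kernelConst, ENNReal.ofReal_mul (by positivity)]
  ring

/-- The elementary inequality `(∫_E |x-m|^{γ-n})^s ≤ C ∫_E |x-m|^{γs-n}` for `s ≥ 1`: the part of `E`
where `|x-m|^γ` is small carries at most half of the integral on the left. -/
lemma rpow_lintegral_kernel_le {γ s : ℝ} (hγ : γ ≠ 0) (hs : 1 ≤ s) (m : Rn n)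
    {E : Set (Rn n)} (hE : MeasurableSet E) (hEm : m ∉ E) :
    (∫⁻ x in E, ENNReal.ofReal (‖x - m‖ ^ (γ - n))) ^ s ≤
      (2 * (2 * kernelConst n γ) ^ (s - 1)) *
        ∫⁻ x in E, ENNReal.ofReal (‖x - m‖ ^ (γ * s - n)) := by
  set I := ∫⁻ x in E, ENNReal.ofReal (‖x - m‖ ^ (γ - n)) with hI
  set J := ∫⁻ x in E, ENNReal.ofReal (‖x - m‖ ^ (γ * s - n)) with hJ
  have hK0 := kernelConst_pos n γ
  have hKt := kernelConst_ne_top n γ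
  have hmeas : ∀ a : ℝ, Measurable fun x : Rn n => ENNReal.ofReal (‖x - m‖ ^ a) := fun a => by
    fun_prop
  -- at least half of `I` comes from the points with `‖x - m‖ ^ γ ≥ T`
  have key : ∀ T : ℝ, 0 < T → 2 * (kernelConst n γ * ENNReal.ofReal T) ≤ I →
      ENNReal.ofReal T ^ (s - 1) * I ≤ 2 * J := by
    intro T hT hTI
    set A := {x : Rn n | ‖x - m‖ ^ γ < T} with hA
    have hAm : MeasurableSet A := measurableSet_lt (by fun_prop) measurable_const
    have h1 : ∫⁻ x in E ∩ A, ENNReal.ofReal (‖x - m‖ ^ (γ - n)) ≤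
        kernelConst n γ * ENNReal.ofReal T := by
      refine le_trans ?_ (lintegral_kernel_le_const hγ hT m)
      rw [← lintegral_indicator (hE.inter hAm)]
      refine lintegral_mono fun x => indicator_le_indicator_of_subset ?_ (fun _ => bot_le) x
      exact fun y hy => ⟨fun h => hEm (h ▸ hy.1), hy.2⟩
    have h2 : I ≤ 2 * ∫⁻ x in E \ A, ENNReal.ofReal (‖x - m‖ ^ (γ - n)) := by
      have h3 : I = (∫⁻ x in E ∩ A, ENNReal.ofReal (‖x - m‖ ^ (γ - n))) +
          ∫⁻ x in E \ A, ENNReal.ofReal (‖x - m‖ ^ (γ - n)) :=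
        (lintegral_inter_add_sdiff _ E hAm).symm
      by_cases hIt : I = ∞
      · have : ∫⁻ x in E \ A, ENNReal.ofReal (‖x - m‖ ^ (γ - n)) = ∞ := by
          by_contra h
          have h4 : ∫⁻ x in E ∩ A, ENNReal.ofReal (‖x - m‖ ^ (γ - n)) ≠ ∞ :=
            (h1.trans_lt (ENNReal.mul_lt_top hKt.lt_top ENNReal.ofReal_lt_top)).ne
          rw [hIt] at h3
          exact (ENNReal.add_ne_top.2 ⟨h4, h⟩) h3.symm
        rw [this]; simp
      · have h4 : 2 * I ≤ I + 2 * ∫⁻ x in E \ A, ENNReal.ofReal (‖x - m‖ ^ (γ - n)) := by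
          conv_lhs => rw [h3]
          rw [mul_add]
          gcongr
          exact (by gcongr : _ ≤ 2 * (kernelConst n γ * ENNReal.ofReal T)).trans hTI
        rw [two_mul I] at h4
        exact (ENNReal.add_le_add_iff_left hIt).1 h4
    have h5 : ENNReal.ofReal T ^ (s - 1) * ∫⁻ x in E \ A, ENNReal.ofReal (‖x - m‖ ^ (γ - n)) ≤ J := by
      rw [← lintegral_const_mul _ (hmeas _)]
      refine le_trans (setLIntegral_mono' (hE.diff hAm) (g := fun x =>
        ENNReal.ofReal (‖x - m‖ ^ (γ * s - n))) fun x hx => ?_) (lintegral_mono_set sdiff_subset)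
      have hx0 : 0 < ‖x - m‖ := norm_pos_iff.2 (sub_ne_zero.2 fun h => hEm (h ▸ hx.1))
      have hxT : T ≤ ‖x - m‖ ^ γ := not_lt.1 hx.2
      rw [ENNReal.ofReal_rpow_of_pos hT, ← ENNReal.ofReal_mul (by positivity)]
      refine ENNReal.ofReal_le_ofReal ?_
      have e : γ * s - n = γ * (s - 1) + (γ - n) := by ring
      rw [e, Real.rpow_add hx0, Real.rpow_mul hx0.le]
      gcongr
    calc ENNReal.ofReal T ^ (s - 1) * I ≤ ENNReal.ofReal T ^ (s - 1) *
          (2 * ∫⁻ x in E \ A, ENNReal.ofReal (‖x - m‖ ^ (γ - n))) := by gcongr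
      _ = 2 * (ENNReal.ofReal T ^ (s - 1) *
          ∫⁻ x in E \ A, ENNReal.ofReal (‖x - m‖ ^ (γ - n))) := by ring
      _ ≤ _ := by gcongr
  by_cases hI0 : I = 0
  · rw [hI0, ENNReal.zero_rpow_of_pos (by linarith)]; exact bot_le
  by_cases hIt : I = ∞
  · have h1 := key 1 one_pos (by rw [hIt]; exact le_top)
    rw [ENNReal.ofReal_one, ENNReal.one_rpow, one_mul, hIt, top_le_iff] at h1
    have hJt : J = ∞ := by
      by_contra h
      exact ENNReal.mul_ne_top ENNReal.ofNat_ne_top h h1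
    rw [hJt, ENNReal.mul_top]
    · exact le_top
    · refine mul_ne_zero two_ne_zero (ENNReal.rpow_pos_of_nonneg ?_ (by linarith)).ne'
      exact ENNReal.mul_pos two_ne_zero hK0.ne'
  -- the largest threshold to which `key` applies
  · set t := I / (2 * kernelConst n γ) with ht
    have h2K0 : 2 * kernelConst n γ ≠ 0 := mul_ne_zero two_ne_zero hK0.ne'
    have h2Kt : 2 * kernelConst n γ ≠ ∞ := ENNReal.mul_ne_top ENNReal.ofNat_ne_top hKt
    have htt : t ≠ ∞ := ENNReal.div_ne_top hIt h2K0
    have ht0 : t ≠ 0 := by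
      rw [ht, ENNReal.div_ne_zero]; exact ⟨hI0, h2Kt⟩
    have hIe : I = 2 * kernelConst n γ * t := (ENNReal.mul_div_cancel h2K0 h2Kt).symm
    have h1 := key t.toReal (ENNReal.toReal_pos ht0 htt) (by
      rw [ENNReal.ofReal_toReal htt, ← mul_assoc, ← hIe])
    rw [ENNReal.ofReal_toReal htt] at h1
    have e : s = (s - 1) + 1 := by ring
    calc I ^ s = I ^ (s - 1) * I := by
          conv_lhs => rw [e, ENNReal.rpow_add _ _ hI0 hIt, ENNReal.rpow_one]
      _ = (2 * kernelConst n γ) ^ (s - 1) * (t ^ (s - 1) * I) := by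
          conv_lhs => rw [hIe]
          rw [ENNReal.mul_rpow_of_nonneg _ _ (by linarith), ← hIe]
          ring
      _ ≤ (2 * kernelConst n γ) ^ (s - 1) * (2 * J) := by gcongr
      _ = _ := by ring

end Kernel

section Covering

variable {n : ℕ}

/-- The constant of the dyadic covering estimate. -/
def coverConst (n : ℕ) (a : ℝ) : ℝ≥0∞ :=
  ENNReal.ofReal (2 ^ a) * (1 - ENNReal.ofReal (2 ^ (-a)))⁻¹ * ENNReal.ofReal (3 ^ (n : ℝ))

lemma coverConst_ne_top (n : ℕ) {a : ℝ} (ha : 0 < a) : coverConst n a ≠ ∞ := by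
  refine ENNReal.mul_ne_top (ENNReal.mul_ne_top ENNReal.ofReal_ne_top ?_) ENNReal.ofReal_ne_top
  rw [ENNReal.inv_ne_top]
  refine (tsub_pos_of_lt ?_).ne'
  rw [ENNReal.ofReal_lt_one]
  exact Real.rpow_lt_one_of_one_lt_of_neg one_lt_two (by linarith)

/-- A geometric series over the dyadic scales `2^l ≤ 2 · 2^L`. -/
lemma tsum_zpow_rpow_le {a : ℝ} (L : ℤ) :
    ∑' l : ℤ, (if (2 : ℝ) ^ l ≤ 2 * 2 ^ L then ENNReal.ofReal (((2 : ℝ) ^ l) ^ a) else 0) ≤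
      ENNReal.ofReal (2 ^ a) * (1 - ENNReal.ofReal (2 ^ (-a)))⁻¹ *
        ENNReal.ofReal (((2 : ℝ) ^ L) ^ a) := by
  have hinj : Function.Injective fun k : ℕ => L + 1 - (k : ℤ) := fun k k' h => by
    simp only at h; omega
  have hsupp : Function.support (fun l : ℤ =>
      if (2 : ℝ) ^ l ≤ 2 * 2 ^ L then ENNReal.ofReal (((2 : ℝ) ^ l) ^ a) else 0) ⊆
      range fun k : ℕ => L + 1 - (k : ℤ) := by
    intro l hl
    have : (2 : ℝ) ^ l ≤ 2 * 2 ^ L := by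
      by_contra h
      simp [h] at hl
    rw [mul_comm, ← zpow_add_one₀ two_ne_zero, zpow_le_zpow_iff_right₀ one_lt_two] at this
    refine ⟨(L + 1 - l).toNat, ?_⟩
    simp only
    omega
  rw [← hinj.tsum_eq hsupp]
  have hterm : ∀ k : ℕ, (if (2 : ℝ) ^ (L + 1 - (k : ℤ)) ≤ 2 * 2 ^ L then
      ENNReal.ofReal (((2 : ℝ) ^ (L + 1 - (k : ℤ))) ^ a) else 0) ≤
      ENNReal.ofReal (2 ^ a) * ENNReal.ofReal (((2 : ℝ) ^ L) ^ a) *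
        ENNReal.ofReal (2 ^ (-a)) ^ k := by
    intro k
    refine (ite_le_sup _ _ _).trans (sup_le ?_ bot_le)
    rw [← ENNReal.ofReal_mul (by positivity), ← ENNReal.ofReal_pow (by positivity),
      ← ENNReal.ofReal_mul (by positivity)]
    refine (congrArg _ ?_).le
    have e : (2 : ℝ) ^ (L + 1 - (k : ℤ)) = 2 * 2 ^ L * (2 ^ k)⁻¹ := by
      rw [zpow_sub₀ two_ne_zero, zpow_add_one₀ two_ne_zero, zpow_natCast]
      field_simp
    rw [e, Real.mul_rpow (by positivity) (by positivity),
      Real.mul_rpow (by positivity) (by positivity), Real.inv_rpow (by positivity),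
      Real.rpow_neg (by norm_num), inv_pow, ← Real.rpow_natCast 2 k,
      ← Real.rpow_mul_natCast (by norm_num), ← Real.rpow_mul (by norm_num), mul_comm (k : ℝ)]
  refine (ENNReal.tsum_le_tsum hterm).trans (le_of_eq ?_)
  rw [ENNReal.tsum_mul_left, ENNReal.tsum_geometric]
  ring

/-- A Vitali covering estimate. The balls on which the average of `u` exceeds `μ` times a positive
power of the radius have bounded radii; those of a disjoint subfamily, chosen with the largest radii
first, control all the others, and carry enough mass of `u`. -/
lemma tsum_lintegral_superlevel_le {a : ℝ} (ha : 0 < a) {u w : Rn n → ℝ≥0∞}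
    (hu : Measurable u) (hufin : ∫⁻ x, u x < ∞) (hw : Measurable w) {μ : ℝ} (hμ : 0 < μ) :
    ∑' l : ℤ, ∫⁻ x, ({x | ENNReal.ofReal (μ * ((2 : ℝ) ^ l) ^ a) <
        ballAvg ((2 : ℝ) ^ l) u x}).indicator
        (fun x => ENNReal.ofReal (((2 : ℝ) ^ l) ^ a) * w x) x ≤
      coverConst n a * (ENNReal.ofReal μ)⁻¹ * ∫⁻ x, u x * maximal w x := by
  set t : Set (Rn n × ℤ) := {b | ENNReal.ofReal (μ * ((2 : ℝ) ^ b.2) ^ a) <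
        ballAvg ((2 : ℝ) ^ b.2) u b.1} with ht
  set v1 := volume (Metric.ball (0 : Rn n) 1) with hv1
  have hv10 : v1 ≠ 0 := (Metric.measure_ball_pos volume _ one_pos).ne'
  have hv1t : v1 ≠ ∞ := measure_ball_lt_top.ne
  have h2 : ∀ l : ℤ, (0 : ℝ) < 2 ^ l := fun l => by positivity
  have hmass : ∀ b ∈ t, ENNReal.ofReal (μ * ((2 : ℝ) ^ b.2) ^ a) *
      volume (Metric.ball b.1 ((2 : ℝ) ^ b.2)) ≤ ∫⁻ x in Metric.ball b.1 ((2 : ℝ) ^ b.2), u x := by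
    intro b hb
    have hb' : ENNReal.ofReal (μ * ((2 : ℝ) ^ b.2) ^ a) ≤ _ := (le_of_lt hb)
    rw [ballAvg, ENNReal.le_div_iff_mul_le
      (Or.inl (Metric.measure_ball_pos volume _ (h2 _)).ne') (Or.inl measure_ball_lt_top.ne)] at hb'
    exact hb'
  -- the radii are bounded because `u` is integrable
  obtain ⟨R, hR⟩ : ∃ R : ℝ, ∀ b ∈ t, (2 : ℝ) ^ b.2 ≤ R := by
    refine ⟨((∫⁻ x, u x).toReal / (μ * v1.toReal)) ^ (1 / (a + n)), fun b hb => ?_⟩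
    have h1 := (hmass b hb).trans (setLIntegral_le_lintegral _ _)
    rw [volume_ball_scale _ (h2 _), ← mul_assoc, ← ENNReal.ofReal_mul (by positivity)] at h1
    have h3 := ENNReal.toReal_mono hufin.ne h1
    rw [ENNReal.toReal_mul, ENNReal.toReal_ofReal (by positivity)] at h3
    have hv1pos : 0 < v1.toReal := ENNReal.toReal_pos hv10 hv1t
    have h4 : ((2 : ℝ) ^ b.2) ^ (a + n) ≤ (∫⁻ x, u x).toReal / (μ * v1.toReal) := by
      rw [le_div_iff₀ (by positivity), Real.rpow_add (h2 _)]
      calc _ = μ * ((2 : ℝ) ^ b.2) ^ a * ((2 : ℝ) ^ b.2) ^ (n : ℝ) * v1.toReal := by ring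
        _ ≤ _ := h3
    have hap : 0 < a + n := by positivity
    calc (2 : ℝ) ^ b.2 = (((2 : ℝ) ^ b.2) ^ (a + n)) ^ (1 / (a + n)) := by
          rw [← Real.rpow_mul (h2 _).le, mul_one_div_cancel hap.ne', Real.rpow_one]
      _ ≤ _ := Real.rpow_le_rpow (by positivity) h4 (by positivity)
  obtain ⟨s, hst, hdisj, hcov⟩ := Vitali.exists_disjoint_subfamily_covering_enlargement
    (fun b : Rn n × ℤ => Metric.ball b.1 ((2 : ℝ) ^ b.2)) t (fun b => (2 : ℝ) ^ b.2) 2 one_lt_two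
    (fun b _ => (h2 _).le) R hR (fun b _ => ⟨b.1, Metric.mem_ball_self (h2 _)⟩)
  have hscount : s.Countable := hdisj.countable_of_isOpen (fun b _ => Metric.isOpen_ball)
    fun b _ => ⟨b.1, Metric.mem_ball_self (h2 _)⟩
  have : Countable s := hscount.to_subtype
  have hpt : ∀ (l : ℤ) (x : Rn n), ({x | ENNReal.ofReal (μ * ((2 : ℝ) ^ l) ^ a) <
        ballAvg ((2 : ℝ) ^ l) u x}).indicator
        (fun x => ENNReal.ofReal (((2 : ℝ) ^ l) ^ a) * w x) x ≤
      ∑' b : s, (if (2 : ℝ) ^ l ≤ 2 * 2 ^ (b : Rn n × ℤ).2 then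
        ENNReal.ofReal (((2 : ℝ) ^ l) ^ a) else 0) *
        (Metric.ball (b : Rn n × ℤ).1 (3 * (2 : ℝ) ^ (b : Rn n × ℤ).2)).indicator w x := by
    intro l x
    by_cases hx : x ∈ {x | ENNReal.ofReal (μ * ((2 : ℝ) ^ l) ^ a) < ballAvg ((2 : ℝ) ^ l) u x}
    · rw [indicator_of_mem hx]
      obtain ⟨b, hbs, hne, hle⟩ := hcov (x, l) hx
      simp only at hle hne
      refine le_trans ?_ (ENNReal.le_tsum (⟨b, hbs⟩ : s))
      have hxb : x ∈ Metric.ball b.1 (3 * (2 : ℝ) ^ b.2) := by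
        obtain ⟨z, hz1, hz2⟩ := hne
        rw [Metric.mem_ball] at hz1 hz2 ⊢
        calc dist x b.1 ≤ dist x z + dist z b.1 := dist_triangle _ _ _
          _ < 2 ^ l + 2 ^ b.2 := by rw [dist_comm x z]; exact add_lt_add hz1 hz2
          _ ≤ _ := by linarith
      rw [if_pos hle, indicator_of_mem hxb]
    · rw [indicator_of_notMem hx]; exact bot_le
  have hwm : ∀ b : s, Measurable fun x =>
      (Metric.ball (b : Rn n × ℤ).1 (3 * (2 : ℝ) ^ (b : Rn n × ℤ).2)).indicator w x := fun b =>
    hw.indicator measurableSet_ball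
  have hterm : ∀ b : s, ENNReal.ofReal (2 ^ a) * (1 - ENNReal.ofReal (2 ^ (-a)))⁻¹ *
        ENNReal.ofReal (((2 : ℝ) ^ (b : Rn n × ℤ).2) ^ a) *
        (∫⁻ x in Metric.ball (b : Rn n × ℤ).1 (3 * (2 : ℝ) ^ (b : Rn n × ℤ).2), w x) ≤
      coverConst n a * (ENNReal.ofReal μ)⁻¹ *
        ∫⁻ x in Metric.ball (b : Rn n × ℤ).1 ((2 : ℝ) ^ (b : Rn n × ℤ).2), u x * maximal w x := by
    rintro ⟨b, hb⟩
    simp only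
    set B := Metric.ball b.1 ((2 : ℝ) ^ b.2) with hB
    set i := ⨅ y ∈ B, maximal w y with hi
    have h3 : ∫⁻ x in Metric.ball b.1 (3 * (2 : ℝ) ^ b.2), w x ≤
        ENNReal.ofReal (3 ^ (n : ℝ)) * volume B * i := by
      have h30 : ENNReal.ofReal (3 ^ (n : ℝ)) * volume B ≠ 0 := by
        refine mul_ne_zero ?_ (Metric.measure_ball_pos volume _ (h2 _)).ne'
        simp only [ne_eq, ENNReal.ofReal_eq_zero, not_le]
        positivity
      have h3t : ENNReal.ofReal (3 ^ (n : ℝ)) * volume B ≠ ∞ :=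
        ENNReal.mul_ne_top ENNReal.ofReal_ne_top measure_ball_lt_top.ne
      rw [mul_comm _ i, ← ENNReal.div_le_iff h30 h3t]
      refine le_iInf₂ fun y hy => ?_
      rw [ENNReal.div_le_iff h30 h3t, mul_comm (maximal w y)]
      refine (setLIntegral_ball_le_maximal w (by have := h2 b.2; positivity) (x := y) ?_).trans ?_
      · exact Metric.ball_subset_ball (by have := h2 b.2; linarith) hy
      · gcongr
        rw [volume_ball_scale _ (by have := h2 b.2; positivity), hB, volume_ball_scale _ (h2 _),
          Real.mul_rpow (by norm_num) (h2 _).le, ENNReal.ofReal_mul (by positivity), mul_assoc]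
    have h4 : ENNReal.ofReal (((2 : ℝ) ^ b.2) ^ a) * volume B ≤
        (ENNReal.ofReal μ)⁻¹ * ∫⁻ x in B, u x := by
      have := hmass b (hst hb)
      rw [ENNReal.ofReal_mul hμ.le, mul_assoc] at this
      have hμ0 : ENNReal.ofReal μ ≠ 0 := by simpa using hμ
      calc _ = (ENNReal.ofReal μ)⁻¹ * (ENNReal.ofReal μ *
            (ENNReal.ofReal (((2 : ℝ) ^ b.2) ^ a) * volume B)) := by
            rw [← mul_assoc (ENNReal.ofReal μ)⁻¹, ENNReal.inv_mul_cancel hμ0 ENNReal.ofReal_ne_top,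
              one_mul]
        _ ≤ _ := by gcongr
    have h5 : (∫⁻ x in B, u x) * i ≤ ∫⁻ x in B, u x * maximal w x := by
      rw [← lintegral_mul_const _ hu]
      refine setLIntegral_mono (hu.mul (measurable_maximal w)) fun x hx => ?_
      gcongr
      exact iInf₂_le x hx
    calc _ ≤ ENNReal.ofReal (2 ^ a) * (1 - ENNReal.ofReal (2 ^ (-a)))⁻¹ *
          ENNReal.ofReal (((2 : ℝ) ^ b.2) ^ a) * (ENNReal.ofReal (3 ^ (n : ℝ)) * volume B * i) := by
          gcongr
      _ = coverConst n a * (ENNReal.ofReal (((2 : ℝ) ^ b.2) ^ a) * volume B) * i := by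
          rw [coverConst]; ring
      _ ≤ coverConst n a * ((ENNReal.ofReal μ)⁻¹ * ∫⁻ x in B, u x) * i := by gcongr
      _ = coverConst n a * (ENNReal.ofReal μ)⁻¹ * ((∫⁻ x in B, u x) * i) := by ring
      _ ≤ _ := by gcongr
  calc _ ≤ ∑' l : ℤ, ∑' b : s, (if (2 : ℝ) ^ l ≤ 2 * 2 ^ (b : Rn n × ℤ).2 then
        ENNReal.ofReal (((2 : ℝ) ^ l) ^ a) else 0) *
        ∫⁻ x in Metric.ball (b : Rn n × ℤ).1 (3 * (2 : ℝ) ^ (b : Rn n × ℤ).2), w x := by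
        refine ENNReal.tsum_le_tsum fun l => (lintegral_mono (hpt l)).trans (le_of_eq ?_)
        rw [lintegral_tsum fun b => ((hwm b).const_mul _).aemeasurable]
        refine tsum_congr fun b => ?_
        rw [lintegral_const_mul _ (hwm b), lintegral_indicator measurableSet_ball]
    _ ≤ ∑' b : s, ENNReal.ofReal (2 ^ a) * (1 - ENNReal.ofReal (2 ^ (-a)))⁻¹ *
        ENNReal.ofReal (((2 : ℝ) ^ (b : Rn n × ℤ).2) ^ a) *
        (∫⁻ x in Metric.ball (b : Rn n × ℤ).1 (3 * (2 : ℝ) ^ (b : Rn n × ℤ).2), w x) := by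
        rw [ENNReal.tsum_comm]
        refine ENNReal.tsum_le_tsum fun b => ?_
        rw [ENNReal.tsum_mul_right]
        gcongr
        exact tsum_zpow_rpow_le _
    _ ≤ ∑' b : s, coverConst n a * (ENNReal.ofReal μ)⁻¹ *
        ∫⁻ x in Metric.ball (b : Rn n × ℤ).1 ((2 : ℝ) ^ (b : Rn n × ℤ).2), u x * maximal w x :=
        ENNReal.tsum_le_tsum hterm
    _ ≤ _ := by
        rw [ENNReal.tsum_mul_left]
        gcongr
        rw [← lintegral_iUnion (fun b : s => measurableSet_ball)
          (fun b b' hbb' => hdisj b.property b'.property fun h => hbb' (Subtype.ext h))]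
        exact setLIntegral_le_lintegral _ _

end Covering

section Threshold

variable {n : ℕ}

lemma indicator_threshold_le {γ q κ : ℝ} (hq : 0 < q) (hκ : 0 < κ) {N : ℝ≥0∞}
    (hN : N ≠ ∞) (x : Rn n) :
    {y : Rn n | y ≠ x ∧ ENNReal.ofReal (κ * ‖y - x‖ ^ (γ / q)) < N} ⊆
      {y : Rn n | y ≠ x ∧ ‖y - x‖ ^ γ < (N.toReal / κ) ^ q} := by
  rintro y ⟨hy, hlt⟩
  refine ⟨hy, ?_⟩
  have h1 : κ * ‖y - x‖ ^ (γ / q) < N.toReal := (ENNReal.ofReal_lt_iff_lt_toReal (by positivity) hN).1 hlt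
  have h2 : ‖y - x‖ ^ (γ / q) < N.toReal / κ := by
    rw [lt_div_iff₀ hκ, mul_comm]; exact h1
  calc ‖y - x‖ ^ γ = (‖y - x‖ ^ (γ / q)) ^ q := by
        rw [← Real.rpow_mul (norm_nonneg _), div_mul_cancel₀ _ hq.ne']
    _ < _ := Real.rpow_lt_rpow (by positivity) h2 hq

lemma ofReal_threshold {q κ : ℝ} (hq : 0 < q) (hκ : 0 < κ) {N : ℝ≥0∞} (hN : N ≠ ∞) :
    ENNReal.ofReal ((N.toReal / κ) ^ q) = (N / ENNReal.ofReal κ) ^ q := by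
  rw [← ENNReal.ofReal_rpow_of_nonneg (by positivity) hq.le, ENNReal.ofReal_div_of_pos hκ,
    ENNReal.ofReal_toReal hN]

/-- Integration of the power kernel over the points `y` with `κ |y - x|^{γ/q} < N`. -/
lemma lintegral_threshold_le {γ q κ : ℝ} (hγ : γ ≠ 0) (hq : 0 < q) (hκ : 0 < κ) {N : ℝ≥0∞}
    (hN : N ≠ ∞) (x : Rn n) {h : Rn n → ℝ≥0∞} (hh : Measurable h) :
    ∫⁻ y, ({y : Rn n | y ≠ x ∧ ENNReal.ofReal (κ * ‖y - x‖ ^ (γ / q)) < N}).indicator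
      (fun y => ENNReal.ofReal (‖y - x‖ ^ (γ - n)) * h y) y ≤
        kernelConst n γ * (N / ENNReal.ofReal κ) ^ q * maximal h x := by
  by_cases hN0 : N = 0
  · simp [hN0]
  have hT : 0 < (N.toReal / κ) ^ q :=
    Real.rpow_pos_of_pos (div_pos (ENNReal.toReal_pos hN0 hN) hκ) q
  rw [← ofReal_threshold hq hκ hN]
  refine le_trans (lintegral_mono fun y => ?_) (lintegral_kernel_le_maximal hγ hT (m := x) hh
    fun R hR _ => Metric.mem_ball_self hR)
  exact indicator_le_indicator_of_subset (indicator_threshold_le hq hκ hN x) (fun _ => bot_le) y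

lemma lintegral_threshold_le_const {γ q κ : ℝ} (hγ : γ ≠ 0) (hq : 0 < q) (hκ : 0 < κ) {N : ℝ≥0∞}
    (hN : N ≠ ∞) (x : Rn n) :
    ∫⁻ y, ({y : Rn n | y ≠ x ∧ ENNReal.ofReal (κ * ‖y - x‖ ^ (γ / q)) < N}).indicator
      (fun y => ENNReal.ofReal (‖y - x‖ ^ (γ - n))) y ≤
        kernelConst n γ * (N / ENNReal.ofReal κ) ^ q := by
  have := lintegral_threshold_le hγ hq hκ hN x (h := fun _ : Rn n => 1) measurable_const
  simp only [mul_one] at this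
  refine this.trans ?_
  calc _ ≤ kernelConst n γ * (N / ENNReal.ofReal κ) ^ q * 1 := by
        gcongr
        exact maximal_le_of_le (fun _ => le_rfl) x
    _ = _ := mul_one _

/-- A function is dominated by its maximal function, by the Lebesgue differentiation theorem applied
to its truncations. -/
lemma ae_le_maximal {h : Rn n → ℝ≥0∞} (hh : Measurable h) : ∀ᵐ x, h x ≤ maximal h x := by
  have key : ∀ N : ℕ, ∀ᵐ x, truncate h N x ≤ maximal h x := by
    intro N
    have hfin : ∫⁻ x, truncate h N x ≠ ∞ := by
      refine ne_top_of_le_ne_top (b := ∫⁻ _ in Metric.ball (0 : Rn n) N, (N : ℝ≥0∞)) ?_ ?_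
      · rw [setLIntegral_const]
        exact ENNReal.mul_ne_top (ENNReal.natCast_ne_top N) measure_ball_lt_top.ne
      · rw [← lintegral_indicator measurableSet_ball]
        refine lintegral_mono fun x => indicator_le_indicator ?_
        exact min_le_right _ _
    filter_upwards [(Besicovitch.vitaliFamily (volume : Measure (Rn n))).ae_tendsto_lintegral_div
      (aemeasurable_truncate hh.aemeasurable N) hfin] with x hx
    have h1 := hx.comp (Besicovitch.tendsto_filterAt (volume : Measure (Rn n)) x)
    refine le_of_tendsto h1 ?_
    filter_upwards [self_mem_nhdsWithin] with r hr
    have hr' : 0 < r := hr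
    have h2 := setLIntegral_closedBall_le_maximal (truncate h N) hr' (Metric.mem_ball_self hr' : x ∈ _)
    refine ENNReal.div_le_of_le_mul ?_
    refine h2.trans ?_
    rw [volume_closedBall_eq x hr', volume_ball_scale x hr', ← mul_assoc, mul_comm]
    gcongr
    refine iSup₂_mono fun c R => iSup₂_mono fun hR _ => ENNReal.div_le_div_right ?_ _
    exact lintegral_mono fun y => truncate_le h N y
  filter_upwards [ae_all_iff.2 key] with x hx
  exact le_of_tendsto' (tendsto_truncate h x) hx

end Threshold

/-! ### Pointwise estimates for functions with a continuous gradient -/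

section Pointwise

variable {n : ℕ}

/-- `f` is continuously differentiable with gradient `K`. -/
structure HasContGradient (f : Rn n → ℝ) (K : Rn n → Rn n) : Prop where
  hasGradientAt : ∀ x, HasGradientAt f (K x) x
  continuous_grad : Continuous K

namespace HasContGradient

variable {f : Rn n → ℝ} {K : Rn n → Rn n}

lemma continuous (h : HasContGradient f K) : Continuous f :=
  continuous_iff_continuousAt.2 fun x => (h.hasGradientAt x).differentiableAt.continuousAt

lemma hasDerivAt_line (h : HasContGradient f K) (x v : Rn n) (t : ℝ) :
    HasDerivAt (fun t : ℝ => f (x + t • v)) (inner ℝ (K (x + t • v)) v) t := by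
  have h1 : HasDerivAt (fun t : ℝ => x + t • v) v t := by
    simpa using ((hasDerivAt_id t).smul_const v).const_add x
  exact (h.hasGradientAt (x + t • v)).hasFDerivAt.comp_hasDerivAt t h1

lemma sub_eq_integral (h : HasContGradient f K) (x v : Rn n) :
    f (x + v) - f x = ∫ t in (0 : ℝ)..1, inner ℝ (K (x + t • v)) v := by
  have hc : Continuous fun t : ℝ => (inner ℝ (K (x + t • v)) v : ℝ) :=
    (h.continuous_grad.comp (by fun_prop)).inner continuous_const
  have := intervalIntegral.integral_eq_sub_of_hasDerivAt (fun t _ => h.hasDerivAt_line x v t)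
    (hc.intervalIntegrable 0 1)
  simpa using this.symm

lemma enorm_sub_le (h : HasContGradient f K) (x z : Rn n) :
    ‖f z - f x‖ₑ ≤ ∫⁻ t in Ioo (0 : ℝ) 1, ‖K (x + t • (z - x))‖ₑ * ‖z - x‖ₑ := by
  have h1 := h.sub_eq_integral x (z - x)
  rw [add_sub_cancel] at h1
  rw [h1, intervalIntegral.integral_of_le zero_le_one, ← restrict_Ioo_eq_restrict_Ioc]
  refine (enorm_integral_le_lintegral_enorm _).trans (lintegral_mono fun t => ?_)
  rw [← ofReal_norm, ← ofReal_norm, ← ofReal_norm, ← ENNReal.ofReal_mul (norm_nonneg _)]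
  exact ENNReal.ofReal_le_ofReal (norm_inner_le_norm _ _)

end HasContGradient

/-- The contraction `z ↦ x + t (z - x)` maps the ball of radius `r` around `x` onto the one of radius
`t r`. -/
lemma setLIntegral_ball_homothety {g : Rn n → ℝ≥0∞} (hg : Measurable g) (x : Rn n) {r t : ℝ}
    (hr : 0 < r) (ht : 0 < t) :
    ∫⁻ z in Metric.ball x r, g (x + t • (z - x)) =
      volume (Metric.ball x r) * ballAvg (t * r) g x := by
  have htr : 0 < t * r := mul_pos ht hr
  have e1 : ∫⁻ z in Metric.ball x r, g (x + t • (z - x)) =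
      ∫⁻ w, (Metric.ball (0 : Rn n) (t * r)).indicator (fun w => g (x + w)) (t • w) := by
    rw [← lintegral_indicator measurableSet_ball, ← lintegral_add_right_eq_self _ x]
    refine lintegral_congr fun w => ?_
    by_cases hw : ‖w‖ < r
    · rw [indicator_of_mem (by simpa using hw), indicator_of_mem, add_sub_cancel_right]
      rw [mem_ball_zero_iff, norm_smul, Real.norm_of_nonneg ht.le]
      exact mul_lt_mul_of_pos_left hw ht
    · rw [indicator_of_notMem (by simpa using hw), indicator_of_notMem]
      rw [mem_ball_zero_iff, norm_smul, Real.norm_of_nonneg ht.le, not_lt]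
      exact mul_le_mul_of_nonneg_left (not_lt.1 hw) ht.le
  have hm : Measurable ((Metric.ball (0 : Rn n) (t * r)).indicator (fun w => g (x + w))) :=
    (hg.comp (measurable_const_add x)).indicator measurableSet_ball
  have e2 := lintegral_map (μ := (volume : Measure (Rn n))) hm (measurable_const_smul t)
  rw [Measure.map_addHaar_smul volume ht.ne', lintegral_smul_measure] at e2
  rw [e1, ← e2, lintegral_indicator measurableSet_ball]
  have e3 : ∫⁻ w in Metric.ball (0 : Rn n) (t * r), g (x + w) =
      ∫⁻ y in Metric.ball x (t * r), g y := by
    rw [← lintegral_indicator measurableSet_ball, ← lintegral_indicator measurableSet_ball,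
      ← lintegral_add_left_eq_self ((Metric.ball x (t * r)).indicator g) x]
    refine lintegral_congr fun w => ?_
    by_cases hw : ‖w‖ < t * r
    · rw [indicator_of_mem (by simpa using hw), indicator_of_mem (by simpa using hw)]
    · rw [indicator_of_notMem (by simpa using hw), indicator_of_notMem (by simpa using hw)]
  have hd := finrank_euclideanSpace_fin (𝕜 := ℝ) (n := n)
  have htn : 0 < t ^ n := by positivity
  have hrn : 0 < r ^ n := by positivity
  rw [e3, ballAvg, volume_ball_scale x htr, volume_ball_scale x hr, hd, smul_eq_mul,
    abs_of_pos (inv_pos.2 htn), Real.mul_rpow ht.le hr.le, ENNReal.ofReal_mul (by positivity),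
    Real.rpow_natCast, Real.rpow_natCast, ENNReal.ofReal_inv_of_pos htn]
  set v1 := volume (Metric.ball (0 : Rn n) 1)
  have hv10 : v1 ≠ 0 := (Metric.measure_ball_pos volume _ one_pos).ne'
  have hv1t : v1 ≠ ∞ := measure_ball_lt_top.ne
  have hr0 : ENNReal.ofReal (r ^ n) * v1 ≠ 0 := mul_ne_zero (ENNReal.ofReal_pos.2 hrn).ne' hv10
  have hrt : ENNReal.ofReal (r ^ n) * v1 ≠ ∞ := ENNReal.mul_ne_top ENNReal.ofReal_ne_top hv1t
  rw [mul_assoc (ENNReal.ofReal (t ^ n)), div_eq_mul_inv, ENNReal.mul_inv (Or.inr hrt) (Or.inr hr0)]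
  set I := ∫⁻ y in Metric.ball x (t * r), g y
  calc _ = ((ENNReal.ofReal (r ^ n) * v1) * (ENNReal.ofReal (r ^ n) * v1)⁻¹) *
        ((ENNReal.ofReal (t ^ n))⁻¹ * I) := by
        rw [ENNReal.mul_inv_cancel hr0 hrt, one_mul]
    _ = _ := by ring

/-- On a ball, the mean oscillation from the value at the centre is controlled by averages of the
gradient over concentric balls. -/
lemma HasContGradient.setLIntegral_sub_le {f : Rn n → ℝ} {K : Rn n → Rn n}
    (h : HasContGradient f K) (x : Rn n) {r : ℝ} (hr : 0 < r) :
    ∫⁻ z in Metric.ball x r, ‖f z - f x‖ₑ ≤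
      ENNReal.ofReal r * volume (Metric.ball x r) * radialAvg r (fun y => ‖K y‖ₑ) x := by
  have hKm : Measurable fun y => ‖K y‖ₑ := h.continuous_grad.enorm.measurable
  have hjoint : Measurable fun p : Rn n × ℝ => ‖K (x + p.2 • (p.1 - x))‖ₑ :=
    (h.continuous_grad.comp (by fun_prop)).enorm.measurable
  calc _ ≤ ∫⁻ z in Metric.ball x r, ∫⁻ t in Ioo (0 : ℝ) 1,
        ENNReal.ofReal r * ‖K (x + t • (z - x))‖ₑ := by
        refine setLIntegral_mono' measurableSet_ball fun z hz => (h.enorm_sub_le x z).trans ?_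
        refine lintegral_mono fun t => ?_
        rw [mul_comm]
        gcongr
        rw [← ofReal_norm]
        exact ENNReal.ofReal_le_ofReal (mem_ball_iff_norm.1 hz).le
    _ = ∫⁻ t in Ioo (0 : ℝ) 1, ∫⁻ z in Metric.ball x r,
        ENNReal.ofReal r * ‖K (x + t • (z - x))‖ₑ :=
        lintegral_lintegral_swap (f := fun z t => ENNReal.ofReal r * ‖K (x + t • (z - x))‖ₑ)
          (hjoint.const_mul _).aemeasurable
    _ = ∫⁻ t in Ioo (0 : ℝ) 1, ENNReal.ofReal r *
        (volume (Metric.ball x r) * ballAvg (t * r) (fun y => ‖K y‖ₑ) x) := by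
        refine setLIntegral_congr_fun measurableSet_Ioo fun t ht => ?_
        rw [lintegral_const_mul' _ _ ENNReal.ofReal_ne_top, setLIntegral_ball_homothety hKm x hr ht.1]
    _ = _ := by
        simp_rw [← mul_assoc]
        rw [lintegral_const_mul _ (measurable_ballAvg_radius hKm r x)]
        rfl

/-- The difference of two values is controlled by averages of the gradient around the two points, by
comparison with the values on the ball that has the segment between them as a diameter. -/
lemma HasContGradient.enorm_sub_le_radialAvg {f : Rn n → ℝ} {K : Rn n → Rn n}
    (h : HasContGradient f K) {x y : Rn n} (hxy : x ≠ y) :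
    ‖f x - f y‖ₑ ≤ ENNReal.ofReal (2 ^ (n : ℝ) * ‖x - y‖) *
      (radialAvg ‖x - y‖ (fun z => ‖K z‖ₑ) x + radialAvg ‖x - y‖ (fun z => ‖K z‖ₑ) y) := by
  set r := ‖x - y‖ with hrdef
  have hr : 0 < r := norm_pos_iff.2 (sub_ne_zero.2 hxy)
  set m := midpoint ℝ x y with hm
  set S := Metric.ball m (r / 2) with hS
  have hSx : S ⊆ Metric.ball x r := by
    refine Metric.ball_subset_ball' ?_
    rw [hm, dist_midpoint_left, dist_eq_norm, ← hrdef, Real.norm_of_nonneg (by norm_num)]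
    linarith
  have hSy : S ⊆ Metric.ball y r := by
    refine Metric.ball_subset_ball' ?_
    rw [hm, dist_midpoint_right, dist_eq_norm, ← hrdef, Real.norm_of_nonneg (by norm_num)]
    linarith
  have hcont := h.continuous
  have hv : ∀ c : Rn n, volume (Metric.ball c r) = ENNReal.ofReal (2 ^ (n : ℝ)) * volume S := by
    intro c
    rw [volume_ball_scale c hr, hS, volume_ball_scale m (by positivity : 0 < r / 2), ← mul_assoc,
      ← ENNReal.ofReal_mul (by positivity), ← Real.mul_rpow (by norm_num) (by positivity),
      mul_div_cancel₀ _ two_ne_zero]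
  have hS0 : volume S ≠ 0 := (Metric.measure_ball_pos volume _ (by positivity)).ne'
  have hSt : volume S ≠ ∞ := measure_ball_lt_top.ne
  have h1 : ‖f x - f y‖ₑ * volume S ≤ ENNReal.ofReal (2 ^ (n : ℝ) * r) *
      (radialAvg r (fun z => ‖K z‖ₑ) x + radialAvg r (fun z => ‖K z‖ₑ) y) * volume S := by
    calc ‖f x - f y‖ₑ * volume S = ∫⁻ z in S, ‖f x - f y‖ₑ := by rw [setLIntegral_const]
      _ ≤ ∫⁻ z in S, (‖f z - f x‖ₑ + ‖f z - f y‖ₑ) := by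
          refine lintegral_mono fun z => ?_
          have e : f x - f y = (f z - f y) - (f z - f x) := by ring
          rw [e, add_comm]
          exact _root_.enorm_sub_le
      _ = (∫⁻ z in S, ‖f z - f x‖ₑ) + ∫⁻ z in S, ‖f z - f y‖ₑ :=
          lintegral_add_left (by fun_prop) _
      _ ≤ (∫⁻ z in Metric.ball x r, ‖f z - f x‖ₑ) + ∫⁻ z in Metric.ball y r, ‖f z - f y‖ₑ :=
          add_le_add (lintegral_mono_set hSx) (lintegral_mono_set hSy)
      _ ≤ _ := add_le_add (h.setLIntegral_sub_le x hr) (h.setLIntegral_sub_le y hr)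
      _ = _ := by
          rw [hv, hv, ENNReal.ofReal_mul (by positivity)]
          ring
  rwa [ENNReal.mul_le_mul_iff_left hS0 hSt] at h1

end Pointwise

/-! ### Upper bounds through pointwise estimates -/

section LevelIntegral

variable {n : ℕ}

/-- The integral `∫ 1_{E_{l,b}[f]}(x,y) |x - y|^{γ-n} dy`. -/
def levelIntegral (l b γ : ℝ) (f : Rn n → ℝ) (x : Rn n) : ℝ≥0∞ :=
  ∫⁻ y, (levelSet l b f).indicator (fun z => ENNReal.ofReal (‖z.1 - z.2‖ ^ (γ - n))) (x, y)

lemma measurableSet_levelSet {f : Rn n → ℝ} (hf : Measurable f) (l b : ℝ) :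
    MeasurableSet (levelSet l b f) := by
  refine MeasurableSet.inter (measurableSet_eq_fun measurable_fst measurable_snd).compl ?_
  have h1 : Measurable fun z : Rn n × Rn n => |f z.1 - f z.2| := by
    have : Measurable fun z : Rn n × Rn n => f z.1 - f z.2 :=
      (hf.comp measurable_fst).sub (hf.comp measurable_snd)
    exact this.abs
  exact measurableSet_lt measurable_const (h1.div (by fun_prop))

lemma measurable_kernel (γ : ℝ) :
    Measurable fun z : Rn n × Rn n => ENNReal.ofReal (‖z.1 - z.2‖ ^ (γ - n)) := by
  fun_prop

lemma measurable_levelIntegral {f : Rn n → ℝ} (hf : Measurable f) (l b γ : ℝ) :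
    Measurable (levelIntegral l b γ f) :=
  ((measurable_kernel γ).indicator (measurableSet_levelSet hf l b)).lintegral_prod_right'

lemma levelIntegral_eq {f : Rn n → ℝ} (hf : Measurable f) (l b γ : ℝ) (x : Rn n) :
    levelIntegral l b γ f x =
      ∫⁻ y in {y | (x, y) ∈ levelSet l b f}, ENNReal.ofReal (‖y - x‖ ^ (γ - n)) := by
  have hm : MeasurableSet {y | (x, y) ∈ levelSet l b f} :=
    measurable_prodMk_left (measurableSet_levelSet hf l b)
  rw [← lintegral_indicator hm]
  refine lintegral_congr fun y => ?_
  by_cases hy : (x, y) ∈ levelSet l b f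
  · rw [indicator_of_mem hy, indicator_of_mem (show y ∈ {y | (x, y) ∈ levelSet l b f} from hy),
      norm_sub_rev]
  · rw [indicator_of_notMem hy,
      indicator_of_notMem (show y ∉ {y | (x, y) ∈ levelSet l b f} from hy)]

lemma functional_eq {ρ : FunctionNorm n} (hρ : IsBallBanach ρ) {f : Rn n → ℝ} (hf : Measurable f)
    (q γ l : ℝ) : functional ρ q γ l f =
      ρ fun x => ENNReal.ofReal l * levelIntegral l (γ / q) γ f x ^ (1 / q) :=
  (hρ.smul l.toNNReal _ ((measurable_levelIntegral hf l (γ / q) γ).pow_const _).aemeasurable).symm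

/-- The reduction of an exponent `q ≤ p` to the exponent `p`. -/
lemma rpow_levelIntegral_le {f : Rn n → ℝ} (hf : Measurable f) {p q γ : ℝ} (hγ : γ ≠ 0)
    (hq : 0 < q) (hqp : q ≤ p) (l b : ℝ) (x : Rn n) :
    levelIntegral l b γ f x ^ (p / q) ≤
      (2 * (2 * kernelConst n γ) ^ (p / q - 1)) * levelIntegral l b (γ * (p / q)) f x := by
  rw [levelIntegral_eq hf, levelIntegral_eq hf]
  exact rpow_lintegral_kernel_le hγ ((one_le_div hq).2 hqp) x
    (measurable_prodMk_left (measurableSet_levelSet hf l b)) fun h => h.1 rfl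

lemma ofReal_lt_enorm_of_mem_levelSet {f : Rn n → ℝ} {l b : ℝ} (hl : 0 < l)
    {x y : Rn n} (h : (x, y) ∈ levelSet l b f) :
    ENNReal.ofReal (l * (‖x - y‖ * ‖x - y‖ ^ b)) < ‖f x - f y‖ₑ := by
  obtain ⟨h1, h2⟩ := h
  have hr : 0 < ‖x - y‖ := norm_pos_iff.2 (sub_ne_zero.2 h1)
  have h3 : l * (‖x - y‖ * ‖x - y‖ ^ b) < |f x - f y| := by
    rw [lt_div_iff₀ (by positivity)] at h2
    simpa [Real.rpow_add hr] using h2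
  have h4 : 0 < |f x - f y| := lt_of_le_of_lt (by positivity) h3
  rw [← ofReal_norm, Real.norm_eq_abs]
  exact (ENNReal.ofReal_lt_ofReal_iff h4).2 h3

/-- If `|f(x) - f(y)| ≤ c |x - y| (N(x) + N(y))`, then the weighted integral of the level integral is
controlled by `∫ N^p M h`: the pair is close, relative to `N`, to one of its points, and both
possibilities are integrated over the other point. -/
lemma lintegral_levelIntegral_mul_le {f : Rn n → ℝ} {N : Rn n → ℝ≥0∞}
    (hN : Measurable N) (hNfin : ∀ x, N x ≠ ∞) {c : ℝ} (hc : 0 < c)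
    (hfN : ∀ x y, x ≠ y → ‖f x - f y‖ₑ ≤ ENNReal.ofReal (c * ‖x - y‖) * (N x + N y))
    {p γ l : ℝ} (hγ : γ ≠ 0) (hp : 0 < p) (hl : 0 < l) {h : Rn n → ℝ≥0∞} (hh : Measurable h) :
    ENNReal.ofReal l ^ p * ∫⁻ x, levelIntegral l (γ / p) γ f x * h x ≤
      2 * kernelConst n γ * ENNReal.ofReal (2 * c) ^ p * ∫⁻ x, N x ^ p * maximal h x := by
  set κ := l / (2 * c) with hκ
  have hκ0 : 0 < κ := by positivity
  set S : Set (Rn n × Rn n) :=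
    {z | z.1 ≠ z.2 ∧ ENNReal.ofReal (κ * ‖z.2 - z.1‖ ^ (γ / p)) < N z.1} with hS
  have hSm : MeasurableSet S :=
    (measurableSet_eq_fun measurable_fst measurable_snd).compl.inter
      (measurableSet_lt (by fun_prop) (hN.comp measurable_fst))
  set k : Rn n × Rn n → ℝ≥0∞ := fun z => ENNReal.ofReal (‖z.2 - z.1‖ ^ (γ - n)) with hk
  have hkm : Measurable k := by fun_prop
  have hpt : ∀ x y, (levelSet l (γ / p) f).indicator
      (fun z => ENNReal.ofReal (‖z.1 - z.2‖ ^ (γ - n))) (x, y) ≤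
      S.indicator k (x, y) + S.indicator k (y, x) := by
    intro x y
    by_cases hxy : (x, y) ∈ levelSet l (γ / p) f
    · rw [indicator_of_mem hxy]
      have hne : x ≠ y := hxy.1
      have hlt := (ofReal_lt_enorm_of_mem_levelSet hl hxy).trans_le (hfN x y hne)
      have hr : 0 < ‖x - y‖ := norm_pos_iff.2 (sub_ne_zero.2 hne)
      -- one of the two summands is at least half of the sum
      have hor : (x, y) ∈ S ∨ (y, x) ∈ S := by
        by_contra! hcon
        obtain ⟨h1, h2⟩ := hcon
        have h1' : N x ≤ ENNReal.ofReal (κ * ‖x - y‖ ^ (γ / p)) := by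
          by_contra! h3
          exact h1 ⟨hne, by rwa [norm_sub_rev]⟩
        have h2' : N y ≤ ENNReal.ofReal (κ * ‖x - y‖ ^ (γ / p)) := by
          by_contra! h3
          exact h2 ⟨hne.symm, h3⟩
        refine absurd hlt (not_lt.2 ?_)
        calc _ ≤ ENNReal.ofReal (c * ‖x - y‖) * (ENNReal.ofReal (κ * ‖x - y‖ ^ (γ / p)) +
              ENNReal.ofReal (κ * ‖x - y‖ ^ (γ / p))) := by gcongr
          _ = _ := by
              rw [← ENNReal.ofReal_add (by positivity) (by positivity),
                ← ENNReal.ofReal_mul (by positivity)]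
              congr 1
              rw [hκ]
              field_simp
              ring
      rcases hor with h1 | h1
      · rw [indicator_of_mem h1, hk, norm_sub_rev]
        exact le_self_add
      · rw [indicator_of_mem h1]
        exact le_add_self
    · rw [indicator_of_notMem hxy]
      exact bot_le
  have hSk : Measurable (S.indicator k) := hkm.indicator hSm
  have hSx : ∀ x, ∀ w : Rn n → ℝ≥0∞, ∀ y, S.indicator k (x, y) * w y =
      ({y : Rn n | y ≠ x ∧ ENNReal.ofReal (κ * ‖y - x‖ ^ (γ / p)) < N x}).indicator
      (fun y => ENNReal.ofReal (‖y - x‖ ^ (γ - n)) * w y) y := by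
    intro x w y
    by_cases hy : (x, y) ∈ S
    · have hy' : y ∈ {y : Rn n | y ≠ x ∧ ENNReal.ofReal (κ * ‖y - x‖ ^ (γ / p)) < N x} :=
        ⟨Ne.symm hy.1, hy.2⟩
      rw [indicator_of_mem hy, indicator_of_mem hy']
    · rw [indicator_of_notMem hy, zero_mul, indicator_of_notMem]
      exact fun h' => hy ⟨Ne.symm h'.1, h'.2⟩
  have hNp : Measurable fun x => N x ^ p := hN.pow_const p
  have hMh := measurable_maximal h
  set P := ∫⁻ x, N x ^ p * maximal h x with hP
  have hdiv : ∀ x, (N x / ENNReal.ofReal κ) ^ p = (ENNReal.ofReal κ)⁻¹ ^ p * N x ^ p := fun x => by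
    rw [div_eq_mul_inv, mul_comm, ENNReal.mul_rpow_of_nonneg _ _ hp.le]
  have h1 : ∫⁻ x, (∫⁻ y, S.indicator k (x, y)) * h x ≤
      kernelConst n γ * (ENNReal.ofReal κ)⁻¹ ^ p * P := by
    calc _ ≤ ∫⁻ x, kernelConst n γ * (ENNReal.ofReal κ)⁻¹ ^ p * (N x ^ p * maximal h x) := by
          refine lintegral_mono_ae ?_
          filter_upwards [ae_le_maximal hh] with x hx
          have e : ∫⁻ y, S.indicator k (x, y) ≤
              kernelConst n γ * ((ENNReal.ofReal κ)⁻¹ ^ p * N x ^ p) := by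
            rw [← hdiv]
            refine le_trans (le_of_eq ?_) (lintegral_threshold_le_const hγ hp hκ0 (hNfin x) x)
            refine lintegral_congr fun y => ?_
            simpa using hSx x (fun _ => 1) y
          calc _ ≤ kernelConst n γ * ((ENNReal.ofReal κ)⁻¹ ^ p * N x ^ p) * maximal h x := by
                gcongr
            _ = _ := by ring
      _ = _ := lintegral_const_mul _ (hNp.mul hMh)
  have h2 : ∫⁻ x, (∫⁻ y, S.indicator k (y, x)) * h x ≤
      kernelConst n γ * (ENNReal.ofReal κ)⁻¹ ^ p * P := by
    have hm2 : Measurable fun z : Rn n × Rn n => S.indicator k (z.2, z.1) * h z.1 :=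
      (hSk.comp measurable_swap).mul (hh.comp measurable_fst)
    calc _ = ∫⁻ x, ∫⁻ y, S.indicator k (y, x) * h x := by
          refine lintegral_congr fun x => ?_
          have : Measurable fun y => S.indicator k (y, x) :=
            Measurable.of_uncurry_right (f := fun y x => S.indicator k (y, x)) hSk
          rw [lintegral_mul_const _ this]
      _ = ∫⁻ y, ∫⁻ x, S.indicator k (y, x) * h x :=
          lintegral_lintegral_swap (f := fun x y => S.indicator k (y, x) * h x) hm2.aemeasurable
      _ ≤ ∫⁻ y, kernelConst n γ * (ENNReal.ofReal κ)⁻¹ ^ p * (N y ^ p * maximal h y) := by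
          refine lintegral_mono fun y => ?_
          simp only [hSx]
          refine (lintegral_threshold_le hγ hp hκ0 (hNfin y) y hh).trans (le_of_eq ?_)
          rw [hdiv]; ring
      _ = _ := lintegral_const_mul _ (hNp.mul hMh)
  calc _ ≤ ENNReal.ofReal l ^ p * ∫⁻ x, ((∫⁻ y, S.indicator k (x, y)) * h x +
        (∫⁻ y, S.indicator k (y, x)) * h x) := by
        gcongr with x
        rw [← add_mul]
        gcongr
        rw [← lintegral_add_left (f := fun y => S.indicator k (x, y))
          (hSk.comp measurable_prodMk_left)]
        exact lintegral_mono fun y => hpt x y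
    _ = ENNReal.ofReal l ^ p * ((∫⁻ x, (∫⁻ y, S.indicator k (x, y)) * h x) +
        ∫⁻ x, (∫⁻ y, S.indicator k (y, x)) * h x) := by
        rw [lintegral_add_left]
        exact hSk.lintegral_prod_right'.mul hh
    _ ≤ ENNReal.ofReal l ^ p * (kernelConst n γ * (ENNReal.ofReal κ)⁻¹ ^ p * P +
        kernelConst n γ * (ENNReal.ofReal κ)⁻¹ ^ p * P) := by gcongr
    _ = 2 * kernelConst n γ * (ENNReal.ofReal l * (ENNReal.ofReal κ)⁻¹) ^ p * P := by
        rw [ENNReal.mul_rpow_of_nonneg _ _ hp.le]; ring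
    _ = _ := by
        have e : l * κ⁻¹ = 2 * c := by rw [hκ]; field_simp
        rw [← ENNReal.ofReal_inv_of_pos hκ0, ← ENNReal.ofReal_mul hl.le, e]

/-- The functional is controlled by the maximal function of the gradient if `q ≤ p`. -/
lemma functional_le_maximal {p q γ : ℝ} (hp : 1 ≤ p) (hγ : γ ≠ 0) (hq : 0 < q) (hqp : q ≤ p) :
    ∃ C : ℝ≥0∞, C ≠ ∞ ∧ ∀ ρ : FunctionNorm n, IsBallBanach ρ →
      IsBallBanach (convexify ρ (1 / p)) →
      maximalOpNorm (associate (convexify ρ (1 / p))) < ∞ →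
      ∀ (f : Rn n → ℝ) (K : Rn n → Rn n), HasContGradient f K →
      (∃ L : ℝ≥0, ∀ x, ‖K x‖ₑ ≤ L) → ρ (maximal fun x => ‖K x‖ₑ) < ∞ → ∀ l : ℝ, 0 < l →
      functional ρ q γ l f ≤ (C * (maximalOpNorm (associate (convexify ρ (1 / p))) +
        maximalOpNorm (associate (convexify ρ (1 / p))) ^ 2)) ^ (1 / p) *
        ρ (maximal fun x => ‖K x‖ₑ) := by
  have hp0 : 0 < p := by linarith
  set γ' := γ * (p / q) with hγ'
  have hγ'0 : γ' ≠ 0 := mul_ne_zero hγ (by positivity)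
  set C1 : ℝ≥0∞ := 2 * (2 * kernelConst n γ) ^ (p / q - 1) with hC1
  have hC1t : C1 ≠ ∞ := by
    refine ENNReal.mul_ne_top ENNReal.ofNat_ne_top (ENNReal.rpow_ne_top_of_nonneg ?_ ?_)
    · have := (one_le_div hq).2 hqp
      linarith
    · exact ENNReal.mul_ne_top ENNReal.ofNat_ne_top (kernelConst_ne_top n γ)
  refine ⟨C1 * (2 * kernelConst n γ' * ENNReal.ofReal (2 * 2 ^ (n : ℝ)) ^ p), ?_, ?_⟩
  · refine ENNReal.mul_ne_top hC1t (ENNReal.mul_ne_top (ENNReal.mul_ne_top ENNReal.ofNat_ne_top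
      (kernelConst_ne_top n γ')) (ENNReal.rpow_ne_top_of_nonneg hp0.le ENNReal.ofReal_ne_top))
  intro ρ hρ hY ht f K hfK ⟨L, hL⟩ hfin l hl
  have hf : Measurable f := hfK.continuous.measurable
  have hLI := measurable_levelIntegral hf l (γ / q) γ
  have hM := measurable_maximal fun x => ‖K x‖ₑ
  rw [functional_eq hρ hf]
  refine norm_le_of_weighted hp hY ht ((hLI.pow_const _).const_mul _).aemeasurable hM.aemeasurable
    hfin _ fun h hh => ?_
  have hb : γ / q = γ' / p := by rw [hγ']; field_simp
  calc _ ≤ ∫⁻ x, C1 * (ENNReal.ofReal l ^ p * (levelIntegral l (γ' / p) γ' f x * h x)) := by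
        refine lintegral_mono fun x => ?_
        have := rpow_levelIntegral_le hf hγ hq hqp l (γ / q) x
        rw [ENNReal.mul_rpow_of_nonneg _ _ hp0.le, ← ENNReal.rpow_mul, one_div_mul_eq_div]
        calc _ ≤ ENNReal.ofReal l ^ p * (C1 * levelIntegral l (γ / q) γ' f x) * h x := by gcongr
          _ = _ := by rw [hb]; ring
    _ = C1 * (ENNReal.ofReal l ^ p * ∫⁻ x, levelIntegral l (γ' / p) γ' f x * h x) := by
        rw [lintegral_const_mul' _ _ hC1t, lintegral_const_mul' _ _
          (ENNReal.rpow_ne_top_of_nonneg hp0.le ENNReal.ofReal_ne_top)]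
    _ ≤ C1 * (2 * kernelConst n γ' * ENNReal.ofReal (2 * 2 ^ (n : ℝ)) ^ p *
        ∫⁻ x, maximal (fun x => ‖K x‖ₑ) x ^ p * maximal h x) := by
        refine mul_le_mul_right ?_ C1
        refine lintegral_levelIntegral_mul_le hM (fun x => ?_) (by positivity)
          (fun x y hxy => ?_) hγ'0 hp0 hl hh
        · exact ne_top_of_le_ne_top ENNReal.coe_ne_top (maximal_le_of_le hL x)
        · have hr : 0 < ‖x - y‖ := norm_pos_iff.2 (sub_ne_zero.2 hxy)
          refine (hfK.enorm_sub_le_radialAvg hxy).trans ?_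
          gcongr
          · exact radialAvg_le_maximal hr _ x
          · exact radialAvg_le_maximal hr _ y
    _ ≤ _ := by
        rw [← mul_assoc]
        gcongr with x
        exact le_self_add

/-- The constant `∫_0^1 (2/t)^{n/r} dt` of Morrey's inequality. -/
def morreyConst (n : ℕ) (r : ℝ) : ℝ≥0∞ := ∫⁻ t in Ioo (0 : ℝ) 1, ENNReal.ofReal ((2 / t) ^ (n / r))

lemma morreyConst_ne_top {r : ℝ} (hr : (n : ℝ) < r) : morreyConst n r ≠ ∞ := by
  have hr0 : 0 < r := lt_of_le_of_lt (Nat.cast_nonneg n) hr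
  have h1 : (n : ℝ) / r < 1 := (div_lt_one hr0).2 hr
  have hint : IntegrableOn (fun t : ℝ => 2 ^ ((n : ℝ) / r) * t ^ (-((n : ℝ) / r))) (Ioo 0 1) := by
    have := (intervalIntegral.intervalIntegrable_rpow' (a := 0) (b := 1)
      (by linarith : -1 < -((n : ℝ) / r))).1
    exact (this.mono_set Ioo_subset_Ioc_self).const_mul _
  have := hint.lintegral_lt_top
  refine ne_top_of_le_ne_top this.ne (setLIntegral_mono' measurableSet_Ioo fun t ht => ?_)
  rw [Real.div_rpow (by norm_num) ht.1.le, Real.rpow_neg ht.1.le, div_eq_mul_inv]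

/-- By Hölder's inequality the average of `g` over the ball of radius `t s` is at most a multiple of
`t^{-n/r} (M(g^r)(x))^{1/r}`, and `t^{-n/r}` is integrable over `(0,1)` because `r > n`. -/
lemma radialAvg_le_morrey {r : ℝ} (hn : 1 ≤ n) (hr : (n : ℝ) < r) {g : Rn n → ℝ≥0∞}
    (hg : Measurable g) {s : ℝ} (hs : 0 < s) {x y : Rn n} (hxy : ‖x - y‖ ≤ s) :
    radialAvg s g y ≤ morreyConst n r * maximal (fun z => g z ^ r) x ^ (1 / r) := by
  have hn1 : (1 : ℝ) ≤ n := by exact_mod_cast hn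
  have hr1 : 1 ≤ r := by linarith
  have hr0 : 0 < r := by linarith
  rw [morreyConst, ← lintegral_mul_const _ (by fun_prop)]
  refine setLIntegral_mono (by fun_prop) fun t ht => ?_
  have hts : 0 < t * s := mul_pos ht.1 hs
  have h1 : ballAvg (t * s) g y ^ r ≤ ENNReal.ofReal ((2 / t) ^ (n : ℝ)) *
      maximal (fun z => g z ^ r) x := by
    refine (rpow_ballAvg_le hr1 hg hts y).trans (ENNReal.div_le_of_le_mul ?_)
    calc ∫⁻ z in Metric.ball y (t * s), g z ^ r ≤ ∫⁻ z in Metric.ball y (2 * s), g z ^ r := by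
          refine lintegral_mono_set (Metric.ball_subset_ball ?_)
          nlinarith [ht.2]
      _ ≤ volume (Metric.ball y (2 * s)) * maximal (fun z => g z ^ r) x := by
          refine setLIntegral_ball_le_maximal _ (by positivity) ?_
          rw [mem_ball_iff_norm]
          linarith
      _ = _ := by
          rw [volume_ball_scale y (by positivity : 0 < 2 * s), volume_ball_scale y hts]
          have e : (2 * s) ^ (n : ℝ) = (2 / t) ^ (n : ℝ) * (t * s) ^ (n : ℝ) := by
            rw [← Real.mul_rpow (div_pos two_pos ht.1).le hts.le]
            congr 1
            have := ht.1.ne'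
            field_simp
          have ht2 : 0 ≤ (2 / t) ^ (n : ℝ) := Real.rpow_nonneg (div_pos two_pos ht.1).le _
          rw [e, ENNReal.ofReal_mul ht2]
          ring
  have h2 := ENNReal.rpow_le_rpow h1 (one_div_nonneg.2 hr0.le)
  rw [← ENNReal.rpow_mul, mul_one_div_cancel hr0.ne', ENNReal.rpow_one,
    ENNReal.mul_rpow_of_nonneg _ _ (one_div_nonneg.2 hr0.le),
    ENNReal.ofReal_rpow_of_nonneg (Real.rpow_nonneg (div_pos two_pos ht.1).le _)
      (one_div_nonneg.2 hr0.le), ← Real.rpow_mul (div_pos two_pos ht.1).le, mul_one_div] at h2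
  exact h2

/-- If the maximal operator is bounded on `X^{1/r}` with `r > n`, Morrey's inequality bounds the level
integral pointwise. -/
lemma functional_le_morrey {q γ r : ℝ} (hn : 1 ≤ n) (hγ : γ ≠ 0) (hq : 0 < q) (hr : (n : ℝ) < r) :
    ∃ C : ℝ≥0∞, C ≠ ∞ ∧ ∀ ρ : FunctionNorm n, IsBallBanach ρ →
      maximalOpNorm (convexify ρ (1 / r)) < ∞ →
      ∀ (f : Rn n → ℝ) (K : Rn n → Rn n), HasContGradient f K →
      (∃ L : ℝ≥0, ∀ x, ‖K x‖ₑ ≤ L) → ρ (fun x => ‖K x‖ₑ) < ∞ → ∀ l : ℝ, 0 < l →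
      functional ρ q γ l f ≤ C * maximalOpNorm (convexify ρ (1 / r)) ^ (1 / r) *
        ρ (fun x => ‖K x‖ₑ) := by
  have hr0 : 0 < r := lt_of_le_of_lt (Nat.cast_nonneg n) hr
  set c : ℝ := 2 * 2 ^ (n : ℝ) * (morreyConst n r).toReal + 1 with hc
  have hc0 : 0 < c := by positivity
  refine ⟨kernelConst n γ ^ (1 / q) * ENNReal.ofReal c, ENNReal.mul_ne_top
    (ENNReal.rpow_ne_top_of_nonneg (by positivity) (kernelConst_ne_top n γ))
    ENNReal.ofReal_ne_top, ?_⟩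
  intro ρ hρ hA f K hfK ⟨L, hL⟩ hfin l hl
  have hf : Measurable f := hfK.continuous.measurable
  have hgm : Measurable fun x => ‖K x‖ₑ := hfK.continuous_grad.enorm.measurable
  set N : Rn n → ℝ≥0∞ := fun x => maximal (fun z => ‖K z‖ₑ ^ r) x ^ (1 / r) with hN
  have hNm : Measurable N := (measurable_maximal _).pow_const _
  have hNfin : ∀ x, N x ≠ ∞ := by
    intro x
    refine ENNReal.rpow_ne_top_of_nonneg (one_div_nonneg.2 hr0.le) ?_
    refine ne_top_of_le_ne_top (ENNReal.rpow_ne_top_of_nonneg hr0.le (ENNReal.coe_ne_top (r := L)))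
      (maximal_le_of_le (fun z => ?_) x)
    exact ENNReal.rpow_le_rpow (hL z) hr0.le
  have hfN : ∀ x y, x ≠ y → ‖f x - f y‖ₑ ≤ ENNReal.ofReal (c * ‖x - y‖) * N x := by
    intro x y hxy
    have hs : 0 < ‖x - y‖ := norm_pos_iff.2 (sub_ne_zero.2 hxy)
    refine (hfK.enorm_sub_le_radialAvg hxy).trans ?_
    have hmt := morreyConst_ne_top hr
    calc _ ≤ ENNReal.ofReal (2 ^ (n : ℝ) * ‖x - y‖) *
          (morreyConst n r * N x + morreyConst n r * N x) := by
          gcongr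
          · exact radialAvg_le_morrey hn hr hgm hs (by simp)
          · exact radialAvg_le_morrey hn hr hgm hs le_rfl
      _ = ENNReal.ofReal ((c - 1) * ‖x - y‖) * N x := by
          have : morreyConst n r = ENNReal.ofReal (morreyConst n r).toReal :=
            (ENNReal.ofReal_toReal hmt).symm
          rw [this, ← add_mul, ← ENNReal.ofReal_add (by positivity) (by positivity), ← mul_assoc,
            ← ENNReal.ofReal_mul (by positivity)]
          congr 2
          rw [hc]; ring
      _ ≤ _ := by gcongr; linarith
  set κ := l / c with hκ
  have hκ0 : 0 < κ := by positivity
  have hLI : ∀ x, levelIntegral l (γ / q) γ f x ≤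
      kernelConst n γ * (N x / ENNReal.ofReal κ) ^ q := by
    intro x
    refine le_trans (lintegral_mono fun y => ?_)
      (lintegral_threshold_le_const hγ hq hκ0 (hNfin x) x)
    by_cases hxy : (x, y) ∈ levelSet l (γ / q) f
    · have hr' : 0 < ‖x - y‖ := norm_pos_iff.2 (sub_ne_zero.2 hxy.1)
      have hlt := (ofReal_lt_enorm_of_mem_levelSet hl hxy).trans_le (hfN x y hxy.1)
      have hmem : y ∈ {y : Rn n | y ≠ x ∧ ENNReal.ofReal (κ * ‖y - x‖ ^ (γ / q)) < N x} := by
        refine ⟨Ne.symm hxy.1, ?_⟩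
        by_contra! h3
        refine absurd hlt (not_lt.2 ?_)
        calc _ ≤ ENNReal.ofReal (c * ‖x - y‖) * ENNReal.ofReal (κ * ‖y - x‖ ^ (γ / q)) := by gcongr
          _ = _ := by
            rw [← ENNReal.ofReal_mul (by positivity), hκ, norm_sub_rev y x]
            congr 1
            field_simp
      rw [indicator_of_mem hxy, indicator_of_mem hmem, norm_sub_rev]
    · rw [indicator_of_notMem hxy]; exact bot_le
  have hpt : ∀ x, ENNReal.ofReal l * levelIntegral l (γ / q) γ f x ^ (1 / q) ≤
      kernelConst n γ ^ (1 / q) * ENNReal.ofReal c * N x := by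
    intro x
    have h1 := ENNReal.rpow_le_rpow (hLI x) (one_div_nonneg.2 hq.le)
    rw [ENNReal.mul_rpow_of_nonneg _ _ (one_div_nonneg.2 hq.le), ← ENNReal.rpow_mul,
      mul_one_div_cancel hq.ne', ENNReal.rpow_one] at h1
    calc _ ≤ ENNReal.ofReal l * (kernelConst n γ ^ (1 / q) * (N x / ENNReal.ofReal κ)) := by gcongr
      _ = kernelConst n γ ^ (1 / q) * (ENNReal.ofReal l * (ENNReal.ofReal κ)⁻¹) * N x := by
          rw [div_eq_mul_inv (N x)]; ring
      _ = _ := by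
          have e : l * κ⁻¹ = c := by rw [hκ]; field_simp
          rw [← ENNReal.ofReal_inv_of_pos hκ0, ← ENNReal.ofReal_mul hl.le, e]
  have hNρ : ρ N ≤ maximalOpNorm (convexify ρ (1 / r)) ^ (1 / r) * ρ (fun x => ‖K x‖ₑ) := by
    have h1 : convexify ρ (1 / r) (fun x => ‖K x‖ₑ ^ r) < ∞ := by
      rw [← norm_eq_convexify hr0]
      exact ENNReal.rpow_lt_top_of_nonneg hr0.le hfin.ne
    have h2 := norm_maximal_le hA (hgm.pow_const r).aemeasurable h1
    have e : maximal (fun z => ‖K z‖ₑ ^ r) = fun x => N x ^ r := by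
      funext x
      rw [hN]
      simp only
      rw [← ENNReal.rpow_mul, one_div_mul_cancel hr0.ne', ENNReal.rpow_one]
    rw [e, ← norm_eq_convexify hr0, ← norm_eq_convexify hr0] at h2
    have h3 := ENNReal.rpow_le_rpow h2 (one_div_nonneg.2 hr0.le)
    rwa [← ENNReal.rpow_mul, mul_one_div_cancel hr0.ne', ENNReal.rpow_one,
      ENNReal.mul_rpow_of_nonneg _ _ (one_div_nonneg.2 hr0.le), ← ENNReal.rpow_mul,
      mul_one_div_cancel hr0.ne', ENNReal.rpow_one] at h3
  rw [functional_eq hρ hf]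
  have hCt : kernelConst n γ ^ (1 / q) * ENNReal.ofReal c ≠ ∞ := ENNReal.mul_ne_top
    (ENNReal.rpow_ne_top_of_nonneg (by positivity) (kernelConst_ne_top n γ))
    ENNReal.ofReal_ne_top
  lift kernelConst n γ ^ (1 / q) * ENNReal.ofReal c to ℝ≥0 using hCt with C hC
  calc _ ≤ ρ (fun x => (C : ℝ≥0∞) * N x) := hρ.mono _ _
        (((measurable_levelIntegral hf l (γ / q) γ).pow_const _).const_mul _).aemeasurable
        (hNm.const_mul _).aemeasurable (Eventually.of_forall hpt)
    _ = C * ρ N := hρ.smul C N hNm.aemeasurable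
    _ ≤ _ := by
        rw [mul_assoc]
        gcongr

end LevelIntegral

/-! ### Dyadic estimates for positive `γ` -/

section Dyadic

variable {n : ℕ}

/-- Powers `s ≤ 1` are subadditive. -/
lemma rpow_tsum_le {ι : Type*} {s : ℝ} (hs0 : 0 < s) (hs : s ≤ 1) (f : ι → ℝ≥0∞) :
    (∑' i, f i) ^ s ≤ ∑' i, f i ^ s := by
  classical
  have hfin : ∀ t : Finset ι, (∑ i ∈ t, f i) ^ s ≤ ∑ i ∈ t, f i ^ s := by
    intro t
    induction t using Finset.induction_on with
    | empty => simp [hs0]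
    | insert i t hi ih =>
      rw [Finset.sum_insert hi, Finset.sum_insert hi]
      exact (ENNReal.rpow_add_le_add_rpow _ _ hs0.le hs).trans (by gcongr)
  exact le_of_tendsto ((ENNReal.continuous_rpow_const.tendsto _).comp ENNReal.summable.hasSum)
    (Eventually.of_forall fun t => (hfin t).trans (ENNReal.sum_le_tsum t))

lemma rpow_le_of_dyadic {r R : ℝ} (e : ℝ) (hR : 0 < R) (h1 : R / 2 < r) (h2 : r ≤ R) :
    r ^ e ≤ 2 ^ |e| * R ^ e := by
  have hr : 0 < r := by linarith
  have h3 : r / R ≤ 1 := (div_le_one hR).2 h2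
  have h4 : (2 : ℝ)⁻¹ ≤ r / R := by rw [le_div_iff₀ hR]; linarith
  have h5 : (r / R) ^ e ≤ 2 ^ |e| := by
    calc (r / R) ^ e ≤ (r / R) ^ (-|e|) :=
          Real.rpow_le_rpow_of_exponent_ge (by positivity) h3 (neg_abs_le e)
      _ ≤ (2 : ℝ)⁻¹ ^ (-|e|) :=
          Real.rpow_le_rpow_of_nonpos (by norm_num) h4 (neg_nonpos.2 (abs_nonneg e))
      _ = _ := by rw [Real.rpow_neg (by norm_num), Real.inv_rpow (by norm_num), inv_inv]
  rwa [Real.div_rpow hr.le hR.le, div_le_iff₀ (by positivity)] at h5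

lemma maximal_add_le {g h : Rn n → ℝ≥0∞} (hg : Measurable g) (x : Rn n) :
    maximal (fun y => g y + h y) x ≤ maximal g x + maximal h x := by
  refine iSup₂_le fun c R => iSup₂_le fun hR hx => ?_
  rw [lintegral_add_left hg, ENNReal.add_div]
  exact add_le_add (le_iSup₂_of_le c R (le_iSup₂_of_le hR hx le_rfl))
    (le_iSup₂_of_le c R (le_iSup₂_of_le hR hx le_rfl))

lemma ballAvg_le_of_subset (u : Rn n → ℝ≥0∞) {δ R : ℝ} (hδ : 0 < δ) (hR : 0 < R) {w z : Rn n}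
    (h : Metric.ball w δ ⊆ Metric.ball z R) :
    ballAvg δ u w ≤ ENNReal.ofReal ((R / δ) ^ (n : ℝ)) * ballAvg R u z := by
  have h0 : volume (Metric.ball w δ) ≠ 0 := (Metric.measure_ball_pos volume w hδ).ne'
  have h1 : volume (Metric.ball w δ) ≠ ∞ := measure_ball_lt_top.ne
  have e : volume (Metric.ball z R) = ENNReal.ofReal ((R / δ) ^ (n : ℝ)) *
      volume (Metric.ball w δ) := by
    rw [volume_ball_scale z hR, volume_ball_scale w hδ, ← mul_assoc,
      ← ENNReal.ofReal_mul (by positivity), ← Real.mul_rpow (by positivity) hδ.le,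
      div_mul_cancel₀ _ hδ.ne']
  have hc0 : ENNReal.ofReal ((R / δ) ^ (n : ℝ)) ≠ 0 := by
    rw [ne_eq, ENNReal.ofReal_eq_zero, not_le]; positivity
  rw [ballAvg, ballAvg, e, ← mul_div_assoc, ENNReal.mul_div_mul_left _ _ hc0 ENNReal.ofReal_ne_top]
  exact ENNReal.div_le_div_right (lintegral_mono_set h) _

/-- The constant in the dyadic decomposition of the level integral. -/
def dyadicConst (n : ℕ) (γ : ℝ) : ℝ≥0∞ :=
  ENNReal.ofReal (2 ^ |γ - n| * 2 ^ (n : ℝ)) * volume (Metric.ball (0 : Rn n) 1)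

lemma dyadicConst_ne_top (n : ℕ) (γ : ℝ) : dyadicConst n γ ≠ ∞ :=
  ENNReal.mul_ne_top ENNReal.ofReal_ne_top measure_ball_lt_top.ne

/-- The dyadic decomposition of the level integral: if each pair of the level set at distance about
`2^k` has a point in one of the sets `S j k`, then either `x` is this point, or `y` is, and the
kernel is about `2^{k(γ-n)}`. -/
lemma levelIntegral_le_tsum {f : Rn n → ℝ} {l b γ : ℝ} (S : ℕ → ℤ → Set (Rn n))
    (hS : ∀ j k, MeasurableSet (S j k))
    (H : ∀ x y (k : ℤ), (x, y) ∈ levelSet l b f → (2 : ℝ) ^ k / 2 < ‖x - y‖ → ‖x - y‖ ≤ 2 ^ k →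
      ∃ j, x ∈ S j k ∨ y ∈ S j k) (x : Rn n) :
    levelIntegral l b γ f x ≤ dyadicConst n γ * ∑' j, ∑' k : ℤ, ENNReal.ofReal (((2 : ℝ) ^ k) ^ γ) *
      ((S j k).indicator 1 x + ballAvg (2 * 2 ^ k) ((S j k).indicator 1) x) := by
  have h2 : ∀ k : ℤ, (0 : ℝ) < 2 ^ k := fun k => by positivity
  set c : ℤ → ℝ≥0∞ := fun k => ENNReal.ofReal (2 ^ |γ - n| * ((2 : ℝ) ^ k) ^ (γ - n)) with hc
  set T : ℕ → ℤ → Rn n → ℝ≥0∞ := fun j k y => c k *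
    (Metric.ball x (2 * 2 ^ k)).indicator
      (fun y => (S j k).indicator (1 : Rn n → ℝ≥0∞) x + (S j k).indicator 1 y) y with hT
  have hSm : ∀ j k, Measurable ((S j k).indicator (1 : Rn n → ℝ≥0∞)) := fun j k =>
    measurable_one.indicator (hS j k)
  have hm1 : ∀ j k, Measurable fun y =>
      (Metric.ball x (2 * 2 ^ k)).indicator
      (fun y => (S j k).indicator (1 : Rn n → ℝ≥0∞) x + (S j k).indicator 1 y) y := fun j k =>
    ((hSm j k).const_add _).indicator measurableSet_ball
  have hTm : ∀ j k, Measurable (T j k) := fun j k => (hm1 j k).const_mul _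
  have hpt : ∀ y, (levelSet l b f).indicator
      (fun z => ENNReal.ofReal (‖z.1 - z.2‖ ^ (γ - n))) (x, y) ≤ ∑' j, ∑' k, T j k y := by
    intro y
    by_cases hxy : (x, y) ∈ levelSet l b f
    · rw [indicator_of_mem hxy]
      have hr : 0 < ‖x - y‖ := norm_pos_iff.2 (sub_ne_zero.2 hxy.1)
      obtain ⟨m, hm⟩ := exists_mem_Ioc_zpow hr one_lt_two
      have hk1 : (2 : ℝ) ^ (m + 1) / 2 < ‖x - y‖ := by
        rw [zpow_add_one₀ two_ne_zero]; simpa using hm.1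
      obtain ⟨j, hj⟩ := H x y (m + 1) hxy hk1 hm.2
      refine le_trans ?_ ((ENNReal.le_tsum (f := fun k => T j k y) (m + 1)).trans
        (ENNReal.le_tsum (f := fun j => ∑' k, T j k y) j))
      have hyb : y ∈ Metric.ball x (2 * 2 ^ (m + 1)) := by
        rw [mem_ball_iff_norm, norm_sub_rev]
        have := hm.2
        have := h2 (m + 1)
        linarith
      simp only [hT]
      rw [indicator_of_mem hyb]
      have hone : 1 ≤ (S j (m + 1)).indicator (1 : Rn n → ℝ≥0∞) x +
          (S j (m + 1)).indicator 1 y := by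
        rcases hj with hj | hj
        · rw [indicator_of_mem hj]; exact le_self_add
        · rw [indicator_of_mem hj]; exact le_add_self
      calc _ ≤ c (m + 1) * 1 := by
            rw [mul_one, hc]
            exact ENNReal.ofReal_le_ofReal (rpow_le_of_dyadic _ (h2 _) hk1 hm.2)
        _ ≤ _ := by gcongr
    · rw [indicator_of_notMem hxy]; exact bot_le
  have hterm : ∀ j k, ∫⁻ y, T j k y = dyadicConst n γ * (ENNReal.ofReal (((2 : ℝ) ^ k) ^ γ) *
      ((S j k).indicator 1 x + ballAvg (2 * 2 ^ k) ((S j k).indicator 1) x)) := by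
    intro j k
    have hk := h2 k
    have hR : (0 : ℝ) < 2 * 2 ^ k := by positivity
    have hB0 : volume (Metric.ball x (2 * (2 : ℝ) ^ k)) ≠ 0 := (Metric.measure_ball_pos volume x hR).ne'
    have hBt : volume (Metric.ball x (2 * (2 : ℝ) ^ k)) ≠ ∞ := measure_ball_lt_top.ne
    have e1 : c k * volume (Metric.ball x (2 * (2 : ℝ) ^ k)) =
        dyadicConst n γ * ENNReal.ofReal (((2 : ℝ) ^ k) ^ γ) := by
      have e3 : 2 ^ |γ - n| * ((2 : ℝ) ^ k) ^ (γ - n) * (2 * (2 : ℝ) ^ k) ^ (n : ℝ) =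
          2 ^ |γ - n| * 2 ^ (n : ℝ) * ((2 : ℝ) ^ k) ^ γ := by
        rw [Real.mul_rpow zero_le_two hk.le, Real.rpow_sub hk]
        have : (0 : ℝ) < ((2 : ℝ) ^ k) ^ (n : ℝ) := by positivity
        field_simp
      rw [volume_ball_scale x hR, hc, ← mul_assoc, ← ENNReal.ofReal_mul (by positivity), e3,
        dyadicConst, ENNReal.ofReal_mul (by positivity)]
      ring
    rw [lintegral_const_mul _ (hm1 j k), lintegral_indicator measurableSet_ball,
      lintegral_add_left measurable_const, setLIntegral_const]
    have e2 : ∫⁻ y in Metric.ball x (2 * (2 : ℝ) ^ k), (S j k).indicator (1 : Rn n → ℝ≥0∞) y =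
        volume (Metric.ball x (2 * (2 : ℝ) ^ k)) * ballAvg (2 * 2 ^ k) ((S j k).indicator 1) x := by
      rw [ballAvg, ENNReal.mul_div_cancel hB0 hBt]
    rw [e2, mul_comm ((S j k).indicator 1 x), ← mul_add, ← mul_assoc, e1, mul_assoc]
  calc levelIntegral l b γ f x ≤ ∫⁻ y, ∑' j, ∑' k, T j k y := lintegral_mono hpt
    _ = ∑' j, ∑' k, ∫⁻ y, T j k y := by
        rw [lintegral_tsum fun j => (Measurable.tsum fun k => hTm j k).aemeasurable]
        exact tsum_congr fun j => lintegral_tsum fun k => (hTm j k).aemeasurable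
    _ = _ := by
        simp_rw [hterm, ENNReal.tsum_mul_left]

/-- A power `s ≤ 1` of the density of `S` in a ball is controlled by the density of a neighbourhood
of `S`, because the latter, unless it vanishes, is not too small. -/
lemma rpow_ballAvg_indicator_le {S H : Set (Rn n)} (hS : MeasurableSet S) (hH : MeasurableSet H)
    {s : ℝ} (hs0 : 0 < s) (hs : s ≤ 1) {R δ : ℝ} (hδ : 0 < δ) (hδR : δ ≤ R)
    (hSH : ∀ w ∈ S, Metric.ball w δ ⊆ H) (x : Rn n) :
    ballAvg R (S.indicator 1) x ^ s ≤ ENNReal.ofReal (2 ^ (n : ℝ) * (R / δ) ^ (n * (1 - s))) *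
      ballAvg (2 * R) (H.indicator 1) x := by
  have hR : 0 < R := hδ.trans_le hδR
  have hB0 : volume (Metric.ball x R) ≠ 0 := (Metric.measure_ball_pos volume x hR).ne'
  have hBt : volume (Metric.ball x R) ≠ ∞ := measure_ball_lt_top.ne
  set m := ∫⁻ y in Metric.ball x (2 * R), H.indicator (1 : Rn n → ℝ≥0∞) y with hm
  have hmt : m ≠ ∞ := by
    refine ne_top_of_le_ne_top (measure_ball_lt_top (x := x) (r := 2 * R) (μ := volume)).ne ?_
    calc m ≤ ∫⁻ _ in Metric.ball x (2 * R), 1 :=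
          lintegral_mono fun y => indicator_le_self' (fun _ _ => zero_le_one) y
      _ = _ := by simp
  have hSm : ∫⁻ y in Metric.ball x R, S.indicator (1 : Rn n → ℝ≥0∞) y ≤ m := by
    refine (lintegral_mono fun y => ?_).trans (lintegral_mono_set
      (Metric.ball_subset_ball (by linarith)))
    exact indicator_le_indicator_of_subset
      (fun w hw => hSH w hw (Metric.mem_ball_self hδ)) (fun _ => zero_le_one) y
  by_cases hemp : (S ∩ Metric.ball x R).Nonempty
  swap
  · have : ballAvg R (S.indicator 1) x = 0 := by
      rw [ballAvg, lintegral_indicator_one hS, Measure.restrict_apply hS,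
        not_nonempty_iff_eq_empty.1 hemp]
      simp
    rw [this, ENNReal.zero_rpow_of_pos hs0]
    exact bot_le
  obtain ⟨w, hwS, hwB⟩ := hemp
  have hlow : volume (Metric.ball w δ) ≤ m := by
    rw [hm, lintegral_indicator_one hH, Measure.restrict_apply hH]
    refine measure_mono (subset_inter (hSH w hwS) (Metric.ball_subset_ball' ?_))
    rw [Metric.mem_ball] at hwB
    linarith
  set y := m / volume (Metric.ball x R) with hy
  have hyt : y ≠ ∞ := ENNReal.div_ne_top hmt hB0
  have hδR0 : 0 < (δ / R) ^ (n : ℝ) := by positivity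
  have hylow : ENNReal.ofReal ((δ / R) ^ (n : ℝ)) ≤ y := by
    rw [hy, ENNReal.le_div_iff_mul_le (Or.inl hB0) (Or.inl hBt)]
    refine le_trans (le_of_eq ?_) hlow
    rw [volume_ball_scale x hR, volume_ball_scale w hδ, ← mul_assoc,
      ← ENNReal.ofReal_mul hδR0.le, ← Real.mul_rpow (by positivity) hR.le, div_mul_cancel₀ _ hR.ne']
  have hy0 : y ≠ 0 := (lt_of_lt_of_le (ENNReal.ofReal_pos.2 hδR0) hylow).ne'
  have hneg : y ^ (-(1 - s)) ≤ ENNReal.ofReal ((R / δ) ^ (n * (1 - s))) := by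
    have e : (R / δ) ^ (n * (1 - s)) = (((δ / R) ^ (n : ℝ)) ^ (1 - s))⁻¹ := by
      rw [← Real.rpow_mul (by positivity), ← Real.inv_rpow (by positivity), inv_div]
    rw [ENNReal.rpow_neg, e, ENNReal.ofReal_inv_of_pos (by positivity),
      ← ENNReal.ofReal_rpow_of_pos hδR0]
    exact ENNReal.inv_le_inv.2 (ENNReal.rpow_le_rpow hylow (by linarith))
  have hvol : volume (Metric.ball x (2 * R)) = ENNReal.ofReal (2 ^ (n : ℝ)) *
      volume (Metric.ball x R) := by
    rw [volume_ball_scale x hR, volume_ball_scale x (by positivity : 0 < 2 * R), ← mul_assoc,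
      ← ENNReal.ofReal_mul (by positivity), ← Real.mul_rpow (by positivity) hR.le]
  have hy2 : y = ENNReal.ofReal (2 ^ (n : ℝ)) * ballAvg (2 * R) (H.indicator 1) x := by
    have h20 : ENNReal.ofReal (2 ^ (n : ℝ)) ≠ 0 := by
      rw [ne_eq, ENNReal.ofReal_eq_zero, not_le]; positivity
    rw [ballAvg, hvol, ← mul_div_assoc, ENNReal.mul_div_mul_left _ _ h20 ENNReal.ofReal_ne_top]
  calc _ ≤ y ^ s := ENNReal.rpow_le_rpow (ENNReal.div_le_div_right hSm _) hs0.le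
    _ = y ^ (1 : ℝ) * y ^ (-(1 - s)) := by
        rw [← ENNReal.rpow_add _ _ hy0 hyt]; congr 1; ring
    _ ≤ y * ENNReal.ofReal ((R / δ) ^ (n * (1 - s))) := by
        rw [ENNReal.rpow_one]; gcongr
    _ = _ := by
        rw [hy2, ENNReal.ofReal_mul (by positivity)]; ring

/-- If the averages over all balls of radius `2^{-j} R` were at most `Λ 2^{jα}`, the mean over the radii
`t r` would be at most a multiple of `Λ ∫ t^{-α} dt`, which is finite for `α < 1`. -/
lemma exists_lt_ballAvg_of_lt_radialAvg {α : ℝ} (hα0 : 0 < α) (hα : α < 1) {R r Λ : ℝ} (hR : 0 < R)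
    (h1 : R / 2 < r) (h2 : r ≤ R) (hΛ : 0 < Λ) {g : Rn n → ℝ≥0∞} {x : Rn n}
    (h : ENNReal.ofReal (4 ^ (n : ℝ) / (1 - α) * Λ) < radialAvg r g x) :
    ∃ j : ℕ, ENNReal.ofReal (Λ * 2 ^ (j * α)) < ballAvg (R / 2 ^ j) g x := by
  by_contra! hcon
  refine absurd h (not_lt.2 ?_)
  have hr : 0 < r := by linarith
  have hpt : ∀ t ∈ Ioo (0 : ℝ) 1, ballAvg (t * r) g x ≤
      ENNReal.ofReal (4 ^ (n : ℝ) * Λ * t ^ (-α)) := by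
    intro t ht
    have ht0 := ht.1
    obtain ⟨j, hj1, hj2⟩ := exists_nat_pow_near_of_lt_one ht.1 ht.2.le
      (by norm_num : (0 : ℝ) < 2⁻¹) (by norm_num)
    have hp : (0 : ℝ) < 2 ^ j := by positivity
    rw [inv_pow, pow_succ] at hj1
    rw [inv_pow] at hj2
    have hj1' : 1 < t * (2 ^ j * 2) := by
      rw [← div_lt_iff₀ (by positivity), one_div]; exact hj1
    have hj2' : t * 2 ^ j ≤ 1 := by
      rw [← le_div_iff₀ hp, one_div]; exact hj2
    have hsub : Metric.ball x (t * r) ⊆ Metric.ball x (R / 2 ^ j) := by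
      refine Metric.ball_subset_ball ?_
      rw [le_div_iff₀ hp]
      nlinarith
    refine (ballAvg_le_of_subset g (by positivity) (by positivity) hsub).trans ?_
    have hq : R / 2 ^ j / (t * r) ≤ 4 := by
      rw [div_div, div_le_iff₀ (by positivity)]
      nlinarith
    have ht2 : (2 : ℝ) ^ (j * α) ≤ t ^ (-α) := by
      rw [Real.rpow_neg ht0.le, ← Real.inv_rpow ht0.le, Real.rpow_mul zero_le_two,
        Real.rpow_natCast]
      refine Real.rpow_le_rpow hp.le ?_ hα0.le
      rwa [← one_div, le_div_iff₀ ht0, mul_comm]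
    calc _ ≤ ENNReal.ofReal (4 ^ (n : ℝ)) * ENNReal.ofReal (Λ * 2 ^ (j * α)) := by
          gcongr
          exact hcon j
      _ = ENNReal.ofReal (4 ^ (n : ℝ) * Λ * 2 ^ (j * α)) := by
          rw [← ENNReal.ofReal_mul (by positivity), mul_assoc]
      _ ≤ _ := by gcongr
  have hint : IntegrableOn (fun t : ℝ => 4 ^ (n : ℝ) * Λ * t ^ (-α)) (Ioo 0 1) := by
    have := (intervalIntegral.intervalIntegrable_rpow' (a := 0) (b := 1)
      (by linarith : -1 < -α)).1
    exact (this.mono_set Ioo_subset_Ioc_self).const_mul _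
  calc radialAvg r g x ≤ ∫⁻ t in Ioo (0 : ℝ) 1, ENNReal.ofReal (4 ^ (n : ℝ) * Λ * t ^ (-α)) :=
        setLIntegral_mono' measurableSet_Ioo hpt
    _ = ENNReal.ofReal (∫ t in Ioo (0 : ℝ) 1, 4 ^ (n : ℝ) * Λ * t ^ (-α)) := by
        rw [ofReal_integral_eq_lintegral_ofReal hint]
        filter_upwards [ae_restrict_mem measurableSet_Ioo] with t ht
        have := ht.1
        positivity
    _ = _ := by
        rw [integral_const_mul, ← integral_Ioc_eq_integral_Ioo,
          ← intervalIntegral.integral_of_le zero_le_one, integral_rpow (Or.inl (by linarith))]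
        congr 1
        rw [Real.zero_rpow (by linarith), Real.one_rpow]
        have : 1 - α ≠ 0 := by linarith
        have : -α + 1 ≠ 0 := by linarith
        field_simp
        ring

end Dyadic

section DyadicBound

variable {n : ℕ}

lemma tsum_dyadic_factor_ne_top {θ c : ℝ} (hθ : θ < 0) :
    ∑' j : ℕ, ENNReal.ofReal (c * 2 ^ (j * θ)) ≠ ∞ := by
  have e : ∀ j : ℕ, ENNReal.ofReal (c * 2 ^ (j * θ)) ≤
      ENNReal.ofReal c * ENNReal.ofReal (2 ^ θ) ^ j := by
    intro j
    rw [ENNReal.ofReal_mul' (by positivity), mul_comm (j : ℝ), Real.rpow_mul zero_le_two,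
      Real.rpow_natCast, ENNReal.ofReal_pow (by positivity)]
  refine ne_top_of_le_ne_top ?_ (ENNReal.tsum_le_tsum e)
  rw [ENNReal.tsum_mul_left, ENNReal.tsum_geometric]
  refine ENNReal.mul_ne_top ENNReal.ofReal_ne_top (ENNReal.inv_ne_top.2 (tsub_pos_of_lt ?_).ne')
  rw [ENNReal.ofReal_lt_one]
  exact Real.rpow_lt_one_of_one_lt_of_neg one_lt_two hθ

/-- The bound for the level integrals in weighted `L^p` spaces, uniform in the weight `h`, from which
the bound for the functional in `X` follows by duality. -/
def WeightedBound (n : ℕ) (p q γ : ℝ) : Prop :=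
  ∃ C : ℝ≥0∞, C ≠ ∞ ∧ ∀ (f : Rn n → ℝ) (K : Rn n → Rn n), HasContGradient f K →
    ∫⁻ x, ‖K x‖ₑ ^ p < ∞ → ∀ l : ℝ, 0 < l → ∀ h : Rn n → ℝ≥0∞, Measurable h →
    ENNReal.ofReal l ^ p * ∫⁻ x, levelIntegral l (γ / q) γ f x ^ (p / q) * h x ≤
      C * ∫⁻ x, ‖K x‖ₑ ^ p * (maximal h x + maximal (maximal h) x)

/-- The extrapolation principle applied to a weighted bound. -/
lemma WeightedBound.functional_le {p q γ : ℝ} (hp : 1 ≤ p) (H : WeightedBound n p q γ) :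
    ∃ C : ℝ≥0∞, C ≠ ∞ ∧ ∀ ρ : FunctionNorm n, IsBallBanach ρ →
      IsBallBanach (convexify ρ (1 / p)) →
      maximalOpNorm (associate (convexify ρ (1 / p))) < ∞ →
      ∀ (f : Rn n → ℝ) (K : Rn n → Rn n), HasContGradient f K →
      ∫⁻ x, ‖K x‖ₑ ^ p < ∞ → ρ (fun x => ‖K x‖ₑ) < ∞ → ∀ l : ℝ, 0 < l →
      functional ρ q γ l f ≤ (C * (maximalOpNorm (associate (convexify ρ (1 / p))) +
        maximalOpNorm (associate (convexify ρ (1 / p))) ^ 2)) ^ (1 / p) *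
        ρ (fun x => ‖K x‖ₑ) := by
  have hp0 : 0 < p := by linarith
  obtain ⟨C, hC, H⟩ := H
  refine ⟨C, hC, fun ρ hρ hY ht f K hfK hu hfin l hl => ?_⟩
  have hf : Measurable f := hfK.continuous.measurable
  have hLI := measurable_levelIntegral hf l (γ / q) γ
  rw [functional_eq hρ hf]
  refine norm_le_of_weighted hp hY ht ((hLI.pow_const _).const_mul _).aemeasurable
    hfK.continuous_grad.enorm.measurable.aemeasurable hfin C fun h hh => ?_
  refine le_trans (le_of_eq ?_) (H f K hfK hu l hl h hh)
  rw [← lintegral_const_mul' _ _ (ENNReal.rpow_ne_top_of_nonneg hp0.le ENNReal.ofReal_ne_top)]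
  refine lintegral_congr fun x => ?_
  rw [ENNReal.mul_rpow_of_nonneg _ _ hp0.le, ← ENNReal.rpow_mul, one_div_mul_eq_div, mul_assoc]

/-- The reduction of the weighted bound with an exponent `q ≤ p` to the exponent `p`. -/
lemma WeightedBound.of_le {p q γ : ℝ} (hγ : γ ≠ 0) (hq : 0 < q) (hqp : q ≤ p)
    (H : WeightedBound n p p (γ * (p / q))) : WeightedBound n p q γ := by
  have hp0 : 0 < p := hq.trans_le hqp
  obtain ⟨C, hC, H⟩ := H
  set C1 : ℝ≥0∞ := 2 * (2 * kernelConst n γ) ^ (p / q - 1) with hC1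
  have hC1t : C1 ≠ ∞ := by
    refine ENNReal.mul_ne_top ENNReal.ofNat_ne_top (ENNReal.rpow_ne_top_of_nonneg ?_ ?_)
    · have := (one_le_div hq).2 hqp
      linarith
    · exact ENNReal.mul_ne_top ENNReal.ofNat_ne_top (kernelConst_ne_top n γ)
  refine ⟨C1 * C, ENNReal.mul_ne_top hC1t hC, fun f K hfK hu l hl h hh => ?_⟩
  have hf : Measurable f := hfK.continuous.measurable
  have hb : γ * (p / q) / p = γ / q := by field_simp
  have h3 := H f K hfK hu l hl h hh
  rw [hb, div_self hp0.ne'] at h3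
  simp only [ENNReal.rpow_one] at h3
  calc _ ≤ ENNReal.ofReal l ^ p * ∫⁻ x, C1 *
        (levelIntegral l (γ / q) (γ * (p / q)) f x * h x) := by
        refine mul_le_mul_right (lintegral_mono fun x => ?_) _
        rw [← mul_assoc]
        exact mul_le_mul_left (rpow_levelIntegral_le hf hγ hq hqp l (γ / q) x) _
    _ = C1 * (ENNReal.ofReal l ^ p * ∫⁻ x, levelIntegral l (γ / q) (γ * (p / q)) f x * h x) := by
        rw [lintegral_const_mul' _ _ hC1t]; ring
    _ ≤ _ := by
        rw [mul_assoc C1]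
        exact mul_le_mul_right h3 C1

/-- The weighted bound for `γ > 0` and `q ≥ p`. Each pair of the level set at distance about `2^k` has
a point at which, for some `j ≥ 0`, the average of the gradient at the scale `2^{k-j}` exceeds a
constant times `l 2^{jα} 2^{kγ/q}`; the gain `2^{jα}` with `α < 1` close to `1` pays for the loss
`2^{jn(1-p/q)}` from enlarging the sets of such points. -/
lemma weightedBound_of_le {p q γ : ℝ} (hp : 1 ≤ p) (hpq : p ≤ q) (hγ : 0 < γ)
    (hn : (n : ℝ) * (1 / p - 1 / q) < 1) :
    WeightedBound n p q γ := by
  have hp0 : 0 < p := by linarith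
  have hq0 : 0 < q := by linarith
  set s := p / q with hs
  have hs0 : 0 < s := by positivity
  have hs1 : s ≤ 1 := (div_le_one hq0).2 hpq
  set a := γ * s with ha
  have ha0 : 0 < a := by positivity
  set b := γ / q with hb
  have hb0 : 0 < b := by positivity
  have hab : b * p = a := by rw [ha, hb, hs]; ring
  set σ := (n : ℝ) * (1 / p - 1 / q) with hσ
  have hσ0 : 0 ≤ σ := mul_nonneg (Nat.cast_nonneg n)
    (sub_nonneg.2 (one_div_le_one_div_of_le hp0 hpq))
  -- the exponent of the gain lies strictly between `σ` and `1`
  set α := (σ + 1) / 2 with hα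
  have hα0 : 0 < α := by positivity
  have hα1 : α < 1 := by rw [hα]; linarith
  have hσα : σ < α := by rw [hα]; linarith
  have hns : (n : ℝ) * (1 - s) = σ * p := by rw [hσ, hs]; field_simp
  set c : ℝ := 2 ^ (-b) * (1 - α) / (2 * 2 ^ (n : ℝ) * 4 ^ (n : ℝ)) with hc
  have h1α : 0 < 1 - α := by linarith
  have hc0 : 0 < c := by positivity
  set d : ℝ := 2 ^ (-(n : ℝ)) * c with hd
  have hd0 : 0 < d := by positivity
  set Z : ℕ → ℝ≥0∞ := fun j => ENNReal.ofReal
    (2 ^ (n : ℝ) * 2 ^ ((n : ℝ) * (1 - s)) * (d ^ p)⁻¹ * 2 ^ (j * ((σ - α) * p))) with hZ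
  have hZt : ∑' j, Z j ≠ ∞ :=
    tsum_dyadic_factor_ne_top (mul_neg_of_neg_of_pos (by linarith) hp0)
  have hDt : dyadicConst n γ ^ s ≠ ∞ := ENNReal.rpow_ne_top_of_nonneg hs0.le (dyadicConst_ne_top n γ)
  refine ⟨dyadicConst n γ ^ s * (∑' j, Z j) * coverConst n a, ENNReal.mul_ne_top
    (ENNReal.mul_ne_top hDt hZt) (coverConst_ne_top n ha0), ?_⟩
  intro f K hfK hufin l hl h hh
  have hf : Measurable f := hfK.continuous.measurable
  set g : Rn n → ℝ≥0∞ := fun x => ‖K x‖ₑ with hg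
  have hgm : Measurable g := hfK.continuous_grad.enorm.measurable
  set u : Rn n → ℝ≥0∞ := fun x => g x ^ p with hu
  have hum : Measurable u := hgm.pow_const p
  have h2 : ∀ k : ℤ, (0 : ℝ) < 2 ^ k := fun k => by positivity
  set Λ : ℤ → ℝ := fun k => c * l * ((2 : ℝ) ^ k) ^ b with hΛ
  have hΛ0 : ∀ k, 0 < Λ k := fun k => by have := h2 k; positivity
  set S : ℕ → ℤ → Set (Rn n) := fun j k =>
    {x | ENNReal.ofReal (Λ k * 2 ^ (j * α)) < ballAvg (2 ^ k / 2 ^ j) g x} with hS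
  have hSm : ∀ j k, MeasurableSet (S j k) := fun j k =>
    measurableSet_lt measurable_const (measurable_ballAvg hgm _)
  set μ : ℕ → ℝ := fun j => (d * l * 2 ^ (j * α)) ^ p * ((2 : ℝ) ^ ((j : ℤ) - 1)) ^ a with hμ
  have hμ0 : ∀ j, 0 < μ j := fun j => by have := h2 ((j : ℤ) - 1); positivity
  set H : ℕ → ℤ → Set (Rn n) := fun j i =>
    {x | ENNReal.ofReal (μ j * ((2 : ℝ) ^ i) ^ a) < ballAvg (2 ^ i) u x} with hH
  have hHm : ∀ j i, MeasurableSet (H j i) := fun j i =>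
    measurableSet_lt measurable_const (measurable_ballAvg hum _)
  -- the constant `c` is chosen such that this holds
  have hpts : ∀ x y (k : ℤ), (x, y) ∈ levelSet l b f → (2 : ℝ) ^ k / 2 < ‖x - y‖ →
      ‖x - y‖ ≤ 2 ^ k → ∃ j, x ∈ S j k ∨ y ∈ S j k := by
    intro x y k hxy hk1 hk2
    have hk := h2 k
    have hr : 0 < ‖x - y‖ := norm_pos_iff.2 (sub_ne_zero.2 hxy.1)
    have hlt := (ofReal_lt_enorm_of_mem_levelSet hl hxy).trans_le
      (hfK.enorm_sub_le_radialAvg hxy.1)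
    have hor : ENNReal.ofReal (4 ^ (n : ℝ) / (1 - α) * Λ k) < radialAvg ‖x - y‖ g x ∨
        ENNReal.ofReal (4 ^ (n : ℝ) / (1 - α) * Λ k) < radialAvg ‖x - y‖ g y := by
      by_contra! hcon
      refine absurd hlt (not_lt.2 ?_)
      have hΛk := hΛ0 k
      calc _ ≤ ENNReal.ofReal (2 ^ (n : ℝ) * ‖x - y‖) *
            (ENNReal.ofReal (4 ^ (n : ℝ) / (1 - α) * Λ k) +
            ENNReal.ofReal (4 ^ (n : ℝ) / (1 - α) * Λ k)) :=
            mul_le_mul_right (add_le_add hcon.1 hcon.2) _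
        _ = ENNReal.ofReal (l * (‖x - y‖ * ((2 : ℝ) ^ k / 2) ^ b)) := by
            rw [← ENNReal.ofReal_add (by positivity) (by positivity),
              ← ENNReal.ofReal_mul (by positivity)]
            congr 1
            simp only [hΛ, hc]
            rw [Real.div_rpow hk.le zero_le_two, Real.rpow_neg zero_le_two]
            field_simp
            ring
        _ ≤ _ := by gcongr
    rcases hor with h3 | h3
    · obtain ⟨j, hj⟩ := exists_lt_ballAvg_of_lt_radialAvg hα0 hα1 hk hk1 hk2 (hΛ0 k) h3
      exact ⟨j, Or.inl hj⟩
    · obtain ⟨j, hj⟩ := exists_lt_ballAvg_of_lt_radialAvg hα0 hα1 hk hk1 hk2 (hΛ0 k) h3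
      exact ⟨j, Or.inr hj⟩
  -- the scales `k` and `i = k - j + 1`: balls of radius `2^{k-j}` are compared with those of radius
  -- `2^i = 2 · 2^{k-j}`
  have hshift : ∀ (i : ℤ) (j : ℕ), (2 : ℝ) ^ (i + ((j : ℤ) - 1)) / 2 ^ j * 2 = 2 ^ i := by
    intro i j
    rw [zpow_add₀ two_ne_zero, zpow_sub_one₀ two_ne_zero, zpow_natCast]
    have : (2 : ℝ) ^ j ≠ 0 := by positivity
    field_simp
  -- the neighbourhoods of the sets `S` lie in superlevel sets of the averages of `u`
  have hSH : ∀ j i, ∀ w ∈ S j (i + ((j : ℤ) - 1)),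
      Metric.ball w (2 ^ (i + ((j : ℤ) - 1)) / 2 ^ j) ⊆ H j i := by
    intro j i w hw z hz
    set k := i + ((j : ℤ) - 1) with hk
    set δ := (2 : ℝ) ^ k / 2 ^ j with hδ
    have hδ0 : 0 < δ := by positivity
    have h2δ : δ * 2 = 2 ^ i := hshift i j
    have hi := h2 i
    have hsub : Metric.ball w δ ⊆ Metric.ball z (2 ^ i) := by
      refine Metric.ball_subset_ball' ?_
      rw [Metric.mem_ball, dist_comm] at hz
      linarith
    have h3 : ENNReal.ofReal (Λ k * 2 ^ (j * α)) < ENNReal.ofReal (2 ^ (n : ℝ)) *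
        ballAvg (2 ^ i) g z := by
      have := ballAvg_le_of_subset g hδ0 hi hsub
      rw [← h2δ, mul_div_cancel_left₀ _ hδ0.ne', h2δ] at this
      exact lt_of_lt_of_le hw this
    have h4 : ENNReal.ofReal (2 ^ (-(n : ℝ)) * (Λ k * 2 ^ (j * α))) < ballAvg (2 ^ i) g z := by
      rw [ENNReal.ofReal_mul (by positivity), Real.rpow_neg zero_le_two,
        ENNReal.ofReal_inv_of_pos (by positivity), mul_comm, ← div_eq_mul_inv]
      exact ENNReal.div_lt_of_lt_mul' h3
    have h5 := (ENNReal.rpow_lt_rpow h4 hp0).trans_le (rpow_ballAvg_le hp hgm hi z)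
    have hΛk := hΛ0 k
    rw [ENNReal.ofReal_rpow_of_nonneg (by positivity) hp0.le] at h5
    refine lt_of_eq_of_lt (congrArg _ ?_) h5
    have hj := h2 ((j : ℤ) - 1)
    have e1 : ((2 : ℝ) ^ k) ^ a = ((2 : ℝ) ^ i) ^ a * ((2 : ℝ) ^ ((j : ℤ) - 1)) ^ a := by
      rw [hk, zpow_add₀ two_ne_zero, Real.mul_rpow hi.le hj.le]
    have e2 : 2 ^ (-(n : ℝ)) * (Λ k * 2 ^ (j * α)) = (d * l * 2 ^ (j * α)) * ((2 : ℝ) ^ k) ^ b := by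
      simp only [hΛ, hd]; ring
    have hkk := h2 k
    rw [e2, Real.mul_rpow (by positivity) (by positivity), ← Real.rpow_mul hkk.le, hab, e1]
    simp only [hμ]
    ring
  set w : Rn n → ℝ≥0∞ := fun x => h x + maximal h x with hw
  have hMh := measurable_maximal h
  have hwm : Measurable w := hh.add hMh
  have h1m : ∀ j i, Measurable ((H j i).indicator (1 : Rn n → ℝ≥0∞)) := fun j i =>
    measurable_one.indicator (hHm j i)
  have h1S : ∀ j k, Measurable ((S j k).indicator (1 : Rn n → ℝ≥0∞)) := fun j k =>
    measurable_one.indicator (hSm j k)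
  set D : ℕ → ℝ≥0∞ := fun j => ENNReal.ofReal (2 ^ (n : ℝ) * (2 * 2 ^ j) ^ ((n : ℝ) * (1 - s)))
    with hD
  have hDn : ∀ j, D j ≠ ∞ := fun j => ENNReal.ofReal_ne_top
  have hns0 : 0 ≤ (n : ℝ) * (1 - s) := mul_nonneg (Nat.cast_nonneg n) (by linarith)
  have hD1 : ∀ j, 1 ≤ D j := by
    intro j
    rw [hD, ENNReal.one_le_ofReal]
    have h3 : (1 : ℝ) ≤ 2 ^ j := one_le_pow₀ one_le_two
    refine one_le_mul_of_one_le_of_one_le (Real.one_le_rpow one_le_two (Nat.cast_nonneg n))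
      (Real.one_le_rpow (by linarith) hns0)
  -- the contribution of one pair of scales
  have hterm : ∀ (j : ℕ) (i : ℤ), ∫⁻ x, (ENNReal.ofReal (((2 : ℝ) ^ (i + ((j : ℤ) - 1))) ^ γ) *
      ((S j (i + ((j : ℤ) - 1))).indicator 1 x + ballAvg (2 * 2 ^ (i + ((j : ℤ) - 1)))
        ((S j (i + ((j : ℤ) - 1))).indicator 1) x)) ^ s * h x ≤
      D j * ENNReal.ofReal (((2 : ℝ) ^ ((j : ℤ) - 1)) ^ a) *
        ∫⁻ x, (H j i).indicator (fun x => ENNReal.ofReal (((2 : ℝ) ^ i) ^ a) * w x) x := by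
    intro j i
    set k := i + ((j : ℤ) - 1) with hk
    have hkk := h2 k
    have hi := h2 i
    have hj := h2 ((j : ℤ) - 1)
    set δ := (2 : ℝ) ^ k / 2 ^ j with hδ
    have hδ0 : 0 < δ := by positivity
    have h1j : (1 : ℝ) ≤ 2 ^ j := one_le_pow₀ one_le_two
    have hδk : δ ≤ 2 * 2 ^ k := by
      rw [hδ, div_le_iff₀ (by positivity)]
      nlinarith
    have hRδ : 2 * 2 ^ k / δ = 2 * 2 ^ j := by rw [hδ]; field_simp
    have hpt : ∀ x, (ENNReal.ofReal (((2 : ℝ) ^ k) ^ γ) *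
        ((S j k).indicator 1 x + ballAvg (2 * 2 ^ k) ((S j k).indicator 1) x)) ^ s ≤
        ENNReal.ofReal (((2 : ℝ) ^ k) ^ a) * (D j * ((H j i).indicator 1 x +
          ballAvg (2 * (2 * 2 ^ k)) ((H j i).indicator 1) x)) := by
      intro x
      rw [ENNReal.mul_rpow_of_nonneg _ _ hs0.le, ENNReal.ofReal_rpow_of_nonneg (by positivity) hs0.le,
        ← Real.rpow_mul hkk.le]
      gcongr
      refine (ENNReal.rpow_add_le_add_rpow _ _ hs0.le hs1).trans ?_
      rw [mul_add]
      refine add_le_add ?_ ?_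
      · by_cases hx : x ∈ S j k
        · have hx' : x ∈ H j i := hSH j i x hx (Metric.mem_ball_self hδ0)
          rw [indicator_of_mem hx, indicator_of_mem hx']
          simpa using hD1 j
        · rw [indicator_of_notMem hx, ENNReal.zero_rpow_of_pos hs0]
          exact bot_le
      · have := rpow_ballAvg_indicator_le (hSm j k) (hHm j i) hs0 hs1 hδ0 hδk (hSH j i) x
        rwa [hRδ] at this
    have hAm : Measurable (ballAvg (2 * (2 * 2 ^ k)) ((H j i).indicator (1 : Rn n → ℝ≥0∞))) :=
      measurable_ballAvg (h1m j i) _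
    calc _ ≤ ∫⁻ x, ENNReal.ofReal (((2 : ℝ) ^ k) ^ a) * D j * ((H j i).indicator 1 x * h x +
          ballAvg (2 * (2 * 2 ^ k)) ((H j i).indicator 1) x * h x) := by
          refine lintegral_mono fun x => ?_
          calc _ ≤ _ := mul_le_mul_left (hpt x) (h x)
            _ = _ := by ring
      _ = ENNReal.ofReal (((2 : ℝ) ^ k) ^ a) * D j * ((∫⁻ x, (H j i).indicator 1 x * h x) +
          ∫⁻ x, ballAvg (2 * (2 * 2 ^ k)) ((H j i).indicator 1) x * h x) := by
          rw [lintegral_const_mul' _ _ (ENNReal.mul_ne_top ENNReal.ofReal_ne_top (hDn j)),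
            lintegral_add_left (f := fun x => (H j i).indicator 1 x * h x) ((h1m j i).mul hh)]
      _ ≤ ENNReal.ofReal (((2 : ℝ) ^ k) ^ a) * D j * ((∫⁻ x, (H j i).indicator 1 x * h x) +
          ∫⁻ x, (H j i).indicator 1 x * maximal h x) := by
          exact mul_le_mul_right (add_le_add le_rfl
            (lintegral_ballAvg_mul_le (h1m j i) hh (by positivity))) _
      _ = ENNReal.ofReal (((2 : ℝ) ^ k) ^ a) * D j * ∫⁻ x, (H j i).indicator 1 x * w x := by
          rw [← lintegral_add_left (f := fun x => (H j i).indicator 1 x * h x) ((h1m j i).mul hh)]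
          simp only [hw, mul_add]
      _ = D j * ENNReal.ofReal (((2 : ℝ) ^ ((j : ℤ) - 1)) ^ a) *
          ∫⁻ x, ENNReal.ofReal (((2 : ℝ) ^ i) ^ a) * ((H j i).indicator 1 x * w x) := by
          rw [lintegral_const_mul' _ _ ENNReal.ofReal_ne_top, hk, zpow_add₀ two_ne_zero,
            Real.mul_rpow hi.le hj.le, ENNReal.ofReal_mul (by positivity)]
          ring
      _ = _ := by
          congr 1
          refine lintegral_congr fun x => ?_
          by_cases hx : x ∈ H j i
          · rw [indicator_of_mem hx, indicator_of_mem hx, Pi.one_apply, one_mul]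
          · rw [indicator_of_notMem hx, indicator_of_notMem hx, zero_mul, mul_zero]
  set I := ∫⁻ x, u x * maximal w x with hI
  -- the sum over all pairs with `i = k - j + 1`, by the covering estimate
  have hsum : ∀ j : ℕ, ∑' i : ℤ, ∫⁻ x, (ENNReal.ofReal (((2 : ℝ) ^ (i + ((j : ℤ) - 1))) ^ γ) *
      ((S j (i + ((j : ℤ) - 1))).indicator 1 x + ballAvg (2 * 2 ^ (i + ((j : ℤ) - 1)))
        ((S j (i + ((j : ℤ) - 1))).indicator 1) x)) ^ s * h x ≤
      (ENNReal.ofReal l ^ p)⁻¹ * (Z j * (coverConst n a * I)) := by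
    intro j
    have hj := h2 ((j : ℤ) - 1)
    calc _ ≤ ∑' i : ℤ, D j * ENNReal.ofReal (((2 : ℝ) ^ ((j : ℤ) - 1)) ^ a) *
        ∫⁻ x, (H j i).indicator (fun x => ENNReal.ofReal (((2 : ℝ) ^ i) ^ a) * w x) x :=
          ENNReal.tsum_le_tsum fun i => hterm j i
      _ ≤ D j * ENNReal.ofReal (((2 : ℝ) ^ ((j : ℤ) - 1)) ^ a) *
          (coverConst n a * (ENNReal.ofReal (μ j))⁻¹ * I) := by
          rw [ENNReal.tsum_mul_left]
          gcongr
          exact tsum_lintegral_superlevel_le ha0 hum hufin hwm (hμ0 j)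
      _ = (D j * ENNReal.ofReal (((2 : ℝ) ^ ((j : ℤ) - 1)) ^ a) * (ENNReal.ofReal (μ j))⁻¹) *
          (coverConst n a * I) := by ring
      _ = (ENNReal.ofReal l ^ p)⁻¹ * Z j * (coverConst n a * I) := by
          congr 1
          have hμj := hμ0 j
          rw [ENNReal.ofReal_rpow_of_nonneg hl.le hp0.le,
            ← ENNReal.ofReal_inv_of_pos (hμ0 j), ← ENNReal.ofReal_inv_of_pos (by positivity),
            ← ENNReal.ofReal_mul (by positivity), ← ENNReal.ofReal_mul (by positivity),
            ← ENNReal.ofReal_mul (by positivity)]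
          congr 1
          have e1 : (2 : ℝ) ^ (j * ((σ - α) * p)) =
              ((2 : ℝ) ^ j) ^ ((n : ℝ) * (1 - s)) * (((2 : ℝ) ^ (j * α)) ^ p)⁻¹ := by
            rw [hns, ← Real.rpow_natCast 2 j, ← Real.rpow_mul zero_le_two,
              ← Real.rpow_mul zero_le_two, ← Real.rpow_neg zero_le_two,
              ← Real.rpow_add two_pos]
            congr 1
            ring
          simp only [hμ]
          rw [e1, Real.mul_rpow (x := d * l) (by positivity) (by positivity),
            Real.mul_rpow hd0.le hl.le, Real.mul_rpow zero_le_two (by positivity)]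
          have : (0 : ℝ) < ((2 : ℝ) ^ ((j : ℤ) - 1)) ^ a := by positivity
          field_simp
      _ = _ := by rw [mul_assoc]
  have hV : ∫⁻ x, levelIntegral l b γ f x ^ s * h x ≤
      dyadicConst n γ ^ s * ∑' j, (ENNReal.ofReal l ^ p)⁻¹ * (Z j * (coverConst n a * I)) := by
    have hQm : ∀ (j : ℕ) (k : ℤ), Measurable fun x => (ENNReal.ofReal (((2 : ℝ) ^ k) ^ γ) *
        ((S j k).indicator 1 x + ballAvg (2 * 2 ^ k) ((S j k).indicator 1) x)) ^ s * h x :=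
      fun j k => ((((h1S j k).add (measurable_ballAvg (h1S j k) _)).const_mul _).pow_const s).mul hh
    calc _ ≤ ∫⁻ x, dyadicConst n γ ^ s * ∑' j, ∑' k : ℤ, (ENNReal.ofReal (((2 : ℝ) ^ k) ^ γ) *
        ((S j k).indicator 1 x + ballAvg (2 * 2 ^ k) ((S j k).indicator 1) x)) ^ s * h x := by
          refine lintegral_mono fun x => ?_
          have h3 := ENNReal.rpow_le_rpow (levelIntegral_le_tsum (γ := γ) S hSm hpts x) hs0.le
          rw [ENNReal.mul_rpow_of_nonneg _ _ hs0.le] at h3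
          simp_rw [ENNReal.tsum_mul_right]
          rw [← mul_assoc]
          refine mul_le_mul_left (h3.trans ?_) _
          gcongr
          refine (rpow_tsum_le hs0 hs1 _).trans (ENNReal.tsum_le_tsum fun j => ?_)
          exact rpow_tsum_le hs0 hs1 _
      _ = dyadicConst n γ ^ s * ∑' j, ∑' k : ℤ, ∫⁻ x, (ENNReal.ofReal (((2 : ℝ) ^ k) ^ γ) *
        ((S j k).indicator 1 x + ballAvg (2 * 2 ^ k) ((S j k).indicator 1) x)) ^ s * h x := by
          rw [lintegral_const_mul' _ _ hDt,
            lintegral_tsum fun j => (Measurable.tsum fun k => hQm j k).aemeasurable]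
          congr 1
          exact tsum_congr fun j => lintegral_tsum fun k => (hQm j k).aemeasurable
      _ ≤ _ := by
          gcongr with j
          rw [← (Equiv.addRight ((j : ℤ) - 1)).tsum_eq]
          exact hsum j
  have hlp : ENNReal.ofReal l ^ p ≠ 0 := by
    rw [ENNReal.ofReal_rpow_of_nonneg hl.le hp0.le, ne_eq, ENNReal.ofReal_eq_zero, not_le]
    positivity
  have hlpt : ENNReal.ofReal l ^ p ≠ ∞ := ENNReal.rpow_ne_top_of_nonneg hp0.le ENNReal.ofReal_ne_top
  calc _ ≤ ENNReal.ofReal l ^ p * (dyadicConst n γ ^ s *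
        ∑' j, (ENNReal.ofReal l ^ p)⁻¹ * (Z j * (coverConst n a * I))) := by gcongr
    _ = (ENNReal.ofReal l ^ p * (ENNReal.ofReal l ^ p)⁻¹) *
        (dyadicConst n γ ^ s * (∑' j, Z j) * coverConst n a * I) := by
        rw [ENNReal.tsum_mul_left, ENNReal.tsum_mul_right]; ring
    _ = dyadicConst n γ ^ s * (∑' j, Z j) * coverConst n a * I := by
        rw [ENNReal.mul_inv_cancel hlp hlpt, one_mul]
    _ ≤ _ := by
        refine mul_le_mul_right (lintegral_mono fun x => mul_le_mul_right ?_ _) _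
        exact maximal_add_le hh x

/-- The case `γ > 0` and `n (1/p - 1/q) < 1`. -/
lemma weightedBound_of_pos {p q γ : ℝ} (hp : 1 ≤ p) (hq : 0 < q) (hγ : 0 < γ)
    (hn : (n : ℝ) * (1 / p - 1 / q) < 1) : WeightedBound n p q γ := by
  rcases le_total p q with hpq | hqp
  · exact weightedBound_of_le hp hpq hγ hn
  · exact (weightedBound_of_le hp le_rfl (by positivity) (by simp)).of_le hγ.ne' hq hqp

end DyadicBound

/-! ### The one-dimensional bound for `γ < -1` -/

section Line

/-- The real line, as the one-dimensional Euclidean space. -/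
def lineEquiv : ℝ ≃ₗᵢ[ℝ] Rn 1 := (OrthonormalBasis.singleton (Fin 1) ℝ).repr

lemma measurePreserving_lineEquiv : MeasurePreserving lineEquiv volume volume :=
  lineEquiv.measurePreserving

/-- On the line, `|f(x) - f(y)|` is at most the integral of `|f'|` over the interval between `x`
and `y`, that is, over the ball with this diameter. -/
lemma HasContGradient.enorm_sub_le_lintegral_ball {f : Rn 1 → ℝ} {K : Rn 1 → Rn 1}
    (h : HasContGradient f K) {x y : Rn 1} (hxy : x ≠ y) :
    ‖f x - f y‖ₑ ≤ ∫⁻ z in Metric.ball (midpoint ℝ x y) (‖x - y‖ / 2), ‖K z‖ₑ := by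
  set a := lineEquiv.symm x with ha
  set b := lineEquiv.symm y with hb
  have hx : lineEquiv a = x := lineEquiv.apply_symm_apply x
  have hy : lineEquiv b = y := lineEquiv.apply_symm_apply y
  have hab : a - b ≠ 0 := sub_ne_zero.2 fun h => hxy (lineEquiv.symm.injective h)
  have hline : ∀ t : ℝ, y + t • (x - y) = lineEquiv (b + t * (a - b)) := by
    intro t
    rw [map_add, ← smul_eq_mul, map_smul, map_sub, hx, hy]
  have hnorm : ‖x - y‖ₑ = ENNReal.ofReal |a - b| := by
    rw [← hx, ← hy, ← map_sub, ← ofReal_norm, lineEquiv.norm_map, Real.norm_eq_abs]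
  set F : ℝ → ℝ≥0∞ := fun s => ‖K (lineEquiv s)‖ₑ with hF
  have hmp := measurePreserving_lineEquiv
  have himg := lintegral_image_eq_lintegral_abs_deriv_mul (s := Ioo (0 : ℝ) 1)
    (f := fun t : ℝ => b + t * (a - b)) (f' := fun _ => a - b) measurableSet_Ioo
    (fun t _ => by
      simpa using (((hasDerivAt_id t).mul_const (a - b)).const_add b).hasDerivWithinAt)
    (fun s _ t _ hst => mul_right_cancel₀ hab (add_left_cancel hst)) F
  calc ‖f x - f y‖ₑ ≤ ∫⁻ t in Ioo (0 : ℝ) 1, ENNReal.ofReal |a - b| * F (b + t * (a - b)) := by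
        refine (h.enorm_sub_le y x).trans (le_of_eq (lintegral_congr fun t => ?_))
        rw [hline, hnorm, mul_comm]
    _ = ∫⁻ s in (fun t : ℝ => b + t * (a - b)) '' Ioo (0 : ℝ) 1, F s := himg.symm
    _ ≤ ∫⁻ s in lineEquiv ⁻¹' Metric.ball (midpoint ℝ x y) (‖x - y‖ / 2), F s := by
        refine lintegral_mono_set ?_
        rintro _ ⟨t, ht, rfl⟩
        rw [mem_preimage, ← hline, mem_ball_iff_norm]
        have e : y + t • (x - y) - midpoint ℝ x y = (t - 1 / 2) • (x - y) := by
          rw [midpoint_eq_smul_add, invOf_eq_inv]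
          module
        rw [e, norm_smul, Real.norm_eq_abs]
        have hr : 0 < ‖x - y‖ := norm_pos_iff.2 (sub_ne_zero.2 hxy)
        have : |t - 1 / 2| < 1 / 2 := abs_lt.2 ⟨by linarith [ht.1], by linarith [ht.2]⟩
        nlinarith
    _ = _ := hmp.setLIntegral_comp_preimage measurableSet_ball h.continuous_grad.enorm.measurable

lemma volume_ball_rn_one (c : Rn 1) {R : ℝ} (hR : 0 < R) :
    volume (Metric.ball c R) = ENNReal.ofReal (2 * R) := by
  have h1 : volume (Metric.ball (0 : Rn 1) 1) = 2 := by
    rw [← measurePreserving_lineEquiv.measure_preimage measurableSet_ball.nullMeasurableSet]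
    have : lineEquiv ⁻¹' Metric.ball (0 : Rn 1) 1 = Metric.ball (0 : ℝ) 1 := by
      ext s; simp
    rw [this, Real.volume_ball]; norm_num
  rw [volume_ball_scale c hR, h1, Nat.cast_one, Real.rpow_one, mul_comm 2 R,
    ENNReal.ofReal_mul hR.le]
  simp

/-- The integral of `h` against `(max(R, |x - m|) / 2)^γ`: the part with `|x - m| ≤ R` is an average
of `h` over a ball, the other one an integral of `h` against a kernel with cutoff, for the exponent
`γ + 1 < 0`. -/
lemma lintegral_max_rpow_le {γ : ℝ} (hγ : γ < -1) {m z : Rn 1} {R : ℝ} (hR : 0 < R)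
    (hz : z ∈ Metric.ball m R) {h : Rn 1 → ℝ≥0∞} (hh : Measurable h) :
    ∫⁻ x, ENNReal.ofReal ((max R ‖x - m‖ / 2) ^ γ) * h x ≤
      ENNReal.ofReal ((1 / 2) ^ γ) * (4 + 2 * kernelConst 1 (γ + 1)) *
        ENNReal.ofReal (R ^ (γ + 1)) * maximal h z := by
  have hγ1 : γ + 1 < 0 := by linarith
  have hT : 0 < 2 * R ^ (γ + 1) := by positivity
  have hy : ∀ R' : ℝ, 0 < R' → R' ^ (γ + 1) ≤ R ^ (γ + 1) → z ∈ Metric.ball m R' := by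
    intro R' hR' hle
    refine Metric.ball_subset_ball ?_ hz
    by_contra! hlt
    exact absurd hle (not_le.2 (Real.rpow_lt_rpow_of_neg hR' hlt hγ1))
  have hfar := lintegral_kernel_le_maximal (n := 1) hγ1.ne (by positivity : 0 < R ^ (γ + 1)) hh hy
  have hnear := setLIntegral_ball_le_maximal h (by positivity : 0 < 2 * R)
    (Metric.ball_subset_ball (by linarith) hz : z ∈ Metric.ball m (2 * R))
  rw [volume_ball_rn_one m (by positivity)] at hnear
  set far : Rn 1 → ℝ≥0∞ := ({x : Rn 1 | x ≠ m ∧ ‖x - m‖ ^ (γ + 1) < R ^ (γ + 1)}).indicator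
      (fun x => ENNReal.ofReal (‖x - m‖ ^ (γ + 1 - (1 : ℕ))) * h x) with hfardef
  have hpt : ∀ x, ENNReal.ofReal ((max R ‖x - m‖ / 2) ^ γ) * h x ≤
      ENNReal.ofReal ((1 / 2) ^ γ) * (ENNReal.ofReal (R ^ γ) *
        (Metric.ball m (2 * R)).indicator h x + far x) := by
    intro x
    have hmax : 0 < max R ‖x - m‖ := lt_max_of_lt_left hR
    rw [div_eq_mul_one_div, Real.mul_rpow hmax.le (by norm_num), mul_comm,
      ENNReal.ofReal_mul (by positivity)]
    rw [mul_comm _ (ENNReal.ofReal ((1 / 2) ^ γ)), ← mul_assoc, mul_comm (h x), mul_assoc]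
    gcongr
    rcases le_or_gt ‖x - m‖ R with hle | hlt
    · rw [max_eq_left hle, indicator_of_mem, mul_comm (h x)]
      · exact le_self_add
      · rw [mem_ball_iff_norm]; linarith
    · have hx0 : 0 < ‖x - m‖ := hR.trans hlt
      have hmem : x ∈ {x : Rn 1 | x ≠ m ∧ ‖x - m‖ ^ (γ + 1) < R ^ (γ + 1)} :=
        ⟨sub_ne_zero.1 (norm_pos_iff.1 hx0), Real.rpow_lt_rpow_of_neg hR hlt hγ1⟩
      rw [max_eq_right hlt.le, hfardef, indicator_of_mem hmem]
      simp only [Nat.cast_one, add_sub_cancel_right]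
      rw [mul_comm (h x)]
      exact le_add_self
  have hfarm : Measurable ((Metric.ball m (2 * R)).indicator h) := hh.indicator measurableSet_ball
  calc _ ≤ ∫⁻ x, ENNReal.ofReal ((1 / 2) ^ γ) * (ENNReal.ofReal (R ^ γ) *
        (Metric.ball m (2 * R)).indicator h x + far x) := lintegral_mono hpt
    _ = ENNReal.ofReal ((1 / 2) ^ γ) * (ENNReal.ofReal (R ^ γ) *
        (∫⁻ x in Metric.ball m (2 * R), h x) + ∫⁻ x, far x) := by
        rw [lintegral_const_mul' _ _ ENNReal.ofReal_ne_top, lintegral_add_left (hfarm.const_mul _),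
          lintegral_const_mul _ hfarm, lintegral_indicator measurableSet_ball]
    _ ≤ ENNReal.ofReal ((1 / 2) ^ γ) * (ENNReal.ofReal (R ^ γ) *
        (ENNReal.ofReal (2 * (2 * R)) * maximal h z) +
          kernelConst 1 (γ + 1) * ENNReal.ofReal (R ^ (γ + 1)) * maximal h z) := by gcongr
    _ = ENNReal.ofReal ((1 / 2) ^ γ) * (4 + kernelConst 1 (γ + 1)) *
        ENNReal.ofReal (R ^ (γ + 1)) * maximal h z := by
        have e : ENNReal.ofReal (R ^ γ) * ENNReal.ofReal (2 * (2 * R)) =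
            4 * ENNReal.ofReal (R ^ (γ + 1)) := by
          rw [← ENNReal.ofReal_mul (by positivity), Real.rpow_add_one hR.ne']
          have : R ^ γ * (2 * (2 * R)) = 4 * (R ^ γ * R) := by ring
          rw [this, ENNReal.ofReal_mul (by norm_num)]
          norm_num
        rw [← mul_assoc, e]
        ring
    _ ≤ _ := by
        gcongr
        exact le_mul_of_one_le_left' one_le_two

/-- For a pair of the level set at distance `r`, the interval between the two points carries at least
the mass `l^p r^{γ+1}` of `|f'|^p`. -/
lemma HasContGradient.ofReal_le_lintegral_ball {f : Rn 1 → ℝ} {K : Rn 1 → Rn 1}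
    (hfK : HasContGradient f K) {p γ l : ℝ} (hp : 1 ≤ p) (hl : 0 < l) {z : Rn 1 × Rn 1}
    (hz : z ∈ levelSet l (γ / p) f) :
    ENNReal.ofReal (l ^ p * ‖z.1 - z.2‖ ^ (γ + 1)) ≤
      ∫⁻ x in Metric.ball (midpoint ℝ z.1 z.2) (‖z.1 - z.2‖ / 2), ‖K x‖ₑ ^ p := by
  have hp0 : 0 < p := by linarith
  obtain ⟨x, y⟩ := z
  simp only
  have hr : 0 < ‖x - y‖ := norm_pos_iff.2 (sub_ne_zero.2 hz.1)
  have hr2 : 0 < ‖x - y‖ / 2 := half_pos hr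
  have hgm : Measurable fun x => ‖K x‖ₑ := hfK.continuous_grad.enorm.measurable
  have hvol : volume (Metric.ball (midpoint ℝ x y) (‖x - y‖ / 2)) = ENNReal.ofReal ‖x - y‖ := by
    rw [volume_ball_rn_one _ hr2, mul_div_cancel₀ _ two_ne_zero]
  have hv0 : ENNReal.ofReal ‖x - y‖ ≠ 0 := by simpa using hr
  have hvt : ENNReal.ofReal ‖x - y‖ ≠ ∞ := ENNReal.ofReal_ne_top
  have h1 : ENNReal.ofReal (l * ‖x - y‖ ^ (γ / p)) ≤
      ballAvg (‖x - y‖ / 2) (fun x => ‖K x‖ₑ) (midpoint ℝ x y) := by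
    rw [ballAvg, hvol, ENNReal.le_div_iff_mul_le (Or.inl hv0) (Or.inl hvt)]
    refine le_trans (le_of_eq ?_) ((ofReal_lt_enorm_of_mem_levelSet hl hz).le.trans
      (hfK.enorm_sub_le_lintegral_ball hz.1))
    rw [← ENNReal.ofReal_mul (by positivity)]
    congr 1; ring
  have h2 := (ENNReal.rpow_le_rpow h1 hp0.le).trans
    (rpow_ballAvg_le (g := fun x => ‖K x‖ₑ) hp hgm hr2 (midpoint ℝ x y))
  rw [ballAvg, hvol, ENNReal.le_div_iff_mul_le (Or.inl hv0) (Or.inl hvt)] at h2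
  refine le_trans (le_of_eq ?_) h2
  rw [ENNReal.ofReal_rpow_of_nonneg (by positivity) hp0.le,
    ← ENNReal.ofReal_mul (by positivity), Real.mul_rpow hl.le (by positivity),
    ← Real.rpow_mul hr.le, div_mul_cancel₀ _ hp0.ne', Real.rpow_add_one hr.ne']
  congr 1; ring

set_option maxHeartbeats 600000 in
/-- The weighted bound on the line for `γ < -1`. The intervals spanned by the pairs of the level set
have lengths bounded from below. A disjoint subfamily, chosen with the shortest lengths first, meets
each of them in an interval of at most twice its length; therefore the distance of a pair is at least
a multiple of the length of some selected interval and of the distance of `x` from its centre. -/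
lemma weightedBound_line_self {p γ : ℝ} (hp : 1 ≤ p) (hγ : γ < -1) : WeightedBound 1 p p γ := by
  have hp0 : 0 < p := by linarith
  have hγ0 : γ ≠ 0 := by linarith
  have hγ1 : γ + 1 < 0 := by linarith
  set C0 : ℝ≥0∞ := ENNReal.ofReal ((1 / 2) ^ γ) * (4 + 2 * kernelConst 1 (γ + 1)) *
    ENNReal.ofReal ((1 / 2) ^ (γ + 1)) with hC0
  set C1 := kernelConst 1 γ * 2 * C0 with hC1
  refine ⟨C1, ?_, ?_⟩
  · refine ENNReal.mul_ne_top (ENNReal.mul_ne_top (kernelConst_ne_top 1 γ) ENNReal.ofNat_ne_top)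
      (ENNReal.mul_ne_top (ENNReal.mul_ne_top ENNReal.ofReal_ne_top (ENNReal.add_ne_top.2
      ⟨ENNReal.ofNat_ne_top, ENNReal.mul_ne_top ENNReal.ofNat_ne_top (kernelConst_ne_top 1 _)⟩))
      ENNReal.ofReal_ne_top)
  intro f K hfK hufin l hl h hh
  rw [div_self hp0.ne']
  simp only [ENNReal.rpow_one]
  set u : Rn 1 → ℝ≥0∞ := fun x => ‖K x‖ₑ ^ p with hu
  have hgm : Measurable fun x => ‖K x‖ₑ := hfK.continuous_grad.enorm.measurable
  have hum : Measurable u := hgm.pow_const p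
  set E := levelSet l (γ / p) f with hE
  set B : Rn 1 × Rn 1 → Set (Rn 1) := fun z => Metric.ball (midpoint ℝ z.1 z.2) (‖z.1 - z.2‖ / 2)
    with hB
  have hrpos : ∀ z ∈ E, 0 < ‖z.1 - z.2‖ := fun z hz => norm_pos_iff.2 (sub_ne_zero.2 hz.1)
  have hmass : ∀ z ∈ E, ENNReal.ofReal (l ^ p * ‖z.1 - z.2‖ ^ (γ + 1)) ≤ ∫⁻ x in B z, u x :=
    fun z hz => hfK.ofReal_le_lintegral_ball hp hl hz
  -- the distances of the pairs are bounded from below because `u` is integrable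
  obtain ⟨R, hR⟩ : ∃ R : ℝ, ∀ z ∈ E, ‖z.1 - z.2‖⁻¹ ≤ R := by
    refine ⟨((∫⁻ x, u x).toReal / l ^ p) ^ (1 / -(γ + 1)), fun z hz => ?_⟩
    have hr := hrpos z hz
    have h1 := ENNReal.toReal_mono hufin.ne ((hmass z hz).trans (setLIntegral_le_lintegral _ _))
    rw [ENNReal.toReal_ofReal (by positivity)] at h1
    have h2 : ‖z.1 - z.2‖ ^ (γ + 1) ≤ (∫⁻ x, u x).toReal / l ^ p := by
      rw [le_div_iff₀ (by positivity), mul_comm]; exact h1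
    calc ‖z.1 - z.2‖⁻¹ = (‖z.1 - z.2‖ ^ (γ + 1)) ^ (1 / -(γ + 1)) := by
          rw [← Real.rpow_mul hr.le, one_div, inv_neg, mul_neg, mul_inv_cancel₀ hγ1.ne,
            Real.rpow_neg_one]
      _ ≤ _ := Real.rpow_le_rpow (by positivity) h2 (one_div_nonneg.2 (by linarith))
  obtain ⟨s, hsE, hdisj, hcov⟩ := Vitali.exists_disjoint_subfamily_covering_enlargement B E
    (fun z => ‖z.1 - z.2‖⁻¹) 2 one_lt_two (fun z hz => by positivity) R hR
    (fun z hz => ⟨_, Metric.mem_ball_self (half_pos (hrpos z hz))⟩)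
  have hscount : s.Countable := hdisj.countable_of_isOpen (fun z _ => Metric.isOpen_ball)
    fun z hz => ⟨_, Metric.mem_ball_self (half_pos (hrpos z (hsE hz)))⟩
  have : Countable s := hscount.to_subtype
  set M : s → Rn 1 := fun b => midpoint ℝ b.1.1 b.1.2 with hM
  set D : s → ℝ := fun b => ‖b.1.1 - b.1.2‖ / 2 with hD
  have hD0 : ∀ b : s, 0 < D b := fun b => half_pos (hrpos _ (hsE b.2))
  set κ : s → Rn 1 → ℝ := fun b x => max (D b) ‖x - M b‖ / 2 with hκ
  have hκ0 : ∀ b x, 0 < κ b x := fun b x => half_pos (lt_max_of_lt_left (hD0 b))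
  have hκm : ∀ b, Measurable fun x => ENNReal.ofReal (κ b x ^ γ) := fun b => by
    simp only [hκ]; fun_prop
  -- the distance of every pair of the level set is at least `κ b x` for a selected interval `b`; the
  -- factor `2` makes the inequality strict
  have hfar : ∀ x y, (x, y) ∈ E → ∃ b : s, ‖y - x‖ ^ γ < 2 * κ b x ^ γ := by
    intro x y hxy
    have hr : 0 < ‖x - y‖ := hrpos (x, y) hxy
    obtain ⟨b, hbs, ⟨w, hw1, hw2⟩, hle⟩ := hcov (x, y) hxy
    have hrb := hrpos b (hsE hbs)
    simp only at hle
    have hle' : ‖b.1 - b.2‖ ≤ 2 * ‖x - y‖ := by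
      rw [inv_eq_one_div, inv_eq_one_div, ← mul_div_assoc, mul_one, div_le_div_iff₀ hr hrb] at hle
      linarith
    refine ⟨⟨b, hbs⟩, ?_⟩
    have hκr : κ ⟨b, hbs⟩ x ≤ ‖x - y‖ := by
      simp only [hκ, hD, hM]
      rw [div_le_iff₀ two_pos]
      refine max_le (by linarith) ?_
      simp only [hB, Metric.mem_ball] at hw1 hw2
      rw [← dist_eq_norm]
      calc dist x (midpoint ℝ b.1 b.2) ≤ dist x (midpoint ℝ x y) + dist (midpoint ℝ x y) w +
            dist w (midpoint ℝ b.1 b.2) := dist_triangle4 _ _ _ _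
        _ ≤ ‖x - y‖ / 2 + ‖x - y‖ / 2 + ‖b.1 - b.2‖ / 2 := by
            refine add_le_add (add_le_add ?_ ?_) hw2.le
            · rw [dist_left_midpoint, dist_eq_norm, Real.norm_of_nonneg (by norm_num)]
              linarith
            · rw [dist_comm]; exact hw1.le
        _ ≤ _ := by linarith
    have h1 := Real.rpow_le_rpow_of_nonpos (hκ0 ⟨b, hbs⟩ x) hκr (by linarith : γ ≤ 0)
    have h2 : 0 < κ ⟨b, hbs⟩ x ^ γ := Real.rpow_pos_of_pos (hκ0 _ _) _
    rw [norm_sub_rev]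
    linarith
  have hV : ∀ x, levelIntegral l (γ / p) γ f x ≤
      ∑' b : s, kernelConst 1 γ * 2 * ENNReal.ofReal (κ b x ^ γ) := by
    intro x
    have hkm : Measurable fun y : Rn 1 => ENNReal.ofReal (‖y - x‖ ^ (γ - (1 : ℕ))) := by fun_prop
    have hSm : ∀ T : ℝ, MeasurableSet {y : Rn 1 | y ≠ x ∧ ‖y - x‖ ^ γ < T} := fun T =>
      (measurableSet_singleton x).compl.inter
        (measurableSet_lt (f := fun y : Rn 1 => ‖y - x‖ ^ γ) (by fun_prop) measurable_const)
    calc _ ≤ ∫⁻ y, ∑' b : s, ({y : Rn 1 | y ≠ x ∧ ‖y - x‖ ^ γ < 2 * κ b x ^ γ}).indicator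
          (fun y => ENNReal.ofReal (‖y - x‖ ^ (γ - (1 : ℕ)))) y := by
          refine lintegral_mono fun y => ?_
          by_cases hxy : (x, y) ∈ E
          · obtain ⟨b, hb⟩ := hfar x y hxy
            rw [indicator_of_mem hxy]
            refine le_trans ?_ (ENNReal.le_tsum b)
            rw [indicator_of_mem (show y ∈ {y : Rn 1 | y ≠ x ∧ ‖y - x‖ ^ γ < 2 * κ b x ^ γ} from
              ⟨hxy.1.symm, hb⟩), norm_sub_rev]
          · rw [indicator_of_notMem hxy]; exact bot_le
      _ = ∑' b : s, ∫⁻ y, ({y : Rn 1 | y ≠ x ∧ ‖y - x‖ ^ γ < 2 * κ b x ^ γ}).indicator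
          (fun y => ENNReal.ofReal (‖y - x‖ ^ (γ - (1 : ℕ)))) y :=
          lintegral_tsum fun b => (hkm.indicator (hSm _)).aemeasurable
      _ ≤ _ := by
          refine ENNReal.tsum_le_tsum fun b => ?_
          have h2 : 0 < κ b x ^ γ := Real.rpow_pos_of_pos (hκ0 _ _) _
          refine (lintegral_kernel_le_const hγ0 (by positivity) x).trans (le_of_eq ?_)
          rw [ENNReal.ofReal_mul zero_le_two, ENNReal.ofReal_ofNat, mul_assoc]
  have hlp : (0 : ℝ) < l ^ p := by positivity
  have hterm : ∀ b : s, ENNReal.ofReal l ^ p * ∫⁻ x, ENNReal.ofReal (κ b x ^ γ) * h x ≤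
      C0 * ∫⁻ x in B b, u x * maximal h x := by
    intro b
    set i := ⨅ y ∈ B b, maximal h y with hi
    have hC0t : C0 * ENNReal.ofReal (‖b.1.1 - b.1.2‖ ^ (γ + 1)) ≠ ∞ :=
      ENNReal.mul_ne_top (ENNReal.mul_ne_top (ENNReal.mul_ne_top ENNReal.ofReal_ne_top
        (ENNReal.add_ne_top.2 ⟨ENNReal.ofNat_ne_top,
          ENNReal.mul_ne_top ENNReal.ofNat_ne_top (kernelConst_ne_top 1 _)⟩))
        ENNReal.ofReal_ne_top) ENNReal.ofReal_ne_top
    have hr := hrpos _ (hsE b.2)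
    have hC00 : C0 * ENNReal.ofReal (‖b.1.1 - b.1.2‖ ^ (γ + 1)) ≠ 0 := by
      refine mul_ne_zero (mul_ne_zero (mul_ne_zero ?_ ?_) ?_) ?_
      · rw [ne_eq, ENNReal.ofReal_eq_zero, not_le]; positivity
      · simp
      · rw [ne_eq, ENNReal.ofReal_eq_zero, not_le]; positivity
      · rw [ne_eq, ENNReal.ofReal_eq_zero, not_le]; positivity
    have h3 : ∫⁻ x, ENNReal.ofReal (κ b x ^ γ) * h x ≤
        C0 * ENNReal.ofReal (‖b.1.1 - b.1.2‖ ^ (γ + 1)) * i := by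
      rw [mul_comm _ i, ← ENNReal.div_le_iff hC00 hC0t]
      refine le_iInf₂ fun z hz => ?_
      rw [ENNReal.div_le_iff hC00 hC0t, mul_comm (maximal h z)]
      refine (lintegral_max_rpow_le hγ (hD0 b) hz hh).trans (le_of_eq ?_)
      have e : D b ^ (γ + 1) = (1 / 2) ^ (γ + 1) * ‖b.1.1 - b.1.2‖ ^ (γ + 1) := by
        rw [← Real.mul_rpow (by norm_num) hr.le]
        congr 1
        simp only [hD]; ring
      rw [e, ENNReal.ofReal_mul (by positivity), hC0]
      ring
    calc _ ≤ ENNReal.ofReal l ^ p * (C0 * ENNReal.ofReal (‖b.1.1 - b.1.2‖ ^ (γ + 1)) * i) := by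
          gcongr
      _ = C0 * ENNReal.ofReal (l ^ p * ‖b.1.1 - b.1.2‖ ^ (γ + 1)) * i := by
          rw [ENNReal.ofReal_mul hlp.le, ENNReal.ofReal_rpow_of_nonneg hl.le hp0.le]; ring
      _ ≤ C0 * (∫⁻ x in B b, u x) * i := by
          gcongr
          exact hmass b.1 (hsE b.2)
      _ = C0 * ∫⁻ x in B b, u x * i := by rw [mul_assoc, lintegral_mul_const _ hum]
      _ ≤ _ := by
          refine mul_le_mul_right (setLIntegral_mono (hum.mul (measurable_maximal h))
            fun x hx => mul_le_mul_right ?_ _) _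
          exact iInf₂_le x hx
  calc _ ≤ ENNReal.ofReal l ^ p * ∫⁻ x, ∑' b : s, kernelConst 1 γ * 2 *
        (ENNReal.ofReal (κ b x ^ γ) * h x) := by
        gcongr with x
        refine (mul_le_mul_left (hV x) (h x)).trans (le_of_eq ?_)
        rw [← ENNReal.tsum_mul_right]
        exact tsum_congr fun b => by ring
    _ = kernelConst 1 γ * 2 * ∑' b : s, ENNReal.ofReal l ^ p *
        ∫⁻ x, ENNReal.ofReal (κ b x ^ γ) * h x := by
        have hm : ∀ b : s, Measurable fun x => ENNReal.ofReal (κ b x ^ γ) * h x := fun b =>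
          (hκm b).mul hh
        rw [lintegral_tsum fun b => ((hm b).const_mul _).aemeasurable,
          ← ENNReal.tsum_mul_left, ← ENNReal.tsum_mul_left]
        refine tsum_congr fun b => ?_
        rw [lintegral_const_mul _ (hm b)]
        ring
    _ ≤ kernelConst 1 γ * 2 * ∑' b : s, C0 * ∫⁻ x in B b, u x * maximal h x := by
        exact mul_le_mul_right (ENNReal.tsum_le_tsum hterm) _
    _ = C1 * ∑' b : s, ∫⁻ x in B b, u x * maximal h x := by
        rw [ENNReal.tsum_mul_left, hC1]; ring
    _ ≤ C1 * ∫⁻ x, u x * maximal h x := by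
        gcongr
        rw [← lintegral_iUnion (fun b : s => measurableSet_ball)
          (fun b b' hbb' => hdisj b.property b'.property fun h => hbb' (Subtype.ext h))]
        exact setLIntegral_le_lintegral _ _
    _ ≤ _ := by
        gcongr with x
        exact le_self_add

/-- The case `n = 1`, `γ < -1` and `q ≤ p`. -/
lemma weightedBound_line {p q γ : ℝ} (hp : 1 ≤ p) (hq : 0 < q) (hqp : q ≤ p) (hγ : γ < -1) :
    WeightedBound 1 p q γ := by
  refine (weightedBound_line_self hp ?_).of_le (by linarith) hq hqp
  have := (one_le_div hq).2 hqp
  nlinarith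

end Line

/-! ### Distributions with a locally integrable gradient are functions -/

section Superposition

variable {n : ℕ} {W : Type*} [MeasurableSpace W] {μ : Measure W}

/-- The superposition `∫ c(w) φ(x - Z(w)) dμ(w)` of translates of `φ`. -/
def superpose {F : Type*} [NormedAddCommGroup F] [NormedSpace ℝ F] (μ : Measure W) (c : W → ℝ)
    (Z : W → Rn n) (φ : Rn n → F) (x : Rn n) : F :=
  ∫ w, c w • φ (x - Z w) ∂μ

lemma integrable_superpose {F : Type*} [NormedAddCommGroup F] [NormedSpace ℝ F] {c : W → ℝ}
    {Z : W → Rn n} (hc : Integrable c μ) (hZ : Measurable Z) {φ : Rn n → F} (hφ : Continuous φ)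
    (hs : HasCompactSupport φ) (x : Rn n) : Integrable (fun w => c w • φ (x - Z w)) μ := by
  obtain ⟨C, hC⟩ := hφ.bounded_above_of_compact_support hs
  refine (hc.norm.mul_const C).mono' (hc.1.smul (hφ.comp_aestronglyMeasurable
    (hZ.const_sub x).aestronglyMeasurable)) (Eventually.of_forall fun w => ?_)
  rw [norm_smul]
  gcongr
  exact hC _

lemma hasFDerivAt_superpose {F : Type*} [NormedAddCommGroup F] [NormedSpace ℝ F]
    {c : W → ℝ} {Z : W → Rn n} (hc : Integrable c μ) (hZ : Measurable Z) {φ : Rn n → F}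
    (hφ : ContDiff ℝ 1 φ) (hs : HasCompactSupport φ) (x : Rn n) :
    HasFDerivAt (superpose μ c Z φ) (superpose μ c Z (fderiv ℝ φ) x) x := by
  have hφ' : Continuous (fderiv ℝ φ) := hφ.continuous_fderiv one_ne_zero
  obtain ⟨C, hC⟩ := hφ'.bounded_above_of_compact_support (hs.fderiv ℝ)
  refine hasFDerivAt_integral_of_dominated_of_fderiv_le (s := univ)
    (F' := fun x w => c w • fderiv ℝ φ (x - Z w)) (bound := fun w => ‖c w‖ * C) univ_mem
    (Eventually.of_forall fun y => (integrable_superpose hc hZ hφ.continuous hs y).1)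
    (integrable_superpose hc hZ hφ.continuous hs x)
    (integrable_superpose hc hZ hφ' (hs.fderiv ℝ) x).1
    (Eventually.of_forall fun w y _ => ?_) (hc.norm.mul_const C)
    (Eventually.of_forall fun w y _ => ?_)
  · rw [norm_smul]
    gcongr
    exact hC _
  · have h1 : HasFDerivAt φ (fderiv ℝ φ (y - Z w)) (y - Z w) :=
      (hφ.differentiable one_ne_zero _).hasFDerivAt
    exact ((hasFDerivAt_comp_sub (Z w)).2 h1).const_smul (c w)

lemma contDiff_superpose {c : W → ℝ} {Z : W → Rn n} (hc : Integrable c μ) (hZ : Measurable Z)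
    (m : ℕ) : ∀ (F : Type) [NormedAddCommGroup F] [NormedSpace ℝ F] (φ : Rn n → F),
      ContDiff ℝ ((⊤ : ℕ∞) : WithTop ℕ∞) φ → HasCompactSupport φ →
      ContDiff ℝ m (superpose μ c Z φ) := by
  induction m with
  | zero =>
    intro F _ _ φ hφ hs
    rw [Nat.cast_zero, contDiff_zero, continuous_iff_continuousAt]
    exact fun x => (hasFDerivAt_superpose hc hZ (hφ.of_le (by simp)) hs x).continuousAt
  | succ m ih =>
    intro F _ _ φ hφ hs
    have h := contDiff_succ_iff_hasFDerivAt (𝕜 := ℝ) (n := m) (f := superpose μ c Z φ)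
    rw [Nat.cast_add, Nat.cast_one]
    refine h.2 ⟨superpose μ c Z (fderiv ℝ φ), ?_, ?_⟩
    · exact ih _ _ (hφ.fderiv_right (by simp)) (hs.fderiv ℝ)
    · exact fun x => hasFDerivAt_superpose hc hZ (hφ.of_le (by simp)) hs x

lemma hasCompactSupport_superpose {F : Type*} [NormedAddCommGroup F] [NormedSpace ℝ F]
    {c : W → ℝ} {Z : W → Rn n} {R : ℝ} (hcZ : ∀ᵐ w ∂μ, c w ≠ 0 → ‖Z w‖ ≤ R) {φ : Rn n → F}
    (hs : HasCompactSupport φ) : HasCompactSupport (superpose μ c Z φ) := by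
  obtain ⟨R', hR'⟩ := hs.isCompact.isBounded.subset_closedBall 0
  refine HasCompactSupport.intro (isCompact_closedBall (0 : Rn n) (R + R')) fun x hx => ?_
  refine integral_eq_zero_of_ae ?_
  filter_upwards [hcZ] with w hw
  by_contra hne
  obtain ⟨h1, h2⟩ := smul_ne_zero_iff.1 hne
  have h3 := hR' (subset_tsupport _ h2)
  rw [mem_closedBall_zero_iff] at hx h3
  refine hx ?_
  calc ‖x‖ = ‖Z w + (x - Z w)‖ := by rw [add_sub_cancel]
    _ ≤ ‖Z w‖ + ‖x - Z w‖ := norm_add_le _ _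
    _ ≤ _ := add_le_add (hw h1) h3

lemma integrable_prod_superpose [SFinite μ] {c : W → ℝ} {Z : W → Rn n} {R R' C : ℝ}
    (hc : Integrable c μ) (hZ : Measurable Z) (hcZ : ∀ᵐ w ∂μ, c w ≠ 0 → ‖Z w‖ ≤ R)
    {φ : Rn n → ℝ} (hφ : Measurable φ) (hφC : ∀ x, ‖φ x‖ ≤ C) (hφs : ∀ x, φ x ≠ 0 → ‖x‖ ≤ R')
    {G : Rn n → ℝ} (hG : LocallyIntegrable G volume) :
    Integrable (fun z : W × Rn n => c z.1 * φ (z.2 - Z z.1) * G z.2) (μ.prod volume) := by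
  have hG1 : Integrable ((Metric.closedBall (0 : Rn n) (R + R')).indicator fun x => C * ‖G x‖)
      volume := IntegrableOn.integrable_indicator
        (((hG.integrableOn_isCompact (isCompact_closedBall _ _)).norm).const_mul C)
        measurableSet_closedBall
  have hb := hc.norm.mul_prod hG1
  have hm : AEStronglyMeasurable (fun z : W × Rn n => φ (z.2 - Z z.1)) (μ.prod volume) :=
    (hφ.comp (measurable_snd.sub (hZ.comp measurable_fst))).aestronglyMeasurable
  refine hb.mono' ((hc.1.comp_fst.mul hm).mul hG.aestronglyMeasurable.comp_snd) ?_
  filter_upwards [Measure.quasiMeasurePreserving_fst.ae hcZ] with z hz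
  by_cases h0 : c z.1 * φ (z.2 - Z z.1) = 0
  · have hC0 : 0 ≤ C := (norm_nonneg _).trans (hφC 0)
    rw [h0, zero_mul, norm_zero]
    exact mul_nonneg (norm_nonneg _) (indicator_nonneg (fun x _ => by positivity) _)
  · obtain ⟨h1, h2⟩ := mul_ne_zero_iff.1 h0
    have hmem : z.2 ∈ Metric.closedBall (0 : Rn n) (R + R') := by
      rw [mem_closedBall_zero_iff]
      calc ‖z.2‖ = ‖Z z.1 + (z.2 - Z z.1)‖ := by rw [add_sub_cancel]
        _ ≤ ‖Z z.1‖ + ‖z.2 - Z z.1‖ := norm_add_le _ _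
        _ ≤ _ := add_le_add (hz h1) (hφs _ h2)
    rw [indicator_of_mem hmem, norm_mul, norm_mul, mul_assoc]
    gcongr
    exact hφC _

lemma measurePreserving_shear [SFinite μ] {Z : W → Rn n} (hZ : Measurable Z) :
    MeasurePreserving (fun z : W × Rn n => (z.1, z.2 + Z z.1)) (μ.prod volume) (μ.prod volume) :=
  (MeasurePreserving.id μ).skew_product (g := fun w y => y + Z w)
    (measurable_snd.add (hZ.comp measurable_fst))
    (Eventually.of_forall fun w => (measurePreserving_add_right volume (Z w)).map_eq)

lemma integrable_prod_superpose_shear [SFinite μ] {c : W → ℝ} {Z : W → Rn n} {R R' C : ℝ}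
    (hc : Integrable c μ) (hZ : Measurable Z) (hcZ : ∀ᵐ w ∂μ, c w ≠ 0 → ‖Z w‖ ≤ R)
    {φ : Rn n → ℝ} (hφ : Measurable φ) (hφC : ∀ x, ‖φ x‖ ≤ C) (hφs : ∀ x, φ x ≠ 0 → ‖x‖ ≤ R')
    {G : Rn n → ℝ} (hG : LocallyIntegrable G volume) :
    Integrable (fun z : W × Rn n => c z.1 * φ z.2 * G (z.2 + Z z.1)) (μ.prod volume) := by
  have := (measurePreserving_shear (μ := μ) hZ).integrable_comp_of_integrable
    (integrable_prod_superpose hc hZ hcZ hφ hφC hφs hG)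
  refine this.congr (Eventually.of_forall fun z => ?_)
  simp

/-- The dual operation to the superposition of translates. -/
lemma locallyIntegrable_superpose_dual [SFinite μ] {c : W → ℝ} {Z : W → Rn n} {R : ℝ}
    (hc : Integrable c μ) (hZ : Measurable Z) (hcZ : ∀ᵐ w ∂μ, c w ≠ 0 → ‖Z w‖ ≤ R)
    {G : Rn n → ℝ} (hG : LocallyIntegrable G volume) :
    LocallyIntegrable (fun y => ∫ w, c w * G (y + Z w) ∂μ) volume := by
  refine (locallyIntegrable_iff).2 fun k hk => ?_
  obtain ⟨R', hR'⟩ := hk.isBounded.subset_closedBall 0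
  refine IntegrableOn.mono_set ?_ hR'
  have h1 := integrable_prod_superpose_shear (R' := R') (C := 1) hc hZ hcZ
    (φ := (Metric.closedBall (0 : Rn n) R').indicator 1)
    (measurable_one.indicator measurableSet_closedBall)
    (fun x => by
      refine (norm_indicator_le_norm_self _ x).trans ?_
      simp) (fun x hx => by
      by_contra h
      exact hx (indicator_of_notMem (by simpa using h) _)) hG
  rw [← integrable_indicator_iff measurableSet_closedBall]
  refine h1.integral_prod_right.congr (Eventually.of_forall fun y => ?_)
  by_cases hy : y ∈ Metric.closedBall (0 : Rn n) R'
  · simp [indicator_of_mem hy]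
  · simp [indicator_of_notMem hy]

/-- Fubini's theorem for the pairing of a superposition of translates of `φ` with `G`, in both orders of
integration. -/
lemma integral_superpose_mul_dual [SFinite μ] {c : W → ℝ} {Z : W → Rn n} {R : ℝ}
    (hc : Integrable c μ) (hZ : Measurable Z) (hcZ : ∀ᵐ w ∂μ, c w ≠ 0 → ‖Z w‖ ≤ R)
    {φ : Rn n → ℝ} (hφ : Continuous φ) (hs : HasCompactSupport φ)
    {G : Rn n → ℝ} (hG : LocallyIntegrable G volume) :
    Integrable (fun y => φ y * ∫ w, c w * G (y + Z w) ∂μ) volume ∧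
    (∫ x, superpose μ c Z φ x * G x = ∫ y, φ y * ∫ w, c w * G (y + Z w) ∂μ) ∧
    ∫ x, superpose μ c Z φ x * G x = ∫ w, c w * ∫ x, φ (x - Z w) * G x ∂volume ∂μ := by
  obtain ⟨C, hC⟩ := hφ.bounded_above_of_compact_support hs
  obtain ⟨R', hR'⟩ := hs.isCompact.isBounded.subset_closedBall 0
  have hφs : ∀ x, φ x ≠ 0 → ‖x‖ ≤ R' := fun x hx =>
    mem_closedBall_zero_iff.1 (hR' (subset_tsupport _ hx))
  have h1 := integrable_prod_superpose hc hZ hcZ hφ.measurable hC hφs hG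
  have h2 := integrable_prod_superpose_shear hc hZ hcZ hφ.measurable hC hφs hG
  have e3 : ∫ x, superpose μ c Z φ x * G x = ∫ w, c w * ∫ x, φ (x - Z w) * G x ∂volume ∂μ := by
    calc ∫ x, superpose μ c Z φ x * G x = ∫ x, ∫ w, c w * φ (x - Z w) * G x ∂μ := by
          refine integral_congr_ae (Eventually.of_forall fun x => ?_)
          simp only [superpose, smul_eq_mul]
          rw [integral_mul_const]
      _ = ∫ w, ∫ x, c w * φ (x - Z w) * G x ∂volume ∂μ :=
          (integral_integral_swap (f := fun w x => c w * φ (x - Z w) * G x) h1).symm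
      _ = _ := by
          refine integral_congr_ae (Eventually.of_forall fun w => ?_)
          simp only [mul_assoc]
          rw [integral_const_mul]
  refine ⟨?_, ?_, e3⟩
  · refine h2.integral_prod_right.congr (Eventually.of_forall fun y => ?_)
    simp only
    rw [← integral_const_mul]
    exact integral_congr_ae (Eventually.of_forall fun w => by simp only; ring)
  · rw [e3]
    calc _ = ∫ w, ∫ y, c w * φ y * G (y + Z w) ∂volume ∂μ := by
          refine integral_congr_ae (Eventually.of_forall fun w => ?_)
          simp only
          rw [← integral_const_mul, ← integral_add_right_eq_self _ (Z w)]
          refine integral_congr_ae (Eventually.of_forall fun y => ?_)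
          simp only [add_sub_cancel_right]
          ring
      _ = ∫ y, ∫ w, c w * φ y * G (y + Z w) ∂μ :=
          integral_integral_swap (f := fun w y => c w * φ y * G (y + Z w)) h2
      _ = _ := by
          refine integral_congr_ae (Eventually.of_forall fun y => ?_)
          simp only
          rw [← integral_const_mul]
          exact integral_congr_ae (Eventually.of_forall fun w => by simp only; ring)

end Superposition

section Divergence

variable {n : ℕ}

/-- The measure `ds dh` for `0 < s < 1` and `h ∈ ℝⁿ`. -/
def segMeasure (n : ℕ) : Measure (ℝ × Rn n) := (volume.restrict (Ioo (0 : ℝ) 1)).prod volume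

instance : SFinite (segMeasure n) := by unfold segMeasure; infer_instance

lemma measurable_seg : Measurable fun w : ℝ × Rn n => w.1 • w.2 := by fun_prop

lemma integrable_segMeasure {b : Rn n → ℝ} (hb : Integrable b volume) :
    Integrable (fun w : ℝ × Rn n => b w.2) (segMeasure n) := by
  have := (integrable_const (1 : ℝ) (μ := volume.restrict (Ioo (0 : ℝ) 1))).mul_prod hb
  simpa [segMeasure] using this

lemma ae_segMeasure_norm_le {b : Rn n → ℝ} {R : ℝ} (hb : ∀ h, b h ≠ 0 → ‖h‖ ≤ R) :
    ∀ᵐ w ∂(segMeasure n), b w.2 ≠ 0 → ‖w.1 • w.2‖ ≤ R := by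
  have h1 : ∀ᵐ w ∂(segMeasure n), w.1 ∈ Ioo (0 : ℝ) 1 :=
    Measure.quasiMeasurePreserving_fst.ae (ae_restrict_mem measurableSet_Ioo)
  filter_upwards [h1] with w hw hne
  have h2 := hb _ hne
  have h3 := norm_nonneg w.2
  rw [norm_smul, Real.norm_of_nonneg hw.1.le]
  nlinarith [hw.1, hw.2]

lemma exists_norm_le_of_hasCompactSupport {a : Rn n → ℝ} (hs : HasCompactSupport a) :
    ∃ R, ∀ h, a h ≠ 0 → ‖h‖ ≤ R := by
  obtain ⟨R, hR⟩ := hs.isCompact.isBounded.subset_closedBall 0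
  exact ⟨R, fun h hh => mem_closedBall_zero_iff.1 (hR (subset_tsupport _ hh))⟩

lemma integrable_mul_coord {a : Rn n → ℝ} (ha : Continuous a) (hs : HasCompactSupport a)
    (i : Fin n) : Integrable (fun h : Rn n => a h * h i) volume := by
  refine Continuous.integrable_of_hasCompactSupport (ha.mul (by fun_prop)) ?_
  exact hs.mul_right

lemma sum_single_apply (L : Rn n →L[ℝ] ℝ) (h : Rn n) :
    ∑ i, h i * L (EuclideanSpace.single i 1) = L h := by
  conv_rhs => rw [← (EuclideanSpace.basisFun (Fin n) ℝ).sum_repr h]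
  simp

/-- The function `(∫ a) φ - a * φ` is the divergence of a superposition of translates of `φ`, by the
fundamental theorem of calculus along the segments from `x - h` to `x`. -/
lemma sum_superpose_fderiv {a : Rn n → ℝ} (ha : Continuous a) (has : HasCompactSupport a)
    {φ : Rn n → ℝ} (hφ : ContDiff ℝ 1 φ) (hs : HasCompactSupport φ) (x : Rn n) :
    ∑ i, superpose (segMeasure n) (fun w => a w.2 * w.2 i) (fun w => w.1 • w.2) (fderiv ℝ φ) x
        (EuclideanSpace.single i 1) = (∫ h, a h) * φ x - ∫ h, a h * φ (x - h) := by
  have hφ' : Continuous (fderiv ℝ φ) := hφ.continuous_fderiv one_ne_zero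
  have hint : ∀ i, Integrable (fun w : ℝ × Rn n =>
      (a w.2 * w.2 i) • fderiv ℝ φ (x - w.1 • w.2)) (segMeasure n) := fun i =>
    integrable_superpose (c := fun w : ℝ × Rn n => a w.2 * w.2 i)
      (integrable_segMeasure (integrable_mul_coord ha has i)) measurable_seg hφ'
      (hs.fderiv ℝ) x
  have hint2 : ∀ i, Integrable (fun w : ℝ × Rn n =>
      (a w.2 * w.2 i) * fderiv ℝ φ (x - w.1 • w.2) (EuclideanSpace.single i 1)) (segMeasure n) :=
    fun i => (hint i).apply_continuousLinearMap (EuclideanSpace.single i 1)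
  have hsum : ∀ w : ℝ × Rn n, ∑ i, (a w.2 * w.2 i) *
      fderiv ℝ φ (x - w.1 • w.2) (EuclideanSpace.single i 1) =
      a w.2 * fderiv ℝ φ (x - w.1 • w.2) w.2 := by
    intro w
    rw [← sum_single_apply (fderiv ℝ φ (x - w.1 • w.2)) w.2, Finset.mul_sum]
    exact Finset.sum_congr rfl fun i _ => by ring
  have hint3 : Integrable (fun w : ℝ × Rn n => a w.2 * fderiv ℝ φ (x - w.1 • w.2) w.2)
      (segMeasure n) := by
    have := integrable_finsetSum Finset.univ fun i _ => hint2 i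
    exact this.congr (Eventually.of_forall hsum)
  have hftc : ∀ h : Rn n, ∫ s in Ioo (0 : ℝ) 1, fderiv ℝ φ (x - s • h) h = φ x - φ (x - h) := by
    intro h
    have hd : ∀ s ∈ uIcc (0 : ℝ) 1, HasDerivAt (fun s : ℝ => -φ (x - s • h))
        (fderiv ℝ φ (x - s • h) h) s := by
      intro s _
      have h1 : HasDerivAt (fun s : ℝ => x - s • h) (-h) s := by
        simpa using ((hasDerivAt_id s).smul_const h).const_sub x
      have h2 := ((hφ.differentiable one_ne_zero (x - s • h)).hasFDerivAt.comp_hasDerivAt s h1).neg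
      simp only [map_neg, neg_neg] at h2
      exact h2
    have hc : Continuous fun s : ℝ => fderiv ℝ φ (x - s • h) h :=
      (hφ'.comp (by fun_prop)).clm_apply continuous_const
    have := intervalIntegral.integral_eq_sub_of_hasDerivAt hd (hc.intervalIntegrable 0 1)
    rw [intervalIntegral.integral_of_le zero_le_one, integral_Ioc_eq_integral_Ioo] at this
    rw [this]
    simp
    ring
  calc _ = ∑ i, ∫ w, (a w.2 * w.2 i) * fderiv ℝ φ (x - w.1 • w.2) (EuclideanSpace.single i 1)
        ∂(segMeasure n) := by
        refine Finset.sum_congr rfl fun i _ => ?_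
        rw [superpose, ContinuousLinearMap.integral_apply (hint i)]
        rfl
    _ = ∫ w, a w.2 * fderiv ℝ φ (x - w.1 • w.2) w.2 ∂(segMeasure n) := by
        rw [← integral_finsetSum _ fun i _ => hint2 i]
        exact integral_congr_ae (Eventually.of_forall hsum)
    _ = ∫ h, a h * (φ x - φ (x - h)) := by
        unfold segMeasure at hint3 ⊢
        rw [integral_prod_symm _ hint3]
        refine integral_congr_ae (Eventually.of_forall fun h => ?_)
        simp only
        rw [integral_const_mul, hftc]
    _ = _ := by
        have i1 : Integrable a volume := ha.integrable_of_hasCompactSupport has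
        have i2 : Integrable (fun h => a h * φ (x - h)) volume := by
          refine Continuous.integrable_of_hasCompactSupport
            (ha.mul (hφ.continuous.comp (by fun_prop))) has.mul_right
        rw [← integral_mul_const, ← integral_sub (i1.mul_const _) i2]
        exact integral_congr_ae (Eventually.of_forall fun h => by simp only; ring)

end Divergence

section Distribution

variable {n : ℕ} {T : 𝓓'((⊤ : Opens (Rn n)), ℝ)} {G : Rn n → Rn n}

/-- A smooth function with compact support, as a test function. -/
def toTest {φ : Rn n → ℝ} (hφ : ContDiff ℝ ((⊤ : ℕ∞) : WithTop ℕ∞) φ) (hs : HasCompactSupport φ) :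
    𝓓((⊤ : Opens (Rn n)), ℝ) :=
  ⟨φ, hφ, hs, subset_univ _⟩

lemma toTest_apply {φ : Rn n → ℝ} (hφ : ContDiff ℝ ((⊤ : ℕ∞) : WithTop ℕ∞) φ)
    (hs : HasCompactSupport φ) (x : Rn n) : toTest hφ hs x = φ x := rfl

lemma lineDerivOp_test_apply (φ : 𝓓((⊤ : Opens (Rn n)), ℝ)) (v x : Rn n) :
    (∂_{v} φ : 𝓓((⊤ : Opens (Rn n)), ℝ)) x = fderiv ℝ φ x v := by
  have h := TestFunction.lineDerivCLM_apply_of_le (𝕜 := ℝ) (k := ⊤) (f := φ) (v := v) (x := x)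
    (by simp)
  refine h.trans ?_
  have hd : DifferentiableAt ℝ φ x := φ.contDiff.differentiable (by simp) x
  exact hd.lineDeriv_eq_fderiv

lemma IsGradient.apply_lineDerivOp (h : IsGradient T G) (i : Fin n)
    (φ : 𝓓((⊤ : Opens (Rn n)), ℝ)) :
    T (∂_{(EuclideanSpace.single i (1 : ℝ) : Rn n)} φ) = -∫ x, φ x * G x i := by
  have := (h i).2 φ
  rw [Distribution.lineDerivOp_apply_apply, map_neg] at this
  linarith

/-- Integration by parts against test functions characterizes the distributional gradient of a
function. -/
lemma IsGradient.integral_fderiv (h : IsGradient T G) {f : Rn n → ℝ} (hf : IsFunction T f)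
    {φ : Rn n → ℝ} (hφ : ContDiff ℝ ((⊤ : ℕ∞) : WithTop ℕ∞) φ) (hs : HasCompactSupport φ)
    (i : Fin n) :
    ∫ x, fderiv ℝ φ x (EuclideanSpace.single i 1) * f x = -∫ x, φ x * G x i := by
  have h1 := h.apply_lineDerivOp i (toTest hφ hs)
  rw [hf.2] at h1
  simp only [lineDerivOp_test_apply] at h1
  exact h1

/-- A distribution whose gradient is locally integrable is a locally integrable function. Fix a test
function `η` of integral one; each test function `φ` is `(∫ φ) η` plus the divergence of a test field
that depends on `φ` through an explicit kernel. -/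
lemma exists_isFunction (h : IsGradient T G) : ∃ f : Rn n → ℝ, IsFunction T f := by
  let bump : ContDiffBump (0 : Rn n) := ⟨1, 2, one_pos, one_lt_two⟩
  set η : Rn n → ℝ := bump.normed volume with hη
  have hηs : HasCompactSupport η := bump.hasCompactSupport_normed
  have hηd : ContDiff ℝ ((⊤ : ℕ∞) : WithTop ℕ∞) η := bump.contDiff_normed
  have hη1 : ∫ x, η x = 1 := bump.integral_normed
  set cf : (Rn n → ℝ) → Fin n → ℝ × Rn n → ℝ := fun a i w => a w.2 * w.2 i with hcf
  set Z : ℝ × Rn n → Rn n := fun w => w.1 • w.2 with hZ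
  have hcfi : ∀ {a : Rn n → ℝ}, Continuous a → HasCompactSupport a → ∀ i,
      Integrable (cf a i) (segMeasure n) := fun ha has i =>
    integrable_segMeasure (integrable_mul_coord ha has i)
  have hcfR : ∀ {a : Rn n → ℝ}, HasCompactSupport a → ∃ R, ∀ i,
      ∀ᵐ w ∂(segMeasure n), cf a i w ≠ 0 → ‖Z w‖ ≤ R := by
    intro a has
    obtain ⟨R, hR⟩ := exists_norm_le_of_hasCompactSupport has
    exact ⟨R, fun i => ae_segMeasure_norm_le (b := fun h => a h * h i)
      fun h hne => hR h (left_ne_zero_of_mul hne)⟩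
  have hsd : ∀ {a φ : Rn n → ℝ}, Continuous a → HasCompactSupport a →
      ContDiff ℝ ((⊤ : ℕ∞) : WithTop ℕ∞) φ → HasCompactSupport φ → ∀ i,
      ContDiff ℝ ((⊤ : ℕ∞) : WithTop ℕ∞) (superpose (segMeasure n) (cf a i) Z φ) :=
    fun ha has hφ hs i => contDiff_infty.2 fun m =>
      contDiff_superpose (hcfi ha has i) measurable_seg m ℝ _ hφ hs
  have hss : ∀ {a φ : Rn n → ℝ}, HasCompactSupport a → HasCompactSupport φ → ∀ i,
      HasCompactSupport (superpose (segMeasure n) (cf a i) Z φ) := by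
    intro a φ has hs i
    obtain ⟨R, hR⟩ := hcfR has
    exact hasCompactSupport_superpose (hR i) hs
  have hGi : ∀ i, LocallyIntegrable (fun x => G x i) volume := fun i => (h i).1
  set H : Fin n → Rn n → ℝ := fun i z => ∫ x, η (x - z) * G x i with hH
  have hHc : ∀ i, Continuous (H i) := by
    intro i
    have : H i = fun z => ∫ x, η (-(z - x)) * G x i := by
      funext z; simp [hH]
    rw [this]
    have hc := HasCompactSupport.continuous_convolution_right (μ := (volume : Measure (Rn n)))
      (ContinuousLinearMap.mul ℝ ℝ) (f := fun x => G x i) (g := fun x => η (-x))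
      (hηs.comp_homeomorph (Homeomorph.neg (Rn n))) (hGi i) (hηd.continuous.comp continuous_neg)
    refine hc.congr fun z => ?_
    simp only [convolution, ContinuousLinearMap.mul_apply']
    exact integral_congr_ae (Eventually.of_forall fun x => mul_comm _ _)
  -- the two parts of the primitive: the superpositions of translates of `φ` and of `η` are moved to `G`
  set f1 : Fin n → Rn n → ℝ := fun i y => ∫ w, cf η i w * G (y + Z w) i ∂(segMeasure n) with hf1
  set f2 : Fin n → Rn n → ℝ := fun i y => y i * ∫ s in (0 : ℝ)..1, H i (s • y) with hf2
  have hf1l : ∀ i, LocallyIntegrable (f1 i) volume := by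
    intro i
    obtain ⟨R, hR⟩ := hcfR hηs
    exact locallyIntegrable_superpose_dual (hcfi hηd.continuous hηs i) measurable_seg (hR i) (hGi i)
  have hf2c : ∀ i, Continuous (f2 i) := by
    intro i
    have : Continuous fun y => ∫ s in (0 : ℝ)..1, H i (s • y) :=
      intervalIntegral.continuous_parametric_intervalIntegral_of_continuous'
        (f := fun y s => H i (s • y)) ((hHc i).comp (by fun_prop)) 0 1
    exact (by fun_prop : Continuous fun y : Rn n => y i).mul this
  refine ⟨fun y => T (toTest hηd hηs) - ∑ i, f1 i y + ∑ i, f2 i y, ?_, fun φ => ?_⟩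
  · refine LocallyIntegrable.add (LocallyIntegrable.sub (locallyIntegrable_const _) ?_) ?_
    · exact locallyIntegrable_finsetSum _ fun i _ => hf1l i
    · exact (continuous_finsetSum _ fun i _ => hf2c i).locallyIntegrable
  have hφd := φ.contDiff
  have hφs := φ.hasCompactSupport
  have hφc := hφd.continuous
  -- the convolutions `η * φ` and `φ * η` cancel
  have hdec : φ = (∫ x, φ x) • toTest hηd hηs +
      ∑ i, (∂_{(EuclideanSpace.single i (1 : ℝ) : Rn n)}
        (toTest (hsd hηd.continuous hηs hφd hφs i) (hss hηs hφs i)) : 𝓓((⊤ : Opens (Rn n)), ℝ)) -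
      ∑ i, (∂_{(EuclideanSpace.single i (1 : ℝ) : Rn n)}
        (toTest (hsd hφc hφs hηd hηs i) (hss hφs hηs i)) : 𝓓((⊤ : Opens (Rn n)), ℝ)) := by
    have hone : ∀ {ψ : Rn n → ℝ}, ContDiff ℝ ((⊤ : ℕ∞) : WithTop ℕ∞) ψ → ContDiff ℝ 1 ψ :=
      fun hψ => hψ.of_le (by simp)
    ext x
    have e1 := sum_superpose_fderiv hηd.continuous hηs (hone hφd) hφs x
    have e2 := sum_superpose_fderiv hφc hφs (hone hηd) hηs x
    have e3 : ∫ h, η h * φ (x - h) = ∫ h, φ h * η (x - h) := by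
      rw [← integral_sub_left_eq_self _ volume x]
      exact integral_congr_ae (Eventually.of_forall fun h => by simp [mul_comm])
    have hd : ∀ {a ψ : Rn n → ℝ} (ha : Continuous a) (has : HasCompactSupport a)
        (hψ : ContDiff ℝ ((⊤ : ℕ∞) : WithTop ℕ∞) ψ) (hψs : HasCompactSupport ψ) (i : Fin n),
        (∂_{(EuclideanSpace.single i (1 : ℝ) : Rn n)}
        (toTest (hsd ha has hψ hψs i) (hss has hψs i)) : 𝓓((⊤ : Opens (Rn n)), ℝ)) x =
        superpose (segMeasure n) (cf a i) Z (fderiv ℝ ψ) x (EuclideanSpace.single i 1) := by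
      intro a ψ ha has hψ hψs i
      rw [lineDerivOp_test_apply]
      exact congrArg (fun L : Rn n →L[ℝ] ℝ => L (EuclideanSpace.single i 1))
        (hasFDerivAt_superpose (hcfi ha has i) measurable_seg (hone hψ) hψs x).fderiv
    have hsumapp : ∀ (F : Fin n → 𝓓((⊤ : Opens (Rn n)), ℝ)), (∑ i, F i) x = ∑ i, F i x := by
      intro F
      exact map_sum (⟨⟨fun ψ : 𝓓((⊤ : Opens (Rn n)), ℝ) => ψ x, rfl⟩, fun _ _ => rfl⟩ :
        𝓓((⊤ : Opens (Rn n)), ℝ) →+ ℝ) F Finset.univ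
    change φ x = (∫ x, φ x) * η x + (∑ i, _ : 𝓓((⊤ : Opens (Rn n)), ℝ)) x -
      (∑ i, _ : 𝓓((⊤ : Opens (Rn n)), ℝ)) x
    rw [hsumapp, hsumapp]
    simp only [hd hηd.continuous hηs hφd hφs, hd hφc hφs hηd hηs]
    rw [hcf, hZ, e1, e2, hη1, e3]
    ring
  have hT := congrArg T hdec
  rw [map_sub, map_add, map_smul, map_sum, map_sum] at hT
  simp only [h.apply_lineDerivOp, toTest_apply] at hT
  have hG1 : ∀ i, Integrable (fun y => φ y * f1 i y) volume ∧
      ∫ x, superpose (segMeasure n) (cf η i) Z φ x * G x i = ∫ y, φ y * f1 i y := by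
    intro i
    obtain ⟨R, hR⟩ := hcfR hηs
    have := integral_superpose_mul_dual (hcfi hηd.continuous hηs i) measurable_seg (hR i) hφc hφs
      (hGi i)
    exact ⟨this.1, this.2.1⟩
  have hG2 : ∀ i, Integrable (fun y => φ y * f2 i y) volume ∧
      ∫ x, superpose (segMeasure n) (cf φ i) Z η x * G x i = ∫ y, φ y * f2 i y := by
    intro i
    refine ⟨(hφc.mul (hf2c i)).integrable_of_hasCompactSupport hφs.mul_right, ?_⟩
    obtain ⟨R, hR⟩ := hcfR hφs
    rw [(integral_superpose_mul_dual (hcfi hφc hφs i) measurable_seg (hR i) hηd.continuous hηs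
      (hGi i)).2.2]
    have hint : Integrable (fun w => cf φ i w * H i (Z w)) (segMeasure n) := by
      have hk : Continuous fun w : ℝ × Rn n => (φ w.2 * w.2 i) * H i (w.1 • w.2) :=
        (((hφc.comp continuous_snd).mul (by fun_prop))).mul ((hHc i).comp (by fun_prop))
      obtain ⟨R', hR'⟩ := exists_norm_le_of_hasCompactSupport hφs
      obtain ⟨C, hC⟩ := (isCompact_closedBall (0 : Rn n) R).exists_bound_of_continuousOn
        (hHc i).continuousOn
      refine ((hcfi hφc hφs i).norm.mul_const C).mono' hk.aestronglyMeasurable ?_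
      filter_upwards [hR i] with w hw
      rw [norm_mul]
      by_cases h0 : cf φ i w = 0
      · simp [h0]
      · gcongr
        exact hC _ (mem_closedBall_zero_iff.2 (hw h0))
    change ∫ w, cf φ i w * H i (Z w) ∂(segMeasure n) = _
    unfold segMeasure at hint ⊢
    rw [integral_prod_symm _ hint]
    refine integral_congr_ae (Eventually.of_forall fun y => ?_)
    simp only [hcf, hZ, hf2]
    rw [integral_const_mul, intervalIntegral.integral_of_le zero_le_one,
      integral_Ioc_eq_integral_Ioo, mul_assoc]
  have hφi : Integrable φ volume := hφc.integrable_of_hasCompactSupport hφs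
  rw [hT]
  simp only [fun i => (hG1 i).2, fun i => (hG2 i).2]
  simp only [mul_add, mul_sub, Finset.mul_sum]
  rw [integral_add, integral_sub, integral_finsetSum _ fun i _ => (hG1 i).1,
    integral_finsetSum _ fun i _ => (hG2 i).1, integral_mul_const]
  · simp only [Finset.sum_neg_distrib, smul_eq_mul]
    ring
  · exact hφi.mul_const _
  · exact integrable_finsetSum _ fun i _ => (hG1 i).1
  · exact (hφi.mul_const _).sub (integrable_finsetSum _ fun i _ => (hG1 i).1)
  · exact integrable_finsetSum _ fun i _ => (hG2 i).1

end Distribution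

/-! ### Mollification in `X` -/

section Mollify

variable {n : ℕ} {ρ : FunctionNorm n}

/-- The bump function of radius `1/(k+1)` around the origin. -/
def bump (n k : ℕ) : ContDiffBump (0 : Rn n) where
  rIn := 1 / (k + 1) / 2
  rOut := 1 / (k + 1)
  rIn_pos := by positivity
  rIn_lt_rOut := half_lt_self (by positivity)

/-- The convolution of `H` with the normalized bump function of radius `1/(k+1)`. -/
def mollify {F : Type*} [NormedAddCommGroup F] [NormedSpace ℝ F] (k : ℕ) (H : Rn n → F) :
    Rn n → F :=
  convolution ((bump n k).normed volume) H (ContinuousLinearMap.lsmul ℝ ℝ) volume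

section Basic

variable {F : Type*} [NormedAddCommGroup F] [NormedSpace ℝ F]

lemma mollify_apply (k : ℕ) (H : Rn n → F) (x : Rn n) :
    mollify k H x = ∫ y, (bump n k).normed volume (x - y) • H y := by
  rw [mollify, convolution_eq_swap]
  rfl

lemma integrable_mollify (k : ℕ) {H : Rn n → F} (hH : LocallyIntegrable H volume) (x : Rn n) :
    Integrable (fun y => (bump n k).normed volume (x - y) • H y) volume := by
  have h := ((bump n k).hasCompactSupport_normed (μ := volume)).convolutionExists_left
    (μ := volume) (ContinuousLinearMap.lsmul ℝ ℝ) (bump n k).continuous_normed hH x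
  have h2 := h.integrable_swap
  exact h2

lemma continuous_mollify (k : ℕ) {H : Rn n → F} (hH : LocallyIntegrable H volume) :
    Continuous (mollify k H) :=
  ((bump n k).hasCompactSupport_normed (μ := volume)).continuous_convolution_left _
    (bump n k).continuous_normed hH

lemma ae_tendsto_mollify [CompleteSpace F] {H : Rn n → F} (hH : LocallyIntegrable H volume) :
    ∀ᵐ x, Tendsto (fun k => mollify k H x) atTop (𝓝 (H x)) := by
  refine ContDiffBump.ae_convolution_tendsto_right_of_locallyIntegrable (K := 2)
    tendsto_one_div_add_atTop_nhds_zero_nat (Eventually.of_forall fun k => ?_) hH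
  change (1 : ℝ) / (k + 1) ≤ 2 * (1 / (k + 1) / 2)
  linarith

lemma enorm_bump_le (k : ℕ) (x y : Rn n) :
    ‖(bump n k).normed volume (x - y)‖ₑ ≤ (Metric.ball x (1 / (k + 1))).indicator
      (fun _ => ENNReal.ofReal (2 ^ (n : ℝ)) * (volume (Metric.ball x (1 / (k + 1))))⁻¹) y := by
  have hr : (0 : ℝ) < 1 / (k + 1) := by positivity
  by_cases hy : y ∈ Metric.ball x (1 / (k + 1))
  · rw [indicator_of_mem hy]
    have h1 := (bump n k).normed_le_div_measure_closedBall_rOut volume 2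
      (by change (1 : ℝ) / (k + 1) ≤ 2 * (1 / (k + 1) / 2); linarith) (x - y)
    have h0 := (bump n k).nonneg_normed (μ := volume) (x - y)
    change _ ≤ 2 ^ _ / (volume (Metric.closedBall (0 : Rn n) (1 / (k + 1)))).toReal at h1
    have hv : volume (Metric.closedBall (0 : Rn n) (1 / (k + 1))) =
        volume (Metric.ball x (1 / (k + 1))) := by
      rw [volume_closedBall_eq _ hr, volume_ball_scale x hr, volume_ball_scale 0 hr]
    have hpos : 0 < (volume (Metric.ball x (1 / ((k : ℝ) + 1)))).toReal :=
      ENNReal.toReal_pos (Metric.measure_ball_pos volume x hr).ne' measure_ball_lt_top.ne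
    rw [hv, finrank_euclideanSpace_fin] at h1
    rw [← ofReal_norm, Real.norm_of_nonneg h0]
    refine (ENNReal.ofReal_le_ofReal h1).trans (le_of_eq ?_)
    rw [ENNReal.ofReal_div_of_pos hpos, ENNReal.ofReal_toReal measure_ball_lt_top.ne,
      div_eq_mul_inv, Real.rpow_natCast]
  · have : (bump n k).normed volume (x - y) = 0 := by
      rw [← Function.notMem_support, ContDiffBump.support_normed_eq, mem_ball_zero_iff]
      change ¬ ‖x - y‖ < 1 / ((k : ℝ) + 1)
      rwa [mem_ball_iff_norm, norm_sub_rev] at hy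
    rw [this, enorm_zero]
    exact bot_le

lemma enorm_mollify_le (k : ℕ) (H : Rn n → F) (x : Rn n) :
    ‖mollify k H x‖ₑ ≤
      ENNReal.ofReal (2 ^ (n : ℝ)) * ballAvg (1 / (k + 1)) (fun y => ‖H y‖ₑ) x := by
  have hr : (0 : ℝ) < 1 / (k + 1) := by positivity
  have hct : ENNReal.ofReal (2 ^ (n : ℝ)) * (volume (Metric.ball x (1 / ((k : ℝ) + 1))))⁻¹ ≠ ∞ :=
    ENNReal.mul_ne_top ENNReal.ofReal_ne_top
      (ENNReal.inv_ne_top.2 (Metric.measure_ball_pos volume x hr).ne')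
  rw [mollify_apply]
  refine (enorm_integral_le_lintegral_enorm _).trans ?_
  calc _ ≤ ∫⁻ y in Metric.ball x (1 / (k + 1)),
        ENNReal.ofReal (2 ^ (n : ℝ)) * (volume (Metric.ball x (1 / (k + 1))))⁻¹ * ‖H y‖ₑ := by
        rw [← lintegral_indicator measurableSet_ball]
        refine lintegral_mono fun y => ?_
        simp only [enorm_smul]
        refine (mul_le_mul_left (enorm_bump_le k x y) _).trans (le_of_eq ?_)
        by_cases hy : y ∈ Metric.ball x (1 / ((k : ℝ) + 1))
        · rw [indicator_of_mem hy, indicator_of_mem hy]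
        · rw [indicator_of_notMem hy, indicator_of_notMem hy, zero_mul]
    _ = _ := by
        rw [lintegral_const_mul' _ _ hct, ballAvg, ENNReal.div_eq_inv_mul, mul_assoc]

lemma mollify_sub (k : ℕ) {H H' : Rn n → F} (hH : LocallyIntegrable H volume)
    (hH' : LocallyIntegrable H' volume) (x : Rn n) :
    mollify k (fun y => H y - H' y) x = mollify k H x - mollify k H' x := by
  rw [mollify_apply, mollify_apply, mollify_apply,
    ← integral_sub (integrable_mollify k hH x) (integrable_mollify k hH' x)]
  exact integral_congr_ae (Eventually.of_forall fun y => smul_sub _ _ _)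

end Basic

/-- Mollification turns a distributional gradient into a gradient. -/
lemma hasContGradient_mollify {T : 𝓓'((⊤ : Opens (Rn n)), ℝ)} {G : Rn n → Rn n}
    (h : IsGradient T G) (hG : LocallyIntegrable G volume) {f : Rn n → ℝ} (hf : IsFunction T f)
    (k : ℕ) : HasContGradient (mollify k f) (mollify k G) := by
  refine ⟨fun x => ?_, continuous_mollify k hG⟩
  set φ := (bump n k).normed volume with hφ
  have hφs : HasCompactSupport φ := (bump n k).hasCompactSupport_normed
  have hφd : ContDiff ℝ ((⊤ : ℕ∞) : WithTop ℕ∞) φ := (bump n k).contDiff_normed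
  have hφ1 : ContDiff ℝ 1 φ := hφd.of_le (by simp)
  have hd := hφs.hasFDerivAt_convolution_left (μ := volume) (ContinuousLinearMap.lsmul ℝ ℝ) hφ1
    hf.1 x
  rw [hasGradientAt_iff_hasFDerivAt]
  refine hd.congr_fderiv ?_
  set L := convolution (fderiv ℝ φ) f ((ContinuousLinearMap.lsmul ℝ ℝ).precompL (Rn n)) volume x
    with hL
  have hcoord : ∀ i, L (EuclideanSpace.single i 1) = mollify k G x i := by
    intro i
    have e1 : L (EuclideanSpace.single i 1) =
        ∫ y, fderiv ℝ φ (x - y) (EuclideanSpace.single i 1) * f y := by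
      have hex : ConvolutionExistsAt (fderiv ℝ φ) f x
          ((ContinuousLinearMap.lsmul ℝ ℝ).precompL (Rn n)) volume :=
        (hφs.fderiv ℝ).convolutionExists_left _ (hφ1.continuous_fderiv one_ne_zero) hf.1 x
      rw [hL, convolution_eq_swap, ContinuousLinearMap.integral_apply hex.integrable_swap]
      rfl
    have e2 : mollify k G x i = ∫ y, φ (x - y) * G y i := by
      rw [mollify_apply]
      have := (EuclideanSpace.proj (𝕜 := ℝ) i).integral_comp_comm (integrable_mollify k hG x)
      exact this.symm
    have hψ : ∀ y, fderiv ℝ (fun y => φ (x - y)) y (EuclideanSpace.single i 1) =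
        -fderiv ℝ φ (x - y) (EuclideanSpace.single i 1) := by
      intro y
      have h1 := (hφ1.differentiable one_ne_zero (x - y)).hasFDerivAt.comp y
        ((hasFDerivAt_id y).const_sub x)
      have h2 := h1.fderiv
      simp only [Function.comp_def] at h2
      rw [h2]
      simp
    have h3 := h.integral_fderiv hf (φ := fun y => φ (x - y))
      (hφd.comp (contDiff_const.sub contDiff_id)) (hφs.comp_homeomorph (Homeomorph.subLeft x)) i
    simp only [hψ, neg_mul] at h3
    rw [integral_neg] at h3
    rw [e1, e2]
    linarith
  ext v
  rw [← sum_single_apply L v, InnerProductSpace.toDual_apply_apply]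
  simp only [hcoord, PiLp.inner_apply, RCLike.inner_apply, conj_trivial]

/-- Mollifications converge in `X`: those of the bounded functions with bounded support by dominated
convergence, the others because the averaging operators are uniformly bounded on `X`. -/
lemma tendsto_norm_mollify_sub {p : ℝ} (hp : 1 ≤ p) (hρ : IsBallBanach ρ)
    (hY : IsBallBanach (convexify ρ (1 / p)))
    (ht : maximalOpNorm (associate (convexify ρ (1 / p))) < ∞)
    (hac : HasAbsolutelyContinuousNorm ρ) {G : Rn n → Rn n} (hGm : Measurable G)
    (hG : LocallyIntegrable G volume) (hfin : ρ (fun x => ‖G x‖ₑ) < ∞) :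
    Tendsto (fun k => ρ (fun x => ‖mollify k G x - G x‖ₑ)) atTop (𝓝 0) := by
  set M := (maximalOpNorm (associate (convexify ρ (1 / p))) +
      maximalOpNorm (associate (convexify ρ (1 / p))) ^ 2) ^ (1 / p) with hM
  have hMt : M ≠ ∞ := by
    refine ENNReal.rpow_ne_top_of_nonneg (by positivity) (ENNReal.add_ne_top.2 ⟨ht.ne, ?_⟩)
    exact ENNReal.pow_ne_top ht.ne
  -- the truncations of `G` are bounded with bounded support; the remainders have small norms `a N`
  set S : ℕ → Set (Rn n) := fun N => {x | ‖x‖ < N ∧ ‖G x‖ ≤ N} with hS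
  have hSm : ∀ N, MeasurableSet (S N) := fun N =>
    (measurableSet_lt measurable_norm measurable_const).inter
      (measurableSet_le hGm.norm measurable_const)
  have hGe : Measurable fun x => ‖G x‖ₑ := hGm.enorm
  set a : ℕ → ℝ≥0∞ := fun N => ρ ((S N)ᶜ.indicator fun x => ‖G x‖ₑ) with ha
  have ha0 : Tendsto a atTop (𝓝 0) := by
    refine tendsto_norm_zero_of_dominated hρ hac hGe.aemeasurable hfin
      (fun N => (hGe.indicator (hSm N).compl).aemeasurable)
      (fun N => Eventually.of_forall fun x => indicator_le_self' (fun _ _ => bot_le) x)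
      (Eventually.of_forall fun x => ?_)
    obtain ⟨N0, hN0⟩ := exists_nat_gt (max ‖x‖ ‖G x‖)
    refine tendsto_const_nhds.congr' ?_
    filter_upwards [eventually_ge_atTop N0] with N hN
    have hN' : (N0 : ℝ) ≤ N := by exact_mod_cast hN
    have hx : x ∈ S N := ⟨by linarith [le_max_left ‖x‖ ‖G x‖], by linarith [le_max_right ‖x‖ ‖G x‖]⟩
    rw [indicator_of_notMem (by simpa using hx)]
  set c : ℝ≥0∞ := ENNReal.ofReal (2 ^ (n : ℝ)) * M + 1 with hc
  have hct : c ≠ ∞ :=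
    ENNReal.add_ne_top.2 ⟨ENNReal.mul_ne_top ENNReal.ofReal_ne_top hMt, ENNReal.one_ne_top⟩
  set b : ℕ → ℕ → ℝ≥0∞ := fun N k =>
    ρ (fun x => ‖mollify k ((S N).indicator G) x - (S N).indicator G x‖ₑ) with hb
  have hind : ∀ N, LocallyIntegrable ((S N).indicator G) volume := fun N => by
    refine hG.mono (hGm.indicator (hSm N)).aestronglyMeasurable (Eventually.of_forall fun x => ?_)
    exact norm_indicator_le_norm_self _ _
  have hindc : ∀ N, LocallyIntegrable ((S N)ᶜ.indicator G) volume := fun N => by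
    refine hG.mono (hGm.indicator (hSm N).compl).aestronglyMeasurable
      (Eventually.of_forall fun x => norm_indicator_le_norm_self _ _)
  have hb0 : ∀ N, Tendsto (b N) atTop (𝓝 0) := by
    intro N
    set B := Metric.ball (0 : Rn n) (N + 1) with hB
    refine tendsto_norm_zero_of_dominated hρ hac
      (g := fun x => ((ENNReal.toNNReal (ENNReal.ofReal (2 ^ (n : ℝ)) * N + N) : ℝ≥0) : ℝ≥0∞) *
        B.indicator 1 x)
      ((measurable_one.indicator measurableSet_ball).const_mul _).aemeasurable ?_
      (fun k => ?_) (fun k => Eventually.of_forall fun x => ?_) ?_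
    · rw [hρ.smul _ _ (measurable_one.indicator measurableSet_ball).aemeasurable]
      exact ENNReal.mul_lt_top ENNReal.coe_lt_top (hρ.ball_mem 0 _ (by positivity))
    · exact ((continuous_mollify k (hind N)).measurable.sub
        (hGm.indicator (hSm N))).enorm.aemeasurable
    · have hfinC : ENNReal.ofReal (2 ^ (n : ℝ)) * (N : ℝ≥0∞) + N ≠ ∞ :=
        ENNReal.add_ne_top.2 ⟨ENNReal.mul_ne_top ENNReal.ofReal_ne_top (ENNReal.natCast_ne_top N),
          ENNReal.natCast_ne_top N⟩
      beta_reduce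
      rw [ENNReal.coe_toNNReal hfinC]
      have hbound : ∀ y, ‖(S N).indicator G y‖ₑ ≤ N := by
        intro y
        by_cases hy : y ∈ S N
        · rw [indicator_of_mem hy, ← ofReal_norm, ← ENNReal.ofReal_natCast]
          exact ENNReal.ofReal_le_ofReal hy.2
        · rw [indicator_of_notMem hy]; simp
      have hr : (0 : ℝ) < 1 / (k + 1) := by positivity
      have hr1 : (1 : ℝ) / (k + 1) ≤ 1 := by
        rw [div_le_one (by positivity)]
        have : (0 : ℝ) ≤ k := Nat.cast_nonneg k
        linarith
      by_cases hx : x ∈ B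
      · rw [indicator_of_mem hx, Pi.one_apply, mul_one]
        refine _root_.enorm_sub_le.trans (add_le_add ((enorm_mollify_le k _ x).trans ?_) (hbound x))
        gcongr
        exact (ballAvg_le_maximal hr _ x).trans (maximal_le_of_le hbound x)
      · have hx' : (N : ℝ) + 1 ≤ ‖x‖ := by simpa [hB] using hx
        have hzero : ∀ y ∈ Metric.ball x (1 / ((k : ℝ) + 1)), (S N).indicator G y = 0 := by
          intro y hy
          refine indicator_of_notMem (fun hyS => ?_) _
          rw [mem_ball_iff_norm] at hy
          have h1 := hyS.1
          have h2 : ‖x‖ ≤ ‖y‖ + ‖y - x‖ := by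
            have := norm_sub_le y (y - x)
            rwa [sub_sub_cancel] at this
          linarith
        have h1 : ballAvg (1 / ((k : ℝ) + 1)) (fun y => ‖(S N).indicator G y‖ₑ) x = 0 := by
          rw [ballAvg, setLIntegral_congr_fun (g := fun _ => 0) measurableSet_ball
            (fun y hy => by simp [hzero y hy])]
          simp
        have h2 : ‖mollify k ((S N).indicator G) x‖ₑ = 0 := by
          have := enorm_mollify_le k ((S N).indicator G) x
          rw [h1, mul_zero] at this
          exact le_antisymm this bot_le
        rw [enorm_eq_zero] at h2
        rw [h2, hzero x (Metric.mem_ball_self hr)]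
        simp
    · filter_upwards [ae_tendsto_mollify (hind N)] with x hx
      have := (hx.sub_const ((S N).indicator G x)).enorm
      simpa using this
  have hmain : ∀ N k, ρ (fun x => ‖mollify k G x - G x‖ₑ) ≤ c * a N + b N k := by
    intro N k
    have hgc : Measurable ((S N)ᶜ.indicator fun x => ‖G x‖ₑ) := hGe.indicator (hSm N).compl
    have hr : (0 : ℝ) < 1 / (k + 1) := by positivity
    have hafin : ρ ((S N)ᶜ.indicator fun x => ‖G x‖ₑ) < ∞ :=
      (hρ.mono _ _ hgc.aemeasurable hGe.aemeasurable
        (Eventually.of_forall fun x => indicator_le_self' (fun _ _ => bot_le) x)).trans_lt hfin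
    have hAm := measurable_ballAvg hgc (1 / ((k : ℝ) + 1))
    have hdiff : Measurable fun x => ‖mollify k ((S N).indicator G) x - (S N).indicator G x‖ₑ :=
      ((continuous_mollify k (hind N)).measurable.sub (hGm.indicator (hSm N))).enorm
    have hpt : ∀ x, ‖mollify k G x - G x‖ₑ ≤
        ((((2 : ℝ≥0) ^ (n : ℝ) : ℝ≥0) : ℝ≥0∞) * ballAvg (1 / ((k : ℝ) + 1))
          ((S N)ᶜ.indicator fun x => ‖G x‖ₑ) x + (S N)ᶜ.indicator (fun x => ‖G x‖ₑ) x) +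
        ‖mollify k ((S N).indicator G) x - (S N).indicator G x‖ₑ := by
      intro x
      have hsplit : (S N)ᶜ.indicator G = fun y => G y - (S N).indicator G y := by
        funext y
        by_cases hy : y ∈ S N <;> simp [hy]
      have e : mollify k G x - G x = (mollify k ((S N)ᶜ.indicator G) x - (S N)ᶜ.indicator G x) +
          (mollify k ((S N).indicator G) x - (S N).indicator G x) := by
        have h1 := mollify_sub k hG (hind N) x
        have h2 := congrFun hsplit x
        rw [← hsplit] at h1
        rw [h1, h2]
        abel
      rw [e]
      refine (enorm_add_le _ _).trans (add_le_add (_root_.enorm_sub_le.trans ?_) le_rfl)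
      have e2 : ∀ y, ‖(S N)ᶜ.indicator G y‖ₑ = (S N)ᶜ.indicator (fun x => ‖G x‖ₑ) y := fun y =>
        enorm_indicator_eq_indicator_enorm _ _
      have e3 : ((((2 : ℝ≥0) ^ (n : ℝ) : ℝ≥0) : ℝ≥0∞)) = ENNReal.ofReal (2 ^ (n : ℝ)) := by
        rw [ENNReal.ofReal, Real.toNNReal_of_nonneg (by positivity)]
        congr 1
      refine add_le_add ?_ (e2 x).le
      rw [e3, ← funext e2]
      exact enorm_mollify_le k _ x
    have e3 : ((((2 : ℝ≥0) ^ (n : ℝ) : ℝ≥0) : ℝ≥0∞)) = ENNReal.ofReal (2 ^ (n : ℝ)) := by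
      rw [ENNReal.ofReal, Real.toNNReal_of_nonneg (by positivity)]
      congr 1
    calc _ ≤ ρ (fun x => ((((2 : ℝ≥0) ^ (n : ℝ) : ℝ≥0) : ℝ≥0∞) * ballAvg (1 / ((k : ℝ) + 1))
          ((S N)ᶜ.indicator fun x => ‖G x‖ₑ) x + (S N)ᶜ.indicator (fun x => ‖G x‖ₑ) x) +
          ‖mollify k ((S N).indicator G) x - (S N).indicator G x‖ₑ) :=
          hρ.mono _ _ ((continuous_mollify k hG).measurable.sub hGm).enorm.aemeasurable
            (((hAm.const_mul _).add hgc).add hdiff).aemeasurable (Eventually.of_forall hpt)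
      _ ≤ (((((2 : ℝ≥0) ^ (n : ℝ) : ℝ≥0) : ℝ≥0∞) * ρ (ballAvg (1 / ((k : ℝ) + 1))
          ((S N)ᶜ.indicator fun x => ‖G x‖ₑ))) + a N) + b N k := by
          refine (hρ.add_le _ _ ((hAm.const_mul _).add hgc).aemeasurable
            hdiff.aemeasurable).trans (add_le_add ?_ le_rfl)
          refine (hρ.add_le _ _ (hAm.const_mul _).aemeasurable hgc.aemeasurable).trans
            (add_le_add ?_ le_rfl)
          exact (hρ.smul _ _ hAm.aemeasurable).le
      _ ≤ (ENNReal.ofReal (2 ^ (n : ℝ)) * (M * a N) + a N) + b N k := by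
          rw [e3]
          gcongr
          exact norm_ballAvg_le hp hY ht hgc hafin hr
      _ = _ := by rw [hc]; ring
  rw [ENNReal.tendsto_nhds_zero]
  intro ε hε
  have hca : Tendsto (fun N => c * a N) atTop (𝓝 0) := by
    have := ENNReal.Tendsto.const_mul ha0 (Or.inr hct)
    simpa using this
  have hε2 : 0 < ε / 2 := ENNReal.half_pos hε.ne'
  obtain ⟨N, hN⟩ := ((ENNReal.tendsto_nhds_zero.1 hca) _ hε2).exists
  filter_upwards [(ENNReal.tendsto_nhds_zero.1 (hb0 N)) _ hε2] with k hk
  calc _ ≤ c * a N + b N k := hmain N k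
    _ ≤ ε / 2 + ε / 2 := add_le_add hN hk
    _ = ε := ENNReal.add_halves ε

end Mollify

/-! ### Approximation by functions with compactly supported gradient -/

section Cutoff

variable {n : ℕ} {ρ : FunctionNorm n}

/-- Functions of class `C¹` whose gradient `K` has compact support and which, if `n ≥ 2`, are
constant outside a ball. (For `n = 1` the values near `±∞` may differ.) -/
structure IsNice (f : Rn n → ℝ) (K : Rn n → Rn n) : Prop extends HasContGradient f K where
  hasCompactSupport : HasCompactSupport K
  exists_const : 2 ≤ n → ∃ c R : ℝ, ∀ x, R ≤ ‖x‖ → f x = c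

/-- A segment from `x` to a point near `3 R v` avoids the ball of radius `R / 10` around the origin
unless `x` lies in a cone around `-v`: it stays in a half-space whose normal is the bisector of `x`
and `v`. -/
lemma le_norm_segment {x v z : Rn n} {R t : ℝ} (hR : 0 < R) (hv : ‖v‖ = 1) (hx : R ≤ ‖x‖)
    (hxv : -(4 / 5) * ‖x‖ ≤ inner ℝ x v) (hz : ‖z - (3 * R) • v‖ < R / 10)
    (ht : t ∈ Ioo (0 : ℝ) 1) : R / 10 ≤ ‖x + t • (z - x)‖ := by
  have hx0 : 0 < ‖x‖ := hR.trans_le hx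
  set c := inner ℝ x v / ‖x‖ with hc
  have hxv' : inner ℝ x v = c * ‖x‖ := by rw [hc, div_mul_cancel₀ _ hx0.ne']
  have hc1 : -(4 / 5) ≤ c := by rw [hc, le_div_iff₀ hx0]; exact hxv
  set ν := ‖x‖⁻¹ • x + v with hν
  have hvv : inner ℝ v v = 1 := by rw [real_inner_self_eq_norm_sq, hv]; norm_num
  have hxx : inner ℝ x x = ‖x‖ * ‖x‖ := by rw [real_inner_self_eq_norm_sq, sq]
  have h1 : inner ℝ x ν = ‖x‖ * (1 + c) := by
    rw [hν, inner_add_right, inner_smul_right, hxx, hxv']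
    field_simp
  have h2 : inner ℝ v ν = 1 + c := by
    rw [hν, inner_add_right, inner_smul_right, real_inner_comm, hxv', hvv]
    field_simp
    ring
  have h3 : ‖ν‖ ^ 2 = 2 * (1 + c) := by
    rw [← real_inner_self_eq_norm_sq]
    conv_lhs => rw [hν]
    rw [← hν, inner_add_left, inner_smul_left, h1, h2]
    simp only [conj_trivial]
    field_simp
    ring
  set N := ‖ν‖ with hN
  have hN0 : 0 ≤ N := norm_nonneg _
  -- `N ^ 2 = 2 * (1 + c) ≥ 2 / 5`
  have hN2 : (3 / 5 : ℝ) ≤ N := by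
    by_contra hlt
    push Not at hlt
    nlinarith
  set w := z - (3 * R) • v with hw
  have hz' : z = (3 * R) • v + w := by rw [hw]; abel
  have h4 : inner ℝ z ν = 3 * R * (1 + c) + inner ℝ w ν := by
    rw [hz', inner_add_left, inner_smul_left, h2]; simp
  have h5 : -(R / 10 * N) ≤ inner ℝ w ν := by
    have := abs_real_inner_le_norm w ν
    have h6 : ‖w‖ * ‖ν‖ ≤ R / 10 * N := mul_le_mul_of_nonneg_right hz.le hN0
    linarith [neg_abs_le (inner ℝ w ν)]
  have h7 : inner ℝ (x + t • (z - x)) ν = (1 - t) * inner ℝ x ν + t * inner ℝ z ν := by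
    rw [inner_add_left, inner_smul_left, inner_sub_left]
    simp only [conj_trivial]
    ring
  have hA : R / 10 * N ≤ inner ℝ x ν := by
    rw [h1]
    have : R * (1 + c) ≤ ‖x‖ * (1 + c) := mul_le_mul_of_nonneg_right hx (by linarith)
    nlinarith [mul_le_mul_of_nonneg_left hN2 (mul_nonneg hR.le hN0)]
  have hB : R / 10 * N ≤ inner ℝ z ν := by
    rw [h4]
    nlinarith [mul_le_mul_of_nonneg_left hN2 (mul_nonneg hR.le hN0)]
  have h8 : R / 10 * N ≤ ‖x + t • (z - x)‖ * N := by
    refine le_trans ?_ (real_inner_le_norm (x + t • (z - x)) ν)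
    rw [h7]
    nlinarith [ht.1, ht.2, mul_le_mul_of_nonneg_left hA (by linarith [ht.2] : 0 ≤ 1 - t),
      mul_le_mul_of_nonneg_left hB ht.1.le]
  exact le_of_mul_le_mul_right h8 (by linarith)

lemma lintegral_ball_segment {g : Rn n → ℝ≥0∞} (hg : Measurable g) (x : Rn n) {r : ℝ} (hr : 0 < r) :
    ∫⁻ z in Metric.ball x r, ∫⁻ t in Ioo (0 : ℝ) 1, g (x + t • (z - x)) =
      volume (Metric.ball x r) * radialAvg r g x := by
  have hjoint : Measurable fun p : Rn n × ℝ => g (x + p.2 • (p.1 - x)) :=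
    hg.comp (by fun_prop)
  rw [lintegral_lintegral_swap (f := fun (z : Rn n) (t : ℝ) => g (x + t • (z - x)))
    hjoint.aemeasurable, radialAvg, ← lintegral_const_mul _ (measurable_ballAvg_radius hg r x)]
  exact setLIntegral_congr_fun measurableSet_Ioo fun t ht => setLIntegral_ball_homothety hg x hr ht.1

lemma enorm_sub_average_le {F : Rn n → ℝ} (hF : Continuous F) (a : ℝ) (c : Rn n) {r : ℝ}
    (hr : 0 < r) : ‖a - ⨍ z in Metric.ball c r, F z‖ₑ ≤
      (∫⁻ z in Metric.ball c r, ‖F z - a‖ₑ) / volume (Metric.ball c r) := by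
  have h0 : volume (Metric.ball c r) ≠ 0 := (Metric.measure_ball_pos volume c hr).ne'
  have ht : volume (Metric.ball c r) ≠ ∞ := measure_ball_lt_top.ne
  have hint : IntegrableOn F (Metric.ball c r) volume :=
    (hF.continuousOn.integrableOn_compact (isCompact_closedBall c r)).mono_set
      Metric.ball_subset_closedBall
  have e : a - ⨍ z in Metric.ball c r, F z = -⨍ z in Metric.ball c r, (F z - a) := by
    rw [setAverage_eq, setAverage_eq, integral_sub hint (integrableOn_const ht), setIntegral_const,
      smul_sub, smul_smul, inv_mul_cancel₀ (by
        rw [measureReal_def]; exact (ENNReal.toReal_pos h0 ht).ne'), one_smul]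
    ring
  rw [e, enorm_neg, setAverage_eq, enorm_smul, ENNReal.div_eq_inv_mul]
  refine mul_le_mul' (le_of_eq ?_) (enorm_integral_le_lintegral_enorm _)
  rw [measureReal_def, Real.enorm_of_nonneg (by positivity),
    ENNReal.ofReal_inv_of_pos (ENNReal.toReal_pos h0 ht), ENNReal.ofReal_toReal ht]

/-- The ratio of the volumes of the ball around `x` over which segments are averaged and of the distant
ball on which `F` is averaged. -/
lemma volume_ball_div (x y : Rn n) {R : ℝ} (hR : 0 < R) : volume (Metric.ball x (8 * R)) =
    ENNReal.ofReal (80 ^ (n : ℝ)) * volume (Metric.ball y (R / 10)) := by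
  rw [volume_ball_scale x (by positivity), volume_ball_scale y (by positivity), ← mul_assoc,
    ← ENNReal.ofReal_mul (by positivity), ← Real.mul_rpow (by positivity) (by positivity)]
  congr 3
  ring

/-- Outside a cone, the distance of `F x` to the mean of `F` over a distant ball is controlled by the
gradient away from the origin. -/
lemma HasContGradient.enorm_sub_average_le_of_cone {F : Rn n → ℝ} {K : Rn n → Rn n}
    (h : HasContGradient F K) {x v : Rn n} {R : ℝ} (hR : 0 < R) (hv : ‖v‖ = 1) (hx : R ≤ ‖x‖)
    (hx4 : ‖x‖ ≤ 4 * R) (hxv : -(4 / 5) * ‖x‖ ≤ inner ℝ x v) :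
    ‖F x - ⨍ z in Metric.ball ((3 * R) • v) (R / 10), F z‖ₑ ≤
      ENNReal.ofReal (80 ^ (n : ℝ) * (8 * R)) *
        radialAvg (8 * R) ({y | R / 10 ≤ ‖y‖}.indicator fun y => ‖K y‖ₑ) x := by
  have hA : MeasurableSet {y : Rn n | R / 10 ≤ ‖y‖} := measurableSet_le measurable_const
    measurable_norm
  set g := {y : Rn n | R / 10 ≤ ‖y‖}.indicator fun y => ‖K y‖ₑ with hg
  have hgm : Measurable g := h.continuous_grad.enorm.measurable.indicator hA
  set S := Metric.ball ((3 * R) • v) (R / 10) with hS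
  have hzx : ∀ z ∈ S, ‖z - x‖ < 8 * R := by
    intro z hz
    rw [hS, mem_ball_iff_norm] at hz
    have h1 : z - x = (z - (3 * R) • v) + (3 * R) • v - x := by abel
    have h2 : ‖(3 * R) • v‖ = 3 * R := by
      rw [norm_smul, hv, mul_one, Real.norm_of_nonneg (by positivity)]
    rw [h1]
    linarith [norm_sub_le ((z - (3 * R) • v) + (3 * R) • v) x,
      norm_add_le (z - (3 * R) • v) ((3 * R) • v)]
  have hSsub : S ⊆ Metric.ball x (8 * R) := fun z hz => by
    rw [mem_ball_iff_norm]; exact hzx z hz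
  have hS0 : volume S ≠ 0 := (Metric.measure_ball_pos volume _ (by positivity)).ne'
  have hSt : volume S ≠ ∞ := measure_ball_lt_top.ne
  refine (enorm_sub_average_le h.continuous (F x) _ (by positivity)).trans ?_
  refine ENNReal.div_le_of_le_mul ?_
  calc _ ≤ ∫⁻ z in S, ENNReal.ofReal (8 * R) * ∫⁻ t in Ioo (0 : ℝ) 1, g (x + t • (z - x)) := by
        refine setLIntegral_mono' measurableSet_ball fun z hz => (h.enorm_sub_le x z).trans ?_
        rw [← lintegral_const_mul' _ _ ENNReal.ofReal_ne_top]
        refine setLIntegral_mono' measurableSet_Ioo fun t ht => ?_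
        rw [mul_comm, hg, indicator_of_mem]
        · refine mul_le_mul_left ?_ _
          rw [← ofReal_norm]
          exact ENNReal.ofReal_le_ofReal (hzx z hz).le
        · exact le_norm_segment hR hv hx hxv (by rwa [mem_ball_iff_norm] at hz) ht
    _ ≤ ∫⁻ z in Metric.ball x (8 * R),
          ENNReal.ofReal (8 * R) * ∫⁻ t in Ioo (0 : ℝ) 1, g (x + t • (z - x)) :=
        lintegral_mono_set hSsub
    _ = ENNReal.ofReal (8 * R) * (volume (Metric.ball x (8 * R)) * radialAvg (8 * R) g x) := by
        rw [lintegral_const_mul' _ _ ENNReal.ofReal_ne_top,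
          lintegral_ball_segment hgm x (by positivity)]
    _ = _ := by
        rw [volume_ball_div x ((3 * R) • v) hR,
          ENNReal.ofReal_mul (p := (80 : ℝ) ^ (n : ℝ)) (by positivity)]
        ring

/-- A Poincaré inequality on annuli: in dimension at least `2`, the distance of `F` to a suitable
constant is controlled by averages of the gradient away from the origin. A point of the bad cone
around `-v` is compared with a second distant ball, in the direction `w` orthogonal to `v`. -/
lemma HasContGradient.enorm_sub_average_le_annulus {F : Rn n → ℝ} {K : Rn n → Rn n}
    (h : HasContGradient F K) {x v w : Rn n} {R : ℝ} (hR : 0 < R) (hv : ‖v‖ = 1) (hw : ‖w‖ = 1)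
    (hvw : inner ℝ v w = 0) (hx : R ≤ ‖x‖) (hx4 : ‖x‖ ≤ 4 * R) :
    ‖F x - ⨍ z in Metric.ball ((3 * R) • v) (R / 10), F z‖ₑ ≤
      ENNReal.ofReal (80 ^ (n : ℝ) * (8 * R)) *
        (radialAvg (8 * R) ({y | R / 10 ≤ ‖y‖}.indicator fun y => ‖K y‖ₑ) x +
          ENNReal.ofReal (80 ^ (n : ℝ)) * ballAvg (8 * R)
            (radialAvg (8 * R) ({y | R / 10 ≤ ‖y‖}.indicator fun y => ‖K y‖ₑ)) x) := by
  have hA : MeasurableSet {y : Rn n | R / 10 ≤ ‖y‖} := measurableSet_le measurable_const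
    measurable_norm
  set g := {y : Rn n | R / 10 ≤ ‖y‖}.indicator fun y => ‖K y‖ₑ with hg
  have hgm : Measurable g := h.continuous_grad.enorm.measurable.indicator hA
  set u := radialAvg (8 * R) g with hu
  by_cases hxv : -(4 / 5) * ‖x‖ ≤ inner ℝ x v
  · exact (h.enorm_sub_average_le_of_cone hR hv hx hx4 hxv).trans
      (mul_le_mul_right le_self_add _)
  push Not at hxv
  have hx0 : 0 < ‖x‖ := hR.trans_le hx
  -- a unit vector in the plane of `v` and `w`: `x` cannot lie in the bad cones of both
  have hxw : -(4 / 5) * ‖x‖ ≤ inner ℝ x w := by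
    have h1 := real_inner_le_norm x (-(4 / 5 : ℝ) • v - (3 / 5 : ℝ) • w)
    have h2 : ‖-(4 / 5 : ℝ) • v - (3 / 5 : ℝ) • w‖ = 1 := by
      rw [← sq_eq_sq₀ (norm_nonneg _) zero_le_one, norm_sub_sq_real, norm_smul, norm_smul,
        inner_smul_left, inner_smul_right, hv, hw, hvw]
      norm_num
    rw [h2, mul_one, inner_sub_right, inner_smul_right, inner_smul_right] at h1
    nlinarith
  set c1 := ⨍ z in Metric.ball ((3 * R) • v) (R / 10), F z with hc1
  set c2 := ⨍ z in Metric.ball ((3 * R) • w) (R / 10), F z with hc2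
  set S := Metric.ball ((3 * R) • w) (R / 10) with hS
  have h3w : ‖(3 * R) • w‖ = 3 * R := by
    rw [norm_smul, hw, mul_one, Real.norm_of_nonneg (by positivity)]
  have hz : ∀ z ∈ S, ‖F z - c1‖ₑ ≤ ENNReal.ofReal (80 ^ (n : ℝ) * (8 * R)) * u z := by
    intro z hz
    rw [hS, mem_ball_iff_norm] at hz
    have e1 : z = (z - (3 * R) • w) + (3 * R) • w := by abel
    have hzl : 2 * R ≤ ‖z‖ := by
      have := norm_sub_le ((z - (3 * R) • w) + (3 * R) • w) (z - (3 * R) • w)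
      rw [add_sub_cancel_left, h3w, ← e1] at this
      linarith
    have hzu : ‖z‖ ≤ 4 * R := by
      have := norm_add_le (z - (3 * R) • w) ((3 * R) • w)
      rw [h3w, ← e1] at this
      linarith
    refine h.enorm_sub_average_le_of_cone hR hv (by linarith) hzu ?_
    have h4 : inner ℝ z v = inner ℝ (z - (3 * R) • w) v := by
      rw [inner_sub_left, inner_smul_left, real_inner_comm v w, hvw]; simp
    have h5 := abs_real_inner_le_norm (z - (3 * R) • w) v
    rw [hv, mul_one] at h5
    rw [h4]
    linarith [neg_abs_le (inner ℝ (z - (3 * R) • w) v)]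
  have hSsub : S ⊆ Metric.ball x (8 * R) := fun z hz => by
    rw [hS, mem_ball_iff_norm] at hz
    rw [mem_ball_iff_norm]
    have e1 : z - x = (z - (3 * R) • w) + (3 * R) • w - x := by abel
    rw [e1]
    linarith [norm_sub_le ((z - (3 * R) • w) + (3 * R) • w) x,
      norm_add_le (z - (3 * R) • w) ((3 * R) • w)]
  have hS0 : volume S ≠ 0 := (Metric.measure_ball_pos volume _ (by positivity)).ne'
  have hSt : volume S ≠ ∞ := measure_ball_lt_top.ne
  have h80 : ENNReal.ofReal ((80 : ℝ) ^ (n : ℝ)) ≠ 0 := by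
    rw [Ne, ENNReal.ofReal_eq_zero, not_le]; positivity
  have h12 : ‖c1 - c2‖ₑ ≤ ENNReal.ofReal (80 ^ (n : ℝ) * (8 * R)) *
      (ENNReal.ofReal (80 ^ (n : ℝ)) * ballAvg (8 * R) u x) := by
    refine (enorm_sub_average_le h.continuous c1 _ (by positivity)).trans ?_
    refine ENNReal.div_le_of_le_mul ?_
    calc _ ≤ ∫⁻ z in S, ENNReal.ofReal (80 ^ (n : ℝ) * (8 * R)) * u z :=
          setLIntegral_mono' measurableSet_ball hz
      _ ≤ ENNReal.ofReal (80 ^ (n : ℝ) * (8 * R)) * ∫⁻ z in Metric.ball x (8 * R), u z := by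
          rw [lintegral_const_mul' _ _ ENNReal.ofReal_ne_top]
          exact mul_le_mul_right (lintegral_mono_set hSsub) _
      _ = _ := by
          have hb0 : volume (Metric.ball x (8 * R)) ≠ 0 :=
            (Metric.measure_ball_pos volume _ (by positivity)).ne'
          have hbt : volume (Metric.ball x (8 * R)) ≠ ∞ := measure_ball_lt_top.ne
          have e : ∫⁻ z in Metric.ball x (8 * R), u z =
              volume (Metric.ball x (8 * R)) * ballAvg (8 * R) u x := by
            rw [ballAvg, ENNReal.mul_div_cancel hb0 hbt]
          rw [e, volume_ball_div x ((3 * R) • w) hR]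
          ring
  have e : F x - c1 = (F x - c2) - (c1 - c2) := by ring
  rw [e, mul_add]
  exact _root_.enorm_sub_le.trans
    (add_le_add (h.enorm_sub_average_le_of_cone hR hw hx hx4 hxw) h12)

end Cutoff

section NiceApproximation

variable {n : ℕ} {ρ : FunctionNorm n}

/-- A fixed cutoff function, equal to `1` on the unit ball and to `0` outside the ball of radius
`2`. -/
def cutoff (n : ℕ) : ContDiffBump (0 : Rn n) := ⟨1, 2, one_pos, one_lt_two⟩

/-- The gradient of the cutoff function. -/
def cutoffGrad (n : ℕ) (x : Rn n) : Rn n := (InnerProductSpace.toDual ℝ (Rn n)).symm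
  (fderiv ℝ (cutoff n) x)

lemma cutoff_eq_one {x : Rn n} (hx : ‖x‖ ≤ 1) : cutoff n x = 1 :=
  (cutoff n).one_of_mem_closedBall (by simpa [cutoff] using hx)

lemma cutoff_eq_zero {x : Rn n} (hx : 2 ≤ ‖x‖) : cutoff n x = 0 :=
  (cutoff n).zero_of_le_dist (by simpa [cutoff] using hx)

lemma hasGradientAt_cutoff (x : Rn n) : HasGradientAt (cutoff n) (cutoffGrad n x) x := by
  rw [hasGradientAt_iff_hasFDerivAt, cutoffGrad, LinearIsometryEquiv.apply_symm_apply]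
  exact (((cutoff n).contDiff (n := 1)).differentiable one_ne_zero x).hasFDerivAt

lemma continuous_cutoffGrad : Continuous (cutoffGrad n) :=
  (LinearIsometryEquiv.continuous _).comp
    (((cutoff n).contDiff (n := 1)).continuous_fderiv one_ne_zero)

lemma cutoffGrad_eq_zero_of_lt {x : Rn n} (hx : ‖x‖ < 1) : cutoffGrad n x = 0 := by
  have : (cutoff n : Rn n → ℝ) =ᶠ[𝓝 x] fun _ => 1 := by
    filter_upwards [Metric.isOpen_ball.mem_nhds (mem_ball_zero_iff.2 hx)] with y hy
    exact cutoff_eq_one (mem_ball_zero_iff.1 hy).le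
  rw [cutoffGrad, this.fderiv_eq]
  simp

lemma cutoffGrad_eq_zero_of_gt {x : Rn n} (hx : 2 < ‖x‖) : cutoffGrad n x = 0 := by
  have : (cutoff n : Rn n → ℝ) =ᶠ[𝓝 x] fun _ => 0 := by
    filter_upwards [(isOpen_lt continuous_const continuous_norm).mem_nhds hx] with y hy
    exact cutoff_eq_zero (show (2 : ℝ) < ‖y‖ from hy).le
  rw [cutoffGrad, this.fderiv_eq]
  simp

lemma exists_enorm_cutoffGrad_le (n : ℕ) : ∃ L : ℝ≥0, ∀ x : Rn n, ‖cutoffGrad n x‖ₑ ≤ L := by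
  have hs : HasCompactSupport (cutoffGrad n) :=
    HasCompactSupport.of_support_subset_isCompact (isCompact_closedBall (0 : Rn n) 2) fun x hx => by
      by_contra h
      exact hx (cutoffGrad_eq_zero_of_gt (by simpa using h))
  obtain ⟨C, hC⟩ := hs.exists_bound_of_continuous continuous_cutoffGrad
  refine ⟨C.toNNReal, fun x => ?_⟩
  rw [← ofReal_norm]
  exact ENNReal.ofReal_le_ofReal (hC x)

lemma tendsto_norm_indicator_compl (hρ : IsBallBanach ρ) (hac : HasAbsolutelyContinuousNorm ρ)
    {g : Rn n → ℝ≥0∞} (hg : Measurable g) (hgfin : ρ g < ∞) :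
    Tendsto (fun N : ℕ => ρ ({y | ((N : ℝ) + 1) / 10 ≤ ‖y‖}.indicator g)) atTop (𝓝 0) := by
  have hA : ∀ N : ℕ, MeasurableSet {y : Rn n | ((N : ℝ) + 1) / 10 ≤ ‖y‖} := fun N =>
    measurableSet_le measurable_const measurable_norm
  refine tendsto_norm_zero_of_dominated hρ hac hg.aemeasurable hgfin
    (fun N => (hg.indicator (hA N)).aemeasurable)
    (fun N => Eventually.of_forall fun x => indicator_le_self' (fun _ _ => bot_le) x)
    (Eventually.of_forall fun x => ?_)
  obtain ⟨N0, hN0⟩ := exists_nat_gt (10 * ‖x‖)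
  refine tendsto_const_nhds.congr' ?_
  filter_upwards [eventually_ge_atTop N0] with N hN
  have hN' : (N0 : ℝ) ≤ N := by exact_mod_cast hN
  rw [indicator_of_notMem]
  rw [mem_ofPred_eq, not_le, lt_div_iff₀ (by norm_num)]
  linarith

/-- In dimension at least two, `F` is replaced by `c + χ (F - c)` with a cutoff function `χ` at scale `R`
and the mean `c` of `F` over a distant ball; the Poincaré inequality on the annulus bounds
`(F - c) ∇χ` by averages of `|∇F|` away from the origin. -/
lemma exists_isNice_of_two_le {p : ℝ} (hp : 1 ≤ p) (hn : 2 ≤ n) (hρ : IsBallBanach ρ)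
    (hY : IsBallBanach (convexify ρ (1 / p)))
    (ht : maximalOpNorm (associate (convexify ρ (1 / p))) < ∞)
    (hac : HasAbsolutelyContinuousNorm ρ) {F : Rn n → ℝ} {K : Rn n → Rn n}
    (h : HasContGradient F K) (hfin : ρ (fun x => ‖K x‖ₑ) < ∞) {ε : ℝ≥0∞} (hε : 0 < ε) (N : ℕ) :
    ∃ (f : Rn n → ℝ) (k : Rn n → Rn n), IsNice f k ∧ (∀ x, ‖x‖ < N → f x = F x) ∧
      ρ (fun x => ‖k x - K x‖ₑ) ≤ ε := by
  obtain ⟨L, hL⟩ := exists_enorm_cutoffGrad_le n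
  set M := (maximalOpNorm (associate (convexify ρ (1 / p))) +
      maximalOpNorm (associate (convexify ρ (1 / p))) ^ 2) ^ (1 / p) with hM
  have hMt : M ≠ ∞ := by
    refine ENNReal.rpow_ne_top_of_nonneg (by positivity) (ENNReal.add_ne_top.2 ⟨ht.ne, ?_⟩)
    exact ENNReal.pow_ne_top ht.ne
  set κ : ℝ≥0 := (80 : ℝ≥0) ^ (n : ℝ) with hκ
  have hκ' : (κ : ℝ≥0∞) = ENNReal.ofReal (80 ^ (n : ℝ)) := by
    rw [ENNReal.ofReal, Real.toNNReal_of_nonneg (by positivity)]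
    congr 1
  set D : ℝ≥0∞ := 1 + (κ * 8 * L : ℝ≥0) * (M + κ * (M * M)) with hD
  have hDt : D ≠ ∞ := by
    refine ENNReal.add_ne_top.2 ⟨ENNReal.one_ne_top, ENNReal.mul_ne_top ENNReal.coe_ne_top ?_⟩
    exact ENNReal.add_ne_top.2 ⟨hMt, ENNReal.mul_ne_top ENNReal.coe_ne_top (ENNReal.mul_ne_top hMt hMt)⟩
  have hgm : Measurable fun x => ‖K x‖ₑ := h.continuous_grad.enorm.measurable
  have hlim : Tendsto (fun N : ℕ => D * ρ ({y | ((N : ℝ) + 1) / 10 ≤ ‖y‖}.indicator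
      fun y => ‖K y‖ₑ)) atTop (𝓝 0) := by
    have := ENNReal.Tendsto.const_mul (tendsto_norm_indicator_compl hρ hac hgm hfin) (Or.inr hDt)
    simpa using this
  obtain ⟨m, hm, hmN⟩ := (((ENNReal.tendsto_nhds_zero.1 hlim) ε hε).and
    (eventually_ge_atTop N)).exists
  set R : ℝ := (m : ℝ) + 1 with hRdef
  have hR : 0 < R := by positivity
  have hNR : (N : ℝ) ≤ R := by
    have : (N : ℝ) ≤ m := by exact_mod_cast hmN
    linarith
  set v : Rn n := EuclideanSpace.single ⟨0, by omega⟩ 1 with hv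
  set w : Rn n := EuclideanSpace.single ⟨1, by omega⟩ 1 with hw
  have hv1 : ‖v‖ = 1 := by simp [hv]
  have hw1 : ‖w‖ = 1 := by simp [hw]
  have hvw : inner ℝ v w = 0 := by
    rw [hv, hw, EuclideanSpace.inner_single_left]
    simp
  set c := ⨍ z in Metric.ball ((3 * R) • v) (R / 10), F z with hc
  set A : Set (Rn n) := {y | R / 10 ≤ ‖y‖} with hAdef
  have hA : MeasurableSet A := measurableSet_le measurable_const measurable_norm
  set g := A.indicator fun y => ‖K y‖ₑ with hg
  have hgm' : Measurable g := hgm.indicator hA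
  have hgfin : ρ g < ∞ := (hρ.mono _ _ hgm'.aemeasurable hgm.aemeasurable
    (Eventually.of_forall fun x => indicator_le_self' (fun _ _ => bot_le) x)).trans_lt hfin
  have h8 : 0 < 8 * R := by positivity
  set u := radialAvg (8 * R) g with hu
  have hum : Measurable u := measurable_radialAvg hgm' _
  have hu1 : ρ u ≤ M * ρ g := norm_radialAvg_le hp hY ht hgm' hgfin h8
  have hufin : ρ u < ∞ := hu1.trans_lt (ENNReal.mul_lt_top hMt.lt_top hgfin)
  have hu2 : ρ (ballAvg (8 * R) u) ≤ M * (M * ρ g) :=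
    (norm_ballAvg_le hp hY ht hum hufin h8).trans (mul_le_mul_right hu1 _)
  have hbm : Measurable (ballAvg (8 * R) u) := measurable_ballAvg hum _
  set χ : Rn n → ℝ := fun x => cutoff n (R⁻¹ • x) with hχ
  have hsc : ∀ x : Rn n, ‖R⁻¹ • x‖ = ‖x‖ / R := fun x => by
    rw [norm_smul, Real.norm_of_nonneg (by positivity), div_eq_inv_mul]
  set k : Rn n → Rn n := fun x => χ x • K x + ((F x - c) * R⁻¹) • cutoffGrad n (R⁻¹ • x) with hk
  have hχc : Continuous χ := (cutoff n).continuous.comp (continuous_const_smul _)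
  have hNc : Continuous fun x : Rn n => cutoffGrad n (R⁻¹ • x) :=
    continuous_cutoffGrad.comp (continuous_const_smul _)
  have hFc := h.continuous
  refine ⟨fun x => c + χ x * (F x - c), k, ⟨⟨fun x => ?_, ?_⟩, ?_, fun _ => ?_⟩, fun x hx => ?_, ?_⟩
  · have h1 : HasFDerivAt χ (R⁻¹ • InnerProductSpace.toDual ℝ (Rn n) (cutoffGrad n (R⁻¹ • x))) x := by
      have h2 := (hasGradientAt_cutoff (R⁻¹ • x)).hasFDerivAt.comp x
        ((hasFDerivAt_id x).const_smul R⁻¹)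
      refine h2.congr_fderiv ?_
      ext y
      simp
    have h3 := ((h1.mul ((h.hasGradientAt x).hasFDerivAt.sub_const c)).const_add c)
    rw [hasGradientAt_iff_hasFDerivAt]
    refine h3.congr_fderiv ?_
    rw [hk]
    simp only [map_add, map_smul]
    ext y
    simp
    ring
  · rw [hk]
    have := h.continuous_grad
    fun_prop
  · refine HasCompactSupport.of_support_subset_isCompact (isCompact_closedBall (0 : Rn n) (2 * R))
      fun x hx => ?_
    by_contra hx2
    rw [mem_closedBall_zero_iff, not_le] at hx2
    have : 2 < ‖R⁻¹ • x‖ := by rw [hsc, lt_div_iff₀ hR]; exact hx2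
    refine hx ?_
    rw [hk]
    simp only [hχ, cutoff_eq_zero this.le, cutoffGrad_eq_zero_of_gt this, zero_smul, smul_zero,
      add_zero]
  · refine ⟨c, 2 * R, fun x hx => ?_⟩
    have : 2 ≤ ‖R⁻¹ • x‖ := by rw [hsc, le_div_iff₀ hR]; exact hx
    simp only [hχ, cutoff_eq_zero this, zero_mul, add_zero]
  · have : ‖R⁻¹ • x‖ ≤ 1 := by rw [hsc, div_le_one hR]; linarith
    simp only [hχ, cutoff_eq_one this]
    ring
  · have hpt : ∀ x, ‖k x - K x‖ₑ ≤ g x + (κ * 8 * L : ℝ≥0) * (u x + κ * ballAvg (8 * R) u x) := by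
      intro x
      have e : k x - K x = (χ x - 1) • K x + ((F x - c) * R⁻¹) • cutoffGrad n (R⁻¹ • x) := by
        rw [hk]; module
      rw [e]
      refine (enorm_add_le _ _).trans (add_le_add ?_ ?_)
      · by_cases hx : R / 10 ≤ ‖x‖
        · rw [hg, indicator_of_mem (by exact hx), enorm_smul]
          have h1 : ‖χ x - 1‖ₑ ≤ 1 := by
            rw [← ofReal_norm, ← ENNReal.ofReal_one]
            refine ENNReal.ofReal_le_ofReal ?_
            rw [Real.norm_eq_abs, abs_le]
            have h2 := (cutoff n).nonneg (x := R⁻¹ • x)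
            have h3 := (cutoff n).le_one (x := R⁻¹ • x)
            constructor <;> simp only [hχ] <;> linarith
          calc _ ≤ 1 * ‖K x‖ₑ := mul_le_mul_left h1 _
            _ = _ := one_mul _
        · have : ‖R⁻¹ • x‖ ≤ 1 := by rw [hsc, div_le_one hR]; linarith
          simp [hχ, cutoff_eq_one this]
      · by_cases hx : ‖R⁻¹ • x‖ < 1
        · rw [cutoffGrad_eq_zero_of_lt hx]; simp
        by_cases hx2 : 2 < ‖R⁻¹ • x‖
        · rw [cutoffGrad_eq_zero_of_gt hx2]; simp
        rw [hsc, not_lt, le_div_iff₀ hR] at hx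
        rw [hsc, not_lt, div_le_iff₀ hR] at hx2
        have hP := h.enorm_sub_average_le_annulus hR hv1 hw1 hvw (by linarith) (by linarith)
          (x := x)
        rw [enorm_smul, enorm_mul]
        have hRe : ‖R⁻¹‖ₑ = ENNReal.ofReal R⁻¹ := Real.enorm_of_nonneg (by positivity)
        calc _ ≤ (ENNReal.ofReal (80 ^ (n : ℝ) * (8 * R)) *
              (u x + ENNReal.ofReal (80 ^ (n : ℝ)) * ballAvg (8 * R) u x)) * ENNReal.ofReal R⁻¹ * L := by
              rw [hRe]
              exact mul_le_mul' (mul_le_mul_left hP _) (hL _)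
          _ = (ENNReal.ofReal (80 ^ (n : ℝ) * (8 * R)) * ENNReal.ofReal R⁻¹) * L *
              (u x + ENNReal.ofReal (80 ^ (n : ℝ)) * ballAvg (8 * R) u x) := by ring
          _ = _ := by
              rw [← ENNReal.ofReal_mul (by positivity), mul_assoc ((80 : ℝ) ^ (n : ℝ)),
                mul_inv_cancel_right₀ hR.ne', ENNReal.ofReal_mul (by positivity), ← hκ',
                ENNReal.coe_mul, ENNReal.coe_mul, ENNReal.ofReal_ofNat]
              norm_num
    calc _ ≤ ρ (fun x => g x + (κ * 8 * L : ℝ≥0) * (u x + κ * ballAvg (8 * R) u x)) := by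
          refine hρ.mono _ _ ?_ ?_ (Eventually.of_forall hpt)
          · rw [hk]
            have := h.continuous_grad
            exact (Continuous.measurable (by fun_prop)).aemeasurable
          · exact (hgm'.add ((hum.add (hbm.const_mul _)).const_mul _)).aemeasurable
      _ ≤ ρ g + (κ * 8 * L : ℝ≥0) * (ρ u + κ * ρ (ballAvg (8 * R) u)) := by
          refine (hρ.add_le _ _ hgm'.aemeasurable
            ((hum.add (hbm.const_mul _)).const_mul _).aemeasurable).trans (add_le_add le_rfl ?_)
          rw [hρ.smul _ _ (hum.add (hbm.const_mul _)).aemeasurable]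
          refine mul_le_mul_right ((hρ.add_le _ _ hum.aemeasurable
            (hbm.const_mul _).aemeasurable).trans ?_) _
          rw [hρ.smul _ _ hbm.aemeasurable]
      _ ≤ ρ g + (κ * 8 * L : ℝ≥0) * (M * ρ g + κ * (M * (M * ρ g))) :=
          add_le_add le_rfl (mul_le_mul_right (add_le_add hu1 (mul_le_mul_right hu2 _)) _)
      _ = D * ρ g := by rw [hD]; ring
      _ ≤ ε := hm

end NiceApproximation

section NiceApproximation

variable {n : ℕ} {ρ : FunctionNorm n}

/-- In dimension one the derivative is cut off and integrated again. -/
lemma exists_isNice_line {ρ : FunctionNorm 1} (hρ : IsBallBanach ρ)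
    (hac : HasAbsolutelyContinuousNorm ρ) {F : Rn 1 → ℝ} {K : Rn 1 → Rn 1}
    (h : HasContGradient F K) (hfin : ρ (fun x => ‖K x‖ₑ) < ∞) {ε : ℝ≥0∞} (hε : 0 < ε) (N : ℕ) :
    ∃ (f : Rn 1 → ℝ) (k : Rn 1 → Rn 1), IsNice f k ∧ (∀ x, ‖x‖ < N → f x = F x) ∧
      ρ (fun x => ‖k x - K x‖ₑ) ≤ ε := by
  have hgm : Measurable fun x => ‖K x‖ₑ := h.continuous_grad.enorm.measurable
  obtain ⟨m, hm, hmN⟩ := (((ENNReal.tendsto_nhds_zero.1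
    (tendsto_norm_indicator_compl hρ hac hgm hfin)) ε hε).and (eventually_ge_atTop N)).exists
  set R : ℝ := (m : ℝ) + 1 with hRdef
  have hR : 0 < R := by positivity
  have hNR : (N : ℝ) ≤ R := by
    have : (N : ℝ) ≤ m := by exact_mod_cast hmN
    linarith
  set χ : Rn 1 → ℝ := fun x => cutoff 1 (R⁻¹ • x) with hχ
  have hsc : ∀ x : Rn 1, ‖R⁻¹ • x‖ = ‖x‖ / R := fun x => by
    rw [norm_smul, Real.norm_of_nonneg (by positivity), div_eq_inv_mul]
  have hχc : Continuous χ := (cutoff 1).continuous.comp (continuous_const_smul _)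
  have hχ1 : ∀ x, ‖x‖ ≤ R → χ x = 1 := fun x hx => by
    have : ‖R⁻¹ • x‖ ≤ 1 := by rw [hsc, div_le_one hR]; exact hx
    exact cutoff_eq_one this
  set k : Rn 1 → Rn 1 := fun x => χ x • K x with hk
  have hkc : Continuous k := hχc.smul h.continuous_grad
  set φ : ℝ → ℝ := fun s => inner ℝ (k (lineEquiv s)) (lineEquiv 1) with hφ
  have hφc : Continuous φ := (hkc.comp lineEquiv.continuous).inner continuous_const
  set f : Rn 1 → ℝ := fun x => F 0 + ∫ s in (0 : ℝ)..lineEquiv.symm x, φ s with hf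
  have hgrad : HasContGradient f k := by
    refine ⟨fun x => ?_, hkc⟩
    have h1 : HasDerivAt (fun a => ∫ s in (0 : ℝ)..a, φ s) (φ (lineEquiv.symm x))
        (lineEquiv.symm x) := intervalIntegral.integral_hasDerivAt_right
      (hφc.intervalIntegrable _ _) (hφc.stronglyMeasurableAtFilter _ _) hφc.continuousAt
    have h2 : HasFDerivAt (fun x : Rn 1 => lineEquiv.symm x)
        (lineEquiv.symm.toContinuousLinearEquiv : Rn 1 →L[ℝ] ℝ) x :=
      (lineEquiv.symm.toContinuousLinearEquiv : Rn 1 →L[ℝ] ℝ).hasFDerivAt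
    have h3 := (h1.hasFDerivAt.comp x h2).const_add (F 0)
    rw [hasGradientAt_iff_hasFDerivAt]
    refine h3.congr_fderiv ?_
    ext y
    obtain ⟨b, rfl⟩ := lineEquiv.surjective y
    have e : lineEquiv b = b • lineEquiv 1 := by rw [← map_smul]; simp
    rw [InnerProductSpace.toDual_apply_apply]
    conv_rhs => rw [e, inner_smul_right]
    simp [hφ]
  refine ⟨f, k, ⟨hgrad, ?_, fun h2 => absurd h2 (by norm_num)⟩, fun x hx => ?_, ?_⟩
  · refine HasCompactSupport.of_support_subset_isCompact (isCompact_closedBall (0 : Rn 1) (2 * R))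
      fun x hx => ?_
    by_contra hx2
    rw [mem_closedBall_zero_iff, not_le] at hx2
    have : 2 < ‖R⁻¹ • x‖ := by rw [hsc, lt_div_iff₀ hR]; exact hx2
    refine hx ?_
    simp only [hk, hχ, cutoff_eq_zero this.le, zero_smul]
  · have h1 := hgrad.sub_eq_integral 0 x
    have h2 := h.sub_eq_integral 0 x
    have h3 : ∫ t in (0 : ℝ)..1, (inner ℝ (k (0 + t • x)) x : ℝ) =
        ∫ t in (0 : ℝ)..1, (inner ℝ (K (0 + t • x)) x : ℝ) := by
      refine intervalIntegral.integral_congr fun t ht => ?_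
      rw [uIcc_of_le zero_le_one] at ht
      have : ‖(0 : Rn 1) + t • x‖ ≤ R := by
        rw [zero_add, norm_smul, Real.norm_of_nonneg ht.1]
        nlinarith [ht.2, norm_nonneg x]
      simp only [hk, hχ1 _ this, one_smul]
    have h4 : f 0 = F 0 := by simp [hf]
    rw [h3, ← h2, h4, zero_add] at h1
    linarith
  · refine (hρ.mono _ _ (hkc.sub h.continuous_grad).enorm.measurable.aemeasurable
      (hgm.indicator (measurableSet_le measurable_const measurable_norm)).aemeasurable
      (Eventually.of_forall fun x => ?_)).trans hm
    have e : k x - K x = (χ x - 1) • K x := by rw [hk]; module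
    change ‖k x - K x‖ₑ ≤ _
    rw [e]
    by_cases hx : R / 10 ≤ ‖x‖
    · rw [indicator_of_mem (by exact hx), enorm_smul]
      have h1 : ‖χ x - 1‖ₑ ≤ 1 := by
        rw [← ofReal_norm, ← ENNReal.ofReal_one]
        refine ENNReal.ofReal_le_ofReal ?_
        rw [Real.norm_eq_abs, abs_le]
        have h2 := (cutoff 1).nonneg (x := R⁻¹ • x)
        have h3 := (cutoff 1).le_one (x := R⁻¹ • x)
        constructor <;> simp only [hχ] <;> linarith
      calc _ ≤ 1 * ‖K x‖ₑ := mul_le_mul_left h1 _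
        _ = _ := one_mul _
    · rw [hχ1 x (by linarith)]
      simp

lemma exists_isNice {p : ℝ} (hp : 1 ≤ p) (hn : 1 ≤ n) (hρ : IsBallBanach ρ)
    (hY : IsBallBanach (convexify ρ (1 / p)))
    (ht : maximalOpNorm (associate (convexify ρ (1 / p))) < ∞)
    (hac : HasAbsolutelyContinuousNorm ρ) {F : Rn n → ℝ} {K : Rn n → Rn n}
    (h : HasContGradient F K) (hfin : ρ (fun x => ‖K x‖ₑ) < ∞) {ε : ℝ≥0∞} (hε : 0 < ε) (N : ℕ) :
    ∃ (f : Rn n → ℝ) (k : Rn n → Rn n), IsNice f k ∧ (∀ x, ‖x‖ < N → f x = F x) ∧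
      ρ (fun x => ‖k x - K x‖ₑ) ≤ ε := by
  obtain rfl | hn2 := hn.eq_or_lt
  · exact exists_isNice_line hρ hac h hfin hε N
  · exact exists_isNice_of_two_le hp hn2 hρ hY ht hac h hfin hε N

/-- Every function with gradient in `X` is approximated by nice functions, almost everywhere and,
on the level of gradients, in `X`. -/
lemma exists_isNice_seq {p : ℝ} (hp : 1 ≤ p) (hn : 1 ≤ n) (hρ : IsBallBanach ρ)
    (hY : IsBallBanach (convexify ρ (1 / p)))
    (ht : maximalOpNorm (associate (convexify ρ (1 / p))) < ∞)
    (hac : HasAbsolutelyContinuousNorm ρ) {T : 𝓓'((⊤ : Opens (Rn n)), ℝ)} {G : Rn n → Rn n}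
    (h : IsGradient T G) (hGm : Measurable G) (hG : LocallyIntegrable G volume)
    (hfin : ρ (fun x => ‖G x‖ₑ) < ∞) {f : Rn n → ℝ} (hf : IsFunction T f) :
    ∃ (u : ℕ → Rn n → ℝ) (K : ℕ → Rn n → Rn n), (∀ j, IsNice (u j) (K j)) ∧
      (∀ᵐ x, Tendsto (fun j => u j x) atTop (𝓝 (f x))) ∧
      Tendsto (fun j => ρ (fun x => ‖K j x - G x‖ₑ)) atTop (𝓝 0) := by
  have hgm : Measurable fun x => ‖G x‖ₑ := hGm.enorm
  have hMt : (maximalOpNorm (associate (convexify ρ (1 / p))) +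
      maximalOpNorm (associate (convexify ρ (1 / p))) ^ 2) ^ (1 / p) < ∞ :=
    (ENNReal.rpow_ne_top_of_nonneg (by positivity)
      (ENNReal.add_ne_top.2 ⟨ht.ne, ENNReal.pow_ne_top ht.ne⟩)).lt_top
  have hKfin : ∀ j, ρ (fun x => ‖mollify j G x‖ₑ) < ∞ := by
    intro j
    have hr : (0 : ℝ) < 1 / (j + 1) := by positivity
    have hbm := measurable_ballAvg hgm (1 / ((j : ℝ) + 1))
    have h1 : ρ (fun x => ‖mollify j G x‖ₑ) ≤
        ρ (fun x => (((2 ^ (n : ℝ) : ℝ).toNNReal : ℝ≥0) : ℝ≥0∞) *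
          ballAvg (1 / (j + 1)) (fun y => ‖G y‖ₑ) x) :=
      hρ.mono _ _ (continuous_mollify j hG).enorm.measurable.aemeasurable
        (hbm.const_mul _).aemeasurable (Eventually.of_forall fun x => enorm_mollify_le j G x)
    rw [hρ.smul _ _ hbm.aemeasurable] at h1
    exact h1.trans_lt (ENNReal.mul_lt_top ENNReal.coe_lt_top
      ((norm_ballAvg_le hp hY ht hgm hfin hr).trans_lt (ENNReal.mul_lt_top hMt hfin)))
  have hex : ∀ j : ℕ, ∃ (u : Rn n → ℝ) (K : Rn n → Rn n), IsNice u K ∧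
      (∀ x, ‖x‖ < j → u x = mollify j f x) ∧
      ρ (fun x => ‖K x - mollify j G x‖ₑ) ≤ ((j : ℝ≥0∞) + 1)⁻¹ := fun j =>
    exists_isNice hp hn hρ hY ht hac (hasContGradient_mollify h hG hf j) (hKfin j)
      (ENNReal.inv_pos.2 (by simp)) j
  choose u K hnice heq herr using hex
  refine ⟨u, K, hnice, ?_, ?_⟩
  · filter_upwards [ae_tendsto_mollify hf.1] with x hx
    refine hx.congr' ?_
    obtain ⟨N0, hN0⟩ := exists_nat_gt ‖x‖
    filter_upwards [eventually_ge_atTop N0] with j hj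
    have hj' : (N0 : ℝ) ≤ j := by exact_mod_cast hj
    exact (heq j x (by linarith)).symm
  · have h0 : Tendsto (fun j : ℕ => ((j : ℝ≥0∞) + 1)⁻¹ + ρ (fun x => ‖mollify j G x - G x‖ₑ))
        atTop (𝓝 0) := by
      have h1 : Tendsto (fun j : ℕ => ((j : ℝ≥0∞) + 1)⁻¹) atTop (𝓝 0) := by
        have := (tendsto_add_atTop_iff_nat 1).2 ENNReal.tendsto_inv_nat_nhds_zero
        simpa using this
      simpa using h1.add (tendsto_norm_mollify_sub hp hρ hY ht hac hGm hG hfin)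
    refine tendsto_of_tendsto_of_tendsto_of_le_of_le tendsto_const_nhds h0 (fun _ => bot_le)
      fun j => ?_
    have hKm : Measurable (K j) := (hnice j).continuous_grad.measurable
    have hMm : Measurable (mollify j G) := (continuous_mollify j hG).measurable
    refine (hρ.mono _ _ (hKm.sub hGm).enorm.aemeasurable
      ((hKm.sub hMm).enorm.add (hMm.sub hGm).enorm).aemeasurable
      (Eventually.of_forall fun x => ?_)).trans ((hρ.add_le _ _ (hKm.sub hMm).enorm.aemeasurable
      (hMm.sub hGm).enorm.aemeasurable).trans (add_le_add (herr j) le_rfl))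
    have e : K j x - G x = (K j x - mollify j G x) + (mollify j G x - G x) := by abel
    change ‖K j x - G x‖ₑ ≤ ‖K j x - mollify j G x‖ₑ + ‖mollify j G x - G x‖ₑ
    rw [e]
    exact enorm_add_le _ _

end NiceApproximation

/-! ### Polar coordinates and the constant `κ(q, n)` -/

section Polar

variable {n : ℕ}

lemma lintegral_polar {h : Rn n → ℝ≥0∞} (hn : 1 ≤ n) (hh : Measurable h) :
    ∫⁻ w, h w = ∫⁻ ω : Metric.sphere (0 : Rn n) 1,
      (∫⁻ r in Ioi (0 : ℝ), ENNReal.ofReal (r ^ (n - 1)) * h (r • (ω : Rn n)))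
        ∂(volume : Measure (Rn n)).toSphere := by
  have : Nontrivial (Rn n) := by
    have : Nonempty (Fin n) := ⟨⟨0, by omega⟩⟩
    infer_instance
  have hmp := (volume : Measure (Rn n)).measurePreserving_homeomorphUnitSphereProd
  rw [finrank_euclideanSpace_fin] at hmp
  set Φ := homeomorphUnitSphereProd (Rn n) with hΦ
  have hg : Measurable fun z : Metric.sphere (0 : Rn n) 1 × Ioi (0 : ℝ) =>
      h ((z.2 : ℝ) • (z.1 : Rn n)) := hh.comp (by fun_prop)
  have hgr : ∀ ω : Metric.sphere (0 : Rn n) 1, Measurable fun r : ℝ => h (r • (ω : Rn n)) :=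
    fun ω => hh.comp (by fun_prop)
  calc ∫⁻ w, h w = ∫⁻ w in ({0}ᶜ : Set (Rn n)), h w := by rw [restrict_compl_singleton]
    _ = ∫⁻ w : ({0}ᶜ : Set (Rn n)), h w ∂(volume.comap Subtype.val) :=
        (lintegral_subtype_comap (measurableSet_singleton _).compl _).symm
    _ = ∫⁻ w : ({0}ᶜ : Set (Rn n)), h (((Φ w).2 : ℝ) • ((Φ w).1 : Rn n)) ∂(volume.comap Subtype.val) := by
        refine lintegral_congr fun w => ?_
        have := homeomorphUnitSphereProd_symm_apply_coe (Rn n) (Φ w)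
        rw [← this, hΦ, Homeomorph.symm_apply_apply]
    _ = ∫⁻ z, h ((z.2 : ℝ) • (z.1 : Rn n))
          ∂((volume : Measure (Rn n)).toSphere.prod (Measure.volumeIoiPow (n - 1))) :=
        hmp.lintegral_comp hg
    _ = ∫⁻ ω, (∫⁻ r, h ((r : ℝ) • (ω : Rn n)) ∂(Measure.volumeIoiPow (n - 1)))
          ∂(volume : Measure (Rn n)).toSphere := lintegral_prod _ hg.aemeasurable
    _ = _ := by
        refine lintegral_congr fun ω => ?_
        rw [Measure.volumeIoiPow, lintegral_withDensity_eq_lintegral_mul _ (by fun_prop)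
          (show Measurable fun r : Ioi (0 : ℝ) => h ((r : ℝ) • (ω : Rn n)) from
            (hgr ω).comp measurable_subtype_coe)]
        exact lintegral_subtype_comap measurableSet_Ioi
          fun r : ℝ => ENNReal.ofReal (r ^ (n - 1)) * h (r • (ω : Rn n))

/-- The radial integral: the condition `r^{γ/q} < a` bounds `r` by `a^{q/γ}` from above if `γ > 0` and
from below if `γ < 0`. -/
lemma lintegral_radial {q γ a : ℝ} (hγ : γ ≠ 0) (hq : 0 < q) (ha : 0 ≤ a) :
    ∫⁻ r in Ioi (0 : ℝ), ({r : ℝ | r ^ (γ / q) < a}).indicator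
      (fun r => ENNReal.ofReal (r ^ (γ - 1))) r = ENNReal.ofReal (a ^ q / |γ|) := by
  have hm : MeasurableSet {r : ℝ | r ^ (γ / q) < a} :=
    measurableSet_lt (by fun_prop) measurable_const
  rw [setLIntegral_indicator hm]
  rcases ha.eq_or_lt with rfl | ha
  · have : {r : ℝ | r ^ (γ / q) < 0} ∩ Ioi 0 = ∅ := by
      ext r
      simp only [mem_inter_iff, mem_ofPred_eq, mem_Ioi, mem_empty_iff_false, iff_false, not_and]
      intro h1 h2
      exact absurd h1 (not_lt.2 (Real.rpow_nonneg h2.le _))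
    rw [this, Real.zero_rpow hq.ne']
    simp
  set A := a ^ (q / γ) with hA
  have hA0 : 0 < A := Real.rpow_pos_of_pos ha _
  have hAa : A ^ (γ / q) = a := by
    rw [hA, ← Real.rpow_mul ha.le, div_mul_div_cancel₀ hγ, div_self hq.ne', Real.rpow_one]
  have hAq : A ^ γ = a ^ q := by
    rw [hA, ← Real.rpow_mul ha.le, div_mul_cancel₀ _ hγ]
  rcases lt_or_gt_of_ne hγ with hneg | hpos
  · have hset : {r : ℝ | r ^ (γ / q) < a} ∩ Ioi 0 = Ioi A := by
      ext r
      simp only [mem_inter_iff, mem_ofPred_eq, mem_Ioi]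
      constructor
      · rintro ⟨h1, h2⟩
        rw [← hAa] at h1
        exact (Real.rpow_lt_rpow_iff_of_neg h2 hA0 (div_neg_of_neg_of_pos hneg hq)).1 h1
      · intro h
        refine ⟨?_, hA0.trans h⟩
        rw [← hAa]
        exact (Real.rpow_lt_rpow_iff_of_neg (hA0.trans h) hA0 (div_neg_of_neg_of_pos hneg hq)).2 h
    rw [hset, ← ofReal_integral_eq_lintegral_ofReal
      (integrableOn_Ioi_rpow_of_lt (by linarith) hA0), integral_Ioi_rpow_of_lt (by linarith) hA0]
    · rw [sub_add_cancel, hAq, abs_of_neg hneg, neg_div, div_neg]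
    · filter_upwards [ae_restrict_mem measurableSet_Ioi] with r hr
      exact Real.rpow_nonneg (hA0.trans hr).le _
  · have hset : {r : ℝ | r ^ (γ / q) < a} ∩ Ioi 0 = Ioo 0 A := by
      ext r
      simp only [mem_inter_iff, mem_ofPred_eq, mem_Ioi, mem_Ioo]
      constructor
      · rintro ⟨h1, h2⟩
        rw [← hAa] at h1
        exact ⟨h2, (Real.rpow_lt_rpow_iff h2.le hA0.le (by positivity)).1 h1⟩
      · rintro ⟨h2, h⟩
        refine ⟨?_, h2⟩
        rw [← hAa]
        exact (Real.rpow_lt_rpow_iff h2.le hA0.le (by positivity)).2 h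
    have hint : IntervalIntegrable (fun r : ℝ => r ^ (γ - 1)) volume 0 A :=
      intervalIntegral.intervalIntegrable_rpow' (by linarith)
    rw [hset, restrict_Ioo_eq_restrict_Ioc, ← ofReal_integral_eq_lintegral_ofReal
      ((intervalIntegrable_iff_integrableOn_Ioc_of_le hA0.le).1 hint),
      ← intervalIntegral.integral_of_le hA0.le, integral_rpow (Or.inl (by linarith))]
    · rw [sub_add_cancel, hAq, abs_of_pos hpos, Real.zero_rpow hγ, sub_zero]
    · filter_upwards [ae_restrict_mem measurableSet_Ioc] with r hr
      exact Real.rpow_nonneg hr.1.le _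

/-- The limit of the rescaled level integrals: the level integral of the linear function
`w ↦ v ⬝ w`. -/
def linearIntegral (q γ : ℝ) (v : Rn n) : ℝ≥0∞ :=
  ∫⁻ w, ({w : Rn n | w ≠ 0 ∧ ‖w‖ ^ (1 + γ / q) < |inner ℝ v w|}).indicator
    (fun w => ENNReal.ofReal (‖w‖ ^ (γ - n))) w

lemma measurableSet_linear (q γ : ℝ) (v : Rn n) :
    MeasurableSet {w : Rn n | w ≠ 0 ∧ ‖w‖ ^ (1 + γ / q) < |inner ℝ v w|} :=
  (measurableSet_singleton (0 : Rn n)).compl.inter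
    (measurableSet_lt (f := fun w : Rn n => ‖w‖ ^ (1 + γ / q)) (g := fun w => |inner ℝ v w|)
      (by fun_prop) (continuous_const.inner continuous_id).abs.measurable)

lemma linearIntegral_eq_sphere (hn : 1 ≤ n) {q γ : ℝ} (hγ : γ ≠ 0) (hq : 0 < q) (v : Rn n) :
    linearIntegral q γ v = ∫⁻ ω : Metric.sphere (0 : Rn n) 1,
      ENNReal.ofReal (|inner ℝ v (ω : Rn n)| ^ q / |γ|) ∂(volume : Measure (Rn n)).toSphere := by
  rw [linearIntegral, lintegral_polar hn
    ((Measurable.indicator (by fun_prop) (measurableSet_linear q γ v)))]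
  refine lintegral_congr fun ω => ?_
  have hω : ‖(ω : Rn n)‖ = 1 := by simp
  rw [← lintegral_radial hγ hq (abs_nonneg _)]
  refine setLIntegral_congr_fun measurableSet_Ioi fun r hr => ?_
  have hr : 0 < r := hr
  have hrω : ‖r • (ω : Rn n)‖ = r := by rw [norm_smul, hω, mul_one, Real.norm_of_nonneg hr.le]
  have hiff : (r • (ω : Rn n) ∈ {w : Rn n | w ≠ 0 ∧ ‖w‖ ^ (1 + γ / q) < |inner ℝ v w|}) ↔
      r ∈ {r : ℝ | r ^ (γ / q) < |inner ℝ v (ω : Rn n)|} := by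
    rw [mem_ofPred_eq, mem_ofPred_eq, hrω, inner_smul_right, abs_mul, abs_of_pos hr,
      Real.rpow_add hr, Real.rpow_one, mul_lt_mul_iff_right₀ hr]
    refine and_iff_right ?_
    rw [← norm_ne_zero_iff, hrω]
    exact hr.ne'
  by_cases h : r ∈ {r : ℝ | r ^ (γ / q) < |inner ℝ v (ω : Rn n)|}
  · rw [indicator_of_mem h, indicator_of_mem (hiff.2 h), hrω, ← ENNReal.ofReal_mul (by positivity),
      ← Real.rpow_natCast, ← Real.rpow_add hr, Nat.cast_sub hn]
    congr 2
    push_cast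
    ring
  · rw [indicator_of_notMem h, indicator_of_notMem (fun h' => h (hiff.1 h')), mul_zero]

lemma linearIntegral_map (A : Rn n ≃ₗᵢ[ℝ] Rn n) (q γ : ℝ) (v : Rn n) :
    linearIntegral q γ (A v) = linearIntegral q γ v := by
  rw [linearIntegral, ← A.measurePreserving.lintegral_comp
    ((Measurable.indicator (by fun_prop) (measurableSet_linear q γ (A v))))]
  refine lintegral_congr fun w => ?_
  have hiff : (A w ∈ {w : Rn n | w ≠ 0 ∧ ‖w‖ ^ (1 + γ / q) < |inner ℝ (A v) w|}) ↔
      w ∈ {w : Rn n | w ≠ 0 ∧ ‖w‖ ^ (1 + γ / q) < |inner ℝ v w|} := by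
    simp only [mem_ofPred_eq, A.norm_map, A.inner_map_map, ne_eq, A.map_eq_zero_iff]
  by_cases h : w ∈ {w : Rn n | w ≠ 0 ∧ ‖w‖ ^ (1 + γ / q) < |inner ℝ v w|}
  · rw [indicator_of_mem h, indicator_of_mem (hiff.2 h), A.norm_map]
  · rw [indicator_of_notMem h, indicator_of_notMem (fun h' => h (hiff.1 h'))]

lemma kappa_nonneg (q : ℝ) (e : Rn n) : 0 ≤ kappa q e :=
  integral_nonneg fun _ => Real.rpow_nonneg (abs_nonneg _) _

/-- The value of the limit; a reflection moves the direction of `v` to any given unit vector. -/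
lemma linearIntegral_eq (hn : 1 ≤ n) {q γ : ℝ} (hγ : γ ≠ 0) (hq : 0 < q) {e : Rn n} (he : ‖e‖ = 1)
    (v : Rn n) : linearIntegral q γ v = ENNReal.ofReal (kappa q e / |γ|) * ‖v‖ₑ ^ q := by
  have h1 : linearIntegral q γ v = linearIntegral q γ (‖v‖ • e) := by
    have hne : ‖(‖v‖ • e)‖ = ‖v‖ := by rw [norm_smul, he, mul_one, norm_norm]
    have := Submodule.reflection_sub hne
    conv_lhs => rw [← this]
    rw [linearIntegral_map]
  have hc : Continuous fun ω : Metric.sphere (0 : Rn n) 1 => |inner ℝ e (ω : Rn n)| ^ q :=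
    Continuous.rpow_const (by fun_prop) fun _ => Or.inr hq.le
  have hint : Integrable (fun ω : Metric.sphere (0 : Rn n) 1 => |inner ℝ e (ω : Rn n)| ^ q)
      (volume : Measure (Rn n)).toSphere :=
    hc.integrable_of_hasCompactSupport (HasCompactSupport.of_compactSpace _)
  rw [h1, linearIntegral_eq_sphere hn hγ hq, kappa, ← integral_div,
    ofReal_integral_eq_lintegral_ofReal (hint.div_const _)
      (Eventually.of_forall fun ω => by positivity), mul_comm,
    ← lintegral_const_mul' _ _ (ENNReal.rpow_ne_top_of_nonneg hq.le enorm_ne_top)]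
  refine lintegral_congr fun ω => ?_
  rw [← ofReal_norm, ENNReal.ofReal_rpow_of_nonneg (norm_nonneg _) hq.le,
    ← ENNReal.ofReal_mul (by positivity), inner_smul_left, abs_mul,
    Real.mul_rpow (abs_nonneg _) (abs_nonneg _), mul_div_assoc]
  simp

/-- The boundary case of the condition in `linearIntegral` has measure zero, since each ray from the
origin contains at most one such point. -/
lemma volume_linear_eq (hn : 1 ≤ n) {q γ : ℝ} (hγ : γ ≠ 0) (hq : 0 < q) (v : Rn n) :
    volume {w : Rn n | ‖w‖ ^ (1 + γ / q) = |inner ℝ v w|} = 0 := by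
  have hm : MeasurableSet {w : Rn n | ‖w‖ ^ (1 + γ / q) = |inner ℝ v w|} :=
    measurableSet_eq_fun (by fun_prop) (continuous_const.inner continuous_id).abs.measurable
  rw [← lintegral_indicator_one hm, lintegral_polar hn (measurable_one.indicator hm)]
  refine (lintegral_congr fun ω => ?_).trans lintegral_zero
  have hω : ‖(ω : Rn n)‖ = 1 := by simp
  set a := |inner ℝ v (ω : Rn n)|
  have hsub : ∀ᵐ r : ℝ, r ≠ a ^ (q / γ) := by
    simp [ae_iff]
  rw [lintegral_eq_zero_iff' (by
    refine AEMeasurable.mul (by fun_prop) (Measurable.aemeasurable ?_)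
    exact (measurable_one.indicator hm).comp (by fun_prop))]
  filter_upwards [ae_restrict_mem measurableSet_Ioi, ae_restrict_of_ae hsub] with r hr hra
  have hr : 0 < r := hr
  have hrω : ‖r • (ω : Rn n)‖ = r := by rw [norm_smul, hω, mul_one, Real.norm_of_nonneg hr.le]
  rw [indicator_of_notMem, mul_zero, Pi.zero_apply]
  rw [mem_ofPred_eq, hrω, inner_smul_right, abs_mul, abs_of_pos hr, Real.rpow_add hr,
    Real.rpow_one]
  intro h
  have h2 : r ^ (γ / q) = a := mul_left_cancel₀ hr.ne' h
  refine hra ?_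
  rw [← h2, ← Real.rpow_mul hr.le, div_mul_div_cancel₀ hq.ne', div_self hγ, Real.rpow_one]

end Polar

/-! ### Rescaling -/

section Scaling

variable {n : ℕ}

/-- The level integral after the substitution `y = x + τ w`, where `l τ^{γ/q} = 1`. -/
def scaledIntegral (q γ τ : ℝ) (f : Rn n → ℝ) (x : Rn n) : ℝ≥0∞ :=
  ∫⁻ w, ({w : Rn n | w ≠ 0 ∧ ‖w‖ ^ (1 + γ / q) < |f (x + τ • w) - f x| / τ}).indicator
    (fun w => ENNReal.ofReal (‖w‖ ^ (γ - n))) w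

lemma measurableSet_scaled {f : Rn n → ℝ} (hf : Measurable f) (q γ τ : ℝ) (x : Rn n) :
    MeasurableSet {w : Rn n | w ≠ 0 ∧ ‖w‖ ^ (1 + γ / q) < |f (x + τ • w) - f x| / τ} := by
  have h1 : Measurable fun w : Rn n => |f (x + τ • w) - f x| / τ := by
    have h2 : Measurable fun w : Rn n => f (x + τ • w) - f x :=
      (hf.comp (by fun_prop)).sub measurable_const
    exact h2.abs.div_const τ
  exact (measurableSet_singleton (0 : Rn n)).compl.inter
    (measurableSet_lt (f := fun w : Rn n => ‖w‖ ^ (1 + γ / q)) (by fun_prop) h1)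

/-- The substitution `y = x + τ w` in the level integral. -/
lemma rpow_mul_levelIntegral {f : Rn n → ℝ} (hf : Measurable f) {q γ τ l : ℝ} (hq : 0 < q)
    (hτ : 0 < τ) (hl : 0 < l) (hlτ : l * τ ^ (γ / q) = 1) (x : Rn n) :
    ENNReal.ofReal l ^ q * levelIntegral l (γ / q) γ f x = scaledIntegral q γ τ f x := by
  set S := levelSet l (γ / q) f with hS
  set k : Rn n × Rn n → ℝ≥0∞ := fun z => ENNReal.ofReal (‖z.1 - z.2‖ ^ (γ - n)) with hk
  have hSm : MeasurableSet S := measurableSet_levelSet hf l (γ / q)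
  have hΨ : Measurable fun z : Rn n => S.indicator k (x, x + z) :=
    ((measurable_kernel γ).indicator hSm).comp (by fun_prop)
  have e1 : levelIntegral l (γ / q) γ f x = ∫⁻ z, S.indicator k (x, x + z) :=
    (lintegral_add_left_eq_self (fun y => S.indicator k (x, y)) x).symm
  have e2 := lintegral_map (μ := (volume : Measure (Rn n))) hΨ (measurable_const_smul τ)
  rw [Measure.map_addHaar_smul volume hτ.ne', lintegral_smul_measure,
    finrank_euclideanSpace_fin, smul_eq_mul, abs_of_pos (by positivity),
    ENNReal.ofReal_inv_of_pos (by positivity)] at e2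
  have h0 : ENNReal.ofReal (τ ^ n) ≠ 0 := by
    rw [Ne, ENNReal.ofReal_eq_zero, not_le]; positivity
  have e3 : levelIntegral l (γ / q) γ f x =
      ENNReal.ofReal (τ ^ n) * ∫⁻ w, S.indicator k (x, x + τ • w) := by
    rw [← e2, ← mul_assoc, ENNReal.mul_inv_cancel h0 ENNReal.ofReal_ne_top, one_mul, e1]
  have hlq : l ^ q * τ ^ γ = 1 := by
    have := congrArg (fun s : ℝ => s ^ q) hlτ
    simpa only [Real.mul_rpow hl.le (Real.rpow_nonneg hτ.le _), ← Real.rpow_mul hτ.le,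
      div_mul_cancel₀ _ hq.ne', Real.one_rpow] using this
  rw [e3, ← mul_assoc, ENNReal.ofReal_rpow_of_pos hl, ← ENNReal.ofReal_mul (by positivity),
    ← lintegral_const_mul' _ _ ENNReal.ofReal_ne_top, scaledIntegral]
  refine lintegral_congr fun w => ?_
  by_cases hw : w = 0
  · rw [indicator_of_notMem (fun h => h.1 (by simp [hw])), indicator_of_notMem (fun h => h.1 hw),
      mul_zero]
  have hr : 0 < ‖w‖ := norm_pos_iff.2 hw
  have hxw : ‖x - (x + τ • w)‖ = τ * ‖w‖ := by
    rw [sub_add_cancel_left, norm_neg, norm_smul, Real.norm_of_nonneg hτ.le]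
  have hiff : (x, x + τ • w) ∈ S ↔
      w ∈ {w : Rn n | w ≠ 0 ∧ ‖w‖ ^ (1 + γ / q) < |f (x + τ • w) - f x| / τ} := by
    have hne : x ≠ x + τ • w := by
      intro h
      rw [left_eq_add, smul_eq_zero] at h
      exact h.elim hτ.ne' hw
    rw [mem_ofPred_eq, hS, levelSet, mem_ofPred_eq]
    refine (and_iff_right hne).trans ((and_iff_right hw).trans ?_).symm
    change _ ↔ l < |f x - f (x + τ • w)| / ‖x - (x + τ • w)‖ ^ (1 + γ / q)
    rw [hxw, abs_sub_comm, lt_div_iff₀ hτ, lt_div_iff₀ (by positivity),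
      Real.mul_rpow hτ.le hr.le, Real.rpow_add hτ, Real.rpow_one]
    have : l * (τ * τ ^ (γ / q) * ‖w‖ ^ (1 + γ / q)) = ‖w‖ ^ (1 + γ / q) * τ := by
      linear_combination (‖w‖ ^ (1 + γ / q) * τ) * hlτ
    rw [this]
  by_cases h : (x, x + τ • w) ∈ S
  · rw [indicator_of_mem h, indicator_of_mem (hiff.1 h), hk, ← ENNReal.ofReal_mul (by positivity)]
    simp only []
    rw [hxw, Real.mul_rpow hτ.le hr.le, Real.rpow_sub hτ, Real.rpow_natCast]
    congr 1
    have hτn : τ ^ n ≠ 0 := by positivity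
    calc _ = (l ^ q * τ ^ γ) * ‖w‖ ^ (γ - n) * (τ ^ n / τ ^ n) := by ring
      _ = _ := by rw [hlq, div_self hτn]; ring
  · rw [indicator_of_notMem h, indicator_of_notMem (fun h' => h (hiff.2 h')), mul_zero]

lemma functional_eq_scaled {ρ : FunctionNorm n} (hρ : IsBallBanach ρ) {f : Rn n → ℝ}
    (hf : Measurable f) {q γ τ l : ℝ} (hq : 0 < q) (hτ : 0 < τ) (hl : 0 < l)
    (hlτ : l * τ ^ (γ / q) = 1) :
    functional ρ q γ l f = ρ fun x => scaledIntegral q γ τ f x ^ (1 / q) := by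
  rw [functional_eq hρ hf]
  congr 1
  funext x
  rw [← rpow_mul_levelIntegral hf hq hτ hl hlτ, ENNReal.mul_rpow_of_nonneg _ _ (by positivity),
    ← ENNReal.rpow_mul, mul_one_div_cancel hq.ne', ENNReal.rpow_one]

lemma HasContGradient.abs_sub_le {f : Rn n → ℝ} {K : Rn n → Rn n} (h : HasContGradient f K)
    {L : ℝ} {x v : Rn n} (hL : ∀ t ∈ Icc (0 : ℝ) 1, ‖K (x + t • v)‖ ≤ L) :
    |f (x + v) - f x| ≤ L * ‖v‖ := by
  rw [h.sub_eq_integral x v, ← Real.norm_eq_abs]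
  have := intervalIntegral.norm_integral_le_of_norm_le_const (a := (0 : ℝ)) (b := 1)
    (f := fun t : ℝ => (inner ℝ (K (x + t • v)) v : ℝ)) (C := L * ‖v‖) fun t ht => by
      rw [uIoc_of_le zero_le_one] at ht
      exact (norm_inner_le_norm _ _).trans
        (mul_le_mul_of_nonneg_right (hL t ⟨ht.1.le, ht.2⟩) (norm_nonneg _))
  simpa using this

/-- A bound `L` for the gradient confines the rescaled level sets, for all `τ`, to one region on which
the kernel is integrable. -/
lemma mem_kernel_of_mem_scaled {f : Rn n → ℝ} {K : Rn n → Rn n} (h : HasContGradient f K)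
    {L : ℝ} (hL : ∀ x, ‖K x‖ ≤ L) {q γ τ : ℝ} (hq : 0 < q) (hτ : 0 < τ) {x w : Rn n}
    (hw : w ∈ {w : Rn n | w ≠ 0 ∧ ‖w‖ ^ (1 + γ / q) < |f (x + τ • w) - f x| / τ}) :
    w ∈ {w : Rn n | w ≠ 0 ∧ ‖w - 0‖ ^ γ < L ^ q} := by
  obtain ⟨hw0, hw1⟩ := hw
  have hr : 0 < ‖w‖ := norm_pos_iff.2 hw0
  refine ⟨hw0, ?_⟩
  have h1 := h.abs_sub_le (x := x) (v := τ • w) (fun t _ => hL _)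
  rw [norm_smul, Real.norm_of_nonneg hτ.le] at h1
  have h2 : ‖w‖ * ‖w‖ ^ (γ / q) < ‖w‖ * L := by
    rw [Real.rpow_add hr, Real.rpow_one, lt_div_iff₀ hτ] at hw1
    refine lt_of_mul_lt_mul_right (hw1.trans_le (h1.trans (le_of_eq ?_))) hτ.le
    ring
  have h3 := lt_of_mul_lt_mul_left h2 hr.le
  have h4 := Real.rpow_lt_rpow (Real.rpow_nonneg hr.le _) h3 hq
  rw [← Real.rpow_mul hr.le, div_mul_cancel₀ _ hq.ne'] at h4
  rwa [sub_zero]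

lemma scaledIntegral_le {f : Rn n → ℝ} {K : Rn n → Rn n} (h : HasContGradient f K)
    {L : ℝ} (hL0 : 0 < L) (hL : ∀ x, ‖K x‖ ≤ L) {q γ τ : ℝ} (hγ : γ ≠ 0) (hq : 0 < q)
    (hτ : 0 < τ) (x : Rn n) :
    scaledIntegral q γ τ f x ≤ kernelConst n γ * ENNReal.ofReal (L ^ q) := by
  refine le_trans (lintegral_mono fun w => ?_)
    (lintegral_kernel_le_const (n := n) hγ (Real.rpow_pos_of_pos hL0 q) 0)
  by_cases hw : w ∈ {w : Rn n | w ≠ 0 ∧ ‖w‖ ^ (1 + γ / q) < |f (x + τ • w) - f x| / τ}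
  · rw [indicator_of_mem hw, indicator_of_mem (mem_kernel_of_mem_scaled h hL hq hτ hw), sub_zero]
  · rw [indicator_of_notMem hw]
    exact bot_le

/-- The difference quotients converge to `∇f(x) ⬝ w`, so the rescaled level sets converge away from a null
set, and the kernel with cutoff dominates. -/
lemma tendsto_scaledIntegral (hn : 1 ≤ n) {f : Rn n → ℝ} {K : Rn n → Rn n}
    (h : HasContGradient f K) {L : ℝ} (hL0 : 0 < L) (hL : ∀ x, ‖K x‖ ≤ L) {q γ : ℝ} (hγ : γ ≠ 0)
    (hq : 0 < q) {τ : ℕ → ℝ} (hτ : ∀ j, 0 < τ j) (hτ0 : Tendsto τ atTop (𝓝 0)) (x : Rn n) :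
    Tendsto (fun j => scaledIntegral q γ (τ j) f x) atTop (𝓝 (linearIntegral q γ (K x))) := by
  have hfm : Measurable f := h.continuous.measurable
  refine tendsto_lintegral_of_dominated_convergence
    (({w : Rn n | w ≠ 0 ∧ ‖w - 0‖ ^ γ < L ^ q}).indicator
      (fun w => ENNReal.ofReal (‖w - 0‖ ^ (γ - n))))
    (fun j => Measurable.indicator (by fun_prop) (measurableSet_scaled hfm q γ (τ j) x))
    (fun j => Eventually.of_forall fun w => ?_) ?_ ?_
  · beta_reduce
    by_cases hw : w ∈ {w : Rn n | w ≠ 0 ∧ ‖w‖ ^ (1 + γ / q) < |f (x + τ j • w) - f x| / τ j}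
    · rw [indicator_of_mem hw, indicator_of_mem (mem_kernel_of_mem_scaled h hL hq (hτ j) hw),
        sub_zero]
    · rw [indicator_of_notMem hw]
      exact bot_le
  · exact ((lintegral_kernel_le_const (n := n) hγ (Real.rpow_pos_of_pos hL0 q) 0).trans_lt
      (ENNReal.mul_lt_top (kernelConst_ne_top n γ).lt_top ENNReal.ofReal_lt_top)).ne
  · have hnull := measure_eq_zero_iff_ae_notMem.1 (volume_linear_eq hn hγ hq (K x))
    filter_upwards [hnull] with w hw
    by_cases hw0 : w = 0
    · refine tendsto_const_nhds.congr fun j => ?_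
      rw [indicator_of_notMem (fun h => h.1 hw0), indicator_of_notMem (fun h => h.1 hw0)]
    have hlim : Tendsto (fun j => |f (x + τ j • w) - f x| / τ j) atTop
        (𝓝 |inner ℝ (K x) w|) := by
      have hd := h.hasDerivAt_line x w 0
      have hs := hd.tendsto_slope_zero
      have hτ' : Tendsto τ atTop (𝓝[≠] 0) :=
        tendsto_nhdsWithin_iff.2 ⟨hτ0, Eventually.of_forall fun j => (hτ j).ne'⟩
      have h2 := (hs.comp hτ').abs
      simp only [zero_smul, add_zero, zero_add] at h2
      refine h2.congr fun j => ?_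
      simp only [Function.comp_apply, smul_eq_mul]
      rw [abs_mul, abs_inv, abs_of_pos (hτ j), div_eq_inv_mul]
    rcases lt_or_gt_of_ne hw with hlt | hgt
    · rw [indicator_of_mem (show w ∈ {w : Rn n | w ≠ 0 ∧ ‖w‖ ^ (1 + γ / q) < |inner ℝ (K x) w|}
        from ⟨hw0, hlt⟩)]
      refine tendsto_const_nhds.congr' ?_
      filter_upwards [hlim.eventually_const_lt hlt] with j hj
      rw [indicator_of_mem (by exact ⟨hw0, hj⟩)]
    · rw [indicator_of_notMem (fun h' => lt_asymm hgt h'.2)]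
      refine tendsto_const_nhds.congr' ?_
      filter_upwards [hlim.eventually_lt_const hgt] with j hj
      rw [indicator_of_notMem (fun h' => lt_asymm hj h'.2)]

end Scaling

/-! ### The limit for functions with compactly supported gradient -/

section NiceLimit

variable {n : ℕ} {ρ : FunctionNorm n}

lemma IsBallBanach.norm_zero (hρ : IsBallBanach ρ) : ρ (fun _ => 0) = 0 := by
  have := hρ.smul 0 (fun _ => 0) aemeasurable_const
  simpa using this

lemma IsBallBanach.tsum_le (hρ : IsBallBanach ρ) {u : ℕ → Rn n → ℝ≥0∞}
    (hu : ∀ k, Measurable (u k)) : ρ (fun x => ∑' k, u k x) ≤ ∑' k, ρ (u k) := by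
  have hsm : ∀ m, Measurable fun x => ∑ k ∈ Finset.range m, u k x := fun m =>
    Finset.measurable_fun_sum _ fun k _ => hu k
  have hfin : ∀ m, ρ (fun x => ∑ k ∈ Finset.range m, u k x) ≤ ∑ k ∈ Finset.range m, ρ (u k) := by
    intro m
    induction m with
    | zero => simp [hρ.norm_zero]
    | succ m ih =>
      simp only [Finset.sum_range_succ]
      exact (hρ.add_le _ _ (hsm m).aemeasurable (hu m).aemeasurable).trans (add_le_add ih le_rfl)
  have := hρ.fatou (fun m x => ∑ k ∈ Finset.range m, u k x) (fun x => ∑' k, u k x)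
    (fun m => (hsm m).aemeasurable) (Measurable.tsum hu).aemeasurable
    (Eventually.of_forall fun x => ⟨fun a b hab =>
      Finset.sum_le_sum_of_subset (Finset.range_mono hab), ENNReal.tendsto_nat_tsum _⟩)
  exact le_of_tendsto this (Eventually.of_forall fun m =>
    (hfin m).trans (ENNReal.sum_le_tsum _))

/-- The growth of the norms of balls. -/
lemma norm_ball_pow_le {p : ℝ} (hp : 1 ≤ p) (hρ : IsBallBanach ρ)
    (hY : IsBallBanach (convexify ρ (1 / p)))
    (ht : maximalOpNorm (associate (convexify ρ (1 / p))) < ∞) (k : ℕ) :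
    ρ ((Metric.ball (0 : Rn n) (2 ^ k)).indicator 1) ≤
      (((2 ^ (k * n) : ℝ≥0) : ℝ≥0∞) * (maximalOpNorm (associate (convexify ρ (1 / p))) +
        maximalOpNorm (associate (convexify ρ (1 / p))) ^ 2)) ^ (1 / p) *
        ρ ((Metric.ball (0 : Rn n) 1).indicator 1) := by
  have hp0 : 0 < p := by linarith
  have h2k : (0 : ℝ) < 2 ^ k := by positivity
  have hind : ∀ (B : Set (Rn n)) (x : Rn n), B.indicator (1 : Rn n → ℝ≥0∞) x ^ p =
      B.indicator 1 x := by
    intro B x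
    by_cases hx : x ∈ B
    · rw [indicator_of_mem hx]; simp
    · rw [indicator_of_notMem hx, ENNReal.zero_rpow_of_pos hp0]
  refine norm_le_of_weighted hp hY ht (measurable_one.indicator measurableSet_ball).aemeasurable
    (measurable_one.indicator measurableSet_ball).aemeasurable (hρ.ball_mem 0 1 one_pos) _
    fun h hh => ?_
  simp only [hind]
  have e1 : ∀ (B : Set (Rn n)) (F : Rn n → ℝ≥0∞), MeasurableSet B →
      ∫⁻ x, B.indicator 1 x * F x = ∫⁻ x in B, F x := by
    intro B F hB
    rw [← lintegral_indicator hB]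
    refine lintegral_congr fun x => ?_
    by_cases hx : x ∈ B
    · rw [indicator_of_mem hx, indicator_of_mem hx, Pi.one_apply, one_mul]
    · rw [indicator_of_notMem hx, indicator_of_notMem hx, zero_mul]
  rw [e1 _ _ measurableSet_ball, e1 _ _ measurableSet_ball]
  set I := ∫⁻ x in Metric.ball (0 : Rn n) (2 ^ k), h x with hI
  have hb0 : volume (Metric.ball (0 : Rn n) 1) ≠ 0 :=
    (Metric.measure_ball_pos volume _ one_pos).ne'
  have hbt : volume (Metric.ball (0 : Rn n) 1) ≠ ∞ := measure_ball_lt_top.ne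
  have hv : volume (Metric.ball (0 : Rn n) (2 ^ k)) =
      ((2 ^ (k * n) : ℝ≥0) : ℝ≥0∞) * volume (Metric.ball (0 : Rn n) 1) := by
    rw [volume_ball_scale 0 h2k, Real.rpow_natCast, ← pow_mul]
    congr 1
    rw [ENNReal.ofReal_pow (by norm_num)]
    simp
  have hpt : ∀ y ∈ Metric.ball (0 : Rn n) 1,
      I / volume (Metric.ball (0 : Rn n) (2 ^ k)) ≤ maximal h y + maximal (maximal h) y := by
    intro y hy
    refine le_trans ?_ le_self_add
    refine le_iSup₂_of_le (0 : Rn n) (2 ^ k) (le_iSup₂_of_le h2k ?_ le_rfl)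
    exact Metric.ball_subset_ball (one_le_pow₀ (by norm_num)) hy
  have hv0 : volume (Metric.ball (0 : Rn n) (2 ^ k)) ≠ 0 :=
    (Metric.measure_ball_pos volume _ h2k).ne'
  have hvt : volume (Metric.ball (0 : Rn n) (2 ^ k)) ≠ ∞ := measure_ball_lt_top.ne
  calc I = volume (Metric.ball (0 : Rn n) (2 ^ k)) *
        (I / volume (Metric.ball (0 : Rn n) (2 ^ k))) := (ENNReal.mul_div_cancel hv0 hvt).symm
    _ = ((2 ^ (k * n) : ℝ≥0) : ℝ≥0∞) * ∫⁻ y in Metric.ball (0 : Rn n) 1,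
        I / volume (Metric.ball (0 : Rn n) (2 ^ k)) := by
        rw [setLIntegral_const]
        nth_rw 1 [hv]
        ring
    _ ≤ _ := mul_le_mul_right (setLIntegral_mono' measurableSet_ball hpt) _

/-- Powers `|x|^{-θ}` with `θ > n / p` belong to `X` away from the origin. -/
lemma norm_power_lt_top {p θ : ℝ} (hp : 1 ≤ p) (hρ : IsBallBanach ρ)
    (hY : IsBallBanach (convexify ρ (1 / p)))
    (ht : maximalOpNorm (associate (convexify ρ (1 / p))) < ∞) (hθ : (n : ℝ) / p < θ) :
    ρ ({x : Rn n | 1 ≤ ‖x‖}.indicator fun x => ENNReal.ofReal (‖x‖ ^ (-θ))) < ∞ := by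
  have hp0 : 0 < p := by linarith
  have hθ0 : 0 < θ := lt_of_le_of_lt (by positivity) hθ
  set c : ℕ → ℝ≥0 := fun k => ((2 : ℝ≥0) ^ (-θ)) ^ k with hc
  set u : ℕ → Rn n → ℝ≥0∞ := fun k x =>
    (c k : ℝ≥0∞) * (Metric.ball (0 : Rn n) (2 ^ (k + 1))).indicator 1 x with hu
  have hum : ∀ k, Measurable (u k) := fun k =>
    (measurable_one.indicator measurableSet_ball).const_mul _
  set D := (maximalOpNorm (associate (convexify ρ (1 / p))) +
    maximalOpNorm (associate (convexify ρ (1 / p))) ^ 2) ^ (1 / p) *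
      ρ ((Metric.ball (0 : Rn n) 1).indicator 1) with hD
  have hDt : D < ∞ := ENNReal.mul_lt_top (ENNReal.rpow_lt_top_of_nonneg (by positivity)
    (ENNReal.add_ne_top.2 ⟨ht.ne, ENNReal.pow_ne_top ht.ne⟩)) (hρ.ball_mem 0 1 one_pos)
  have hAm : MeasurableSet {x : Rn n | 1 ≤ ‖x‖} := measurableSet_le measurable_const measurable_norm
  set b : ℝ≥0 := 2 ^ ((n : ℝ) / p) with hb
  set a : ℝ≥0 := (2 : ℝ≥0) ^ (-θ) * b with ha
  have ha1 : a < 1 := by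
    rw [ha, hb, ← NNReal.rpow_add two_ne_zero]
    exact NNReal.rpow_lt_one_of_one_lt_of_neg one_lt_two (by linarith)
  calc _ ≤ ρ (fun x => ∑' k, u k x) := by
        refine hρ.mono _ _ (Measurable.indicator (by fun_prop) hAm).aemeasurable
          (Measurable.tsum hum).aemeasurable (Eventually.of_forall fun x => ?_)
        by_cases hx : 1 ≤ ‖x‖
        · rw [indicator_of_mem (by exact hx)]
          obtain ⟨k, hk1, hk2⟩ := exists_nat_pow_near hx (one_lt_two)
          refine le_trans ?_ (ENNReal.le_tsum k)
          rw [hu]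
          beta_reduce
          rw [indicator_of_mem (mem_ball_zero_iff.2 hk2), Pi.one_apply, mul_one, hc]
          have e : ((((2 : ℝ≥0) ^ (-θ)) ^ k : ℝ≥0) : ℝ≥0∞) =
              ENNReal.ofReal (((2 : ℝ) ^ k) ^ (-θ)) := by
            rw [ENNReal.ofReal, Real.toNNReal_of_nonneg (by positivity)]
            congr 1
            ext
            push_cast
            rw [← Real.rpow_natCast, ← Real.rpow_natCast, ← Real.rpow_mul (by norm_num),
              ← Real.rpow_mul (by norm_num), mul_comm]
          rw [e]
          exact ENNReal.ofReal_le_ofReal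
            (Real.rpow_le_rpow_of_nonpos (by positivity) hk1 (by linarith))
        · rw [indicator_of_notMem (by exact hx)]
          exact bot_le
    _ ≤ ∑' k, ρ (u k) := hρ.tsum_le hum
    _ ≤ ∑' k, (b * D) * (a : ℝ≥0∞) ^ k := by
        refine ENNReal.tsum_le_tsum fun k => ?_
        rw [hu, hρ.smul _ _ (measurable_one.indicator measurableSet_ball).aemeasurable]
        refine (mul_le_mul_right (norm_ball_pow_le hp hρ hY ht (k + 1)) _).trans (le_of_eq ?_)
        rw [ENNReal.mul_rpow_of_nonneg _ _ (by positivity), mul_assoc, ← hD]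
        have e : (((2 : ℝ≥0) ^ ((k + 1) * n) : ℝ≥0) : ℝ≥0∞) ^ (1 / p) = ((b ^ (k + 1) : ℝ≥0) : ℝ≥0∞) := by
          rw [← ENNReal.coe_rpow_of_nonneg _ (by positivity)]
          congr 1
          rw [hb, ← NNReal.rpow_natCast, ← NNReal.rpow_natCast, ← NNReal.rpow_mul,
            ← NNReal.rpow_mul]
          congr 1
          push_cast
          ring
        rw [e, hc, ha, pow_succ]
        push_cast
        rw [mul_pow]
        ring
    _ < ∞ := by
        rw [ENNReal.tsum_mul_left, ENNReal.tsum_geometric]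
        refine ENNReal.mul_lt_top (ENNReal.mul_lt_top ENNReal.coe_lt_top hDt) ?_
        rw [ENNReal.inv_lt_top, tsub_pos_iff_lt]
        exact_mod_cast ha1

/-- Unless the segment from `x` to `x + τ w` meets the ball of radius `R` that carries the gradient, the
function is constant on it. -/
lemma HasContGradient.lt_of_mem_scaled {f : Rn n → ℝ} {K : Rn n → Rn n} (h : HasContGradient f K)
    {R : ℝ} (hR : ∀ y, R ≤ ‖y‖ → K y = 0) {q γ τ : ℝ} (hτ : 0 < τ) {x w : Rn n}
    (hw : w ∈ {w : Rn n | w ≠ 0 ∧ ‖w‖ ^ (1 + γ / q) < |f (x + τ • w) - f x| / τ}) :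
    ‖x‖ < R + τ * ‖w‖ := by
  by_contra! hcon
  have h1 := h.abs_sub_le (x := x) (v := τ • w) (L := 0) fun t ht => by
    have h2 : ‖t • τ • w‖ ≤ τ * ‖w‖ := by
      rw [norm_smul, norm_smul, Real.norm_of_nonneg ht.1, Real.norm_of_nonneg hτ.le]
      exact mul_le_of_le_one_left (by positivity) ht.2
    have h3 : ‖x‖ ≤ ‖x + t • τ • w‖ + ‖t • τ • w‖ := by
      have := norm_sub_le (x + t • τ • w) (t • τ • w)
      rwa [add_sub_cancel_right] at this
    rw [hR _ (by linarith), norm_zero]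
  rw [zero_mul] at h1
  have h4 := hw.2
  rw [le_antisymm h1 (abs_nonneg _), zero_div] at h4
  exact absurd h4 (not_lt.2 (Real.rpow_nonneg (norm_nonneg _) _))

/-- Decay of the rescaled level integrals: far from the support of the gradient, only the `w` with
`|w| ≥ |x| / 2` contribute. -/
lemma HasContGradient.scaledIntegral_le_rpow {f : Rn n → ℝ} {K : Rn n → Rn n}
    (h : HasContGradient f K) {R : ℝ} (hR0 : 0 < R) (hR : ∀ y, R ≤ ‖y‖ → K y = 0) {q γ τ : ℝ}
    (hγ : γ < 0) (hτ : 0 < τ) (hτ1 : τ ≤ 1) {x : Rn n} (hx : 2 * R ≤ ‖x‖) :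
    scaledIntegral q γ τ f x ≤
      kernelConst n γ * ENNReal.ofReal (2 * 2 ^ (-γ)) * ENNReal.ofReal (‖x‖ ^ γ) := by
  have hx0 : 0 < ‖x‖ := by linarith
  have e : kernelConst n γ * ENNReal.ofReal (2 * 2 ^ (-γ)) * ENNReal.ofReal (‖x‖ ^ γ) =
      kernelConst n γ * ENNReal.ofReal (2 * (‖x‖ / 2) ^ γ) := by
    rw [mul_assoc, ← ENNReal.ofReal_mul (by positivity), Real.div_rpow hx0.le (by norm_num),
      Real.rpow_neg (by norm_num)]
    congr 2
    ring
  rw [e]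
  refine le_trans (lintegral_mono fun w => ?_)
    (lintegral_kernel_le_const (n := n) hγ.ne (by positivity) 0)
  by_cases hw : w ∈ {w : Rn n | w ≠ 0 ∧ ‖w‖ ^ (1 + γ / q) < |f (x + τ • w) - f x| / τ}
  · rw [indicator_of_mem hw, indicator_of_mem, sub_zero]
    refine ⟨hw.1, ?_⟩
    have h1 := h.lt_of_mem_scaled hR hτ hw
    have h2 : τ * ‖w‖ ≤ ‖w‖ := mul_le_of_le_one_left (norm_nonneg _) hτ1
    rw [sub_zero]
    have h3 : ‖w‖ ^ γ ≤ (‖x‖ / 2) ^ γ :=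
      Real.rpow_le_rpow_of_nonpos (by positivity) (by linarith) hγ.le
    have h4 : 0 < (‖x‖ / 2) ^ γ := by positivity
    linarith
  · rw [indicator_of_notMem hw]
    exact bot_le

/-- If `f` is constant outside a ball, the decay is better, because only points of the ball
contribute. -/
lemma scaledIntegral_le_rpow_of_const {f : Rn n → ℝ} {c R : ℝ} (hR0 : 0 < R)
    (hf : ∀ x, R ≤ ‖x‖ → f x = c) {q γ τ : ℝ} (hγ : γ < 0) (hτ : 0 < τ) (hτ1 : τ ≤ 1) {x : Rn n}
    (hx : 2 * R ≤ ‖x‖) :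
    scaledIntegral q γ τ f x ≤ (ENNReal.ofReal (2 ^ ((n : ℝ) - γ) * R ^ (n : ℝ)) *
      volume (Metric.ball (0 : Rn n) 1)) * ENNReal.ofReal (‖x‖ ^ (γ - n)) := by
  have hx0 : 0 < ‖x‖ := by linarith
  have hγn : γ - n ≤ 0 := by
    have : (0 : ℝ) ≤ n := Nat.cast_nonneg n
    linarith
  set B := Metric.ball (-(τ⁻¹ • x)) (R / τ) with hB
  have hRτ : 0 < R / τ := by positivity
  calc scaledIntegral q γ τ f x ≤
        ∫⁻ w in B, ENNReal.ofReal ((‖x‖ / (2 * τ)) ^ (γ - n)) := by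
        rw [← lintegral_indicator measurableSet_ball]
        refine lintegral_mono fun w => ?_
        by_cases hw : w ∈ {w : Rn n | w ≠ 0 ∧ ‖w‖ ^ (1 + γ / q) < |f (x + τ • w) - f x| / τ}
        · have hlt : ‖x + τ • w‖ < R := by
            by_contra! hcon
            have h1 := hw.2
            rw [hf _ hcon, hf x (by linarith), sub_self, abs_zero, zero_div] at h1
            exact absurd h1 (not_lt.2 (Real.rpow_nonneg (norm_nonneg _) _))
          have h2 : ‖τ • w‖ = τ * ‖w‖ := by rw [norm_smul, Real.norm_of_nonneg hτ.le]
          have hwB : w ∈ B := by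
            rw [hB, mem_ball_iff_norm, lt_div_iff₀ hτ]
            have : ‖w - -(τ⁻¹ • x)‖ * τ = ‖x + τ • w‖ := by
              have e : x + τ • w = τ • (w - -(τ⁻¹ • x)) := by
                rw [sub_neg_eq_add, smul_add, smul_smul, mul_inv_cancel₀ hτ.ne', one_smul, add_comm]
              rw [e, norm_smul, Real.norm_of_nonneg hτ.le, mul_comm]
            rwa [this]
          rw [indicator_of_mem hw, indicator_of_mem hwB]
          refine ENNReal.ofReal_le_ofReal
            (Real.rpow_le_rpow_of_nonpos (by positivity) ?_ hγn)
          have h3 : ‖x‖ ≤ ‖x + τ • w‖ + ‖τ • w‖ := by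
            have := norm_sub_le (x + τ • w) (τ • w)
            rwa [add_sub_cancel_right] at this
          rw [div_le_iff₀ (by positivity)]
          linarith
        · rw [indicator_of_notMem hw]
          exact bot_le
    _ = ENNReal.ofReal ((‖x‖ / (2 * τ)) ^ (γ - n) * (R / τ) ^ (n : ℝ)) *
        volume (Metric.ball (0 : Rn n) 1) := by
        rw [setLIntegral_const, volume_ball_scale _ hRτ, ← mul_assoc,
          ← ENNReal.ofReal_mul (by positivity)]
    _ ≤ _ := by
        rw [mul_right_comm, ← ENNReal.ofReal_mul (by positivity)]
        refine mul_le_mul_left (ENNReal.ofReal_le_ofReal ?_) _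
        have h2τ : (2 * τ) ^ (γ - n) = (2 ^ ((n : ℝ) - γ))⁻¹ * (τ ^ γ / τ ^ (n : ℝ)) := by
          rw [Real.mul_rpow (by norm_num) hτ.le, ← Real.rpow_neg (by norm_num), neg_sub,
            Real.rpow_sub hτ]
        have hτγ : 1 ≤ τ ^ γ := Real.one_le_rpow_of_pos_of_le_one_of_nonpos hτ hτ1 hγ.le
        have hτn : 0 < τ ^ (n : ℝ) := by positivity
        have h2n : 0 < (2 : ℝ) ^ ((n : ℝ) - γ) := by positivity
        rw [Real.div_rpow hx0.le (by positivity), Real.div_rpow hR0.le hτ.le, h2τ]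
        have hXR : 0 ≤ ‖x‖ ^ (γ - n) * R ^ (n : ℝ) := by positivity
        calc _ = (2 ^ ((n : ℝ) - γ) * R ^ (n : ℝ) * ‖x‖ ^ (γ - n)) * (τ ^ γ)⁻¹ := by
              field_simp
          _ ≤ (2 ^ ((n : ℝ) - γ) * R ^ (n : ℝ) * ‖x‖ ^ (γ - n)) * 1 := by
              refine mul_le_mul_of_nonneg_left (inv_le_one_of_one_le₀ hτγ) (by positivity)
          _ = _ := mul_one _

end NiceLimit

section NiceLimit

variable {n : ℕ} {ρ : FunctionNorm n}

lemma IsNice.exists_radius {f : Rn n → ℝ} {K : Rn n → Rn n} (h : IsNice f K) :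
    ∃ R : ℝ, 1 ≤ R ∧ (∀ y, R ≤ ‖y‖ → K y = 0) ∧ (2 ≤ n → ∃ c, ∀ x, R ≤ ‖x‖ → f x = c) := by
  obtain ⟨R1, hR1⟩ := h.hasCompactSupport.isCompact.isBounded.subset_closedBall 0
  have hK : ∀ y, R1 < ‖y‖ → K y = 0 := fun y hy => by
    by_contra hne
    exact absurd (mem_closedBall_zero_iff.1 (hR1 (subset_tsupport _ hne))) (not_le.2 hy)
  by_cases hn : 2 ≤ n
  · obtain ⟨c, R2, hc⟩ := h.exists_const hn
    refine ⟨max (max (R1 + 1) R2) 1, le_max_right _ _, fun y hy => hK y ?_, fun _ => ⟨c, fun x hx =>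
      hc x ?_⟩⟩
    · linarith [le_max_left (max (R1 + 1) R2) 1, le_max_left (R1 + 1) R2]
    · linarith [le_max_left (max (R1 + 1) R2) 1, le_max_right (R1 + 1) R2]
  · refine ⟨max (R1 + 1) 1, le_max_right _ _, fun y hy => hK y ?_, fun h2 => absurd h2 hn⟩
    linarith [le_max_left (R1 + 1) 1]

lemma IsNice.exists_bound {f : Rn n → ℝ} {K : Rn n → Rn n} (h : IsNice f K) :
    ∃ L : ℝ, 0 < L ∧ ∀ x, ‖K x‖ ≤ L := by
  obtain ⟨C, hC⟩ := h.hasCompactSupport.exists_bound_of_continuous h.continuous_grad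
  exact ⟨max C 1, by positivity, fun x => (hC x).trans (le_max_left _ _)⟩

/-- The condition on the exponents under which the limit formula holds. -/
def LimitCondition (n : ℕ) (p q γ : ℝ) : Prop :=
  0 < γ ∨ (γ < 0 ∧ ((2 ≤ n ∧ q < ((n : ℝ) - γ) / n * p) ∨ (n = 1 ∧ q < -p * γ)))

lemma LimitCondition.ne_zero {n : ℕ} {p q γ : ℝ} (h : LimitCondition n p q γ) : γ ≠ 0 :=
  h.elim (fun h => h.ne') fun h => h.1.ne

/-- The decay of the rescaled level integrals, in the form in which it is used. -/
lemma IsNice.exists_decay {f : Rn n → ℝ} {K : Rn n → Rn n} (h : IsNice f K) {p q γ : ℝ}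
    (hp : 1 ≤ p) (hq : 0 < q) (hγ : γ < 0)
    (hc : (2 ≤ n ∧ q < ((n : ℝ) - γ) / n * p) ∨ (n = 1 ∧ q < -p * γ)) :
    ∃ (C : ℝ≥0∞) (R s : ℝ), C ≠ ∞ ∧ 1 ≤ R ∧ (n : ℝ) / p < s / q ∧ ∀ τ : ℝ, 0 < τ → τ ≤ 1 →
      ∀ x : Rn n, R ≤ ‖x‖ → scaledIntegral q γ τ f x ≤ C * ENNReal.ofReal (‖x‖ ^ (-s)) := by
  obtain ⟨R, hR1, hRK, hRc⟩ := h.exists_radius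
  have hp0 : 0 < p := by linarith
  rcases hc with ⟨hn, hq'⟩ | ⟨rfl, hq'⟩
  · obtain ⟨c, hc⟩ := hRc hn
    refine ⟨ENNReal.ofReal (2 ^ ((n : ℝ) - γ) * R ^ (n : ℝ)) * volume (Metric.ball (0 : Rn n) 1),
      2 * R, n - γ, ENNReal.mul_ne_top ENNReal.ofReal_ne_top
      (measure_ball_lt_top (μ := volume) (x := (0 : Rn n)) (r := 1)).ne, by linarith, ?_, fun τ hτ hτ1 x hx => ?_⟩
    · have hn0 : (0 : ℝ) < n := by exact_mod_cast (by omega : 0 < n)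
      rw [div_mul_eq_mul_div, lt_div_iff₀ hn0] at hq'
      rw [div_lt_div_iff₀ hp0 hq]
      linarith
    · rw [neg_sub]
      exact scaledIntegral_le_rpow_of_const (by linarith) hc hγ hτ hτ1 hx
  · refine ⟨kernelConst 1 γ * ENNReal.ofReal (2 * 2 ^ (-γ)), 2 * R, -γ, ENNReal.mul_ne_top (kernelConst_ne_top 1 γ) ENNReal.ofReal_ne_top,
      by linarith, ?_, fun τ hτ hτ1 x hx => ?_⟩
    · rw [div_lt_div_iff₀ hp0 hq]
      push_cast
      linarith
    · rw [neg_neg]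
      exact h.scaledIntegral_le_rpow (by linarith) hRK hγ hτ hτ1 hx

/-- The rescaled level integrals of a nice function are dominated by a fixed element of `X`. -/
lemma IsNice.exists_dominating {p q γ : ℝ} (hp : 1 ≤ p) (hρ : IsBallBanach ρ)
    (hY : IsBallBanach (convexify ρ (1 / p)))
    (ht : maximalOpNorm (associate (convexify ρ (1 / p))) < ∞) {f : Rn n → ℝ} {K : Rn n → Rn n}
    (h : IsNice f K) (hq : 0 < q) (hc : LimitCondition n p q γ) :
    ∃ g : Rn n → ℝ≥0∞, Measurable g ∧ ρ g < ∞ ∧ ∀ τ : ℝ, 0 < τ → τ ≤ 1 →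
      ∀ x, scaledIntegral q γ τ f x ^ (1 / q) ≤ g x := by
  obtain ⟨L, hL0, hL⟩ := h.exists_bound
  set C1 : ℝ≥0∞ := (kernelConst n γ * ENNReal.ofReal (L ^ q)) ^ (1 / q) with hC1
  have hC1t : C1 ≠ ∞ := ENNReal.rpow_ne_top_of_nonneg (by positivity)
    (ENNReal.mul_ne_top (kernelConst_ne_top n γ) ENNReal.ofReal_ne_top)
  have hball : ∀ R : ℝ, 0 < R →
      ρ (fun x => C1 * (Metric.ball (0 : Rn n) R).indicator 1 x) < ∞ := by
    intro R hR
    rw [← ENNReal.coe_toNNReal hC1t,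
      hρ.smul _ _ (measurable_one.indicator measurableSet_ball).aemeasurable]
    exact ENNReal.mul_lt_top ENNReal.coe_lt_top (hρ.ball_mem 0 R hR)
  have hbm : ∀ R : ℝ, Measurable fun x => C1 * (Metric.ball (0 : Rn n) R).indicator 1 x := fun R =>
    (measurable_one.indicator measurableSet_ball).const_mul _
  have hle : ∀ τ : ℝ, 0 < τ → ∀ x, scaledIntegral q γ τ f x ^ (1 / q) ≤ C1 := fun τ hτ x =>
    ENNReal.rpow_le_rpow (scaledIntegral_le h.toHasContGradient hL0 hL hc.ne_zero hq hτ x)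
      (by positivity)
  rcases hc with hγ | ⟨hγ, hc⟩
  · obtain ⟨R, hR1, hRK, -⟩ := h.exists_radius
    set R' := R + L ^ (q / γ) with hR'
    have hR'0 : 0 < R' := by positivity
    refine ⟨_, hbm R', hball R' hR'0, fun τ hτ hτ1 x => ?_⟩
    by_cases hx : ‖x‖ < R'
    · rw [indicator_of_mem (mem_ball_zero_iff.2 hx), Pi.one_apply, mul_one]
      exact hle τ hτ x
    · have hzero : scaledIntegral q γ τ f x = 0 := by
        rw [scaledIntegral]
        refine (lintegral_congr fun w => ?_).trans lintegral_zero
        refine indicator_of_notMem (fun hw => hx ?_) _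
        have h1 := h.lt_of_mem_scaled hRK hτ hw
        have h2 := (mem_kernel_of_mem_scaled h.toHasContGradient hL hq hτ hw).2
        rw [sub_zero] at h2
        have h3 : ‖w‖ < L ^ (q / γ) := by
          refine (Real.rpow_lt_rpow_iff (norm_nonneg _) (by positivity) hγ).1 ?_
          rwa [← Real.rpow_mul hL0.le, div_mul_cancel₀ _ hγ.ne']
        have h4 : τ * ‖w‖ ≤ ‖w‖ := mul_le_of_le_one_left (norm_nonneg _) hτ1
        linarith
      rw [hzero, ENNReal.zero_rpow_of_pos (by positivity)]
      exact bot_le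
  · obtain ⟨C, R, s, hCt, hR1, hs, hdec⟩ := h.exists_decay hp hq hγ hc
    set C2 := C ^ (1 / q) with hC2
    have hC2t : C2 ≠ ∞ := ENNReal.rpow_ne_top_of_nonneg (by positivity) hCt
    set P : Rn n → ℝ≥0∞ := {x : Rn n | 1 ≤ ‖x‖}.indicator
      fun x => ENNReal.ofReal (‖x‖ ^ (-(s / q))) with hP
    have hPm : Measurable P := Measurable.indicator (by fun_prop)
      (measurableSet_le measurable_const measurable_norm)
    refine ⟨fun x => C1 * (Metric.ball (0 : Rn n) R).indicator 1 x + C2 * P x,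
      (hbm R).add (hPm.const_mul _), ?_, fun τ hτ hτ1 x => ?_⟩
    · refine (hρ.add_le _ _ (hbm R).aemeasurable (hPm.const_mul _).aemeasurable).trans_lt
        (ENNReal.add_lt_top.2 ⟨hball R (by linarith), ?_⟩)
      rw [← ENNReal.coe_toNNReal hC2t, hρ.smul _ _ hPm.aemeasurable]
      exact ENNReal.mul_lt_top ENNReal.coe_lt_top (norm_power_lt_top hp hρ hY ht hs)
    · beta_reduce
      by_cases hx : ‖x‖ < R
      · rw [indicator_of_mem (mem_ball_zero_iff.2 hx), Pi.one_apply, mul_one]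
        exact (hle τ hτ x).trans le_self_add
      · rw [not_lt] at hx
        have hx0 : 0 < ‖x‖ := by linarith
        refine le_trans ?_ le_add_self
        rw [hP, indicator_of_mem (show x ∈ {x : Rn n | 1 ≤ ‖x‖} from hR1.trans hx)]
        refine (ENNReal.rpow_le_rpow (hdec τ hτ hτ1 x hx) (by positivity)).trans (le_of_eq ?_)
        rw [ENNReal.mul_rpow_of_nonneg _ _ (by positivity), ENNReal.ofReal_rpow_of_pos
          (by positivity), ← Real.rpow_mul hx0.le]
        congr 3
        ring

/-- Along a sequence of levels, the functionals are the norms of functions converging pointwise to a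
multiple of `|∇f|`. -/
lemma HasContGradient.exists_seq_functional {q γ : ℝ} (hn : 1 ≤ n) (hρ : IsBallBanach ρ)
    {f : Rn n → ℝ} {K : Rn n → Rn n} (h : HasContGradient f K) {L : ℝ} (hL0 : 0 < L)
    (hL : ∀ x, ‖K x‖ ≤ L) (hq : 0 < q) (hγ : γ ≠ 0) {e : Rn n} (he : ‖e‖ = 1) {l : ℕ → ℝ}
    (hl : ∀ j, 0 < l j) (hl0 : Tendsto (fun j => l j ^ (-(q / γ))) atTop (𝓝 0)) :
    (∀ j, functional ρ q γ (l j) f =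
      ρ fun x => scaledIntegral q γ (l j ^ (-(q / γ))) f x ^ (1 / q)) ∧
    (∀ j, Measurable fun x => scaledIntegral q γ (l j ^ (-(q / γ))) f x ^ (1 / q)) ∧
    ∀ x, Tendsto (fun j => scaledIntegral q γ (l j ^ (-(q / γ))) f x ^ (1 / q)) atTop
      (𝓝 (ENNReal.ofReal ((kappa q e / |γ|) ^ (1 / q)) * ‖K x‖ₑ)) := by
  have hfm : Measurable f := h.continuous.measurable
  have hτpos : ∀ j, 0 < l j ^ (-(q / γ)) := fun j => Real.rpow_pos_of_pos (hl j) _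
  have hlτ : ∀ j, l j * (l j ^ (-(q / γ))) ^ (γ / q) = 1 := fun j => by
    rw [← Real.rpow_mul (hl j).le, neg_mul, div_mul_div_cancel₀ hγ, div_self hq.ne',
      Real.rpow_neg_one, mul_inv_cancel₀ (hl j).ne']
  refine ⟨fun j => functional_eq_scaled hρ hfm hq (hτpos j) (hl j) (hlτ j), fun j => ?_, fun x => ?_⟩
  · refine Measurable.pow_const ?_ _
    have e : scaledIntegral q γ (l j ^ (-(q / γ))) f = fun x =>
        ENNReal.ofReal (l j) ^ q * levelIntegral (l j) (γ / q) γ f x :=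
      funext fun x => (rpow_mul_levelIntegral hfm hq (hτpos j) (hl j) (hlτ j) x).symm
    rw [e]
    exact (measurable_levelIntegral hfm _ _ _).const_mul _
  · have e2 : ENNReal.ofReal ((kappa q e / |γ|) ^ (1 / q)) * ‖K x‖ₑ =
        linearIntegral q γ (K x) ^ (1 / q) := by
      rw [linearIntegral_eq hn hγ hq he, ENNReal.mul_rpow_of_nonneg _ _ (by positivity),
        ← ENNReal.rpow_mul, mul_one_div_cancel hq.ne', ENNReal.rpow_one,
        ENNReal.ofReal_rpow_of_nonneg (div_nonneg (kappa_nonneg q e) (abs_nonneg _))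
          (by positivity)]
    rw [e2]
    exact (ENNReal.continuous_rpow_const.tendsto _).comp
      (tendsto_scaledIntegral hn h hL0 hL hγ hq hτpos hl0 x)

lemma ofReal_mul_fieldNorm (hρ : IsBallBanach ρ) {K : Rn n → Rn n} (hK : Measurable K) (a : ℝ) :
    ENNReal.ofReal a * fieldNorm ρ K = ρ fun x => ENNReal.ofReal a * ‖K x‖ₑ :=
  (hρ.smul a.toNNReal _ hK.enorm.aemeasurable).symm

/-- The limit formula for nice functions. -/
lemma IsNice.tendsto_functional {p q γ : ℝ} (hp : 1 ≤ p) (hn : 1 ≤ n) (hρ : IsBallBanach ρ)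
    (hY : IsBallBanach (convexify ρ (1 / p)))
    (ht : maximalOpNorm (associate (convexify ρ (1 / p))) < ∞)
    (hac : HasAbsolutelyContinuousNorm ρ) {f : Rn n → ℝ} {K : Rn n → Rn n}
    (h : IsNice f K) (hq : 0 < q) (hc : LimitCondition n p q γ) {e : Rn n} (he : ‖e‖ = 1)
    {F : Filter ℝ} [F.IsCountablyGenerated] (hF : ∀ᶠ l in F, 0 < l)
    (hF0 : Tendsto (fun l : ℝ => l ^ (-(q / γ))) F (𝓝 0)) :
    Tendsto (fun l => functional ρ q γ l f) F
      (𝓝 (ENNReal.ofReal ((kappa q e / |γ|) ^ (1 / q)) * fieldNorm ρ K)) := by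
  obtain ⟨L, hL0, hL⟩ := h.exists_bound
  obtain ⟨g, hgm, hgfin, hg⟩ := h.exists_dominating hp hρ hY ht hq hc
  have hKm := h.continuous_grad.measurable
  rw [tendsto_iff_seq_tendsto]
  intro l hl
  obtain ⟨N, hN⟩ := eventually_atTop.1
    ((hl.eventually hF).and ((hF0.comp hl).eventually (ge_mem_nhds zero_lt_one)))
  refine (tendsto_add_atTop_iff_nat N).1 ?_
  obtain ⟨h1, h2, h3⟩ := h.exists_seq_functional hn hρ hL0 hL hq hc.ne_zero he
    (l := fun j => l (j + N)) (fun j => (hN (j + N) (by omega)).1)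
    ((hF0.comp hl).comp (tendsto_add_atTop_nat N))
  rw [ofReal_mul_fieldNorm hρ hKm]
  simp only [Function.comp_apply, h1]
  exact tendsto_norm_of_dominated hρ hac hgm.aemeasurable hgfin (fun j => (h2 j).aemeasurable)
    (fun j => Eventually.of_forall fun x => hg _ (Real.rpow_pos_of_pos (hN (j + N) (by omega)).1 _)
      (hN (j + N) (by omega)).2 x) (hKm.enorm.const_mul _).aemeasurable
    (Eventually.of_forall fun x => ENNReal.mul_ne_top ENNReal.ofReal_ne_top enorm_ne_top)
    (Eventually.of_forall h3)

/-- The lower half of the limit formula, which needs no domination. -/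
lemma IsNice.eventually_lt_functional {q γ : ℝ} (hn : 1 ≤ n) (hρ : IsBallBanach ρ)
    {f : Rn n → ℝ} {K : Rn n → Rn n} (h : IsNice f K) (hq : 0 < q) (hγ : γ ≠ 0) {e : Rn n}
    (he : ‖e‖ = 1) {F : Filter ℝ} [F.IsCountablyGenerated] (hF : ∀ᶠ l in F, 0 < l)
    (hF0 : Tendsto (fun l : ℝ => l ^ (-(q / γ))) F (𝓝 0)) {y : ℝ≥0∞}
    (hy : y < ENNReal.ofReal ((kappa q e / |γ|) ^ (1 / q)) * fieldNorm ρ K) :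
    ∀ᶠ l in F, y < functional ρ q γ l f := by
  obtain ⟨L, hL0, hL⟩ := h.exists_bound
  rw [eventually_iff_seq_eventually]
  intro l hl
  obtain ⟨N, hN⟩ := eventually_atTop.1 (hl.eventually hF)
  obtain ⟨h1, h2, h3⟩ := h.exists_seq_functional hn hρ hL0 hL hq hγ he
    (l := fun j => l (j + N)) (fun j => hN (j + N) (by omega))
    ((hF0.comp hl).comp (tendsto_add_atTop_nat N))
  rw [ofReal_mul_fieldNorm hρ h.continuous_grad.measurable] at hy
  have h4 := hρ.liminf_le (fun j => (h2 j).aemeasurable)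
  simp only [fun x => (h3 x).liminf_eq] at h4
  have h5 := eventually_lt_of_lt_liminf (hy.trans_le h4)
  obtain ⟨N', hN'⟩ := eventually_atTop.1 h5
  refine eventually_atTop.2 ⟨N' + N, fun j hj => ?_⟩
  have := hN' (j - N) (by omega)
  rw [← h1] at this
  rwa [Nat.sub_add_cancel (by omega)] at this

end NiceLimit

/-! ### The upper bound for functions with compactly supported gradient -/

section UpperBound

variable {n : ℕ}

lemma IsNice.exists_enorm_bound {f : Rn n → ℝ} {K : Rn n → Rn n} (h : IsNice f K) :
    ∃ L : ℝ≥0, ∀ x, ‖K x‖ₑ ≤ L := by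
  obtain ⟨L, hL0, hL⟩ := h.exists_bound
  refine ⟨L.toNNReal, fun x => ?_⟩
  rw [← ofReal_norm]
  exact ENNReal.ofReal_le_ofReal (hL x)

lemma IsNice.fieldNorm_lt_top {ρ : FunctionNorm n} (hρ : IsBallBanach ρ) {f : Rn n → ℝ}
    {K : Rn n → Rn n} (h : IsNice f K) : fieldNorm ρ K < ∞ := by
  obtain ⟨L, hL⟩ := h.exists_enorm_bound
  obtain ⟨R, hR1, hRK, -⟩ := h.exists_radius
  have hm : Measurable ((Metric.ball (0 : Rn n) R).indicator (1 : Rn n → ℝ≥0∞)) :=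
    measurable_one.indicator measurableSet_ball
  refine (hρ.mono _ (fun x => (L : ℝ≥0∞) * (Metric.ball (0 : Rn n) R).indicator 1 x)
    h.continuous_grad.enorm.measurable.aemeasurable (hm.const_mul _).aemeasurable
    (Eventually.of_forall fun x => ?_)).trans_lt ?_
  · beta_reduce
    by_cases hx : ‖x‖ < R
    · rw [indicator_of_mem (mem_ball_zero_iff.2 hx), Pi.one_apply, mul_one]
      exact hL x
    · rw [hRK x (not_lt.1 hx), enorm_zero]
      exact bot_le
  · rw [hρ.smul _ _ hm.aemeasurable]
    exact ENNReal.mul_lt_top ENNReal.coe_lt_top (hρ.ball_mem 0 R (by linarith))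

lemma IsNice.lintegral_rpow_lt_top {f : Rn n → ℝ} {K : Rn n → Rn n} (h : IsNice f K) {p : ℝ}
    (hp : 0 < p) : ∫⁻ x, ‖K x‖ₑ ^ p < ∞ := by
  obtain ⟨L, hL⟩ := h.exists_enorm_bound
  obtain ⟨R, hR1, hRK, -⟩ := h.exists_radius
  calc ∫⁻ x, ‖K x‖ₑ ^ p ≤ ∫⁻ x in Metric.ball (0 : Rn n) R, (L : ℝ≥0∞) ^ p := by
        rw [← lintegral_indicator measurableSet_ball]
        refine lintegral_mono fun x => ?_
        by_cases hx : ‖x‖ < R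
        · rw [indicator_of_mem (mem_ball_zero_iff.2 hx)]
          exact ENNReal.rpow_le_rpow (hL x) hp.le
        · rw [hRK x (not_lt.1 hx), enorm_zero, ENNReal.zero_rpow_of_pos hp]
          exact bot_le
    _ < ∞ := by
        rw [setLIntegral_const]
        exact ENNReal.mul_lt_top (ENNReal.rpow_lt_top_of_nonneg hp.le ENNReal.coe_ne_top)
          measure_ball_lt_top

/-- One of the four conditions under which the upper bound holds. -/
def UpperCondition (n : ℕ) (p q γ r A : ℝ) (ρ : FunctionNorm n) : Prop :=
  (γ ≠ 0 ∧ 0 < q ∧ q ≤ p ∧ maximalOpNorm ρ ≤ ENNReal.ofReal A) ∨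
    (γ ≠ 0 ∧ 0 < q ∧ (n : ℝ) < r ∧ maximalOpNorm (convexify ρ (1 / r)) ≤ ENNReal.ofReal A) ∨
    (0 < γ ∧ 0 < q ∧ (n : ℝ) * (1 / p - 1 / q) < 1) ∨
    (γ < -1 ∧ n = 1 ∧ 1 ≤ q ∧ q ≤ p)

lemma UpperCondition.ne_zero {p q γ r A : ℝ} {ρ : FunctionNorm n}
    (h : UpperCondition n p q γ r A ρ) : γ ≠ 0 := by
  rcases h with h | h | h | h
  exacts [h.1, h.1, h.1.ne', by linarith [h.1]]

lemma UpperCondition.q_pos {p q γ r A : ℝ} {ρ : FunctionNorm n}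
    (h : UpperCondition n p q γ r A ρ) : 0 < q := by
  rcases h with h | h | h | h
  exacts [h.2.1, h.2.1, h.2.1, by linarith [h.2.2.1]]

/-- A bound of the form `C(t)`, continuous and increasing in `t`, for the constants
`(C (t + t²))^{1/p}`. -/
lemma rpow_mul_add_sq_le {p : ℝ} (hp : 1 ≤ p) (C : ℝ≥0∞) {t : ℝ≥0∞} (ht : t < ∞) :
    (C * (t + t ^ 2)) ^ (1 / p) ≤ C ^ (1 / p) * ENNReal.ofReal (Real.exp (2 * t.toReal)) := by
  have hp0 : 0 < p := by linarith
  rw [ENNReal.mul_rpow_of_nonneg _ _ (by positivity)]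
  refine mul_le_mul_right ?_ _
  set s := t.toReal with hs
  have hs0 : 0 ≤ s := ENNReal.toReal_nonneg
  have e : t = ENNReal.ofReal s := (ENNReal.ofReal_toReal ht.ne).symm
  have h1 : (1 : ℝ) ≤ Real.exp (2 * s) := Real.one_le_exp (by positivity)
  have h2 : s + s ^ 2 ≤ Real.exp (2 * s) := by
    have h3 := Real.add_one_le_exp s
    have h4 : Real.exp (2 * s) = Real.exp s * Real.exp s := by rw [← Real.exp_add]; ring_nf
    nlinarith
  rw [e, ← ENNReal.ofReal_pow hs0, ← ENNReal.ofReal_add hs0 (by positivity),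
    ENNReal.ofReal_rpow_of_nonneg (by positivity) (by positivity)]
  refine ENNReal.ofReal_le_ofReal ?_
  calc (s + s ^ 2) ^ (1 / p) ≤ Real.exp (2 * s) ^ (1 / p) :=
        Real.rpow_le_rpow (by positivity) h2 (by positivity)
    _ ≤ Real.exp (2 * s) ^ (1 : ℝ) := by
        refine Real.rpow_le_rpow_of_exponent_le h1 ?_
        rw [div_le_one hp0]
        exact hp
    _ = _ := Real.rpow_one _

/-- The bound for the functionals of nice functions with the constant `c exp(2t)`. -/
def NiceBound (p q γ : ℝ) (c : ℝ≥0∞) (ρ : FunctionNorm n) : Prop :=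
  ∀ (f : Rn n → ℝ) (K : Rn n → Rn n), IsNice f K → ∀ l : ℝ, 0 < l → functional ρ q γ l f ≤
    c * ENNReal.ofReal (Real.exp (2 *
      (maximalOpNorm (associate (convexify ρ (1 / p)))).toReal)) * fieldNorm ρ K

lemma NiceBound.mono {p q γ : ℝ} {c c' : ℝ≥0∞} {ρ : FunctionNorm n} (h : NiceBound p q γ c ρ)
    (hc : c ≤ c') : NiceBound p q γ c' ρ := fun f K hf l hl =>
  (h f K hf l hl).trans (mul_le_mul_left (mul_le_mul_left hc _) _)

lemma WeightedBound.exists_niceBound {p q γ : ℝ} (hp : 1 ≤ p) (H : WeightedBound n p q γ) :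
    ∃ c : ℝ≥0∞, c ≠ ∞ ∧ ∀ ρ : FunctionNorm n, IsBallBanach ρ →
      IsBallBanach (convexify ρ (1 / p)) →
      maximalOpNorm (associate (convexify ρ (1 / p))) < ∞ → NiceBound p q γ c ρ := by
  obtain ⟨C, hC, hb⟩ := H.functional_le hp
  refine ⟨C ^ (1 / p), ENNReal.rpow_ne_top_of_nonneg (by positivity) hC,
    fun ρ hρ hY ht f K hf l hl => ?_⟩
  exact (hb ρ hρ hY ht f K hf.toHasContGradient (hf.lintegral_rpow_lt_top (by linarith))
    (hf.fieldNorm_lt_top hρ) l hl).trans (mul_le_mul_left (rpow_mul_add_sq_le hp C ht) _)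

/-- The upper bound for nice functions, in all four cases; the constant is the sum of those of the cases
that the exponents permit. -/
lemma exists_niceBound (hn : 1 ≤ n) {p q γ : ℝ} (hp : 1 ≤ p) (r A : ℝ) :
    ∃ c : ℝ≥0∞, c ≠ ∞ ∧ ∀ ρ : FunctionNorm n, IsBallBanach ρ →
      IsBallBanach (convexify ρ (1 / p)) →
      maximalOpNorm (associate (convexify ρ (1 / p))) < ∞ →
      UpperCondition n p q γ r A ρ → NiceBound p q γ c ρ := by
  have ha : ∃ c : ℝ≥0∞, c ≠ ∞ ∧ ∀ ρ : FunctionNorm n, IsBallBanach ρ →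
      IsBallBanach (convexify ρ (1 / p)) →
      maximalOpNorm (associate (convexify ρ (1 / p))) < ∞ →
      (γ ≠ 0 ∧ 0 < q ∧ q ≤ p ∧ maximalOpNorm ρ ≤ ENNReal.ofReal A) → NiceBound p q γ c ρ := by
    by_cases hc : γ ≠ 0 ∧ 0 < q ∧ q ≤ p
    · obtain ⟨C, hC, hb⟩ := functional_le_maximal (n := n) hp hc.1 hc.2.1 hc.2.2
      refine ⟨C ^ (1 / p) * ENNReal.ofReal A, ENNReal.mul_ne_top
        (ENNReal.rpow_ne_top_of_nonneg (by positivity) hC) ENNReal.ofReal_ne_top,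
        fun ρ hρ hY ht hcond f K hf l hl => ?_⟩
      have hfin := hf.fieldNorm_lt_top hρ
      have hopt : maximalOpNorm ρ < ∞ := hcond.2.2.2.trans_lt ENNReal.ofReal_lt_top
      have hmax : ρ (maximal fun x => ‖K x‖ₑ) ≤ ENNReal.ofReal A * fieldNorm ρ K :=
        (norm_maximal_le hopt hf.continuous_grad.enorm.measurable.aemeasurable hfin).trans
          (mul_le_mul_left hcond.2.2.2 _)
      refine (hb ρ hρ hY ht f K hf.toHasContGradient hf.exists_enorm_bound
        (hmax.trans_lt (ENNReal.mul_lt_top ENNReal.ofReal_lt_top hfin)) l hl).trans ?_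
      refine (mul_le_mul' (rpow_mul_add_sq_le hp C ht) hmax).trans (le_of_eq ?_)
      ring
    · exact ⟨0, ENNReal.zero_ne_top, fun ρ _ _ _ h => absurd ⟨h.1, h.2.1, h.2.2.1⟩ hc⟩
  have hb : ∃ c : ℝ≥0∞, c ≠ ∞ ∧ ∀ ρ : FunctionNorm n, IsBallBanach ρ →
      (γ ≠ 0 ∧ 0 < q ∧ (n : ℝ) < r ∧
        maximalOpNorm (convexify ρ (1 / r)) ≤ ENNReal.ofReal A) → NiceBound p q γ c ρ := by
    by_cases hc : γ ≠ 0 ∧ 0 < q ∧ (n : ℝ) < r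
    · have hr0 : 0 < r := lt_of_le_of_lt (Nat.cast_nonneg n) hc.2.2
      obtain ⟨C, hC, hb⟩ := functional_le_morrey hn hc.1 hc.2.1 hc.2.2
      refine ⟨C * ENNReal.ofReal A ^ (1 / r), ENNReal.mul_ne_top hC
        (ENNReal.rpow_ne_top_of_nonneg (by positivity) ENNReal.ofReal_ne_top),
        fun ρ hρ hcond f K hf l hl => ?_⟩
      refine (hb ρ hρ (hcond.2.2.2.trans_lt ENNReal.ofReal_lt_top) f K hf.toHasContGradient
        hf.exists_enorm_bound (hf.fieldNorm_lt_top hρ) l hl).trans (mul_le_mul_left ?_ _)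
      calc _ ≤ C * ENNReal.ofReal A ^ (1 / r) * 1 := by
            rw [mul_one]
            exact mul_le_mul_right (ENNReal.rpow_le_rpow hcond.2.2.2 (by positivity)) _
        _ ≤ _ := by
            refine mul_le_mul_right ?_ _
            rw [← ENNReal.ofReal_one]
            exact ENNReal.ofReal_le_ofReal (Real.one_le_exp (by positivity))
    · exact ⟨0, ENNReal.zero_ne_top, fun ρ _ h => absurd ⟨h.1, h.2.1, h.2.2.1⟩ hc⟩
  have hcd : ∃ c : ℝ≥0∞, c ≠ ∞ ∧ ((0 < γ ∧ 0 < q ∧ (n : ℝ) * (1 / p - 1 / q) < 1) ∨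
      (γ < -1 ∧ n = 1 ∧ 1 ≤ q ∧ q ≤ p) → ∀ ρ : FunctionNorm n, IsBallBanach ρ →
      IsBallBanach (convexify ρ (1 / p)) →
      maximalOpNorm (associate (convexify ρ (1 / p))) < ∞ → NiceBound p q γ c ρ) := by
    by_cases hc : (0 < γ ∧ 0 < q ∧ (n : ℝ) * (1 / p - 1 / q) < 1) ∨
      (γ < -1 ∧ n = 1 ∧ 1 ≤ q ∧ q ≤ p)
    · have H : WeightedBound n p q γ := by
        rcases hc with h | ⟨h1, rfl, h3, h4⟩
        · exact weightedBound_of_pos hp h.2.1 h.1 h.2.2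
        · exact weightedBound_line hp (by linarith) h4 h1
      obtain ⟨c, hc, h⟩ := H.exists_niceBound hp
      exact ⟨c, hc, fun _ => h⟩
    · exact ⟨0, ENNReal.zero_ne_top, fun h => absurd h hc⟩
  obtain ⟨c1, hc1, h1⟩ := ha
  obtain ⟨c2, hc2, h2⟩ := hb
  obtain ⟨c3, hc3, h3⟩ := hcd
  refine ⟨c1 + c2 + c3, ENNReal.add_ne_top.2 ⟨ENNReal.add_ne_top.2 ⟨hc1, hc2⟩, hc3⟩,
    fun ρ hρ hY ht hcond => ?_⟩
  rcases hcond with h | h | h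
  · exact (h1 ρ hρ hY ht h).mono (le_self_add.trans le_self_add)
  · exact (h2 ρ hρ h).mono (le_add_self.trans le_self_add)
  · exact (h3 h ρ hρ hY ht).mono le_add_self

end UpperBound

/-! ### Passage to general functions -/

section Approximation

variable {n : ℕ} {ρ : FunctionNorm n}

/-- `f` is the almost everywhere limit of nice functions whose gradients converge to `G` in `X`. -/
def IsApproximable (ρ : FunctionNorm n) (f : Rn n → ℝ) (G : Rn n → Rn n) : Prop :=
  ∃ (u : ℕ → Rn n → ℝ) (K : ℕ → Rn n → Rn n), (∀ j, IsNice (u j) (K j)) ∧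
    (∀ᵐ x, Tendsto (fun j => u j x) atTop (𝓝 (f x))) ∧
    Tendsto (fun j => fieldNorm ρ (fun x => K j x - G x)) atTop (𝓝 0)

lemma HasContGradient.sub {f g : Rn n → ℝ} {K H : Rn n → Rn n} (hf : HasContGradient f K)
    (hg : HasContGradient g H) :
    HasContGradient (fun x => f x - g x) (fun x => K x - H x) := by
  refine ⟨fun x => ?_, hf.continuous_grad.sub hg.continuous_grad⟩
  have h := (hf.hasGradientAt x).hasFDerivAt.sub (hg.hasGradientAt x).hasFDerivAt
  rw [hasGradientAt_iff_hasFDerivAt, map_sub]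
  exact h

lemma IsNice.sub {f g : Rn n → ℝ} {K H : Rn n → Rn n} (hf : IsNice f K) (hg : IsNice g H) :
    IsNice (fun x => f x - g x) (fun x => K x - H x) := by
  refine ⟨hf.toHasContGradient.sub hg.toHasContGradient,
    hf.hasCompactSupport.sub hg.hasCompactSupport, fun hn => ?_⟩
  obtain ⟨c, R, hc⟩ := hf.exists_const hn
  obtain ⟨c', R', hc'⟩ := hg.exists_const hn
  refine ⟨c - c', max R R', fun x hx => ?_⟩
  rw [hc x ((le_max_left _ _).trans hx), hc' x ((le_max_right _ _).trans hx)]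

lemma IsApproximable.sub {f g : Rn n → ℝ} {G H : Rn n → Rn n} (hf : IsApproximable ρ f G)
    (hg : IsNice g H) : IsApproximable ρ (fun x => f x - g x) (fun x => G x - H x) := by
  obtain ⟨u, K, hu, hlim, hK⟩ := hf
  refine ⟨fun j x => u j x - g x, fun j x => K j x - H x, fun j => (hu j).sub hg, ?_, ?_⟩
  · filter_upwards [hlim] with x hx
    exact hx.sub_const _
  · simpa only [sub_sub_sub_cancel_right] using hK

lemma fieldNorm_le_add (hρ : IsBallBanach ρ) {G H : Rn n → Rn n} (hG : Measurable G)
    (hH : Measurable H) : fieldNorm ρ G ≤ fieldNorm ρ H + fieldNorm ρ (fun x => H x - G x) := by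
  have hm : Measurable fun x => ‖H x - G x‖ₑ := (hH.sub hG).enorm
  refine (hρ.mono _ _ hG.enorm.aemeasurable (hH.enorm.add hm).aemeasurable
    (Eventually.of_forall fun x => ?_)).trans (hρ.add_le _ _ hH.enorm.aemeasurable hm.aemeasurable)
  have e : G x = H x - (H x - G x) := by abel
  change ‖G x‖ₑ ≤ ‖H x‖ₑ + ‖H x - G x‖ₑ
  conv_lhs => rw [e]
  exact _root_.enorm_sub_le

lemma fieldNorm_sub_comm (G H : Rn n → Rn n) :
    fieldNorm ρ (fun x => G x - H x) = fieldNorm ρ (fun x => H x - G x) := by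
  simp only [fieldNorm, enorm_sub_rev]

/-- Lower semicontinuity of the level integrals under pointwise convergence. -/
lemma levelIntegral_le_liminf {u : ℕ → Rn n → ℝ} {f : Rn n → ℝ} (hu : ∀ j, Measurable (u j))
    (hlim : ∀ᵐ x, Tendsto (fun j => u j x) atTop (𝓝 (f x))) (l b γ : ℝ) {x : Rn n}
    (hx : Tendsto (fun j => u j x) atTop (𝓝 (f x))) :
    levelIntegral l b γ f x ≤ liminf (fun j => levelIntegral l b γ (u j) x) atTop := by
  refine le_trans (lintegral_mono_ae ?_) (lintegral_liminf_le fun j =>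
    ((measurable_kernel γ).indicator (measurableSet_levelSet (hu j) l b)).comp
      measurable_prodMk_left)
  filter_upwards [hlim] with y hy
  by_cases hxy : (x, y) ∈ levelSet l b f
  · have hq : Tendsto (fun j => |u j x - u j y| / ‖x - y‖ ^ (1 + b)) atTop
        (𝓝 (|f x - f y| / ‖x - y‖ ^ (1 + b))) := ((hx.sub hy).abs).div_const _
    have hev : ∀ᶠ j in atTop, (x, y) ∈ levelSet l b (u j) := by
      filter_upwards [hq.eventually_const_lt hxy.2] with j hj
      exact ⟨hxy.1, hj⟩
    refine le_liminf_of_le (by isBoundedDefault) ?_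
    filter_upwards [hev] with j hj
    rw [indicator_of_mem hxy, indicator_of_mem hj]
  · rw [indicator_of_notMem hxy]
    exact bot_le

lemma functional_le_liminf (hρ : IsBallBanach ρ) {u : ℕ → Rn n → ℝ} {f : Rn n → ℝ}
    (hu : ∀ j, Measurable (u j)) (hf : Measurable f)
    (hlim : ∀ᵐ x, Tendsto (fun j => u j x) atTop (𝓝 (f x))) {q : ℝ} (hq : 0 < q) (γ l : ℝ) :
    functional ρ q γ l f ≤ liminf (fun j => functional ρ q γ l (u j)) atTop := by
  simp only [functional_eq hρ hf, functional_eq hρ (hu _)]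
  have hm : ∀ g : Rn n → ℝ, Measurable g → Measurable fun x =>
      ENNReal.ofReal l * levelIntegral l (γ / q) γ g x ^ (1 / q) := fun g hg =>
    ((measurable_levelIntegral hg _ _ _).pow_const _).const_mul _
  refine le_trans (hρ.mono _ (fun x => liminf (fun j =>
    ENNReal.ofReal l * levelIntegral l (γ / q) γ (u j) x ^ (1 / q)) atTop)
    (hm f hf).aemeasurable (Measurable.liminf fun j => hm _ (hu j)).aemeasurable ?_)
    (hρ.liminf_le fun j => (hm _ (hu j)).aemeasurable)
  filter_upwards [hlim] with x hx
  have hmono : Monotone fun a : ℝ≥0∞ => ENNReal.ofReal l * a ^ (1 / q) := fun a b hab =>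
    mul_le_mul_right (ENNReal.rpow_le_rpow hab (by positivity)) _
  have hcont : Continuous fun a : ℝ≥0∞ => ENNReal.ofReal l * a ^ (1 / q) :=
    (ENNReal.continuous_const_mul ENNReal.ofReal_ne_top).comp ENNReal.continuous_rpow_const
  have h1 := hmono (levelIntegral_le_liminf hu hlim l (γ / q) γ hx)
  exact h1.trans_eq (hmono.map_liminf_of_continuousAt _ hcont.continuousAt)

/-- The upper bound passes from nice functions to their limits by Fatou's lemma. -/
lemma IsApproximable.functional_le {q γ : ℝ} (hρ : IsBallBanach ρ) (hq : 0 < q) {C : ℝ≥0∞}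
    (hC : C ≠ ∞) (hb : ∀ (f : Rn n → ℝ) (K : Rn n → Rn n), IsNice f K → ∀ l : ℝ, 0 < l →
      functional ρ q γ l f ≤ C * fieldNorm ρ K)
    {f : Rn n → ℝ} {G : Rn n → Rn n} (h : IsApproximable ρ f G) (hf : Measurable f)
    (hG : Measurable G) {l : ℝ} (hl : 0 < l) : functional ρ q γ l f ≤ C * fieldNorm ρ G := by
  obtain ⟨u, K, hu, hlim, hK⟩ := h
  have hKm : ∀ j, Measurable (K j) := fun j => (hu j).continuous_grad.measurable
  refine (functional_le_liminf hρ (fun j => (hu j).continuous.measurable) hf hlim hq γ l).trans ?_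
  have h1 : Tendsto (fun j => C * (fieldNorm ρ G + fieldNorm ρ (fun x => K j x - G x))) atTop
      (𝓝 (C * (fieldNorm ρ G + 0))) :=
    ENNReal.Tendsto.const_mul (tendsto_const_nhds.add hK) (Or.inr hC)
  rw [add_zero] at h1
  rw [← h1.liminf_eq]
  refine liminf_le_liminf (Eventually.of_forall fun j => (hb _ _ (hu j) l hl).trans ?_)
  refine mul_le_mul_right ?_ _
  rw [fieldNorm_sub_comm]
  exact fieldNorm_le_add hρ (hKm j) hG

/-- The inequality `(a + b)^s ≤ (1 + δ) a^s + C b^s`: either `b ≤ η a`, or `a` is bounded by `b / η`. -/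
lemma exists_add_rpow_le {s δ : ℝ} (hs : 0 < s) (hδ : 0 < δ) :
    ∃ C : ℝ≥0, ∀ a b : ℝ≥0∞, (a + b) ^ s ≤ ENNReal.ofReal (1 + δ) * a ^ s + C * b ^ s := by
  set η : ℝ := (1 + δ) ^ (1 / s) - 1 with hη
  have h1 : 1 < (1 + δ) ^ (1 / s) := Real.one_lt_rpow (by linarith) (by positivity)
  have hη0 : 0 < η := by linarith
  have hηs : (1 + η) ^ s = 1 + δ := by
    rw [hη, add_sub_cancel, ← Real.rpow_mul (by linarith), one_div_mul_cancel hs.ne', Real.rpow_one]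
  refine ⟨((1 + 1 / η) ^ s).toNNReal, fun a b => ?_⟩
  have key : ∀ (c : ℝ), 0 < c → ∀ x y : ℝ≥0∞, y ≤ ENNReal.ofReal c * x →
      (x + y) ^ s ≤ ENNReal.ofReal ((1 + c) ^ s) * x ^ s := by
    intro c hc x y hxy
    rw [← ENNReal.ofReal_rpow_of_pos (by positivity), ← ENNReal.mul_rpow_of_nonneg _ _ hs.le]
    refine ENNReal.rpow_le_rpow ?_ hs.le
    rw [ENNReal.ofReal_add zero_le_one hc.le, ENNReal.ofReal_one, add_mul, one_mul]
    exact add_le_add le_rfl hxy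
  rcases le_total b (ENNReal.ofReal η * a) with hab | hab
  · rw [← hηs]
    exact (key η hη0 a b hab).trans le_self_add
  · refine le_trans ?_ le_add_self
    rw [add_comm a b]
    refine key (1 / η) (by positivity) b a ?_
    calc a = ENNReal.ofReal (1 / η) * (ENNReal.ofReal η * a) := by
          rw [← mul_assoc, ← ENNReal.ofReal_mul (by positivity), one_div_mul_cancel hη0.ne',
            ENNReal.ofReal_one, one_mul]
      _ ≤ _ := mul_le_mul_right hab _

/-- A substitute for the triangle inequality: passing from `f` to `g` costs a factor close to `1`, at
the expense of a large constant in front of the functional of `f - g`. -/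
lemma exists_functional_le_add (n : ℕ) {q δ : ℝ} (hq : 0 < q) (hδ : 0 < δ) :
    ∃ C : ℝ≥0∞, C ≠ ∞ ∧ ∀ ρ : FunctionNorm n, IsBallBanach ρ → ∀ f g : Rn n → ℝ, Measurable f →
      Measurable g → ∀ γ l : ℝ, 0 < l → functional ρ q γ ((1 + δ) * l) f ≤
        ENNReal.ofReal ((1 + δ) ^ 2) * functional ρ q γ l g +
          C * functional ρ q γ (δ * l) (fun x => f x - g x) := by
  obtain ⟨C, hC⟩ := exists_add_rpow_le (s := 1 / q) (by positivity) hδ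
  refine ⟨ENNReal.ofReal ((1 + δ) / δ) * C,
    ENNReal.mul_ne_top ENNReal.ofReal_ne_top ENNReal.coe_ne_top,
    fun ρ hρ f g hf hg γ l hl => ?_⟩
  set b := γ / q with hb
  set h : Rn n → ℝ := fun x => f x - g x with hh
  have hhm : Measurable h := hf.sub hg
  have hsub : levelSet ((1 + δ) * l) b f ⊆ levelSet l b g ∪ levelSet (δ * l) b h := by
    rintro ⟨x, y⟩ ⟨hne, hxy⟩
    by_contra hcon
    rw [mem_union, not_or] at hcon
    have h1 : |g x - g y| / ‖x - y‖ ^ (1 + b) ≤ l := by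
      by_contra! h'
      exact hcon.1 ⟨hne, h'⟩
    have h2 : |h x - h y| / ‖x - y‖ ^ (1 + b) ≤ δ * l := by
      by_contra! h'
      exact hcon.2 ⟨hne, h'⟩
    have h3 : |f x - f y| ≤ |g x - g y| + |h x - h y| := by
      have : f x - f y = (g x - g y) + (h x - h y) := by rw [hh]; ring
      rw [this]
      exact abs_add_le _ _
    have h4 : |f x - f y| / ‖x - y‖ ^ (1 + b) ≤ l + δ * l :=
      calc _ ≤ (|g x - g y| + |h x - h y|) / ‖x - y‖ ^ (1 + b) := by gcongr
        _ ≤ _ := by rw [add_div]; exact add_le_add h1 h2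
    change (1 + δ) * l < |f x - f y| / ‖x - y‖ ^ (1 + b) at hxy
    linarith
  set Vf := levelIntegral ((1 + δ) * l) b γ f with hVf
  set Vg := levelIntegral l b γ g with hVg
  set Vh := levelIntegral (δ * l) b γ h with hVh
  have hVgm : Measurable fun x => Vg x ^ (1 / q) := (measurable_levelIntegral hg _ _ _).pow_const _
  have hVhm : Measurable fun x => Vh x ^ (1 / q) := (measurable_levelIntegral hhm _ _ _).pow_const _
  have hV : ∀ x, Vf x ≤ Vg x + Vh x := by
    intro x
    set k : Rn n × Rn n → ℝ≥0∞ := fun z => ENNReal.ofReal (‖z.1 - z.2‖ ^ (γ - n)) with hk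
    have hgy : Measurable fun y => (levelSet l b g).indicator k (x, y) :=
      ((measurable_kernel γ).indicator (measurableSet_levelSet hg l b)).comp measurable_prodMk_left
    have e : Vg x + Vh x = ∫⁻ y, ((levelSet l b g).indicator k (x, y) +
        (levelSet (δ * l) b h).indicator k (x, y)) := (lintegral_add_left hgy _).symm
    rw [e]
    refine lintegral_mono fun y => ?_
    by_cases hxy : (x, y) ∈ levelSet ((1 + δ) * l) b f
    · rw [indicator_of_mem hxy]
      rcases hsub hxy with h' | h'
      · rw [indicator_of_mem h']; exact le_self_add
      · refine le_trans ?_ le_add_self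
        rw [indicator_of_mem h']
    · rw [indicator_of_notMem hxy]; exact bot_le
  have hpt : ∀ x, Vf x ^ (1 / q) ≤
      (((1 + δ).toNNReal : ℝ≥0) : ℝ≥0∞) * Vg x ^ (1 / q) + C * Vh x ^ (1 / q) := fun x =>
    (ENNReal.rpow_le_rpow (hV x) (by positivity)).trans (hC _ _)
  have hN : ρ (fun x => Vf x ^ (1 / q)) ≤ ENNReal.ofReal (1 + δ) * ρ (fun x => Vg x ^ (1 / q)) +
      C * ρ (fun x => Vh x ^ (1 / q)) := by
    refine (hρ.mono _ _ ((measurable_levelIntegral hf _ _ _).pow_const _).aemeasurable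
      ((hVgm.const_mul _).add (hVhm.const_mul _)).aemeasurable
      (Eventually.of_forall hpt)).trans ((hρ.add_le _ _ (hVgm.const_mul _).aemeasurable
      (hVhm.const_mul _).aemeasurable).trans ?_)
    rw [hρ.smul _ _ hVgm.aemeasurable, hρ.smul _ _ hVhm.aemeasurable]
    rfl
  have e1 : ENNReal.ofReal ((1 + δ) * l) = ENNReal.ofReal (1 + δ) * ENNReal.ofReal l :=
    ENNReal.ofReal_mul (by positivity)
  have e2 : ENNReal.ofReal ((1 + δ) * l) = ENNReal.ofReal ((1 + δ) / δ) * ENNReal.ofReal (δ * l) := by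
    rw [← ENNReal.ofReal_mul (by positivity)]
    congr 1
    field_simp
  calc functional ρ q γ ((1 + δ) * l) f
      = ENNReal.ofReal ((1 + δ) * l) * ρ (fun x => Vf x ^ (1 / q)) := rfl
    _ ≤ ENNReal.ofReal ((1 + δ) * l) * (ENNReal.ofReal (1 + δ) * ρ (fun x => Vg x ^ (1 / q)) +
        C * ρ (fun x => Vh x ^ (1 / q))) := mul_le_mul_right hN _
    _ = ENNReal.ofReal (1 + δ) ^ 2 * (ENNReal.ofReal l * ρ (fun x => Vg x ^ (1 / q))) +
        ENNReal.ofReal ((1 + δ) / δ) * C * (ENNReal.ofReal (δ * l) *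
          ρ (fun x => Vh x ^ (1 / q))) := by
        rw [mul_add]
        nth_rw 1 [e1]
        rw [e2]
        ring
    _ = _ := by rw [← ENNReal.ofReal_pow (by positivity)]; rfl

end Approximation

section Limit

variable {n : ℕ} {ρ : FunctionNorm n}

/-- The lower half of the limit formula passes from nice functions to their limits: a nice function `u`
with gradient close to `G` is compared with `f` at the level `l`, and the remainder `u - f` is
controlled by the upper bound. -/
lemma IsApproximable.eventually_lt_functional {q γ : ℝ} (hρ : IsBallBanach ρ) (hq : 0 < q)
    {C κ : ℝ≥0∞} (hC : C ≠ ∞) (hκ : κ ≠ ∞)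
    (hb : ∀ (f : Rn n → ℝ) (K : Rn n → Rn n), IsNice f K → ∀ l : ℝ, 0 < l →
      functional ρ q γ l f ≤ C * fieldNorm ρ K) {F : Filter ℝ} (hF : ∀ᶠ l in F, 0 < l)
    (hFc : ∀ c : ℝ, 0 < c → Tendsto (fun l => c * l) F F)
    (hlow : ∀ (f : Rn n → ℝ) (K : Rn n → Rn n), IsNice f K → ∀ y < κ * fieldNorm ρ K,
      ∀ᶠ l in F, y < functional ρ q γ l f)
    {f : Rn n → ℝ} {G : Rn n → Rn n} (h : IsApproximable ρ f G) (hf : Measurable f)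
    (hG : Measurable G) {y : ℝ≥0∞} (hy : y < κ * fieldNorm ρ G) :
    ∀ᶠ l in F, y < functional ρ q γ l f := by
  have happ := h
  obtain ⟨u, K, hu, -, hK⟩ := h
  have hyt : y ≠ ∞ := (hy.trans_le le_top).ne
  -- the factor lost by passing to a nice function does not matter
  have hδ : ∃ δ : ℝ, 0 < δ ∧ ENNReal.ofReal ((1 + δ) ^ 2) * y < κ * fieldNorm ρ G := by
    have hc : Tendsto (fun δ : ℝ => ENNReal.ofReal ((1 + δ) ^ 2) * y) (𝓝[>] 0)
        (𝓝 (ENNReal.ofReal ((1 + 0) ^ 2) * y)) := by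
      refine ENNReal.Tendsto.mul_const ?_ (Or.inr hyt)
      refine (ENNReal.continuous_ofReal.tendsto _).comp ?_
      have : Continuous fun δ : ℝ => (1 + δ) ^ 2 := by fun_prop
      exact (this.tendsto 0).mono_left nhdsWithin_le_nhds
    rw [add_zero, one_pow, ENNReal.ofReal_one, one_mul] at hc
    obtain ⟨δ, h1, h2⟩ := ((hc.eventually_lt_const hy).and self_mem_nhdsWithin).exists
    exact ⟨δ, h2, h1⟩
  obtain ⟨δ, hδ0, hδy⟩ := hδ
  obtain ⟨D, hD, hsplit⟩ := exists_functional_le_add n hq hδ0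
  have hj : ∃ j, ENNReal.ofReal ((1 + δ) ^ 2) * y + D * (C * fieldNorm ρ (fun x => K j x - G x)) <
      κ * fieldNorm ρ (K j) := by
    set d : ℕ → ℝ≥0∞ := fun j => fieldNorm ρ (fun x => K j x - G x) with hd
    have h1 : Tendsto (fun j => ENNReal.ofReal ((1 + δ) ^ 2) * y + D * (C * d j) + κ * d j) atTop
        (𝓝 (ENNReal.ofReal ((1 + δ) ^ 2) * y + D * (C * 0) + κ * 0)) :=
      (tendsto_const_nhds.add (ENNReal.Tendsto.const_mul (ENNReal.Tendsto.const_mul hK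
        (Or.inr hC)) (Or.inr hD))).add (ENNReal.Tendsto.const_mul hK (Or.inr hκ))
    rw [mul_zero, mul_zero, mul_zero, add_zero, add_zero] at h1
    have hfinal : ∀ᶠ j in atTop, κ * d j < ∞ := by
      filter_upwards [hK.eventually_lt_const (show (0 : ℝ≥0∞) < ∞ from ENNReal.zero_lt_top)] with j hj
      exact ENNReal.mul_lt_top hκ.lt_top hj
    obtain ⟨j, hj, hjf⟩ := ((h1.eventually_lt_const hδy).and hfinal).exists
    refine ⟨j, ?_⟩
    have h2 : κ * fieldNorm ρ G ≤ κ * fieldNorm ρ (K j) + κ * d j := by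
      rw [← mul_add]
      exact mul_le_mul_right (fieldNorm_le_add hρ hG (hu j).continuous_grad.measurable) _
    exact lt_of_add_lt_add_right (hj.trans_le h2)
  obtain ⟨j, hj⟩ := hj
  have hev := (hFc (1 + δ) (by positivity)).eventually (hlow _ _ (hu j) _ hj)
  filter_upwards [hev, hF] with l hl hl0
  by_contra! hcon
  have hgm : Measurable (u j) := (hu j).continuous.measurable
  have h1 := hsplit ρ hρ (u j) f hgm hf γ l hl0
  have h2 : functional ρ q γ (δ * l) (fun x => u j x - f x) ≤
      C * fieldNorm ρ (fun x => K j x - G x) := by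
    have h3 := (happ.sub (hu j)).functional_le hρ hq hC hb (hf.sub hgm)
      (hG.sub (hu j).continuous_grad.measurable) (l := δ * l) (by positivity)
    rw [fieldNorm_sub_comm] at h3
    refine le_trans (le_of_eq ?_) h3
    have e : ∀ x y, |(u j x - f x) - (u j y - f y)| = |(f x - u j x) - (f y - u j y)| := by
      intro x y
      rw [← abs_neg]
      congr 1
      ring
    simp only [functional, levelSet, e]
  refine absurd (hl.trans_le (h1.trans (add_le_add (mul_le_mul_right hcon _)
    (mul_le_mul_right h2 _)))) (lt_irrefl _)

/-- The upper half of the limit formula passes from nice functions to their limits, with the roles of `f`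
and of the nice function exchanged. -/
lemma IsApproximable.eventually_functional_lt {q γ : ℝ} (hρ : IsBallBanach ρ) (hq : 0 < q)
    {C κ : ℝ≥0∞} (hC : C ≠ ∞) (hκ : κ ≠ ∞)
    (hb : ∀ (f : Rn n → ℝ) (K : Rn n → Rn n), IsNice f K → ∀ l : ℝ, 0 < l →
      functional ρ q γ l f ≤ C * fieldNorm ρ K) {F : Filter ℝ} (hF : ∀ᶠ l in F, 0 < l)
    (hFc : ∀ c : ℝ, 0 < c → Tendsto (fun l => c * l) F F)
    (hlim : ∀ (f : Rn n → ℝ) (K : Rn n → Rn n), IsNice f K →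
      Tendsto (fun l => functional ρ q γ l f) F (𝓝 (κ * fieldNorm ρ K)))
    {f : Rn n → ℝ} {G : Rn n → Rn n} (h : IsApproximable ρ f G) (hf : Measurable f)
    (hG : Measurable G) (hGfin : fieldNorm ρ G < ∞) {y : ℝ≥0∞} (hy : κ * fieldNorm ρ G < y) :
    ∀ᶠ l in F, functional ρ q γ l f < y := by
  have happ := h
  obtain ⟨u, K, hu, -, hK⟩ := h
  have hδ : ∃ δ : ℝ, 0 < δ ∧ ENNReal.ofReal ((1 + δ) ^ 2) * (κ * fieldNorm ρ G) < y := by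
    have hc : Tendsto (fun δ : ℝ => ENNReal.ofReal ((1 + δ) ^ 2) * (κ * fieldNorm ρ G)) (𝓝[>] 0)
        (𝓝 (ENNReal.ofReal ((1 + 0) ^ 2) * (κ * fieldNorm ρ G))) := by
      refine ENNReal.Tendsto.mul_const ?_ (Or.inr (ENNReal.mul_ne_top hκ hGfin.ne))
      refine (ENNReal.continuous_ofReal.tendsto _).comp ?_
      have : Continuous fun δ : ℝ => (1 + δ) ^ 2 := by fun_prop
      exact (this.tendsto 0).mono_left nhdsWithin_le_nhds
    rw [add_zero, one_pow, ENNReal.ofReal_one, one_mul] at hc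
    obtain ⟨δ, h1, h2⟩ := ((hc.eventually_lt_const hy).and self_mem_nhdsWithin).exists
    exact ⟨δ, h2, h1⟩
  obtain ⟨δ, hδ0, hδy⟩ := hδ
  obtain ⟨D, hD, hsplit⟩ := exists_functional_le_add n hq hδ0
  have hj : ∃ j, ENNReal.ofReal ((1 + δ) ^ 2) * (κ * fieldNorm ρ (K j)) +
      D * (C * fieldNorm ρ (fun x => K j x - G x)) < y := by
    set d : ℕ → ℝ≥0∞ := fun j => fieldNorm ρ (fun x => K j x - G x) with hd
    have h1 : Tendsto (fun j => ENNReal.ofReal ((1 + δ) ^ 2) * (κ * (fieldNorm ρ G + d j)) +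
        D * (C * d j)) atTop
        (𝓝 (ENNReal.ofReal ((1 + δ) ^ 2) * (κ * (fieldNorm ρ G + 0)) + D * (C * 0))) :=
      (ENNReal.Tendsto.const_mul (ENNReal.Tendsto.const_mul (tendsto_const_nhds.add hK)
        (Or.inr hκ)) (Or.inr ENNReal.ofReal_ne_top)).add
        (ENNReal.Tendsto.const_mul (ENNReal.Tendsto.const_mul hK (Or.inr hC)) (Or.inr hD))
    rw [mul_zero, mul_zero, add_zero, add_zero] at h1
    obtain ⟨j, hj⟩ := (h1.eventually_lt_const hδy).exists
    refine ⟨j, lt_of_le_of_lt (add_le_add (mul_le_mul_right (mul_le_mul_right ?_ _) _) le_rfl) hj⟩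
    rw [hd]
    beta_reduce
    rw [fieldNorm_sub_comm]
    exact fieldNorm_le_add hρ (hu j).continuous_grad.measurable hG
  obtain ⟨j, hj⟩ := hj
  have hgm : Measurable (u j) := (hu j).continuous.measurable
  have ha : (0 : ℝ) < (1 + δ)⁻¹ := by positivity
  have hlim' : Tendsto (fun l => ENNReal.ofReal ((1 + δ) ^ 2) *
      functional ρ q γ ((1 + δ)⁻¹ * l) (u j) + D * (C * fieldNorm ρ (fun x => K j x - G x))) F
      (𝓝 (ENNReal.ofReal ((1 + δ) ^ 2) * (κ * fieldNorm ρ (K j)) +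
        D * (C * fieldNorm ρ (fun x => K j x - G x)))) :=
    (ENNReal.Tendsto.const_mul ((hlim _ _ (hu j)).comp (hFc _ ha))
      (Or.inr ENNReal.ofReal_ne_top)).add tendsto_const_nhds
  filter_upwards [hlim'.eventually_lt_const hj, hF] with l hl hl0
  refine lt_of_le_of_lt ?_ hl
  have h1 := hsplit ρ hρ f (u j) hf hgm γ ((1 + δ)⁻¹ * l) (by positivity)
  rw [← mul_assoc, mul_inv_cancel₀ (by positivity), one_mul] at h1
  refine h1.trans (add_le_add le_rfl (mul_le_mul_right ?_ _))
  rw [fieldNorm_sub_comm]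
  exact (happ.sub (hu j)).functional_le hρ hq hC hb (hf.sub hgm)
    (hG.sub (hu j).continuous_grad.measurable) (by positivity)

lemma functional_congr_ae (hρ : IsBallBanach ρ) {f g : Rn n → ℝ} (hg : Measurable g)
    (hfg : f =ᵐ[volume] g) (q γ l : ℝ) : functional ρ q γ l f = functional ρ q γ l g := by
  have e : (fun x => levelIntegral l (γ / q) γ g x ^ (1 / q)) =ᵐ[volume]
      fun x => levelIntegral l (γ / q) γ f x ^ (1 / q) := by
    filter_upwards [hfg] with x hx
    congr 1
    refine lintegral_congr_ae ?_
    filter_upwards [hfg] with y hy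
    have hiff : (x, y) ∈ levelSet l (γ / q) g ↔ (x, y) ∈ levelSet l (γ / q) f := by
      simp only [levelSet, mem_ofPred_eq, hx, hy]
    by_cases h : (x, y) ∈ levelSet l (γ / q) g
    · rw [indicator_of_mem h, indicator_of_mem (hiff.1 h)]
    · rw [indicator_of_notMem h, indicator_of_notMem fun h' => h (hiff.2 h')]
  have := hρ.congr ((measurable_levelIntegral hg l (γ / q) γ).pow_const (1 / q)).aemeasurable e
  exact congrArg (ENNReal.ofReal l * ·) this.symm

/-- A function with gradient in `X` may be assumed measurable, together with its gradient, and is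
then approximable. -/
lemma exists_isApproximable {p : ℝ} (hp : 1 ≤ p) (hn : 1 ≤ n) (hρ : IsBallBanach ρ)
    (hY : IsBallBanach (convexify ρ (1 / p)))
    (ht : maximalOpNorm (associate (convexify ρ (1 / p))) < ∞)
    (hac : HasAbsolutelyContinuousNorm ρ) {T : 𝓓'((⊤ : Opens (Rn n)), ℝ)} {G : Rn n → Rn n}
    (h : IsGradient T G) (hfin : fieldNorm ρ G < ∞) {f : Rn n → ℝ} (hf : IsFunction T f) :
    ∃ (g : Rn n → ℝ) (H : Rn n → Rn n), Measurable g ∧ Measurable H ∧ f =ᵐ[volume] g ∧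
      fieldNorm ρ H = fieldNorm ρ G ∧ IsApproximable ρ g H := by
  have hGsum : G = fun x => ∑ i, G x i • (EuclideanSpace.single i (1 : ℝ) : Rn n) := by
    funext x
    ext j
    simp [Pi.single_apply]
  have hG : LocallyIntegrable G volume := by
    rw [hGsum]
    have : ∀ i ∈ (Finset.univ : Finset (Fin n)), LocallyIntegrable
        (fun x => G x i • (EuclideanSpace.single i (1 : ℝ) : Rn n)) volume := fun i _ x => by
      obtain ⟨s, hs, hi⟩ := (h i).1 x
      exact ⟨s, hs, Integrable.smul_const hi _⟩
    exact locallyIntegrable_finsetSum _ this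
  obtain ⟨H, hHm, hGH⟩ := hG.aestronglyMeasurable.aemeasurable
  obtain ⟨g, hgm, hfg⟩ := hf.1.aestronglyMeasurable.aemeasurable
  have hH : LocallyIntegrable H volume := hG.congr hGH
  have hnorm : fieldNorm ρ H = fieldNorm ρ G :=
    hρ.congr hHm.enorm.aemeasurable (hGH.symm.fun_comp fun v => ‖v‖ₑ)
  have hT : IsGradient T H := fun i => by
    have hi : (fun x => G x i) =ᵐ[volume] fun x => H x i := hGH.fun_comp fun v => v i
    refine ⟨(h i).1.congr hi, fun φ => ((h i).2 φ).trans (integral_congr_ae ?_)⟩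
    filter_upwards [hi] with x hx
    rw [hx]
  have hfT : IsFunction T g := by
    refine ⟨hf.1.congr hfg, fun φ => (hf.2 φ).trans (integral_congr_ae ?_)⟩
    filter_upwards [hfg] with x hx
    rw [hx]
  exact ⟨g, H, hgm, hHm, hfg, hnorm,
    exists_isNice_seq hp hn hρ hY ht hac hT hHm hH (hnorm.trans_lt hfin) hfT⟩

end Limit

section Filters

lemma tendsto_rpow_neg_div_atTop {q γ : ℝ} (hq : 0 < q) (hγ : 0 < γ) :
    Tendsto (fun l : ℝ => l ^ (-(q / γ))) atTop (𝓝 0) :=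
  tendsto_rpow_neg_atTop (by positivity)

lemma tendsto_rpow_neg_div_zero {q γ : ℝ} (hq : 0 < q) (hγ : γ < 0) :
    Tendsto (fun l : ℝ => l ^ (-(q / γ))) (𝓝[>] 0) (𝓝 0) := by
  have h : 0 < -(q / γ) := neg_pos.2 (div_neg_of_pos_of_neg hq hγ)
  have := ((Real.continuous_rpow_const h.le).tendsto 0).mono_left
    (nhdsWithin_le_nhds (s := Ioi (0 : ℝ)))
  rwa [Real.zero_rpow h.ne'] at this

lemma tendsto_const_mul_nhdsGT_zero {c : ℝ} (hc : 0 < c) :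
    Tendsto (fun l : ℝ => c * l) (𝓝[>] 0) (𝓝[>] 0) := by
  refine tendsto_nhdsWithin_iff.2 ⟨?_, ?_⟩
  · have := ((continuous_const_mul c).tendsto 0).mono_left (nhdsWithin_le_nhds (s := Ioi (0 : ℝ)))
    rwa [mul_zero] at this
  · filter_upwards [self_mem_nhdsWithin] with l hl
    exact mul_pos hc hl

end Filters

section Conclusion

variable {n : ℕ} {ρ : FunctionNorm n}

/-- The constant `c` is increased by `1` so that it is positive. -/
lemma NiceBound.functional_le {p q γ : ℝ} {c : ℝ≥0∞} (hc : c ≠ ∞) (hρ : IsBallBanach ρ)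
    (hq : 0 < q) (hb : NiceBound p q γ c ρ) {f : Rn n → ℝ} {G : Rn n → Rn n}
    (h : IsApproximable ρ f G) (hf : Measurable f) (hG : Measurable G) {l : ℝ} (hl : 0 < l) :
    functional ρ q γ l f ≤ ENNReal.ofReal ((c.toReal + 1) *
      Real.exp (2 * (maximalOpNorm (associate (convexify ρ (1 / p)))).toReal)) * fieldNorm ρ G := by
  refine (h.functional_le hρ hq (ENNReal.mul_ne_top hc ENNReal.ofReal_ne_top) hb hf hG hl).trans
    (mul_le_mul_left ?_ _)
  rw [ENNReal.ofReal_mul (by positivity), ENNReal.ofReal_add ENNReal.toReal_nonneg zero_le_one,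
    ENNReal.ofReal_toReal hc]
  exact mul_le_mul_left le_self_add _

/-- The lower half of the limit formula, along any filter for which the scale tends to zero. -/
lemma NiceBound.eventually_lt {p q γ : ℝ} {c : ℝ≥0∞} (hc : c ≠ ∞) (hn : 1 ≤ n)
    (hρ : IsBallBanach ρ) (hq : 0 < q) (hγ : γ ≠ 0) (hb : NiceBound p q γ c ρ) {e : Rn n}
    (he : ‖e‖ = 1) {F : Filter ℝ} [F.IsCountablyGenerated] (hF : ∀ᶠ l in F, 0 < l)
    (hF0 : Tendsto (fun l : ℝ => l ^ (-(q / γ))) F (𝓝 0))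
    (hFc : ∀ c : ℝ, 0 < c → Tendsto (fun l => c * l) F F) {f : Rn n → ℝ} {G : Rn n → Rn n}
    (h : IsApproximable ρ f G) (hf : Measurable f) (hG : Measurable G) {y : ℝ≥0∞}
    (hy : y < ENNReal.ofReal ((kappa q e / |γ|) ^ (1 / q)) * fieldNorm ρ G) :
    ∀ᶠ l in F, y < functional ρ q γ l f :=
  h.eventually_lt_functional hρ hq (ENNReal.mul_ne_top hc ENNReal.ofReal_ne_top)
    ENNReal.ofReal_ne_top hb hF hFc
    (fun _ _ hu _ hy => hu.eventually_lt_functional hn hρ hq hγ he hF hF0 hy) hf hG hy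

/-- The lower bound of the supremum: the functionals come arbitrarily close to it as `l → ∞` for `γ > 0`
and as `l → 0` for `γ < 0`. -/
lemma NiceBound.le_iSup {p q γ : ℝ} {c : ℝ≥0∞} (hc : c ≠ ∞) (hn : 1 ≤ n)
    (hρ : IsBallBanach ρ) (hq : 0 < q) (hγ : γ ≠ 0) (hb : NiceBound p q γ c ρ) {e : Rn n}
    (he : ‖e‖ = 1) {f : Rn n → ℝ} {G : Rn n → Rn n}
    (h : IsApproximable ρ f G) (hf : Measurable f) (hG : Measurable G) :
    ENNReal.ofReal ((kappa q e / |γ|) ^ (1 / q)) * fieldNorm ρ G ≤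
      ⨆ (l : ℝ) (_ : 0 < l), functional ρ q γ l f := by
  refine le_of_forall_lt fun y hy => ?_
  have hex : ∃ l : ℝ, y < functional ρ q γ l f ∧ 0 < l := by
    rcases lt_or_gt_of_ne hγ with hneg | hpos
    · exact ((hb.eventually_lt hc hn hρ hq hγ he (F := 𝓝[>] 0) self_mem_nhdsWithin
        (tendsto_rpow_neg_div_zero hq hneg) (fun c hc => tendsto_const_mul_nhdsGT_zero hc) h hf hG
        hy).and self_mem_nhdsWithin).exists
    · exact ((hb.eventually_lt hc hn hρ hq hγ he (eventually_gt_atTop 0)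
        (tendsto_rpow_neg_div_atTop hq hpos) (fun c hc => tendsto_id.const_mul_atTop hc) h hf hG
        hy).and (eventually_gt_atTop 0)).exists
  obtain ⟨l, hl, hl0⟩ := hex
  exact hl.trans_le (le_iSup₂_of_le l hl0 le_rfl)

lemma NiceBound.tendsto_functional {p q γ : ℝ} {c : ℝ≥0∞} (hc : c ≠ ∞) (hp : 1 ≤ p) (hn : 1 ≤ n)
    (hρ : IsBallBanach ρ) (hY : IsBallBanach (convexify ρ (1 / p)))
    (ht : maximalOpNorm (associate (convexify ρ (1 / p))) < ∞)
    (hac : HasAbsolutelyContinuousNorm ρ) (hq : 0 < q) (hcond : LimitCondition n p q γ)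
    (hb : NiceBound p q γ c ρ) {e : Rn n}
    (he : ‖e‖ = 1) {F : Filter ℝ} [F.IsCountablyGenerated] (hF : ∀ᶠ l in F, 0 < l)
    (hF0 : Tendsto (fun l : ℝ => l ^ (-(q / γ))) F (𝓝 0))
    (hFc : ∀ c : ℝ, 0 < c → Tendsto (fun l => c * l) F F) {f : Rn n → ℝ} {G : Rn n → Rn n}
    (h : IsApproximable ρ f G) (hf : Measurable f) (hG : Measurable G)
    (hGfin : fieldNorm ρ G < ∞) :
    Tendsto (fun l => functional ρ q γ l f) F
      (𝓝 (ENNReal.ofReal ((kappa q e / |γ|) ^ (1 / q)) * fieldNorm ρ G)) := by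
  refine tendsto_order.2 ⟨fun y hy =>
    hb.eventually_lt hc hn hρ hq hcond.ne_zero he hF hF0 hFc h hf hG hy, fun y hy => ?_⟩
  exact h.eventually_functional_lt hρ hq (ENNReal.mul_ne_top hc ENNReal.ofReal_ne_top)
    ENNReal.ofReal_ne_top hb hF hFc
    (fun _ _ hu => hu.tendsto_functional hp hn hρ hY ht hac hq hcond he hF hF0) hf hG hGfin hy

end Conclusion

end BallBanach

end

theorem theorem2117 (n : ℕ) (hn : 1 ≤ n) (p q γ : ℝ) (hp : 1 ≤ p) (r A : ℝ) :
    -- the upper constant, as a function of the operator norm of the maximal operator on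
    -- `(X^{1/p})'`; the numbers `r` and `A` matter only in the cases (a) and (b)
    ∃ C : ℝ → ℝ, Continuous C ∧ StrictMono C ∧ (∀ t, 0 < C t) ∧
    ∀ ρ : BallBanach.FunctionNorm n,
      BallBanach.IsBallBanach ρ →
      BallBanach.IsBallBanach (BallBanach.convexify ρ (1 / p)) →
      BallBanach.maximalOpNorm (BallBanach.associate (BallBanach.convexify ρ (1 / p))) < ∞ →
      BallBanach.HasAbsolutelyContinuousNorm ρ →
      -- one of the conditions (a), (b), (c), (d)
      ((γ ≠ 0 ∧ 0 < q ∧ q ≤ p ∧ BallBanach.maximalOpNorm ρ ≤ ENNReal.ofReal A) ∨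
        (γ ≠ 0 ∧ 0 < q ∧ (n : ℝ) < r ∧
          BallBanach.maximalOpNorm (BallBanach.convexify ρ (1 / r)) ≤ ENNReal.ofReal A) ∨
        (0 < γ ∧ 0 < q ∧ (n : ℝ) * (1 / p - 1 / q) < 1) ∨
        (γ < -1 ∧ n = 1 ∧ 1 ≤ q ∧ q ≤ p)) →
      -- every distribution whose distributional gradient has modulus in `X`
      ∀ (T : 𝓓'((⊤ : Opens (BallBanach.Rn n)), ℝ)) (G : BallBanach.Rn n → BallBanach.Rn n),
        BallBanach.IsGradient T G → BallBanach.fieldNorm ρ G < ∞ →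
        (∃ f : BallBanach.Rn n → ℝ, BallBanach.IsFunction T f) ∧
        ∀ f : BallBanach.Rn n → ℝ, BallBanach.IsFunction T f →
          ∀ e : BallBanach.Rn n, ‖e‖ = 1 →
          -- (i)
          (ENNReal.ofReal ((BallBanach.kappa q e / |γ|) ^ (1 / q)) * BallBanach.fieldNorm ρ G ≤
              (⨆ (l : ℝ) (_ : 0 < l), BallBanach.functional ρ q γ l f) ∧
            (⨆ (l : ℝ) (_ : 0 < l), BallBanach.functional ρ q γ l f) ≤
              ENNReal.ofReal (C (BallBanach.maximalOpNorm
                (BallBanach.associate (BallBanach.convexify ρ (1 / p)))).toReal) *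
                BallBanach.fieldNorm ρ G) ∧
          -- (ii)
          (0 < γ →
            Tendsto (fun l : ℝ => BallBanach.functional ρ q γ l f) atTop
              (𝓝 (ENNReal.ofReal ((BallBanach.kappa q e / γ) ^ (1 / q)) *
                BallBanach.fieldNorm ρ G))) ∧
          -- (iii)
          (γ < 0 →
            ((2 ≤ n ∧ q < ((n : ℝ) - γ) / n * p) ∨ (n = 1 ∧ q < -p * γ ∧ γ < -1)) →
            Tendsto (fun l : ℝ => BallBanach.functional ρ q γ l f) (𝓝[>] 0)
              (𝓝 (ENNReal.ofReal ((-(BallBanach.kappa q e / γ)) ^ (1 / q)) *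
                BallBanach.fieldNorm ρ G))) := by
  obtain ⟨c, hc, hbound⟩ := BallBanach.exists_niceBound (n := n) (q := q) (γ := γ) hn hp r A
  refine ⟨fun t => (c.toReal + 1) * Real.exp (2 * t), by fun_prop, fun s t hst => ?_,
    fun t => by positivity, fun ρ hρ hY ht hac hcond T G hG hGfin => ?_⟩
  · have h1 : Real.exp (2 * s) < Real.exp (2 * t) := Real.exp_lt_exp.2 (by linarith)
    exact mul_lt_mul_of_pos_left h1 (by positivity)
  refine ⟨BallBanach.exists_isFunction hG, fun f hf e he => ?_⟩
  have hcond' : BallBanach.UpperCondition n p q γ r A ρ := hcond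
  have hγ := hcond'.ne_zero
  have hq := hcond'.q_pos
  have hb := hbound ρ hρ hY ht hcond'
  obtain ⟨g, H, hgm, hHm, hfg, hnorm, happ⟩ :=
    BallBanach.exists_isApproximable hp hn hρ hY ht hac hG hGfin hf
  have hHfin : BallBanach.fieldNorm ρ H < ∞ := hnorm.trans_lt hGfin
  simp only [BallBanach.functional_congr_ae hρ hgm hfg, ← hnorm]
  refine ⟨⟨hb.le_iSup hc hn hρ hq hγ he happ hgm hHm,
    iSup₂_le fun l hl => hb.functional_le hc hρ hq happ hgm hHm hl⟩, fun hpos => ?_,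
    fun hneg hlim => ?_⟩
  · have := hb.tendsto_functional hc hp hn hρ hY ht hac hq (Or.inl hpos) he
      (eventually_gt_atTop 0) (BallBanach.tendsto_rpow_neg_div_atTop hq hpos)
      (fun c hc => tendsto_id.const_mul_atTop hc) happ hgm hHm hHfin
    rwa [abs_of_pos hpos] at this
  · have hl : BallBanach.LimitCondition n p q γ :=
      Or.inr ⟨hneg, hlim.imp_right fun h => ⟨h.1, h.2.1⟩⟩
    have := hb.tendsto_functional hc hp hn hρ hY ht hac hq hl he (F := 𝓝[>] 0)
      self_mem_nhdsWithin
      (BallBanach.tendsto_rpow_neg_div_zero hq hneg)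
      (fun c hc => BallBanach.tendsto_const_mul_nhdsGT_zero hc) happ hgm hHm hHfin
    rwa [abs_of_neg hneg, div_neg] at this
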